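/- **Setting.** Let $(\Gamma,V,E,\mu)$ be a finite undirected graph (loops and multiple edges allowed) with weights $\mu:V\to(0,\infty)$, $\sum_v\mu(v)=1$. Let $\vec E$ be the set of directed edges: an edge with two distinct endpoints gives two opposite elements $\epsilon,\epsilon^{\rm op}$; a loop gives one element $\epsilon=\epsilon^{\rm op}$. Write $s(\epsilon),t(\epsilon)$ for source and target, and $\mu(\epsilon)=\sqrt{\mu(s(\epsilon))\mu(t(\epsilon))}$. On the Fock space of $\Gamma$, with orthonormal basis the directed paths $\gamma$ (a path of length $0$ at each vertex included), let $p_v$ be the projection onto the paths that begin at $v$, let $\ell(\epsilon)\gamma=\epsilon\gamma$ if $\gamma$ begins at $t(\epsilon)$ and $\ell(\epsilon)\gamma=0$ otherwise, and put $$x_\epsilon=\sqrt[4]{\tfrac{\mu(s(\epsilon))}{\mu(t(\epsilon))}}\,\ell(\epsilon)+\sqrt[4]{\tfrac{\mu(t(\epsilon))}{\mu(s(\epsilon))}}\,\ell(\epsilon^{\rm op})^*,\qquad \tau(T)=\sum_{v}\mu(v)\langle p_v,Tp_v\rangle ,$$ where in the last formula $p_v$ stands for the path of length $0$ at $v$.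 The C\*-algebra generated by the $p_v$ and $x_\epsilon$ is $\mathcal S(\Gamma,\mu)$. **Power series.** Let $B$ be the universal unital $*$-algebra generated by $\ell^\infty(V)=\mathrm{span}\{p_v\}$ and $z_\epsilon$ ($\epsilon\in\vec E$) with $z_\epsilon^*=z_{\epsilon^{\rm op}}$ and $p_vz_\epsilon p_w=\delta_{v,s(\epsilon)}\delta_{w,t(\epsilon)}z_\epsilon$. For $\rho>0$ let $B_\rho$ be its completion in $$\Big\|\sum_vb_vp_v+\sum_{\epsilon_1\cdots\epsilon_n}a_{\epsilon_1\cdots\epsilon_n}z_{\epsilon_1}\cdots z_{\epsilon_n}\Big\|_\rho=\sup_v|b_v|+\sum|a_{\epsilon_1\cdots\epsilon_n}|\rho^n ,$$ an algebra of power series. If $\rho>\max_\epsilon\|x_\epsilon\|$, then $z_\epsilon\mapsto x_\epsilon$ extends to a homomorphism $b\mapsto b(x)$ of $B_\rho$ into $\mathcal S(\Gamma,\mu)$; its image is $A_\rho$. The operators below act on power series; an element of $A_\rho$ is given by a power series in $B_\rho$. **Operators.** $\partial_\epsilon:B\to B\otimes B^{\rm op}$ is the derivation with $\partial_\epsilon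 z_{\epsilon'}=\delta_{\epsilon,\epsilon'}\,p_{s(\epsilon)}\otimes p_{t(\epsilon)}$ and $\partial_\epsilon p_v=0$; $\mathscr D_\epsilon a=\sum a_2a_1$ over the decompositions $a=a_1z_{\epsilon^{\rm op}}a_2$ of a monomial $a$; $\mathscr Da=(\mathscr D_\epsilon a)_\epsilon$; $[\mathscr Jf]_{\epsilon\phi}=\partial_\phi f_\epsilon$ for $f=(f_\epsilon)_{\epsilon}$; $\mathcal N_\mu(z_{\epsilon_1}\cdots z_{\epsilon_n})=(\mu(\epsilon_1)+\dots+\mu(\epsilon_n))z_{\epsilon_1}\cdots z_{\epsilon_n}$ and $\mathcal N_\mu p_v=0$; all are extended to power series. Products of $\vec E\times\vec E$ matrices use $(a\otimes b)(c\otimes d)=ac\otimes db$, ${\rm Tr}$ is the sum of the diagonal entries, $(1\otimes\tau)(a\otimes b)=\tau(b(x))\,a$, $(\tau\otimes1)(a\otimes b)=\tau(a(x))\,b$, $f\#h=\sum_\epsilon f_\epsilon h_{\epsilon^{\rm op}}$ and $(M\#f)_\epsilon=\mu(\epsilon)f_\epsilon$. Further, $\|Q\|_{\rho\otimes_\pi\rho}=\max_\epsilon\sum_{\epsilon'}\|Q_{\epsilon\epsilon'}\|_{\rho\otimes_\pi\rho}$,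 with the projective tensor norm of $B_\rho$ and $B_\rho^{\rm op}$ on the entries. **Schwinger–Dyson equation.** A functional $\varphi$ satisfies it with potential $U$ if $\varphi([\mathscr D_\epsilon U]^*q)=(\varphi\otimes\varphi^{\rm op})(\partial_\epsilon q)$ for all $\epsilon\in\vec E$ and $q\in B$. The joint law of $y=(y_\epsilon)_\epsilon$ with respect to $\tau$ is $q\mapsto\tau(q(y))$, where $q(y)$ arises from $q$ by $z_\epsilon\mapsto y_\epsilon$, $p_v\mapsto p_v$. Let $V_\mu=\frac12\sum_{\epsilon\in\vec E}\mu(\epsilon)z_\epsilon^*z_\epsilon$. **Corollary 2.5.** Let $R>0$ with $R>\max_\epsilon\|x_\epsilon\|$, let $g=g^*\in B_R$ (which gives an element of $A_R$ denoted by the same letter) with $\|\mathscr J\mathscr Dg\|_{R\otimes_\pi R}<1$, and let $y_\epsilon=x_\epsilon+(\mathscr D_\epsilon g)(x)$. Let $S>0$ and $W\in B_S$, and suppose that $W(x+\mathscr Dg)$ makes sense in the sense that $\|z_\epsilon+\mathscr D_\epsilon g\|_{r}\le S$ for all $\epsilon$ and some $r>\max_\epsilon\|x_\epsilon\|$. Then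 the series $\sum_{m\ge1}\frac{(-1)^m}{m}(1\otimes\tau+\tau\otimes1)\circ{\rm Tr}((\mathscr J\mathscr Dg)^m)$ converges absolutely in $B_R$, and the joint law of $y$ with respect to $\tau$ satisfies the Schwinger–Dyson equation with potential $V_\mu+W$ if and only if $$\mathscr D\mathcal N_\mu g=\mathscr D\Big[-W(x+\mathscr Dg)-\tfrac12\,\mathscr Dg\#(M\#\mathscr Dg)-\sum_{m=1}^\infty\frac{(-1)^m}{m}(1\otimes\tau+\tau\otimes1)\circ{\rm Tr}\big((\mathscr J\mathscr Dg)^m\big)\Big]$$ as families, indexed by $\epsilon\in\vec E$, of elements of $\mathcal S(\Gamma,\mu)$, that is, after the substitution $z\mapsto x$ in both sides. -/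

import Mathlib

open scoped ENNReal ComplexConjugate

noncomputable section

/-- A finite undirected graph (loops and multiple edges allowed) with vertex set `V` and edge set
`E`, and a strictly positive weighting of the vertices of total mass one. -/
structure WeightedGraph (V E : Type*) [Fintype V] where
  ends : E → Sym2 V
  wt : V → ℝ
  wt_pos : ∀ v, 0 < wt v
  wt_sum : ∑ v, wt v = 1

namespace WeightedGraph

variable {V E : Type*} [Fintype V] (G : WeightedGraph V E)

/-- The directed edges: an edge of `G` with two distinct endpoints gives two of them, one for each
orientation, and a loop gives exactly one. -/
@[ext]
structure Dart where
  edge : E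
  src : V
  tgt : V
  ends_eq : s(src, tgt) = G.ends edge

instance [Fintype E] : Fintype G.Dart :=
  have : Finite G.Dart :=
    Finite.of_injective (fun d : G.Dart => (d.edge, d.src, d.tgt)) (by
      intro a b h
      simp only [Prod.mk.injEq] at h
      exact Dart.ext h.1 h.2.1 h.2.2)
  Fintype.ofFinite _

variable {G}

/-- The opposite directed edge; a loop is its own opposite. -/
def Dart.op (e : G.Dart) : G.Dart := ⟨e.edge, e.tgt, e.src, by rw [Sym2.eq_swap]; exact e.ends_eq⟩

/-- The weight `μ(ε) = √(μ(s(ε)) μ(t(ε)))`. -/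
def Dart.wt (e : G.Dart) : ℝ := Real.sqrt (G.wt e.src * G.wt e.tgt)

/-! ### Paths -/

/-- The list of directed edges is a path that begins at `v`. -/
def IsPathFrom : V → List G.Dart → Prop
  | _, [] => True
  | v, d :: l => d.src = v ∧ IsPathFrom d.tgt l

/-- The last vertex of a path that begins at `v`. -/
def endFrom : V → List G.Dart → V
  | v, [] => v
  | _, d :: l => endFrom d.tgt l

lemma isPathFrom_append (v : V) (l₁ l₂ : List G.Dart) :
    IsPathFrom v (l₁ ++ l₂) ↔ IsPathFrom v l₁ ∧ IsPathFrom (endFrom v l₁) l₂ := by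
  induction l₁ generalizing v with
  | nil => simp [IsPathFrom, endFrom]
  | cons d l ih => simp [IsPathFrom, endFrom, ih, and_assoc]

lemma endFrom_append (v : V) (l₁ l₂ : List G.Dart) :
    endFrom v (l₁ ++ l₂) = endFrom (endFrom v l₁) l₂ := by
  induction l₁ generalizing v with
  | nil => rfl
  | cons d l ih => simp [endFrom, ih]

lemma isPathFrom_reverse (v : V) (l : List G.Dart) (h : IsPathFrom v l) :
    IsPathFrom (endFrom v l) (l.map Dart.op).reverse ∧
      endFrom (endFrom v l) (l.map Dart.op).reverse = v := by
  induction l generalizing v with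
  | nil => simp [IsPathFrom, endFrom]
  | cons d l ih =>
    obtain ⟨h₁, h₂⟩ := h
    obtain ⟨i₁, i₂⟩ := ih _ h₂
    simp only [List.map_cons, List.reverse_cons, endFrom, isPathFrom_append, endFrom_append, i₂]
    exact ⟨⟨i₁, rfl, trivial⟩, h₁⟩

variable (G) in
/-- The paths of the directed graph, including the path of length zero at each vertex. -/
@[ext]
structure Path where
  start : V
  darts : List G.Dart
  isPath : IsPathFrom start darts

namespace Path

/-- The path of length zero at `v`. -/
def triv (v : V) : G.Path := ⟨v, [], trivial⟩

/-- The path of length one along `e`. -/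
def single (e : G.Dart) : G.Path := ⟨e.src, [e], rfl, trivial⟩

def length (γ : G.Path) : ℕ := γ.darts.length

/-- The last vertex. -/
def finish (γ : G.Path) : V := endFrom γ.start γ.darts

/-- The first `i` steps. -/
def take (γ : G.Path) (i : ℕ) : G.Path :=
  ⟨γ.start, γ.darts.take i, by
    have h := γ.isPath
    rw [← List.take_append_drop i γ.darts, isPathFrom_append] at h
    exact h.1⟩

/-- What remains after the first `i` steps. -/
def drop (γ : G.Path) (i : ℕ) : G.Path :=
  ⟨endFrom γ.start (γ.darts.take i), γ.darts.drop i, by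
    have h := γ.isPath
    rw [← List.take_append_drop i γ.darts, isPathFrom_append] at h
    exact h.2⟩

/-- The path that is run through backwards. -/
def rev (γ : G.Path) : G.Path :=
  ⟨γ.finish, (γ.darts.map Dart.op).reverse, (isPathFrom_reverse _ _ γ.isPath).1⟩

/-- The path `γ ε δ`. -/
def join (γ : G.Path) (e : G.Dart) (δ : G.Path) (h : γ.finish = e.src ∧ δ.start = e.tgt) :
    G.Path :=
  ⟨γ.start, γ.darts ++ e :: δ.darts, by
    rw [isPathFrom_append]
    exact ⟨γ.isPath, h.1.symm, h.2 ▸ δ.isPath⟩⟩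

/-- `μ(γ) = μ(ε₁) + ⋯ + μ(εₙ)` for `γ = ε₁ ⋯ εₙ`. -/
def wt (γ : G.Path) : ℝ := (γ.darts.map Dart.wt).sum

end Path

/-! ### The Fock space and the free graph algebra

The Fock space is an orthogonal direct sum of `ℓ^∞(V)`-modules with basis the paths; `⟨γ | γ'⟩` is
`p_{t(γ)}` for `γ = γ'` and zero otherwise. Tensoring it on the right with the faithful
representation of `ℓ^∞(V)` on `ℓ²(V)` represents its adjointable operators faithfully,
and hence isometrically, on the Hilbert space with orthonormal basis the paths. -/

variable (G) in
abbrev Fock : Type _ := lp (fun _ : G.Path => ℂ) 2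

open Classical in
/-- The operator `ξ ↦ 1_T · (ξ ∘ i)` on `ℓ²`, for a map `i` that is injective on `T`. -/
def pullback {α : Type*} (T : Set α) (i : α → α) (hi : Set.InjOn i T) :
    lp (fun _ : α => ℂ) 2 →L[ℂ] lp (fun _ : α => ℂ) 2 :=
  have key : ∀ ξ : lp (fun _ : α => ℂ) 2,
      Summable (fun a => ‖(if a ∈ T then ξ (i a) else 0 : ℂ)‖ ^ (2 : ℝ≥0∞).toReal) ∧
      ∑' a, ‖(if a ∈ T then ξ (i a) else 0 : ℂ)‖ ^ (2 : ℝ≥0∞).toReal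
        ≤ ‖ξ‖ ^ (2 : ℝ≥0∞).toReal := by
    intro ξ
    have h2 : (0 : ℝ) < (2 : ℝ≥0∞).toReal := by norm_num
    have hs := (lp.hasSum_norm h2 ξ).summable
    have hinj : Function.Injective (fun a : T => i a) := fun a b h =>
      Subtype.ext (hi a.2 b.2 h)
    have e : (fun a => ‖(if a ∈ T then ξ (i a) else 0 : ℂ)‖ ^ (2 : ℝ≥0∞).toReal)
        = T.indicator (fun a => ‖ξ (i a)‖ ^ (2 : ℝ≥0∞).toReal) := by
      funext a
      by_cases h : a ∈ T
      · simp [h]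
      · simp [h]
    constructor
    · rw [e, ← summable_subtype_iff_indicator]
      exact hs.comp_injective hinj
    · rw [e, ← tsum_subtype, lp.norm_rpow_eq_tsum h2]
      exact tsum_comp_le_tsum_of_inj hs (fun a => by positivity) hinj
  LinearMap.mkContinuous
    { toFun := fun ξ => ⟨fun a => if a ∈ T then ξ (i a) else 0, memℓp_gen (key ξ).1⟩
      map_add' := by
        intro ξ η
        ext a
        change (if a ∈ T then ξ (i a) + η (i a) else 0) =
          (if a ∈ T then ξ (i a) else 0) + (if a ∈ T then η (i a) else 0)
        by_cases h : a ∈ T <;> simp [h]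
      map_smul' := by
        intro c ξ
        ext a
        by_cases h : a ∈ T <;> simp [h] } 1 (by
      intro ξ
      rw [one_mul]
      exact lp.norm_le_of_tsum_le (by norm_num) (norm_nonneg _) (key ξ).2)

/-- The projection `p_v`: the identity on paths that begin at `v`, zero on the others. -/
def projOp (v : V) : G.Fock →L[ℂ] G.Fock :=
  pullback {γ : G.Path | γ.start = v} id (Set.injOn_id _)

/-- The creation operator `ℓ(ε)`, which maps `γ` to `ε γ` if `γ` begins at `t(ε)` and to zero
otherwise: the coefficient of `ℓ(ε) ξ` at `ε γ` is that of `ξ` at `γ`, and it is zero at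
the paths that do not begin with `ε`. -/
def creation (e : G.Dart) : G.Fock →L[ℂ] G.Fock :=
  pullback {γ : G.Path | γ.darts.head? = some e} (fun γ => γ.drop 1) (by
    rintro ⟨v, l, hl⟩ h ⟨w, k, hk⟩ h' hd
    cases l with
    | nil => simp at h
    | cons a l =>
      cases k with
      | nil => simp at h'
      | cons b k =>
        simp only [Set.mem_ofPred_eq, List.head?_cons, Option.some.injEq] at h h'
        simp only [Path.drop, List.drop_succ_cons, List.drop_zero, Path.mk.injEq] at hd
        subst h
        subst h'
        ext1
        · exact hl.1.symm.trans hk.1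
        · simp [hd.2])

/-- The generator `x_ε = (μ(s(ε))/μ(t(ε)))^{1/4} ℓ(ε) + (μ(t(ε))/μ(s(ε)))^{1/4} ℓ(ε^op)^*`. -/
def gen (e : G.Dart) : G.Fock →L[ℂ] G.Fock :=
  (((G.wt e.src / G.wt e.tgt) ^ (1 / 4 : ℝ) : ℝ) : ℂ) • creation e +
    (((G.wt e.tgt / G.wt e.src) ^ (1 / 4 : ℝ) : ℝ) : ℂ) •
      ContinuousLinearMap.adjoint (creation e.op)

open Classical in
/-- The free graph law `τ(T) = ∑_v μ(v) ⟨p_v | T p_v⟩`. -/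
def trace (T : G.Fock →L[ℂ] G.Fock) : ℂ :=
  ∑ v, (G.wt v : ℂ) *
    inner ℂ (lp.single 2 (Path.triv v) (1 : ℂ) : G.Fock) (T (lp.single 2 (Path.triv v) (1 : ℂ)))

/-! ### Power series and their double series -/

variable (G) in
/-- Formal power series in the `z_ε`, with constant terms in `ℓ^∞(V)`: the value at
`γ = ε₁ ⋯ εₙ` is the coefficient of `z_{ε₁} ⋯ z_{εₙ}`, and the value at the path of length
zero at `v` is the coefficient of `p_v`. -/
abbrev Series : Type _ := G.Path → ℂ

variable (G) in
/-- Formal double series; the value at `(γ, δ)` is the coefficient of `z_γ ⊗ z_δ`. -/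
abbrev Tensor : Type _ := G.Path → G.Path → ℂ

namespace Series

/-- The product; it sums over the ways to cut a path in two. -/
def mul (a b : G.Series) : G.Series := fun γ =>
  ∑ i ∈ Finset.range (γ.length + 1), a (γ.take i) * b (γ.drop i)

/-- The involution, with `p_v^* = p_v` and `z_ε^* = z_{ε^op}`. -/
def adj (a : G.Series) : G.Series := fun γ => conj (a γ.rev)

open Classical in
/-- The monomial `z_γ`. -/
def mono (γ : G.Path) : G.Series := fun δ => if δ = γ then 1 else 0

/-- The variable `z_ε`. -/
def var (e : G.Dart) : G.Series := mono (Path.single e)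

/-- The elements of the polynomial algebra `B`. -/
def IsPoly (a : G.Series) : Prop := (Function.support a).Finite

/-- The norm `‖a‖_R`, equal to `∞` when the series `a` does not define an element of `B_R`. -/
def normR (R : ℝ) (a : G.Series) : ℝ≥0∞ :=
  (⨆ v : V, ‖a (Path.triv v)‖ₑ) +
    ∑' γ : {γ : G.Path // γ.length ≠ 0}, ‖a γ‖ₑ * ENNReal.ofReal R ^ (γ : G.Path).length

/-- The weighted number operator `𝒩_μ`. -/
def number (a : G.Series) : G.Series := fun γ => (γ.wt : ℂ) * a γ

/-- The monomial `y_γ = y_{ε₁} ⋯ y_{εₙ}` in a family `y` of series, which is `p_v` for the path of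
length zero at `v`. -/
def monoAt (y : G.Dart → G.Series) (γ : G.Path) : G.Series :=
  γ.darts.foldr (fun e a => mul (y e) a) (mono (Path.triv γ.finish))

/-- The substitution `W(y) = ∑_γ W_γ y_γ`. -/
def subst (W : G.Series) (y : G.Dart → G.Series) : G.Series := fun γ =>
  ∑' δ : G.Path, W δ * monoAt y δ γ

/-- The monomial `y_γ` in a family `y` of operators. -/
def monoOp (y : G.Dart → (G.Fock →L[ℂ] G.Fock)) (γ : G.Path) : G.Fock →L[ℂ] G.Fock :=
  γ.darts.foldr (fun e T => y e * T) (projOp γ.finish)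

/-- The value `a(y) = ∑_γ a_γ y_γ` at a family `y` of operators. -/
def eval (y : G.Dart → (G.Fock →L[ℂ] G.Fock)) (a : G.Series) : G.Fock →L[ℂ] G.Fock :=
  ∑' γ : G.Path, a γ • monoOp y γ

open Classical in
/-- The free difference quotient `∂_ε`: the coefficient of `∂_ε a` at `z_γ ⊗ z_δ` is that of `a` at
`γ ε δ`, and zero if `γ ε δ` is not a path. -/
def diff (e : G.Dart) (a : G.Series) : G.Tensor := fun γ δ =>
  if h : γ.finish = e.src ∧ δ.start = e.tgt then a (γ.join e δ h) else 0

end Series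

namespace Tensor

/-- The multiplication map, `a ⊗ b ↦ a b`. -/
def mult (u : G.Tensor) : G.Series := fun γ =>
  ∑ i ∈ Finset.range (γ.length + 1), u (γ.take i) (γ.drop i)

/-- The flip, `a ⊗ b ↦ b ⊗ a`. -/
def flip (u : G.Tensor) : G.Tensor := fun γ δ => u δ γ

/-- The product of `B ⊗ B^op`, `(a ⊗ b)(c ⊗ d) = a c ⊗ d b`. -/
def mul (u w : G.Tensor) : G.Tensor := fun γ δ =>
  ∑ i ∈ Finset.range (γ.length + 1), ∑ j ∈ Finset.range (δ.length + 1),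
    u (γ.take i) (δ.drop j) * w (γ.drop i) (δ.take j)

/-- The action on series, `(b ⊗ c) # a = b a c`. -/
def act (u : G.Tensor) (a : G.Series) : G.Series := fun γ =>
  ∑ i ∈ Finset.range (γ.length + 1), ∑ j ∈ Finset.range ((γ.drop i).length + 1),
    u (γ.take i) ((γ.drop i).drop j) * a ((γ.drop i).take j)

/-- `1 ⊗ τ`, that is `a ⊗ b ↦ τ(b(x)) a`. -/
def idTrace (u : G.Tensor) : G.Series := fun γ => ∑' δ : G.Path, u γ δ * trace (Series.monoOp gen δ)

/-- `τ ⊗ 1`, that is `a ⊗ b ↦ τ(a(x)) b`. -/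
def traceId (u : G.Tensor) : G.Series := fun δ => ∑' γ : G.Path, trace (Series.monoOp gen γ) * u γ δ

/-- The projective tensor norm of `B_R ⊗ B_R^op`, the infimum of `∑ ‖aₙ‖_R ‖bₙ‖_R` over the
representations `u = ∑ aₙ ⊗ bₙ`; it is `∞` if `u` is not in the projective tensor product. -/
def projNorm (R : ℝ) (u : G.Tensor) : ℝ≥0∞ :=
  ⨅ (a : ℕ → G.Series) (b : ℕ → G.Series)
    (_ : ∀ γ δ : G.Path, HasSum (fun n => a n γ * b n δ) (u γ δ)),
    ∑' n, (a n).normR R * (b n).normR R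

end Tensor

/-! ### Matrices of double series -/

variable [Fintype E]

variable (G) in
abbrev TMatrix : Type _ := G.Dart → G.Dart → G.Tensor

namespace TMatrix

open Classical in
/-- The diagonal matrix `P` with entries `p_{s(ε)} ⊗ p_{t(ε)}`, the unit of `𝕄(B)`. -/
def P : G.TMatrix := fun e f γ δ =>
  if e = f then Series.mono (Path.triv e.src) γ * Series.mono (Path.triv e.tgt) δ else 0

/-- The diagonal matrix `M` with entries `μ(ε) p_{s(ε)} ⊗ p_{t(ε)}`. -/
def M : G.TMatrix := fun e f => (e.wt : ℂ) • P e f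

def mul (Q Q' : G.TMatrix) : G.TMatrix := fun e f => ∑ w, Tensor.mul (Q e w) (Q' w f)

/-- Powers in `𝕄(B)`. -/
def pow (Q : G.TMatrix) : ℕ → G.TMatrix
  | 0 => P
  | m + 1 => mul (pow Q m) Q

def tr (Q : G.TMatrix) : G.Tensor := ∑ e, Q e e

/-- `(Q # f)_ε = ∑_ε' Q_{ε ε'} # f_ε'`. -/
def act (Q : G.TMatrix) (f : G.Dart → G.Series) : G.Dart → G.Series := fun e =>
  ∑ w, Tensor.act (Q e w) (f w)

/-- The norm `‖Q‖_{R ⊗_π R}`. -/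
def norm (R : ℝ) (Q : G.TMatrix) : ℝ≥0∞ := ⨆ e, ∑ w, Tensor.projNorm R (Q e w)

end TMatrix

/-! ### Vectors, gradient and Jacobian -/

/-- `f # g = ∑_ε f_ε g_{ε^op}`. -/
def dot (f g : G.Dart → G.Series) : G.Series := ∑ e : G.Dart, Series.mul (f e) (g e.op)

/-- The cyclic gradient, `𝒟_ε = m ∘ σ ∘ ∂_{ε^op}`. -/
def grad (a : G.Series) : G.Dart → G.Series := fun e =>
  Tensor.mult (Tensor.flip (Series.diff e.op a))

/-- The Jacobian, `[𝒥 f]_{ε φ} = ∂_φ f_ε`. -/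
def jac (f : G.Dart → G.Series) : G.TMatrix := fun e w => Series.diff w (f e)

/-- `Q_m(g) = (1 ⊗ τ + τ ⊗ 1) ∘ Tr ((𝒥𝒟g)^m)`. -/
def traceTerm (g : G.Series) (m : ℕ) : G.Series :=
  let u := TMatrix.tr (TMatrix.pow (jac (grad g)) m)
  Tensor.idTrace u + Tensor.traceId u

/-! ### The Schwinger-Dyson equation -/

variable (G) in
/-- The potential `V_μ = ½ ∑_ε μ(ε) z_ε^* z_ε`. -/
def quadPotential : G.Series :=
  (1 / 2 : ℂ) • ∑ e : G.Dart, (e.wt : ℂ) • Series.mul (Series.adj (Series.var e)) (Series.var e)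

/-- The joint law of a family `y` of operators with respect to `τ`, that is `q ↦ τ(q(y))`. -/
def law (y : G.Dart → (G.Fock →L[ℂ] G.Fock)) : G.Series → ℂ := fun q => trace (Series.eval y q)

/-- The functional `φ` satisfies the Schwinger-Dyson equation with potential `U`:
`φ([𝒟_ε U]^* q) = (φ ⊗ φ^op)(∂_ε q)` for all directed edges `ε` and all polynomials `q`. -/
def SchwingerDyson (φ : G.Series → ℂ) (U : G.Series) : Prop :=
  ∀ (e : G.Dart) (q : G.Series), q.IsPoly →
    φ (Series.mul (Series.adj (grad U e)) q) =
      ∑ᶠ p : G.Path × G.Path, Series.diff e q p.1 p.2 * (φ (Series.mono p.1) * φ (Series.mono p.2))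

end WeightedGraph

end

open scoped ENNReal ComplexConjugate NNReal

noncomputable section

namespace WeightedGraph

set_option linter.unusedSectionVars false

section

variable {V E : Type*} [Fintype V] {G : WeightedGraph V E}

/-! ### Paths -/

/-! The equation comes from the change of variables Φ(X) = X + 𝒟g(X). Write y = Φ(x), J = (𝒥𝒟g)(x),
and let L be the logarithmic series of the statement.

The starting point is that x itself satisfies the Schwinger-Dyson equation with potential V_μ
(`quadSD_gen`). The operator `rann e`, which strips a last edge, commutes with every generator up to
a rank one operator between paths of length zero, so moving it through a monomial splits the trace
into products of two traces. The trace property holds because the generators commute with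
right-handed twins and both have the same effect on the vector Σ √μ(v) p_v (`gen_vac`,
`rgen_mul_gen`).

Given test series q_ε, a Neumann series produces power series κ_ε with κ + 𝒥𝒟g # κ = q(z + 𝒟g). This
identity holds on a whole ball, so it may be differentiated at x. Since second derivatives are
symmetric, the result is (𝒥q)(y)(1 + J) = A' + (1 + J)(𝒥κ)(x), where A' is the derivative of the
Jacobian in the direction κ(x). Multiplying by (1 + J)⁻¹ and tracing gives Tr (𝒥q)(y) - Tr (𝒥κ)(x) =
Σ (-1)^m Tr(A' J^m) (`hasSum_TT_deriv`). The right side is minus the derivative of τ(L(X)) at x in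
the direction κ(x): the functional τ ⊗ τ has two slots, and varying one while the other is frozen at
x gives 1 ⊗ τ and τ ⊗ 1 (`hasDerivAt_tr2_evT`, `hasSum_psi_logTerm`). The Schwinger-Dyson equation
of x turns Tr (𝒥κ)(x) into Σ μ(ε) τ(x_{ε^op} κ_ε(x)).

The potential terms are directional derivatives as well, namely of ½ Σ μ(ε) τ(Y_{ε^op} Y_ε) and of
τ(W(Y)) along Y = Φ(X). In the quadratic form the cross term between X and 𝒟g(X) is τ((𝒩_μ g)(X)) by
Euler's identity. Put a₀ = 𝒩_μ g + ½ 𝒟g # (M # 𝒟g) + W(z + 𝒟g) + L. Then the defect of the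
Schwinger-Dyson equation of y, tested on q, equals Σ τ((𝒟_{ε^op} a₀)(x) κ_ε(x))
(`schwingerDyson_defect`), and the transport equation says that (𝒟a₀)(x) = 0.

Transposing 1 + J rewrites the defect as Σ τ(ζ_ε q_ε(y)), where ζ = 0 if and only if (𝒟a₀)(x) = 0
(`exists_schwingerDyson_defect`). This proves one implication. For the other, the monomials in y
applied to the vacuum must span a dense subspace (`wordSpan_eq_top`). The reflection u in the
closure of their span commutes with all y_ε and p_v, so u x u is a second solution of Φ(X) = y. The
map Φ is injective on the ball, because 𝒟g is a contraction there, hence u x u = x, the subspace is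
invariant under x, and it is everything. Finally ζ_ε commutes with the right-handed generators, for
which the vacuum is cyclic, so ζ_ε vanishes once its adjoint annihilates the vacuum
(`eq_zero_of_trace_mul_word`).

The analytic part takes place in an arbitrary Banach algebra with vertex projections and a trace.
Weighted ℓ¹ norms at slightly different radii absorb the loss of radius in each differentiation. -/

@[simp] lemma Dart.op_op (e : G.Dart) : e.op.op = e := rfl
@[simp] lemma Dart.op_src (e : G.Dart) : e.op.src = e.tgt := rfl
@[simp] lemma Dart.op_tgt (e : G.Dart) : e.op.tgt = e.src := rfl

lemma Dart.op_injective : Function.Injective (Dart.op : G.Dart → G.Dart) :=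
  Function.Involutive.injective fun _ => rfl

@[simp] lemma Dart.op_inj {e f : G.Dart} : e.op = f.op ↔ e = f := Dart.op_injective.eq_iff

@[simp] lemma Dart.op_wt (e : G.Dart) : e.op.wt = e.wt := by
  simp [Dart.wt, mul_comm]

namespace Path

@[simp] lemma triv_start (v : V) : (triv v : G.Path).start = v := rfl
@[simp] lemma triv_darts (v : V) : (triv v : G.Path).darts = [] := rfl
@[simp] lemma triv_finish (v : V) : (triv v : G.Path).finish = v := rfl
@[simp] lemma triv_length (v : V) : (triv v : G.Path).length = 0 := rfl
@[simp] lemma take_start (γ : G.Path) (i : ℕ) : (γ.take i).start = γ.start := rfl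
@[simp] lemma take_darts (γ : G.Path) (i : ℕ) : (γ.take i).darts = γ.darts.take i := rfl
@[simp] lemma drop_darts (γ : G.Path) (i : ℕ) : (γ.drop i).darts = γ.darts.drop i := rfl
@[simp] lemma drop_start (γ : G.Path) (i : ℕ) : (γ.drop i).start = (γ.take i).finish := rfl

@[simp] lemma drop_finish (γ : G.Path) (i : ℕ) : (γ.drop i).finish = γ.finish := by
  simp only [finish, drop]
  rw [← endFrom_append, List.take_append_drop]

lemma eq_triv_of_darts {γ : G.Path} (h : γ.darts = []) : γ = triv γ.start := by
  ext1
  · rfl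
  · exact h

lemma ext_darts {γ δ : G.Path} (h : γ.start = δ.start) (h' : γ.darts = δ.darts) : γ = δ :=
  Path.ext h h'

lemma start_eq_src {γ : G.Path} {e : G.Dart} (h : γ.darts.head? = some e) : γ.start = e.src := by
  obtain ⟨v, l, hl⟩ := γ
  cases l with
  | nil => simp at h
  | cons a l =>
    simp only [List.head?_cons, Option.some.injEq] at h
    subst h
    exact hl.1.symm

lemma drop_one_start {γ : G.Path} {e : G.Dart} (h : γ.darts.head? = some e) :
    (γ.drop 1).start = e.tgt := by
  obtain ⟨v, l, hl⟩ := γ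
  cases l with
  | nil => simp at h
  | cons a l =>
    simp only [List.head?_cons, Option.some.injEq] at h
    subst h
    rfl

@[simp] lemma join_start (γ δ : G.Path) (e : G.Dart) (h) : (γ.join e δ h).start = γ.start := rfl
@[simp] lemma join_darts (γ δ : G.Path) (e : G.Dart) (h) :
    (γ.join e δ h).darts = γ.darts ++ e :: δ.darts := rfl

@[simp] lemma join_finish (γ δ : G.Path) (e : G.Dart) (h) :
    (γ.join e δ h).finish = δ.finish := by
  simp only [finish, join, endFrom_append, endFrom]
  rw [← h.2]

lemma join_length (γ δ : G.Path) (e : G.Dart) (h) :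
    (γ.join e δ h).length = γ.length + δ.length + 1 := by
  simp [length, add_assoc]

/-- The path `e γ`, or `γ` if that is not a path. -/
def cons (e : G.Dart) (γ : G.Path) : G.Path := by
  classical exact if h : γ.start = e.tgt then (triv e.src).join e γ ⟨rfl, h⟩ else γ

/-- The path `γ e`, or `γ` if that is not a path. -/
def snoc (e : G.Dart) (γ : G.Path) : G.Path := by
  classical exact if h : γ.finish = e.src then γ.join e (triv e.tgt) ⟨h, rfl⟩ else γ

lemma cons_darts {e : G.Dart} {γ : G.Path} (h : γ.start = e.tgt) :
    (cons e γ).darts = e :: γ.darts := by simp [cons, h]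
lemma cons_start {e : G.Dart} {γ : G.Path} (h : γ.start = e.tgt) :
    (cons e γ).start = e.src := by simp [cons, h]
lemma cons_finish (e : G.Dart) (γ : G.Path) : (cons e γ).finish = γ.finish := by
  unfold cons; split_ifs <;> simp
lemma snoc_darts {e : G.Dart} {γ : G.Path} (h : γ.finish = e.src) :
    (snoc e γ).darts = γ.darts ++ [e] := by simp [snoc, h]
lemma snoc_start (e : G.Dart) (γ : G.Path) : (snoc e γ).start = γ.start := by
  unfold snoc; split_ifs <;> rfl

lemma drop_one_cons {e : G.Dart} {γ : G.Path} (h : γ.start = e.tgt) : (cons e γ).drop 1 = γ := by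
  have h1 : (cons e γ).darts.head? = some e := by simp [cons_darts h]
  refine ext_darts ?_ (by simp [cons_darts h])
  rw [drop_one_start h1, h]

lemma cons_drop_one {e : G.Dart} {γ : G.Path} (h : γ.darts.head? = some e) :
    cons e (γ.drop 1) = γ := by
  have h1 := drop_one_start h
  refine ext_darts (by rw [cons_start h1, start_eq_src h]) ?_
  rw [cons_darts h1, drop_darts]
  obtain ⟨l, hl⟩ := List.head?_eq_some_iff.1 h
  simp [hl]

lemma take_snoc {e : G.Dart} {γ : G.Path} (h : γ.finish = e.src) :
    (snoc e γ).take ((snoc e γ).length - 1) = γ := by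
  refine ext_darts (by simp [snoc_start]) ?_
  simp [snoc_darts h, length]

lemma take_finish_of_getLast {e : G.Dart} {γ : G.Path} (h : γ.darts.getLast? = some e) :
    (γ.take (γ.length - 1)).finish = e.src := by
  obtain ⟨v, l, hl⟩ := γ
  obtain rfl | ⟨l, a, rfl⟩ := l.eq_nil_or_concat
  · simp at h
  · simp only [List.concat_eq_append, List.getLast?_append, List.getLast?_singleton,
      Option.some_or, Option.some.injEq] at h
    subst h
    simp only [List.concat_eq_append, isPathFrom_append] at hl
    simpa [finish, take, length] using hl.2.1.symm

lemma snoc_take {e : G.Dart} {γ : G.Path} (h : γ.darts.getLast? = some e) :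
    snoc e (γ.take (γ.length - 1)) = γ := by
  have h1 := take_finish_of_getLast h
  refine ext_darts (by rw [snoc_start, take_start]) ?_
  rw [snoc_darts h1, take_darts]
  obtain ⟨l, hl⟩ := List.getLast?_eq_some_iff.1 h
  simp [hl, length]

lemma cons_snoc {e f : G.Dart} {γ : G.Path} (h : γ.start = e.tgt) (h' : γ.finish = f.src) :
    cons e (snoc f γ) = snoc f (cons e γ) := by
  have h1 : (snoc f γ).start = e.tgt := by rw [snoc_start, h]
  have h2 : (cons e γ).finish = f.src := by rw [cons_finish, h']
  refine ext_darts ?_ ?_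
  · rw [cons_start h1, snoc_start, cons_start h]
  · rw [cons_darts h1, snoc_darts h', snoc_darts h2, cons_darts h]; rfl

end Path

/-! ### Operators on the Fock space -/

/-- The coefficient of a vector of the Fock space at a path. -/
def coef (ξ : G.Fock) (γ : G.Path) : ℂ := ξ γ

lemma fock_ext {ξ η : G.Fock} (h : ∀ γ, coef ξ γ = coef η γ) : ξ = η := lp.ext (funext h)

lemma op_ext {S T : G.Fock →L[ℂ] G.Fock} (h : ∀ ξ γ, coef (S ξ) γ = coef (T ξ) γ) : S = T :=
  ContinuousLinearMap.ext fun ξ => fock_ext (h ξ)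

@[simp] lemma coef_add (ξ η : G.Fock) (γ : G.Path) : coef (ξ + η) γ = coef ξ γ + coef η γ := rfl
@[simp] lemma coef_smul (c : ℂ) (ξ : G.Fock) (γ : G.Path) : coef (c • ξ) γ = c * coef ξ γ := rfl
@[simp] lemma coef_zero (γ : G.Path) : coef (0 : G.Fock) γ = 0 := rfl

lemma coef_sum {ι : Type*} (s : Finset ι) (ξ : ι → G.Fock) (γ : G.Path) :
    coef (∑ i ∈ s, ξ i) γ = ∑ i ∈ s, coef (ξ i) γ := by
  classical
  induction s using Finset.induction_on with
  | empty => simp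
  | insert i s hi ih => simp [Finset.sum_insert hi, ih]

open Classical in
/-- The basis vector of the Fock space at a path. -/
def ket (γ : G.Path) : G.Fock := lp.single 2 γ (1 : ℂ)

open Classical in
lemma coef_ket (γ δ : G.Path) : coef (ket γ) δ = if δ = γ then 1 else 0 := by
  simp [coef, ket, Pi.single_apply]

@[simp] lemma coef_ket_self (γ : G.Path) : coef (ket γ) γ = 1 := by simp [coef_ket]

lemma inner_ket_left (γ : G.Path) (ξ : G.Fock) : inner ℂ (ket γ) ξ = coef ξ γ := by
  classical
  rw [ket, lp.inner_single_left]
  simp [coef]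

open Classical in
lemma pullback_apply {α : Type*} (T : Set α) (i : α → α) (hi : Set.InjOn i T)
    (ξ : lp (fun _ : α => ℂ) 2) (a : α) :
    pullback T i hi ξ a = if a ∈ T then ξ (i a) else 0 := rfl

lemma norm_pullback_le {α : Type*} (T : Set α) (i : α → α) (hi : Set.InjOn i T) :
    ‖pullback T i hi‖ ≤ 1 := by
  rw [pullback]
  apply LinearMap.mkContinuous_norm_le
  exact zero_le_one

/-- The maps `i` and `j` are mutually inverse bijections between `T` and `T'`, so substitution in
the sum for the inner product exchanges the two pullbacks. All operators below come from such
partial bijections of the paths, which settles their adjoints at once. -/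
lemma adjoint_pullback {α : Type*} {T T' : Set α} {i j : α → α} (hi : Set.InjOn i T)
    (hj : Set.InjOn j T') (h : ∀ a ∈ T, i a ∈ T' ∧ j (i a) = a)
    (h' : ∀ b ∈ T', j b ∈ T ∧ i (j b) = b) :
    ContinuousLinearMap.adjoint (pullback T i hi) = pullback T' j hj := by
  classical
  symm
  rw [ContinuousLinearMap.eq_adjoint_iff]
  intro ξ η
  rw [lp.inner_eq_tsum, lp.inner_eq_tsum]
  let φ : T ≃ T' :=
    ⟨fun a => ⟨i a, (h a a.2).1⟩, fun b => ⟨j b, (h' b b.2).1⟩,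
      fun a => Subtype.ext (h a a.2).2, fun b => Subtype.ext (h' b b.2).2⟩
  have e1 : ∀ a, inner ℂ (pullback T' j hj ξ a) (η a)
      = T'.indicator (fun a => inner ℂ (ξ (j a)) (η a)) a := by
    intro a
    by_cases ha : a ∈ T' <;> simp [pullback_apply, ha]
  have e2 : ∀ a, inner ℂ (ξ a) (pullback T i hi η a)
      = T.indicator (fun a => inner ℂ (ξ a) (η (i a))) a := by
    intro a
    by_cases ha : a ∈ T <;> simp [pullback_apply, ha]
  simp_rw [e1, e2]
  rw [← tsum_subtype, ← tsum_subtype, ← φ.tsum_eq]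
  refine tsum_congr fun a => ?_
  change inner ℂ (ξ (j (i a))) (η (i a)) = _
  rw [(h a a.2).2]

/-- The projection onto the paths that end at `v`. -/
def rproj (v : V) : G.Fock →L[ℂ] G.Fock :=
  pullback {γ : G.Path | γ.finish = v} id (Set.injOn_id _)

/-- The annihilation operator that removes the last edge `e`. -/
def rann (e : G.Dart) : G.Fock →L[ℂ] G.Fock :=
  pullback {γ : G.Path | γ.finish = e.src} (Path.snoc e) (by
    intro γ h δ h' hd
    rw [← Path.take_snoc h, hd, Path.take_snoc h'])

lemma adjoint_projOp (v : V) :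
    ContinuousLinearMap.adjoint (projOp v : G.Fock →L[ℂ] G.Fock) = projOp v :=
  adjoint_pullback _ _ (fun _ h => ⟨h, rfl⟩) fun _ h => ⟨h, rfl⟩

lemma adjoint_rproj (v : V) :
    ContinuousLinearMap.adjoint (rproj v : G.Fock →L[ℂ] G.Fock) = rproj v :=
  adjoint_pullback _ _ (fun _ h => ⟨h, rfl⟩) fun _ h => ⟨h, rfl⟩

lemma adjoint_creation (e : G.Dart) : ContinuousLinearMap.adjoint (creation e) =
    pullback {γ : G.Path | γ.start = e.tgt} (Path.cons e) (by
      intro γ h δ h' hd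
      rw [← Path.drop_one_cons h, hd, Path.drop_one_cons h']) :=
  adjoint_pullback _ _ (fun _ h => ⟨Path.drop_one_start h, Path.cons_drop_one h⟩)
    fun γ h => ⟨by simp [Path.cons_darts (e := e) (γ := γ) h], Path.drop_one_cons h⟩

lemma adjoint_rann (e : G.Dart) : ContinuousLinearMap.adjoint (rann e) =
    pullback {γ : G.Path | γ.darts.getLast? = some e} (fun γ => γ.take (γ.length - 1)) (by
      intro γ h δ h' hd
      rw [← Path.snoc_take h, ← Path.snoc_take h']
      exact congrArg _ hd) :=
  adjoint_pullback _ _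
    (fun γ h => ⟨by simp [Path.snoc_darts (e := e) (γ := γ) h], Path.take_snoc h⟩)
    fun γ h => ⟨Path.take_finish_of_getLast h, Path.snoc_take h⟩

open Classical in
lemma coef_pullback (T : Set G.Path) (i : G.Path → G.Path) (hi : Set.InjOn i T)
    (ξ : G.Fock) (γ : G.Path) :
    coef (pullback T i hi ξ) γ = if γ ∈ T then coef ξ (i γ) else 0 := rfl

open Classical in
lemma coef_projOp (v : V) (ξ : G.Fock) (γ : G.Path) :
    coef (projOp v ξ) γ = if γ.start = v then coef ξ γ else 0 := coef_pullback _ _ _ _ _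
open Classical in
lemma coef_rproj (v : V) (ξ : G.Fock) (γ : G.Path) :
    coef (rproj v ξ) γ = if γ.finish = v then coef ξ γ else 0 := coef_pullback _ _ _ _ _
open Classical in
lemma coef_creation (e : G.Dart) (ξ : G.Fock) (γ : G.Path) :
    coef (creation e ξ) γ = if γ.darts.head? = some e then coef ξ (γ.drop 1) else 0 := by
  refine (coef_pullback _ _ _ _ _).trans ?_
  congr
open Classical in
lemma coef_adjoint_creation (e : G.Dart) (ξ : G.Fock) (γ : G.Path) :
    coef (ContinuousLinearMap.adjoint (creation e) ξ) γ
      = if γ.start = e.tgt then coef ξ (Path.cons e γ) else 0 := by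
  rw [adjoint_creation]; exact coef_pullback _ _ _ _ _
open Classical in
lemma coef_rann (e : G.Dart) (ξ : G.Fock) (γ : G.Path) :
    coef (rann e ξ) γ = if γ.finish = e.src then coef ξ (Path.snoc e γ) else 0 :=
  coef_pullback _ _ _ _ _
open Classical in
lemma coef_adjoint_rann (e : G.Dart) (ξ : G.Fock) (γ : G.Path) :
    coef (ContinuousLinearMap.adjoint (rann e) ξ) γ
      = if γ.darts.getLast? = some e then coef ξ (γ.take (γ.length - 1)) else 0 := by
  rw [adjoint_rann]
  refine (coef_pullback _ _ _ _ _).trans ?_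
  congr

/-- The rank one operator `|γ⟩⟨δ|`. -/
def ketbra (γ δ : G.Path) : G.Fock →L[ℂ] G.Fock := (innerSL ℂ (ket δ)).smulRight (ket γ)

lemma ketbra_apply (γ δ : G.Path) (ξ : G.Fock) : ketbra γ δ ξ = coef ξ δ • ket γ := by
  simp [ketbra, inner_ket_left]

lemma adjoint_ketbra (γ δ : G.Path) :
    ContinuousLinearMap.adjoint (ketbra γ δ) = ketbra δ γ := by
  symm
  rw [ContinuousLinearMap.eq_adjoint_iff]
  intro ξ η
  rw [ketbra_apply, ketbra_apply, inner_smul_left, inner_smul_right, inner_ket_left,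
    ← inner_conj_symm ξ (ket γ), inner_ket_left, mul_comm]

end

/-! ### Commutation of left-handed and right-handed operators -/

section

variable {V E : Type*} [Fintype V] {G : WeightedGraph V E}

lemma Path.drop_one_snoc {e : G.Dart} {γ : G.Path} (h : γ.finish = e.src) (h' : γ.darts ≠ []) :
    (Path.snoc e γ).drop 1 = Path.snoc e (γ.drop 1) := by
  have h1 : (γ.drop 1).finish = e.src := by rw [Path.drop_finish, h]
  obtain ⟨v, l, hl⟩ := γ
  cases l with
  | nil => simp at h'
  | cons a l =>
    refine Path.ext_darts ?_ ?_
    · have h2 : (Path.snoc e ⟨v, a :: l, hl⟩).darts.head? = some a := by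
        rw [Path.snoc_darts h]; rfl
      rw [Path.drop_one_start h2, Path.snoc_start]; rfl
    · rw [Path.snoc_darts h1, Path.drop_darts, Path.snoc_darts h]; rfl

open Classical in
-- Adding a first edge and stripping a last one act at opposite ends and interfere only when the
-- edge added is the edge stripped, that is, on a path of length zero. This rank one correction is
-- the source of the free difference quotient in `quadSD_gen`.
lemma rann_mul_creation (e f : G.Dart) : rann e * creation f = creation f * rann e +
    if e = f then ketbra (Path.triv e.src) (Path.triv e.tgt) else 0 := by
  refine op_ext fun ξ γ => ?_
  have hk : coef ((if e = f then ketbra (Path.triv e.src) (Path.triv e.tgt) else 0) ξ) γ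
      = if e = f ∧ γ = Path.triv e.src then coef ξ (Path.triv e.tgt) else 0 := by
    by_cases h : e = f
    · simp [h, ketbra_apply, coef_ket]
    · simp [h]
  rw [add_apply, coef_add, hk,
    mul_apply_eq_comp, mul_apply_eq_comp, coef_rann, coef_creation,
    coef_creation, coef_rann, Path.drop_finish]
  by_cases hd : γ.darts = []
  · rw [Path.eq_triv_of_darts hd]
    rw [Path.triv_finish, Path.triv_darts, List.head?_nil]
    by_cases h : γ.start = e.src
    · have h1 : (Path.triv γ.start).finish = e.src := h
      have h2 : (Path.snoc e (Path.triv γ.start)).darts = [e] := by rw [Path.snoc_darts h1]; rfl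
      by_cases hef : e = f
      · subst hef
        have : (Path.snoc e (Path.triv γ.start)).drop 1 = Path.triv e.tgt := by
          refine Path.ext_darts ?_ (by simp [h2])
          rw [Path.drop_one_start (e := e) (by simp [h2])]; rfl
        rw [h2, if_pos h, if_pos (by simp), this, if_neg (by simp), zero_add, if_pos ⟨rfl, by rw [h]⟩]
      · simp [h2, hef]
    · have : Path.triv γ.start ≠ Path.triv e.src := fun hh => h (congrArg Path.start hh)
      simp [h, this]
  · have hne : ¬ (e = f ∧ γ = Path.triv e.src) := by
      rintro ⟨-, rfl⟩; simp at hd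
    rw [if_neg hne, add_zero]
    by_cases h : γ.finish = e.src
    · have hh : (Path.snoc e γ).darts.head? = γ.darts.head? := by
        rw [Path.snoc_darts h, List.head?_append_of_ne_nil _ hd]
      simp [h, hh, Path.drop_one_snoc h hd]
    · simp [h]

lemma rann_mul_adjoint_creation (e f : G.Dart) :
    rann e * ContinuousLinearMap.adjoint (creation f)
      = ContinuousLinearMap.adjoint (creation f) * rann e := by
  refine op_ext fun ξ γ => ?_
  rw [mul_apply_eq_comp, mul_apply_eq_comp, coef_rann, coef_adjoint_creation,
    coef_adjoint_creation, coef_rann, Path.snoc_start, Path.cons_finish]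
  by_cases h : γ.start = f.tgt <;> by_cases h' : γ.finish = e.src <;>
    simp [h, h', Path.cons_snoc]

lemma rann_mul_projOp (e : G.Dart) (v : V) : rann e * projOp v = projOp v * rann e := by
  refine op_ext fun ξ γ => ?_
  rw [mul_apply_eq_comp, mul_apply_eq_comp, coef_rann, coef_projOp, coef_projOp, coef_rann,
    Path.snoc_start]
  split_ifs <;> simp_all

lemma rproj_mul_projOp (v w : V) :
    (rproj w * projOp v : G.Fock →L[ℂ] G.Fock) = projOp v * rproj w := by
  refine op_ext fun ξ γ => ?_
  simp only [mul_apply_eq_comp, coef_rproj, coef_projOp]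
  split_ifs <;> simp_all

lemma rproj_mul_creation (e : G.Dart) (v : V) : rproj v * creation e = creation e * rproj v := by
  refine op_ext fun ξ γ => ?_
  simp only [mul_apply_eq_comp, coef_rproj, coef_creation, Path.drop_finish]
  split_ifs <;> simp_all

lemma adjoint_mul (S T : G.Fock →L[ℂ] G.Fock) : ContinuousLinearMap.adjoint (S * T)
    = ContinuousLinearMap.adjoint T * ContinuousLinearMap.adjoint S :=
  ContinuousLinearMap.adjoint_comp _ _

lemma adjoint_smul (c : ℂ) (S : G.Fock →L[ℂ] G.Fock) : ContinuousLinearMap.adjoint (c • S)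
    = conj c • ContinuousLinearMap.adjoint S :=
  map_smulₛₗ _ _ _

lemma commute_adjoint {S T : G.Fock →L[ℂ] G.Fock} (h : S * T = T * S) :
    ContinuousLinearMap.adjoint S * ContinuousLinearMap.adjoint T
      = ContinuousLinearMap.adjoint T * ContinuousLinearMap.adjoint S := by
  rw [← adjoint_mul, ← adjoint_mul, h]

/-! ### The generators and their right-handed versions -/

/-- The number `(μ(s(ε))/μ(t(ε)))^{1/4}`. -/
def Dart.quart (e : G.Dart) : ℂ := (((G.wt e.src / G.wt e.tgt) ^ (1 / 4 : ℝ) : ℝ) : ℂ)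

lemma Dart.quart_ne (e : G.Dart) : e.quart ≠ 0 := by
  have : 0 < (G.wt e.src / G.wt e.tgt) ^ (1 / 4 : ℝ) :=
    Real.rpow_pos_of_pos (div_pos (G.wt_pos _) (G.wt_pos _)) _
  exact Complex.ofReal_ne_zero.2 this.ne'

@[simp] lemma Dart.conj_quart (e : G.Dart) : conj e.quart = e.quart := Complex.conj_ofReal _

/-- The fourth roots in the generators are chosen for this identity: two of them appear in the
Schwinger-Dyson equation of the generators, and with the weight `μ(ε)` they produce the product of
the masses of the two vertices, as needed for `τ ⊗ τ`. -/
lemma Dart.wt_mul_quart_sq (e : G.Dart) :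
    (e.wt : ℂ) * (G.wt e.tgt * e.quart ^ 2) = G.wt e.src * G.wt e.tgt := by
  have hs := G.wt_pos e.src
  have ht := G.wt_pos e.tgt
  have h : ((G.wt e.src / G.wt e.tgt) ^ (1 / 4 : ℝ)) ^ 2
      = Real.sqrt (G.wt e.src / G.wt e.tgt) := by
    rw [← Real.rpow_natCast, ← Real.rpow_mul (by positivity), Real.sqrt_eq_rpow]
    norm_num
  have h2 : G.wt e.src * G.wt e.tgt * (G.wt e.src / G.wt e.tgt) = G.wt e.src ^ 2 := by
    field_simp
  rw [Dart.quart, ← Complex.ofReal_pow, h, Dart.wt]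
  norm_cast
  rw [mul_left_comm, ← Real.sqrt_mul (by positivity), h2, Real.sqrt_sq hs.le, mul_comm]

lemma gen_eq (e : G.Dart) : gen e = e.quart • creation e +
    e.op.quart • ContinuousLinearMap.adjoint (creation e.op) := rfl

lemma adjoint_gen (e : G.Dart) : ContinuousLinearMap.adjoint (gen e) = gen e.op := by
  simp [gen_eq, map_add, add_comm, adjoint_smul]

/-- The right-handed version of the generator `x_ε`. -/
def rgen (e : G.Dart) : G.Fock →L[ℂ] G.Fock :=
  e.op.quart • ContinuousLinearMap.adjoint (rann e) + e.quart • rann e.op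

lemma adjoint_rgen (e : G.Dart) : ContinuousLinearMap.adjoint (rgen e) = rgen e.op := by
  simp [rgen, map_add, add_comm, adjoint_smul]

open Classical in
lemma rann_mul_gen (e f : G.Dart) : rann e * gen f = gen f * rann e +
    if e = f then e.quart • ketbra (Path.triv e.src) (Path.triv e.tgt) else 0 := by
  rw [gen_eq, mul_add, mul_smul_comm, mul_smul_comm, rann_mul_creation, rann_mul_adjoint_creation,
    add_mul, smul_mul_assoc, smul_mul_assoc, smul_add]
  by_cases h : e = f
  · subst h; simp only [if_true]; abel
  · simp [h]

open Classical in
lemma adjoint_rann_mul_gen (e f : G.Dart) :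
    ContinuousLinearMap.adjoint (rann e) * gen f = gen f * ContinuousLinearMap.adjoint (rann e) -
      if e = f.op then e.quart • ketbra (Path.triv e.tgt) (Path.triv e.src) else 0 := by
  have h := congrArg ContinuousLinearMap.adjoint (rann_mul_gen e f.op)
  rw [map_add, adjoint_mul, adjoint_mul, adjoint_gen, Dart.op_op] at h
  rw [h]
  by_cases hh : e = f.op
  · simp [hh, adjoint_ketbra, adjoint_smul]
  · simp [hh]

/-- The creation part and the annihilation part of the right-handed generator each leave a rank one
commutator. The two have opposite signs and the same coefficient, the product of the fourth roots of
`e` and of `e.op`, and therefore cancel. -/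
lemma rgen_mul_gen (e f : G.Dart) : rgen e * gen f = gen f * rgen e := by
  classical
  rw [rgen, add_mul, smul_mul_assoc, smul_mul_assoc, rann_mul_gen, adjoint_rann_mul_gen]
  by_cases h : e = f.op
  · subst h
    simp only [Dart.op_op, if_true, Dart.op_src, Dart.op_tgt, mul_add, mul_smul_comm, smul_add,
      smul_sub, smul_smul, mul_comm]
    abel
  · have h' : e.op ≠ f := fun hh => h (by rw [← hh, Dart.op_op])
    simp [h, h', mul_add]

lemma rgen_mul_projOp (e : G.Dart) (v : V) : rgen e * projOp v = projOp v * rgen e := by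
  have h := commute_adjoint (rann_mul_projOp e v)
  rw [adjoint_projOp] at h
  simp [rgen, add_mul, mul_add, h, rann_mul_projOp]

lemma rproj_mul_gen (e : G.Dart) (v : V) : rproj v * gen e = gen e * rproj v := by
  have h := commute_adjoint (rproj_mul_creation e.op v)
  rw [adjoint_rproj] at h
  simp [gen_eq, add_mul, mul_add, h, rproj_mul_creation]

end

/-! ### Cyclicity of the vacuum and the trace property -/

section

variable {V E : Type*} [Fintype V] {G : WeightedGraph V E}

lemma submodule_eq_top_of_ket_mem (K : Submodule ℂ G.Fock) (hK : IsClosed (K : Set G.Fock))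
    (h : ∀ γ, ket γ ∈ K) : K = ⊤ := by
  classical
  rw [eq_top_iff]
  intro ξ _
  have hs := lp.hasSum_single (p := 2) (by norm_num) ξ
  refine hK.mem_of_tendsto hs (Filter.Eventually.of_forall fun s => K.sum_mem fun γ _ => ?_)
  have : (lp.single 2 γ (ξ γ) : G.Fock) = coef ξ γ • ket γ := by
    refine fock_ext fun δ => ?_
    rw [coef_smul, coef_ket, coef, lp.single_apply, Pi.single_apply]
    split_ifs with hh
    · subst hh; simp [coef]
    · simp
  rw [this]
  exact K.smul_mem _ (h γ)

lemma creation_ket {e : G.Dart} {γ : G.Path} (h : γ.start = e.tgt) :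
    creation e (ket γ) = ket (Path.cons e γ) := by
  classical
  refine fock_ext fun δ => ?_
  rw [coef_creation, coef_ket, coef_ket]
  by_cases h1 : δ.darts.head? = some e
  · rw [if_pos h1]
    refine if_congr ⟨fun hd => ?_, fun hd => ?_⟩ rfl rfl
    · rw [← hd, Path.cons_drop_one h1]
    · rw [hd, Path.drop_one_cons h]
  · rw [if_neg h1, if_neg]
    rintro rfl
    simp [Path.cons_darts h] at h1

open Classical in
lemma adjoint_creation_ket (e : G.Dart) (γ : G.Path) :
    ContinuousLinearMap.adjoint (creation e) (ket γ)
      = if γ.darts.head? = some e then ket (γ.drop 1) else 0 := by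
  refine fock_ext fun δ => ?_
  rw [coef_adjoint_creation, coef_ket]
  by_cases h : δ.start = e.tgt
  · rw [if_pos h]
    by_cases h1 : γ.darts.head? = some e
    · rw [if_pos h1, coef_ket]
      refine if_congr ⟨fun hd => ?_, fun hd => ?_⟩ rfl rfl
      · rw [← hd, Path.drop_one_cons h]
      · rw [hd, Path.cons_drop_one h1]
    · rw [if_neg h1, if_neg, coef_zero]
      rintro rfl
      simp [Path.cons_darts h] at h1
  · rw [if_neg h]
    split_ifs with h1
    · rw [coef_ket, if_neg]
      rintro rfl
      exact h (Path.drop_one_start h1)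
    · rfl

lemma adjoint_rann_ket {e : G.Dart} {γ : G.Path} (h : γ.finish = e.src) :
    ContinuousLinearMap.adjoint (rann e) (ket γ) = ket (Path.snoc e γ) := by
  classical
  refine fock_ext fun δ => ?_
  rw [coef_adjoint_rann, coef_ket, coef_ket]
  by_cases h1 : δ.darts.getLast? = some e
  · rw [if_pos h1]
    refine if_congr ⟨fun hd => ?_, fun hd => ?_⟩ rfl rfl
    · rw [← hd, Path.snoc_take h1]
    · rw [hd, Path.take_snoc h]
  · rw [if_neg h1, if_neg]
    rintro rfl
    simp [Path.snoc_darts h] at h1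

open Classical in
lemma rann_ket (e : G.Dart) (γ : G.Path) : rann e (ket γ)
      = if γ.darts.getLast? = some e then ket (γ.take (γ.length - 1)) else 0 := by
  refine fock_ext fun δ => ?_
  rw [coef_rann, coef_ket]
  by_cases h : δ.finish = e.src
  · rw [if_pos h]
    by_cases h1 : γ.darts.getLast? = some e
    · rw [if_pos h1, coef_ket]
      refine if_congr ⟨fun hd => ?_, fun hd => ?_⟩ rfl rfl
      · rw [← hd, Path.take_snoc h]
      · rw [hd, Path.snoc_take h1]
    · rw [if_neg h1, if_neg, coef_zero]
      rintro rfl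
      simp [Path.snoc_darts h] at h1
  · rw [if_neg h]
    split_ifs with h1
    · rw [coef_ket, if_neg]
      rintro rfl
      exact h (Path.take_finish_of_getLast h1)
    · rfl

/-- Induction on length: the generator of the first edge of a path, applied to the rest of the path,
gives a non-zero multiple of the path plus a multiple of a shorter one, which already lies in `K`.
-/
lemma eq_top_of_gen_mem (K : Submodule ℂ G.Fock) (hK : IsClosed (K : Set G.Fock))
    (h0 : ∀ v, ket (Path.triv v) ∈ K) (hg : ∀ e, ∀ ξ ∈ K, gen e ξ ∈ K) : K = ⊤ := by
  classical
  refine submodule_eq_top_of_ket_mem K hK ?_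
  suffices ∀ n, ∀ γ : G.Path, γ.length ≤ n → ket γ ∈ K from fun γ => this _ γ le_rfl
  intro n
  induction n with
  | zero =>
    intro γ hγ
    rw [Path.eq_triv_of_darts (List.eq_nil_of_length_eq_zero (Nat.le_zero.1 hγ))]
    exact h0 _
  | succ n ih =>
    intro γ hγ
    cases hd : γ.darts.head? with
    | none =>
      rw [Path.eq_triv_of_darts (List.head?_eq_none_iff.1 hd)]
      exact h0 _
    | some e =>
      have hl : (γ.drop 1).length ≤ n := by
        simp only [Path.length, Path.drop_darts, List.length_drop] at hγ ⊢; omega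
      have hm := hg e _ (ih _ hl)
      rw [gen_eq, add_apply, smul_apply, smul_apply,
        creation_ket (Path.drop_one_start hd), Path.cons_drop_one hd, adjoint_creation_ket] at hm
      have h2 : (if (γ.drop 1).darts.head? = some e.op then ket ((γ.drop 1).drop 1) else 0) ∈ K := by
        split_ifs
        · refine ih _ (le_trans ?_ hl)
          simp only [Path.length, Path.drop_darts, List.length_drop]
          omega
        · exact K.zero_mem
      have h3 := (K.add_mem_iff_left (K.smul_mem e.op.quart h2)).1 hm
      exact (K.smul_mem_iff e.quart_ne).1 h3

/-- The mirror image of `eq_top_of_gen_mem`, with paths built up from their last edge. -/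
lemma eq_top_of_rgen_mem (K : Submodule ℂ G.Fock) (hK : IsClosed (K : Set G.Fock))
    (h0 : ∀ v, ket (Path.triv v) ∈ K) (hg : ∀ e, ∀ ξ ∈ K, rgen e ξ ∈ K) : K = ⊤ := by
  classical
  refine submodule_eq_top_of_ket_mem K hK ?_
  suffices ∀ n, ∀ γ : G.Path, γ.length ≤ n → ket γ ∈ K from fun γ => this _ γ le_rfl
  intro n
  induction n with
  | zero =>
    intro γ hγ
    rw [Path.eq_triv_of_darts (List.eq_nil_of_length_eq_zero (Nat.le_zero.1 hγ))]
    exact h0 _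
  | succ n ih =>
    intro γ hγ
    cases hd : γ.darts.getLast? with
    | none =>
      rw [Path.eq_triv_of_darts (List.getLast?_eq_none_iff.1 hd)]
      exact h0 _
    | some e =>
      have hl : (γ.take (γ.length - 1)).length ≤ n := by
        simp only [Path.length, Path.take_darts, List.length_take] at hγ ⊢; omega
      have hm := hg e _ (ih _ hl)
      rw [rgen, add_apply, smul_apply, smul_apply,
        adjoint_rann_ket (Path.take_finish_of_getLast hd), Path.snoc_take hd, rann_ket] at hm
      set γ' := γ.take (γ.length - 1)
      have h2 : (if γ'.darts.getLast? = some e.op then ket (γ'.take (γ'.length - 1)) else 0)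
          ∈ K := by
        split_ifs
        · refine ih _ (le_trans ?_ hl)
          simp [Path.length]
        · exact K.zero_mem
      have h3 := (K.add_mem_iff_left (K.smul_mem e.quart h2)).1 hm
      exact (K.smul_mem_iff e.op.quart_ne).1 h3

/-! ### The vacuum vector, the trace and the commutant of the right-handed operators -/

variable (G) in
/-- The unit vector that implements the trace. -/
def vac : G.Fock := ∑ v, ((Real.sqrt (G.wt v) : ℝ) : ℂ) • ket (Path.triv v)

open Classical in
lemma coef_vac (γ : G.Path) :
    coef (vac G) γ = if γ.darts = [] then ((Real.sqrt (G.wt γ.start) : ℝ) : ℂ) else 0 := by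
  rw [vac, coef_sum]
  simp only [coef_smul, coef_ket]
  by_cases h : γ.darts = []
  · rw [if_pos h, Finset.sum_eq_single γ.start]
    · rw [if_pos (Path.eq_triv_of_darts h), mul_one]
    · intro v _ hv
      rw [if_neg, mul_zero]
      rintro rfl
      exact hv rfl
    · simp
  · rw [if_neg h]
    refine Finset.sum_eq_zero fun v _ => ?_
    rw [if_neg, mul_zero]
    rintro rfl
    exact h rfl

lemma projOp_vac (v : V) : projOp v (vac G) = ((Real.sqrt (G.wt v) : ℝ) : ℂ) • ket (Path.triv v) := by
  classical
  refine fock_ext fun γ => ?_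
  rw [coef_projOp, coef_vac, coef_smul, coef_ket]
  by_cases h : γ.darts = []
  · rw [Path.eq_triv_of_darts h]
    by_cases h1 : γ.start = v
    · subst h1; simp
    · have : Path.triv γ.start ≠ (Path.triv v : G.Path) := fun hh => h1 (congrArg Path.start hh)
      simp [h1, this]
  · have : γ ≠ Path.triv v := by rintro rfl; exact h rfl
    simp [h, this]

lemma rproj_vac (v : V) : rproj v (vac G) = projOp v (vac G) := by
  classical
  refine fock_ext fun γ => ?_
  rw [coef_projOp, coef_vac, coef_rproj, coef_vac]
  by_cases h : γ.darts = []
  · rw [Path.eq_triv_of_darts h]; simp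
  · simp [h]

variable (G) in
/-- The operators that commute with the right-handed generators and projections. -/
def leftAlg : Subalgebra ℂ (G.Fock →L[ℂ] G.Fock) :=
  Subalgebra.centralizer ℂ (Set.range rgen ∪ Set.range rproj)

lemma mem_leftAlg {T : G.Fock →L[ℂ] G.Fock} : T ∈ leftAlg G ↔
    (∀ e, rgen e * T = T * rgen e) ∧ ∀ v, rproj v * T = T * rproj v := by
  simp [leftAlg, Subalgebra.mem_centralizer_iff, or_imp, forall_and]

lemma adjoint_mem_leftAlg {T : G.Fock →L[ℂ] G.Fock} (h : T ∈ leftAlg G) :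
    ContinuousLinearMap.adjoint T ∈ leftAlg G := by
  rw [mem_leftAlg] at h ⊢
  refine ⟨fun e => ?_, fun v => ?_⟩
  · have := commute_adjoint (h.1 e.op)
    rwa [adjoint_rgen] at this
  · have := commute_adjoint (h.2 v)
    rwa [adjoint_rproj] at this

lemma gen_mem_leftAlg (e : G.Dart) : gen e ∈ leftAlg G :=
  mem_leftAlg.2 ⟨fun f => rgen_mul_gen f e, fun v => rproj_mul_gen e v⟩

lemma projOp_mem_leftAlg (v : V) : projOp v ∈ leftAlg G :=
  mem_leftAlg.2 ⟨fun f => rgen_mul_projOp f v, fun w => rproj_mul_projOp v w⟩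

lemma isClosed_leftAlg : IsClosed (leftAlg G : Set (G.Fock →L[ℂ] G.Fock)) :=
  Set.isClosed_centralizer _

lemma trace_eq (T : G.Fock →L[ℂ] G.Fock) :
    trace T = ∑ v, (G.wt v : ℂ) * coef (T (ket (Path.triv v))) (Path.triv v) := by
  simp only [← inner_ket_left]; rfl

lemma coef_triv_of_mem_leftAlg {T : G.Fock →L[ℂ] G.Fock} (h : T ∈ leftAlg G) {v w : V}
    (hvw : v ≠ w) : coef (T (ket (Path.triv w))) (Path.triv v) = 0 := by
  classical
  have h1 : rproj w (ket (Path.triv w : G.Path)) = ket (Path.triv w) := by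
    refine fock_ext fun γ => ?_
    rw [coef_rproj, coef_ket]
    by_cases hh : γ = Path.triv w
    · subst hh; simp
    · simp [hh]
  rw [← h1, ← mul_apply_eq_comp T, ← (mem_leftAlg.1 h).2, mul_apply_eq_comp, coef_rproj,
    if_neg]
  exact hvw

/-- The vector state has cross terms between different vertices that `trace` lacks. They vanish here
because `T` commutes with the projections onto paths with a given end. -/
lemma trace_eq_inner {T : G.Fock →L[ℂ] G.Fock} (h : T ∈ leftAlg G) :
    trace T = inner ℂ (vac G) (T (vac G)) := by
  rw [trace_eq]
  conv_rhs => rw [vac, sum_inner]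
  refine Finset.sum_congr rfl fun v _ => ?_
  rw [map_sum, inner_smul_left, inner_ket_left, coef_sum, Finset.sum_eq_single v]
  · rw [map_smul, coef_smul, ← mul_assoc, Complex.conj_ofReal, ← Complex.ofReal_mul,
      Real.mul_self_sqrt (G.wt_pos v).le]
  · intro w _ hw
    rw [map_smul, coef_smul, coef_triv_of_mem_leftAlg h hw.symm, mul_zero]
  · simp

/-- A vector that is cyclic for an algebra separates its commutant: the kernel of `T` is closed and
invariant under the right-handed generators, and it contains the paths of length zero. -/
lemma eq_zero_of_apply_vac {T : G.Fock →L[ℂ] G.Fock} (h : T ∈ leftAlg G) (h0 : T (vac G) = 0) :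
    T = 0 := by
  have hK : (LinearMap.ker T.toLinearMap) = ⊤ := by
    refine eq_top_of_rgen_mem _ ?_ ?_ ?_
    · exact T.isClosed_ker
    · intro v
      have h1 : T (projOp v (vac G)) = 0 := by
        rw [← rproj_vac, ← mul_apply_eq_comp T, ← (mem_leftAlg.1 h).2, mul_apply_eq_comp, h0,
          map_zero]
      rw [projOp_vac, map_smul] at h1
      have h2 : ((Real.sqrt (G.wt v) : ℝ) : ℂ) ≠ 0 :=
        Complex.ofReal_ne_zero.2 (Real.sqrt_pos.2 (G.wt_pos v)).ne'
      exact (smul_eq_zero.1 h1).resolve_left h2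
    · intro e ξ hξ
      change T (rgen e ξ) = 0
      have hξ' : T ξ = 0 := hξ
      rw [← mul_apply_eq_comp T, ← (mem_leftAlg.1 h).1, mul_apply_eq_comp, hξ', map_zero]
  ext1 ξ
  have : ξ ∈ LinearMap.ker T.toLinearMap := by rw [hK]; trivial
  exact this

/-- Both sides equal the fourth root of the product of the two masses. -/
lemma quart_mul_sqrt (e : G.Dart) : e.quart * ((Real.sqrt (G.wt e.tgt) : ℝ) : ℂ)
    = e.op.quart * ((Real.sqrt (G.wt e.src) : ℝ) : ℂ) := by
  have hs := G.wt_pos e.src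
  have ht := G.wt_pos e.tgt
  have key : ∀ a b : ℝ, 0 < a → 0 < b →
      (a / b) ^ (1 / 4 : ℝ) * Real.sqrt b = a ^ (1 / 4 : ℝ) * b ^ (1 / 4 : ℝ) := by
    intro a b ha hb
    have h1 : Real.sqrt b = b ^ (1 / 4 : ℝ) * b ^ (1 / 4 : ℝ) := by
      rw [Real.sqrt_eq_rpow, ← Real.rpow_add hb]; norm_num
    rw [h1, Real.div_rpow ha.le hb.le]
    have : b ^ (1 / 4 : ℝ) ≠ 0 := (Real.rpow_pos_of_pos hb _).ne'
    field_simp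
  simp only [Dart.quart, ← Complex.ofReal_mul]
  congr 1
  rw [key _ _ hs ht, Dart.op_src, Dart.op_tgt, key _ _ ht hs, mul_comm]

/-- The only path that either side can reach is the edge `e` itself. The left-handed generator
starts from its target and the right-handed one from its source, and `quart_mul_sqrt` equates the
coefficients. -/
lemma gen_vac (e : G.Dart) : gen e (vac G) = rgen e (vac G) := by
  classical
  refine fock_ext fun γ => ?_
  rw [gen_eq, rgen, add_apply, add_apply, smul_apply,
    smul_apply, smul_apply,
    smul_apply, coef_add, coef_add, coef_smul, coef_smul, coef_smul, coef_smul,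
    coef_creation, coef_adjoint_creation, coef_adjoint_rann, coef_rann, coef_vac, coef_vac,
    coef_vac, coef_vac]
  -- The vacuum is supported on paths of length zero, and a path extended by an edge is never one of
  -- them, so the annihilation terms drop out on both sides.
  have z1 : (if γ.start = e.op.tgt then (if (Path.cons e.op γ).darts = [] then
      ((Real.sqrt (G.wt (Path.cons e.op γ).start) : ℝ) : ℂ) else 0) else 0) = 0 := by
    by_cases h : γ.start = e.op.tgt
    · rw [if_pos h, if_neg (by simp [Path.cons_darts h])]
    · rw [if_neg h]
  have z2 : (if γ.finish = e.op.src then (if (Path.snoc e.op γ).darts = [] then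
      ((Real.sqrt (G.wt (Path.snoc e.op γ).start) : ℝ) : ℂ) else 0) else 0) = 0 := by
    by_cases h : γ.finish = e.op.src
    · rw [if_pos h, if_neg (by simp [Path.snoc_darts h])]
    · rw [if_neg h]
  rw [z1, z2, mul_zero, mul_zero, add_zero, add_zero]
  by_cases h : γ.darts = [e]
  · have h1 : γ.darts.head? = some e := by rw [h]; rfl
    have h2 : γ.darts.getLast? = some e := by rw [h]; rfl
    have h3 : (γ.drop 1).darts = [] := by simp [h]
    have h4 : (γ.take (γ.length - 1)).darts = [] := by simp [h, Path.length]
    rw [if_pos h1, if_pos h2, if_pos h3, if_pos h4, Path.drop_one_start h1, Path.take_start,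
      Path.start_eq_src h1]
    exact quart_mul_sqrt e
  · have h1 : ¬ (γ.darts.head? = some e ∧ (γ.drop 1).darts = []) := by
      rintro ⟨h1, h2⟩
      obtain ⟨l, hl⟩ := List.head?_eq_some_iff.1 h1
      simp only [Path.drop_darts, hl, List.drop_succ_cons, List.drop_zero] at h2
      exact h (by rw [hl, h2])
    have h2 : ¬ (γ.darts.getLast? = some e ∧ (γ.take (γ.length - 1)).darts = []) := by
      rintro ⟨h1, h2⟩
      obtain ⟨l, hl⟩ := List.getLast?_eq_some_iff.1 h1
      simp [hl, Path.length] at h2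
      exact h (by rw [hl, h2]; rfl)
    rw [← ite_and, ← ite_and, if_neg h1, if_neg h2, mul_zero, mul_zero]

lemma inner_adjoint_vac {S : G.Fock →L[ℂ] G.Fock} (ξ : G.Fock) : inner ℂ (vac G) (S ξ)
    = inner ℂ (ContinuousLinearMap.adjoint S (vac G)) ξ := by
  rw [ContinuousLinearMap.adjoint_inner_left]

/-- In the vector state, `S` on the left may be replaced by its twin `S'` acting on the vacuum,
moved past `T`, and replaced by `S` again on the right. -/
lemma trace_mul_comm_of_vac {S S' T : G.Fock →L[ℂ] G.Fock} (hS : S ∈ leftAlg G)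
    (hT : T ∈ leftAlg G) (hc : S' * T = T * S') (h1 : S (vac G) = S' (vac G))
    (h2 : ContinuousLinearMap.adjoint S (vac G) = ContinuousLinearMap.adjoint S' (vac G)) :
    trace (S * T) = trace (T * S) := by
  rw [trace_eq_inner (mul_mem hS hT), trace_eq_inner (mul_mem hT hS), mul_apply_eq_comp,
    mul_apply_eq_comp, inner_adjoint_vac, h2, ← inner_adjoint_vac, h1, ← mul_apply_eq_comp, hc,
    mul_apply_eq_comp]

variable (G) in
/-- The trace, as a bounded functional. -/
def traceL : (G.Fock →L[ℂ] G.Fock) →L[ℂ] ℂ :=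
  ∑ v, (G.wt v : ℂ) • (innerSL ℂ (ket (Path.triv v))).comp
    (ContinuousLinearMap.apply ℂ G.Fock (ket (Path.triv v)))

lemma traceL_apply (T : G.Fock →L[ℂ] G.Fock) : traceL G T = trace T := by
  rw [trace_eq, traceL, sum_apply]
  simp [inner_ket_left]

variable (G) in
/-- The operators in `leftAlg G` that commute with all others under the trace. -/
def tracialAlg : Subalgebra ℂ (G.Fock →L[ℂ] G.Fock) where
  carrier := {S | S ∈ leftAlg G ∧ ∀ T ∈ leftAlg G, trace (S * T) = trace (T * S)}
  mul_mem' := by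
    rintro S S' ⟨h, h1⟩ ⟨h', h1'⟩
    refine ⟨mul_mem h h', fun T hT => ?_⟩
    -- Testing against all of `leftAlg`, and not only against tracial elements, makes the condition
    -- stable under products: the second factor is absorbed into the test operator.
    rw [mul_assoc, h1 _ (mul_mem h' hT), mul_assoc, h1' _ (mul_mem hT h), mul_assoc]
  add_mem' := by
    rintro S S' ⟨h, h1⟩ ⟨h', h1'⟩
    refine ⟨add_mem h h', fun T hT => ?_⟩
    rw [add_mul, mul_add, ← traceL_apply, ← traceL_apply, map_add, map_add, traceL_apply,
      traceL_apply, traceL_apply, traceL_apply, h1 T hT, h1' T hT]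
  algebraMap_mem' := fun c => ⟨algebraMap_mem _ c, fun T _ => by rw [Algebra.commutes]⟩

lemma leftAlg_of_tracial {S : G.Fock →L[ℂ] G.Fock} (h : S ∈ tracialAlg G) : S ∈ leftAlg G := h.1

lemma trace_mul_comm {S T : G.Fock →L[ℂ] G.Fock} (hS : S ∈ tracialAlg G)
    (hT : T ∈ tracialAlg G) : trace (S * T) = trace (T * S) := hS.2 T hT.1

lemma gen_mem_tracialAlg (e : G.Dart) : gen e ∈ tracialAlg G :=
  ⟨gen_mem_leftAlg e, fun T hT => trace_mul_comm_of_vac (S' := rgen e) (gen_mem_leftAlg e) hT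
    ((mem_leftAlg.1 hT).1 e) (gen_vac e) (by rw [adjoint_gen, adjoint_rgen, gen_vac])⟩

lemma projOp_mem_tracialAlg (v : V) : projOp v ∈ tracialAlg G :=
  ⟨projOp_mem_leftAlg v, fun T hT => trace_mul_comm_of_vac (S' := rproj v) (projOp_mem_leftAlg v) hT
    ((mem_leftAlg.1 hT).2 v) (rproj_vac v).symm
    (by rw [adjoint_projOp, adjoint_rproj, rproj_vac])⟩

lemma isClosed_tracialAlg : IsClosed (tracialAlg G : Set (G.Fock →L[ℂ] G.Fock)) := by
  have : (tracialAlg G : Set (G.Fock →L[ℂ] G.Fock)) = (leftAlg G : Set _) ∩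
      ⋂ T ∈ leftAlg G, {S | traceL G (S * T) = traceL G (T * S)} := by
    ext S
    simp only [Set.mem_inter_iff, Set.mem_iInter, Set.mem_ofPred_eq, traceL_apply]
    rfl
  rw [this]
  refine isClosed_leftAlg.inter (isClosed_biInter fun T _ => isClosed_eq ?_ ?_) <;> fun_prop

end

section

variable {V E : Type*} [Fintype V] {G : WeightedGraph V E}

/-! ### Cutting paths -/

namespace Path

/-- The concatenation of two paths. -/
def append (γ δ : G.Path) (h : γ.finish = δ.start) : G.Path :=
  ⟨γ.start, γ.darts ++ δ.darts, by
    rw [isPathFrom_append]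
    exact ⟨γ.isPath, by have := δ.isPath; rw [← h] at this; exact this⟩⟩

lemma append_take (γ δ : G.Path) (h : γ.finish = δ.start) :
    (γ.append δ h).take γ.length = γ :=
  ext_darts rfl (by simp [append, length])

lemma append_drop (γ δ : G.Path) (h : γ.finish = δ.start) :
    (γ.append δ h).drop γ.length = δ := by
  refine ext_darts ?_ (by simp [append, length])
  rw [drop_start, append_take, h]

lemma length_append (γ δ : G.Path) (h : γ.finish = δ.start) :
    (γ.append δ h).length = γ.length + δ.length := by simp [append, length]

lemma ext_take_drop {γ δ : G.Path} {i j : ℕ} (h : γ.take i = δ.take j) (h' : γ.drop i = δ.drop j) :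
    γ = δ := by
  refine ext_darts (by rw [← take_start γ i, h, take_start]) ?_
  rw [← List.take_append_drop i γ.darts, ← List.take_append_drop j δ.darts]
  rw [← take_darts, ← take_darts, h, ← drop_darts, ← drop_darts, h']

lemma length_take_add_length_drop (γ : G.Path) (i : ℕ) :
    (γ.take i).length + (γ.drop i).length = γ.length := by
  simp [length]; omega

lemma length_take {γ : G.Path} {i : ℕ} (h : i ≤ γ.length) : (γ.take i).length = i := by
  simp only [length, take_darts, List.length_take]
  exact min_eq_left h

lemma take_finish_src (γ : G.Path) (i : Fin γ.length) :
    (γ.take i).finish = (γ.darts[(i : ℕ)]'i.2).src := by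
  have h := γ.isPath
  rw [← List.take_append_drop i γ.darts, isPathFrom_append,
    List.drop_eq_getElem_cons (l := γ.darts) i.2] at h
  exact h.2.1.symm

lemma drop_succ_start (γ : G.Path) (i : Fin γ.length) :
    (γ.drop (i + 1)).start = (γ.darts[(i : ℕ)]'i.2).tgt := by
  change endFrom γ.start (γ.darts.take (i + 1)) = _
  rw [List.take_succ_eq_append_getElem (l := γ.darts) i.2, endFrom_append]
  rfl

lemma join_take_drop (γ : G.Path) (i : Fin γ.length) :
    (γ.take i).join (γ.darts[(i : ℕ)]'i.2) (γ.drop (i + 1))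
      ⟨take_finish_src γ i, drop_succ_start γ i⟩ = γ := by
  refine ext_darts rfl ?_
  rw [join_darts, take_darts, drop_darts, ← List.drop_eq_getElem_cons (l := γ.darts) i.2,
    List.take_append_drop]

lemma take_join (γ δ : G.Path) (e : G.Dart) (h) : (γ.join e δ h).take γ.length = γ :=
  ext_darts rfl (by simp [length])

lemma drop_join (γ δ : G.Path) (e : G.Dart) (h) : (γ.join e δ h).drop (γ.length + 1) = δ := by
  have hl : γ.length < (γ.join e δ h).length := by rw [join_length]; omega
  refine ext_darts ?_ (by simp [length])
  have := drop_succ_start (γ.join e δ h) ⟨γ.length, hl⟩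
  simp only [join_darts] at this
  rw [this, h.2]
  simp [length]

lemma getElem_join (γ δ : G.Path) (e : G.Dart) (h) (hl) :
    (γ.join e δ h).darts[γ.length]'hl = e := by simp [length]

lemma length_take_add_length_drop_succ (γ : G.Path) (i : Fin γ.length) :
    (γ.take i).length + (γ.drop (i + 1)).length + 1 = γ.length := by
  have := i.2
  simp only [length, take_darts, drop_darts, List.length_take, List.length_drop] at *
  omega

end Path

/-- Cutting a path in two. -/
def cutPair (p : Σ γ : G.Path, Fin (γ.length + 1)) : G.Path × G.Path :=
  (p.1.take p.2, p.1.drop p.2)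

lemma cutPair_injective : Function.Injective (cutPair (G := G)) := by
  rintro ⟨γ, i⟩ ⟨δ, j⟩ h
  simp only [cutPair, Prod.mk.injEq] at h
  obtain rfl := Path.ext_take_drop h.1 h.2
  have := congrArg Path.length h.1
  rw [Path.length_take (Nat.le_of_lt_succ i.2), Path.length_take (Nat.le_of_lt_succ j.2)] at this
  rw [Fin.ext this]

lemma mem_range_cutPair {p : G.Path × G.Path} (h : p.1.finish = p.2.start) :
    p ∈ Set.range (cutPair (G := G)) := by
  refine ⟨⟨p.1.append p.2 h, ⟨p.1.length, ?_⟩⟩, ?_⟩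
  · rw [Path.length_append]; omega
  · exact Prod.ext (Path.append_take _ _ h) (Path.append_drop _ _ h)

/-- Cuts of paths inject into pairs of paths, and their image contains all composable pairs. A sum
over pairs that ignores the other pairs can thus be regrouped by the concatenated path. This is how
products of series are evaluated and estimated. -/
lemma hasSum_cut {M : Type*} [AddCommMonoid M] [TopologicalSpace M] [ContinuousAdd M]
    [RegularSpace M] {F : G.Path → G.Path → M}
    (hF : ∀ γ δ, γ.finish ≠ δ.start → F γ δ = 0) {s : M}
    (h : HasSum (fun p : G.Path × G.Path => F p.1 p.2) s) :
    HasSum (fun γ : G.Path => ∑ i ∈ Finset.range (γ.length + 1), F (γ.take i) (γ.drop i)) s := by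
  have h1 : HasSum ((fun p : G.Path × G.Path => F p.1 p.2) ∘ cutPair) s := by
    refine (cutPair_injective.hasSum_iff fun p hp => hF _ _ fun hh => hp ?_).2 h
    exact mem_range_cutPair hh
  refine h1.sigma fun γ => ?_
  rw [Finset.sum_range]
  exact hasSum_fintype _

/-- Cutting an edge out of a path. -/
def cutTriple (p : Σ γ : G.Path, Fin γ.length) : G.Path × G.Dart × G.Path :=
  (p.1.take p.2, p.1.darts[(p.2 : ℕ)]'p.2.2, p.1.drop (p.2 + 1))

lemma cutTriple_injective : Function.Injective (cutTriple (G := G)) := by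
  rintro ⟨γ, i⟩ ⟨δ, j⟩ h
  simp only [cutTriple, Prod.mk.injEq] at h
  obtain rfl : γ = δ := by
    refine Path.ext_darts (by rw [← Path.take_start γ i, h.1, Path.take_start]) ?_
    rw [← Path.join_take_drop γ i, ← Path.join_take_drop δ j, Path.join_darts, Path.join_darts,
      h.1, h.2.1, h.2.2]
  have := congrArg Path.length h.1
  rw [Path.length_take i.2.le, Path.length_take j.2.le] at this
  rw [Fin.ext this]

lemma mem_range_cutTriple {p : G.Path × G.Dart × G.Path}
    (h : p.1.finish = p.2.1.src ∧ p.2.2.start = p.2.1.tgt) :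
    p ∈ Set.range (cutTriple (G := G)) := by
  have hl : p.1.length < (p.1.join p.2.1 p.2.2 h).length := by
    rw [Path.join_length]; omega
  refine ⟨⟨p.1.join p.2.1 p.2.2 h, ⟨p.1.length, hl⟩⟩, ?_⟩
  refine Prod.ext (Path.take_join _ _ _ h) (Prod.ext ?_ (Path.drop_join _ _ _ h))
  exact Path.getElem_join _ _ _ h hl

/-- The analogue of `hasSum_cut` for a path with a marked edge. It turns a sum of all free
difference quotients of a series back into a sum over the paths of that series. -/
lemma hasSum_cutTriple {M : Type*} [AddCommMonoid M] [TopologicalSpace M] [ContinuousAdd M]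
    [RegularSpace M] {F : G.Path → G.Dart → G.Path → M}
    (hF : ∀ γ e δ, ¬ (γ.finish = e.src ∧ δ.start = e.tgt) → F γ e δ = 0) {s : M}
    (h : HasSum (fun p : G.Path × G.Dart × G.Path => F p.1 p.2.1 p.2.2) s) :
    HasSum (fun γ : G.Path => ∑ i : Fin γ.length,
      F (γ.take i) (γ.darts[(i : ℕ)]'i.2) (γ.drop (i + 1))) s := by
  have h1 : HasSum ((fun p : G.Path × G.Dart × G.Path => F p.1 p.2.1 p.2.2) ∘ cutTriple) s := by
    refine (cutTriple_injective.hasSum_iff fun p hp => hF _ _ _ fun hh => hp ?_).2 h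
    exact mem_range_cutTriple hh
  exact h1.sigma fun γ => hasSum_fintype _

namespace Series

lemma diff_cut (a : G.Series) (γ : G.Path) (i : Fin γ.length) :
    diff (γ.darts[(i : ℕ)]'i.2) a (γ.take i) (γ.drop (i + 1)) = a γ := by
  rw [diff, dif_pos ⟨Path.take_finish_src γ i, Path.drop_succ_start γ i⟩, Path.join_take_drop]

lemma diff_of_not {a : G.Series} {γ δ : G.Path} {e : G.Dart}
    (h : ¬ (γ.finish = e.src ∧ δ.start = e.tgt)) : diff e a γ δ = 0 := dif_neg h

end Series

lemma wt_le_one (v : V) : G.wt v ≤ 1 := by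
  rw [← G.wt_sum]
  exact Finset.single_le_sum (fun w _ => (G.wt_pos w).le) (Finset.mem_univ v)

lemma Path.wt_nonneg (γ : G.Path) : 0 ≤ γ.wt :=
  List.sum_nonneg (by
    intro x hx
    obtain ⟨e, -, rfl⟩ := List.mem_map.1 hx
    exact Real.sqrt_nonneg _)

lemma Path.wt_le_length (γ : G.Path) : γ.wt ≤ γ.length := by
  have h : ∀ l : List G.Dart, (l.map Dart.wt).sum ≤ l.length := by
    intro l
    induction l with
    | nil => simp
    | cons e l ih =>
      have h1 : e.wt ≤ 1 := by
        refine Real.sqrt_le_one.2 ?_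
        exact mul_le_one₀ (wt_le_one _) (G.wt_pos _).le (wt_le_one _)
      simp only [List.map_cons, List.sum_cons, List.length_cons, Nat.cast_add, Nat.cast_one]
      linarith
  exact h γ.darts

namespace Series

/-! ### Weighted `ℓ¹` norms -/

/-- The weighted `ℓ¹` norm of a series. -/
def wnorm (ρ : ℝ≥0) (a : G.Series) : ℝ≥0∞ := ∑' γ : G.Path, ‖a γ‖ₑ * (ρ : ℝ≥0∞) ^ γ.length

end Series

namespace Tensor

/-- The weighted `ℓ¹` norm of a double series. -/
def wnorm (ρ : ℝ≥0) (u : G.Tensor) : ℝ≥0∞ :=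
  ∑' p : G.Path × G.Path, ‖u p.1 p.2‖ₑ * (ρ : ℝ≥0∞) ^ (p.1.length + p.2.length)

end Tensor

namespace Series

lemma wnorm_mono {ρ ρ' : ℝ≥0} (h : ρ ≤ ρ') (a : G.Series) : wnorm ρ a ≤ wnorm ρ' a :=
  ENNReal.tsum_le_tsum fun γ => by gcongr

lemma wnorm_add_le (ρ : ℝ≥0) (a b : G.Series) : wnorm ρ (a + b) ≤ wnorm ρ a + wnorm ρ b := by
  rw [wnorm, wnorm, wnorm, ← ENNReal.tsum_add]
  refine ENNReal.tsum_le_tsum fun γ => ?_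
  rw [← add_mul]
  gcongr
  exact enorm_add_le _ _

lemma wnorm_smul (ρ : ℝ≥0) (c : ℂ) (a : G.Series) : wnorm ρ (c • a) = ‖c‖ₑ * wnorm ρ a := by
  rw [wnorm, wnorm, ← ENNReal.tsum_mul_left]
  refine tsum_congr fun γ => ?_
  rw [Pi.smul_apply, enorm_smul, mul_assoc]

lemma wnorm_neg (ρ : ℝ≥0) (a : G.Series) : wnorm ρ (-a) = wnorm ρ a := by
  rw [wnorm, wnorm]
  simp

lemma wnorm_sum_le {ι : Type*} (ρ : ℝ≥0) (s : Finset ι) (a : ι → G.Series) :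
    wnorm ρ (∑ i ∈ s, a i) ≤ ∑ i ∈ s, wnorm ρ (a i) := by
  classical
  induction s using Finset.induction_on with
  | empty => simp [wnorm]
  | insert i s hi ih =>
    rw [Finset.sum_insert hi, Finset.sum_insert hi]
    exact (wnorm_add_le _ _ _).trans (by gcongr)

lemma enorm_tsum_le {ι : Type*} {M : Type*} [NormedAddCommGroup M] (f : ι → M) :
    ‖∑' i, f i‖ₑ ≤ ∑' i, ‖f i‖ₑ := enorm_tsum_le_tsum_enorm

lemma wnorm_tsum_le {ι : Type*} (ρ : ℝ≥0) (a : ι → G.Series) :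
    wnorm ρ (fun γ => ∑' i, a i γ) ≤ ∑' i, wnorm ρ (a i) := by
  simp only [wnorm]
  rw [ENNReal.tsum_comm]
  refine ENNReal.tsum_le_tsum fun γ => ?_
  rw [ENNReal.tsum_mul_right]
  gcongr
  exact enorm_tsum_le _

end Series

namespace Tensor

lemma wnorm_mono {ρ ρ' : ℝ≥0} (h : ρ ≤ ρ') (u : G.Tensor) : wnorm ρ u ≤ wnorm ρ' u :=
  ENNReal.tsum_le_tsum fun γ => by gcongr

lemma wnorm_add_le (ρ : ℝ≥0) (a b : G.Tensor) : wnorm ρ (a + b) ≤ wnorm ρ a + wnorm ρ b := by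
  rw [wnorm, wnorm, wnorm, ← ENNReal.tsum_add]
  refine ENNReal.tsum_le_tsum fun γ => ?_
  rw [← add_mul]
  gcongr
  exact enorm_add_le _ _

lemma wnorm_sum_le {ι : Type*} (ρ : ℝ≥0) (s : Finset ι) (a : ι → G.Tensor) :
    wnorm ρ (∑ i ∈ s, a i) ≤ ∑ i ∈ s, wnorm ρ (a i) := by
  classical
  induction s using Finset.induction_on with
  | empty => simp [wnorm]
  | insert i s hi ih =>
    rw [Finset.sum_insert hi, Finset.sum_insert hi]
    exact (wnorm_add_le _ _ _).trans (by gcongr)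

open Classical in
lemma wnorm_mult_le (ρ : ℝ≥0) (u : G.Tensor) : (mult u).wnorm ρ ≤ wnorm ρ u := by
  set F : G.Path → G.Path → ℝ≥0∞ := fun γ δ => if γ.finish = δ.start then
    ‖u γ δ‖ₑ * (ρ : ℝ≥0∞) ^ (γ.length + δ.length) else 0 with hF
  have h := hasSum_cut (F := F) (fun γ δ h => if_neg h) ENNReal.summable.hasSum
  refine (ENNReal.tsum_le_tsum (g := fun γ => ∑ i ∈ Finset.range (γ.length + 1),
    F (γ.take i) (γ.drop i)) fun γ => ?_).trans (h.tsum_eq.le.trans ?_)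
  · rw [mult]
    refine (mul_le_mul_left (enorm_sum_le _ _) _).trans ?_
    rw [Finset.sum_mul]
    refine Finset.sum_le_sum fun i _ => ?_
    rw [hF]
    dsimp only
    rw [if_pos (by simp), Path.length_take_add_length_drop]
  · refine ENNReal.tsum_le_tsum fun p => ?_
    rw [hF]
    dsimp only
    split_ifs
    · exact le_rfl
    · exact zero_le

lemma wnorm_flip (ρ : ℝ≥0) (u : G.Tensor) : wnorm ρ (flip u) = wnorm ρ u := by
  rw [wnorm, wnorm, ← (Equiv.prodComm _ _).tsum_eq]
  exact tsum_congr fun p => by simp [flip, add_comm]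

end Tensor

namespace Series

/-- Every path occurs once for each of its edges, and removing that edge lowers the exponent of `ρ`
by one. The free difference quotients together thus behave like the derivative of a power series in
one variable. -/
lemma tsum_wnorm_diff (ρ : ℝ≥0) (a : G.Series) : ∑' p : G.Path × G.Dart × G.Path,
    ‖diff p.2.1 a p.1 p.2.2‖ₑ * (ρ : ℝ≥0∞) ^ (p.1.length + p.2.2.length)
      = ∑' γ : G.Path, ‖a γ‖ₑ * (γ.length * (ρ : ℝ≥0∞) ^ (γ.length - 1)) := by
  have h := hasSum_cutTriple (F := fun γ e δ => ‖diff e a γ δ‖ₑ *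
    (ρ : ℝ≥0∞) ^ (γ.length + δ.length)) (fun γ e δ h => by simp [diff_of_not h])
    ENNReal.summable.hasSum
  rw [← h.tsum_eq]
  refine tsum_congr fun γ => ?_
  simp only [diff_cut]
  rw [← Finset.mul_sum]
  congr 1
  rw [Finset.sum_congr rfl (g := fun _ => (ρ : ℝ≥0∞) ^ (γ.length - 1))]
  · simp
  · intro i _
    congr 1
    have := Path.length_take_add_length_drop_succ γ i
    omega

/-- A Cauchy estimate: for `d = ρ' - ρ`, the term `n ρ ^ (n - 1) d` is one term of the binomial
expansion of `(ρ + d) ^ n`. It prices each differentiation at a smaller radius. -/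
lemma nat_mul_pow_le {ρ ρ' : ℝ≥0} (h : ρ < ρ') (n : ℕ) :
    (n : ℝ≥0) * ρ ^ (n - 1) ≤ (ρ' - ρ)⁻¹ * ρ' ^ n := by
  have hp : 0 < ρ' - ρ := tsub_pos_of_lt h
  rw [← div_eq_inv_mul, le_div_iff₀ hp]
  induction n with
  | zero => simp
  | succ n ih =>
    obtain ⟨d, rfl⟩ := le_iff_exists_add.1 h.le
    simp only [add_tsub_cancel_left] at ih ⊢
    cases n with
    | zero => simp
    | succ n =>
      simp only [Nat.add_sub_cancel] at ih ⊢
      push_cast at ih ⊢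
      calc ((n : ℝ≥0) + 1 + 1) * ρ ^ (n + 1) * d
          = ((n + 1) * ρ ^ n * d) * ρ + ρ ^ (n + 1) * d := by ring
        _ ≤ (ρ + d) ^ (n + 1) * ρ + (ρ + d) ^ (n + 1) * d := by
            gcongr
        _ = (ρ + d) ^ (n + 1 + 1) := by ring

lemma enat_mul_pow_le {ρ ρ' : ℝ≥0} (h : ρ < ρ') (n : ℕ) :
    (n : ℝ≥0∞) * (ρ : ℝ≥0∞) ^ (n - 1) ≤ ((ρ' - ρ)⁻¹ : ℝ≥0) * (ρ' : ℝ≥0∞) ^ n := by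
  exact_mod_cast nat_mul_pow_le h n

lemma tsum_length_le {ρ ρ' : ℝ≥0} (h : ρ < ρ') (a : G.Series) :
    ∑' γ : G.Path, ‖a γ‖ₑ * (γ.length * (ρ : ℝ≥0∞) ^ (γ.length - 1))
      ≤ ((ρ' - ρ)⁻¹ : ℝ≥0) * wnorm ρ' a := by
  rw [wnorm, ← ENNReal.tsum_mul_left]
  refine ENNReal.tsum_le_tsum fun γ => ?_
  rw [mul_left_comm _ ‖a γ‖ₑ]
  exact mul_le_mul_right (enat_mul_pow_le h _) _

lemma wnorm_diff_le {ρ ρ' : ℝ≥0} (h : ρ < ρ') (e : G.Dart) (a : G.Series) :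
    (diff e a).wnorm ρ ≤ ((ρ' - ρ)⁻¹ : ℝ≥0) * wnorm ρ' a := by
  refine le_trans ?_ ((tsum_wnorm_diff ρ a).le.trans (tsum_length_le h a))
  let i : G.Path × G.Path → G.Path × G.Dart × G.Path := fun p => (p.1, e, p.2)
  have hi : Function.Injective i := by
    rintro ⟨a, b⟩ ⟨c, d⟩ h
    simp only [i, Prod.mk.injEq, true_and] at h
    exact Prod.ext h.1 h.2
  exact ENNReal.tsum_comp_le_tsum_of_injective hi (fun p : G.Path × G.Dart × G.Path =>
    ‖diff p.2.1 a p.1 p.2.2‖ₑ * (ρ : ℝ≥0∞) ^ (p.1.length + p.2.2.length))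

lemma wnorm_grad_le {ρ ρ' : ℝ≥0} (h : ρ < ρ') (e : G.Dart) (a : G.Series) :
    (grad a e).wnorm ρ ≤ ((ρ' - ρ)⁻¹ : ℝ≥0) * wnorm ρ' a := by
  rw [grad]
  refine (Tensor.wnorm_mult_le _ _).trans ?_
  rw [Tensor.wnorm_flip]
  exact wnorm_diff_le h _ _

lemma mul_eq_mult (a b : G.Series) : mul a b = Tensor.mult (fun γ δ => a γ * b δ) := rfl

lemma wnorm_tmul (ρ : ℝ≥0) (a b : G.Series) :
    Tensor.wnorm ρ (fun γ δ => a γ * b δ : G.Tensor) = wnorm ρ a * wnorm ρ b := by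
  rw [Tensor.wnorm, ENNReal.tsum_prod (f := fun γ δ => ‖a γ * b δ‖ₑ *
    (ρ : ℝ≥0∞) ^ (γ.length + δ.length)), wnorm, ← ENNReal.tsum_mul_right]
  refine tsum_congr fun γ => ?_
  rw [wnorm, ← ENNReal.tsum_mul_left]
  refine tsum_congr fun δ => ?_
  rw [enorm_mul, pow_add]
  ring

lemma wnorm_mul_le (ρ : ℝ≥0) (a b : G.Series) : wnorm ρ (mul a b) ≤ wnorm ρ a * wnorm ρ b := by
  rw [mul_eq_mult, ← wnorm_tmul]
  exact Tensor.wnorm_mult_le _ _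

lemma wnorm_number_le {ρ ρ' : ℝ≥0} (h : ρ < ρ') (a : G.Series) :
    wnorm ρ (number a) ≤ ρ * (((ρ' - ρ)⁻¹ : ℝ≥0) * wnorm ρ' a) := by
  refine le_trans ?_ (mul_le_mul_right (tsum_length_le h a) _)
  rw [wnorm, ← ENNReal.tsum_mul_left]
  refine ENNReal.tsum_le_tsum fun γ => ?_
  have h1 : ‖(γ.wt : ℂ)‖ₑ ≤ γ.length := by
    rw [← ofReal_norm, Complex.norm_real, Real.norm_of_nonneg γ.wt_nonneg]
    exact ENNReal.ofReal_le_of_le_toReal (by simpa using γ.wt_le_length)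
  rw [number, enorm_mul]
  have h2 : (γ.length : ℝ≥0∞) * (ρ : ℝ≥0∞) ^ γ.length
      = ρ * (γ.length * (ρ : ℝ≥0∞) ^ (γ.length - 1)) := by
    cases hh : γ.length with
    | zero => simp
    | succ n => rw [Nat.add_sub_cancel, pow_succ]; ring
  calc ‖(γ.wt : ℂ)‖ₑ * ‖a γ‖ₑ * (ρ : ℝ≥0∞) ^ γ.length
      ≤ γ.length * ‖a γ‖ₑ * (ρ : ℝ≥0∞) ^ γ.length := by gcongr
    _ = ‖a γ‖ₑ * (γ.length * (ρ : ℝ≥0∞) ^ γ.length) := by ring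
    _ = _ := by rw [h2]; ring

end Series

end

/-! ### Double series, their norms and their evaluation -/

section

variable {V E : Type*} [Fintype V] {G : WeightedGraph V E}

lemma hasSum_cut₂ {M : Type*} [AddCommMonoid M] [TopologicalSpace M] [ContinuousAdd M]
    [RegularSpace M] {F : G.Path → G.Path → G.Path → G.Path → M}
    (hF : ∀ γ γ' δ δ', γ.finish ≠ γ'.start ∨ δ.finish ≠ δ'.start → F γ γ' δ δ' = 0) {s : M}
    (h : HasSum (fun p : (G.Path × G.Path) × G.Path × G.Path => F p.1.1 p.1.2 p.2.1 p.2.2) s) :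
    HasSum (fun p : G.Path × G.Path => ∑ i ∈ Finset.range (p.1.length + 1),
      ∑ j ∈ Finset.range (p.2.length + 1), F (p.1.take i) (p.1.drop i) (p.2.take j) (p.2.drop j))
      s := by
  let c : (Σ p : G.Path × G.Path, Fin (p.1.length + 1) × Fin (p.2.length + 1)) →
      (G.Path × G.Path) × G.Path × G.Path :=
    fun p => (cutPair ⟨p.1.1, p.2.1⟩, cutPair ⟨p.1.2, p.2.2⟩)
  have hc : Function.Injective c := by
    rintro ⟨⟨γ, δ⟩, i, j⟩ ⟨⟨γ', δ'⟩, i', j'⟩ hh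
    have h1 := cutPair_injective (congrArg Prod.fst hh)
    have h2 := cutPair_injective (congrArg Prod.snd hh)
    simp only [Sigma.mk.injEq] at h1 h2
    obtain ⟨rfl, h1⟩ := h1
    obtain ⟨rfl, h2⟩ := h2
    simp_all
  have h1 : HasSum ((fun p : (G.Path × G.Path) × G.Path × G.Path =>
      F p.1.1 p.1.2 p.2.1 p.2.2) ∘ c) s := by
    refine (hc.hasSum_iff fun p hp => hF _ _ _ _ ?_).2 h
    by_contra hh
    push Not at hh
    obtain ⟨⟨γ, i⟩, hp1⟩ := mem_range_cutPair hh.1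
    obtain ⟨⟨δ, j⟩, hp2⟩ := mem_range_cutPair hh.2
    exact hp ⟨⟨(γ, δ), i, j⟩, Prod.ext hp1 hp2⟩
  refine h1.sigma fun p => ?_
  rw [Finset.sum_range]
  simp_rw [Finset.sum_range]
  rw [← Finset.sum_product']
  exact hasSum_fintype _

/-- The product cuts both tensor legs. The second leg is cut with its factors in reversed order,
because multiplication there is that of the opposite algebra. -/
lemma Tensor.wnorm_mul_le (ρ : ℝ≥0) (u w : G.Tensor) :
    wnorm ρ (mul u w) ≤ wnorm ρ u * wnorm ρ w := by
  classical
  set F : G.Path → G.Path → G.Path → G.Path → ℝ≥0∞ := fun γ γ' δ δ' =>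
    if γ.finish ≠ γ'.start ∨ δ.finish ≠ δ'.start then 0 else
    (‖u γ δ'‖ₑ * (ρ : ℝ≥0∞) ^ (γ.length + δ'.length)) *
      (‖w γ' δ‖ₑ * (ρ : ℝ≥0∞) ^ (γ'.length + δ.length)) with hF
  have h := hasSum_cut₂ (F := F) (fun _ _ _ _ h => if_pos h) ENNReal.summable.hasSum
  refine (ENNReal.tsum_le_tsum (g := fun p : G.Path × G.Path =>
    ∑ i ∈ Finset.range (p.1.length + 1), ∑ j ∈ Finset.range (p.2.length + 1),
      F (p.1.take i) (p.1.drop i) (p.2.take j) (p.2.drop j)) fun p => ?_).trans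
      (h.tsum_eq.le.trans ?_)
  · rw [mul]
    refine (mul_le_mul_left (enorm_sum_le _ _) _).trans ?_
    rw [Finset.sum_mul]
    refine Finset.sum_le_sum fun i _ => ?_
    refine (mul_le_mul_left (enorm_sum_le _ _) _).trans ?_
    rw [Finset.sum_mul]
    refine Finset.sum_le_sum fun j _ => ?_
    rw [hF]
    dsimp only
    rw [if_neg (by simp), enorm_mul, ← Path.length_take_add_length_drop p.1 i,
      ← Path.length_take_add_length_drop p.2 j]
    apply le_of_eq
    ring
  · have e1 : wnorm ρ u * wnorm ρ w = ∑' (p : G.Path × G.Path) (q : G.Path × G.Path),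
        (‖u p.1 q.2‖ₑ * (ρ : ℝ≥0∞) ^ (p.1.length + q.2.length)) *
        (‖w p.2 q.1‖ₑ * (ρ : ℝ≥0∞) ^ (p.2.length + q.1.length)) := by
      rw [wnorm, wnorm, ENNReal.tsum_prod (f := fun γ δ => ‖u γ δ‖ₑ *
        (ρ : ℝ≥0∞) ^ (γ.length + δ.length)), ENNReal.tsum_prod (f := fun γ δ => ‖w γ δ‖ₑ *
        (ρ : ℝ≥0∞) ^ (γ.length + δ.length)), ENNReal.tsum_prod (f := fun γ γ' =>
          ∑' q : G.Path × G.Path, (‖u γ q.2‖ₑ * (ρ : ℝ≥0∞) ^ (γ.length + q.2.length)) *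
        (‖w γ' q.1‖ₑ * (ρ : ℝ≥0∞) ^ (γ'.length + q.1.length))), ← ENNReal.tsum_mul_right]
      refine tsum_congr fun γ => ?_
      rw [← ENNReal.tsum_mul_left]
      refine tsum_congr fun γ' => ?_
      rw [ENNReal.tsum_prod (f := fun δ δ' => (‖u γ δ'‖ₑ *
        (ρ : ℝ≥0∞) ^ (γ.length + δ'.length)) * (‖w γ' δ‖ₑ * (ρ : ℝ≥0∞) ^ (γ'.length + δ.length))),
        ← ENNReal.tsum_mul_left]
      refine tsum_congr fun δ => ?_
      rw [ENNReal.tsum_mul_right]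
    rw [e1, ← ENNReal.tsum_prod (f := fun p q : G.Path × G.Path =>
      (‖u p.1 q.2‖ₑ * (ρ : ℝ≥0∞) ^ (p.1.length + q.2.length)) *
        (‖w p.2 q.1‖ₑ * (ρ : ℝ≥0∞) ^ (p.2.length + q.1.length)))]
    refine ENNReal.tsum_le_tsum fun p => ?_
    rw [hF]
    dsimp only
    split_ifs
    · exact zero_le
    · exact le_rfl

/-- The permutation `(a, b), (c, d) ↦ (a, d), (b, c)`. -/
def swapPairs (ι : Type*) : (ι × ι) × ι × ι ≃ (ι × ι) × ι × ι :=
  ⟨fun p => ((p.1.1, p.2.2), (p.1.2, p.2.1)), fun p => ((p.1.1, p.2.1), (p.2.2, p.1.2)),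
    fun _ => rfl, fun _ => rfl⟩

lemma hasSum_swapPairs {ι M : Type*} [AddCommMonoid M] [TopologicalSpace M]
    {F : ι → ι → ι → ι → M} {s : M}
    (h : HasSum (fun p : (ι × ι) × ι × ι => F p.1.1 p.1.2 p.2.1 p.2.2) s) :
    HasSum (fun p : (ι × ι) × ι × ι => F p.1.1 p.2.2 p.1.2 p.2.1) s := by
  have := (Equiv.hasSum_iff (swapPairs ι)
    (f := fun p : (ι × ι) × ι × ι => F p.1.1 p.1.2 p.2.1 p.2.2)).2 h
  exact this

/-! ### Absolutely convergent sums -/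

section AbsSum

variable {ι κ M A : Type*} [NormedAddCommGroup M] [NormedRing A]

lemma summable_norm_of_enorm {f : ι → M} (h : ∑' i, ‖f i‖ₑ < ⊤) : Summable fun i => ‖f i‖ := by
  have h1 : Summable fun i => ‖f i‖₊ := ENNReal.tsum_coe_ne_top_iff_summable.1 h.ne
  exact NNReal.summable_coe.2 h1

lemma tsum_smul_of_enorm [NormedSpace ℂ M] {c : ι → ℂ} {x : M} (h : ∑' i, ‖c i • x‖ₑ < ⊤) :
    (∑' i, c i) • x = ∑' i, c i • x := by
  -- For `x = 0` the hypothesis says nothing about the coefficients, which need not be summable, but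
  -- then both sides vanish.
  by_cases hx : x = 0
  · simp [hx]
  · have hc : Summable c := by
      refine Summable.of_enorm fun h' => ?_
      simp only [enorm_smul, ENNReal.tsum_mul_right] at h
      rw [h', ENNReal.top_mul (by simpa using hx)] at h
      exact lt_irrefl _ h
    exact (hc.hasSum.smul_const x).tsum_eq.symm

lemma hasSum_mul_of_enorm [CompleteSpace A] {f : ι → A} {g : κ → A} (hf : ∑' i, ‖f i‖ₑ < ⊤)
    (hg : ∑' i, ‖g i‖ₑ < ⊤) :
    HasSum (fun p : ι × κ => f p.1 * g p.2) ((∑' i, f i) * ∑' i, g i) := by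
  have h1 := summable_norm_of_enorm hf
  have h2 := summable_norm_of_enorm hg
  rw [tsum_mul_tsum_of_summable_norm h1 h2]
  exact (summable_mul_of_summable_norm h1 h2).hasSum

lemma hasSum_smul_mul_smul [NormedAlgebra ℂ A] [CompleteSpace A] {c : ι → ℂ} {f : ι → A} {d : κ → ℂ} {g : κ → A}
    (hf : ∑' i, ‖c i • f i‖ₑ < ⊤) (hg : ∑' i, ‖d i • g i‖ₑ < ⊤) :
    HasSum (fun p : ι × κ => (c p.1 * d p.2) • (f p.1 * g p.2))
      ((∑' i, c i • f i) * ∑' i, d i • g i) := by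
  simpa only [smul_mul_smul_comm] using hasSum_mul_of_enorm hf hg

end AbsSum

open Classical in
lemma wnorm_monomial (ρ : ℝ≥0) (γ : G.Path) :
    (Series.mono γ).wnorm ρ = (ρ : ℝ≥0∞) ^ γ.length := by
  rw [Series.wnorm, tsum_eq_single γ]
  · simp [Series.mono]
  · intro δ h
    simp [Series.mono, h]

lemma enorm_ops_mul_le {A : Type*} [NormedRing A] (S T : A) : ‖S * T‖ₑ ≤ ‖S‖ₑ * ‖T‖ₑ := by
  simp only [enorm_eq_nnnorm, ← ENNReal.coe_mul]
  exact ENNReal.coe_le_coe.2 (nnnorm_mul_le S T)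

namespace Path

@[simp] lemma rev_start (γ : G.Path) : γ.rev.start = γ.finish := rfl
@[simp] lemma rev_finish (γ : G.Path) : γ.rev.finish = γ.start :=
  (isPathFrom_reverse _ _ γ.isPath).2
@[simp] lemma rev_darts (γ : G.Path) : γ.rev.darts = (γ.darts.map Dart.op).reverse := rfl
@[simp] lemma rev_length (γ : G.Path) : γ.rev.length = γ.length := by simp [length]
@[simp] lemma rev_rev (γ : G.Path) : γ.rev.rev = γ := by
  refine ext_darts (by simp) ?_
  simp [Function.comp_def]

variable (G) in
/-- Reversal, as a permutation of the paths. -/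
def revEquiv : G.Path ≃ G.Path := ⟨rev, rev, rev_rev, rev_rev⟩

lemma rev_join (γ δ : G.Path) (e : G.Dart) (h : γ.finish = e.src ∧ δ.start = e.tgt) :
    (γ.join e δ h).rev = δ.rev.join e.op γ.rev (by simpa using h.symm) := by
  refine ext_darts (by simp) ?_
  simp

end Path

lemma Series.wnorm_adj (ρ : ℝ≥0) (a : G.Series) : (adj a).wnorm ρ = a.wnorm ρ := by
  rw [wnorm, wnorm, ← (Path.revEquiv G).tsum_eq]
  refine tsum_congr fun γ => ?_
  change ‖conj (a γ.rev.rev)‖ₑ * (ρ : ℝ≥0∞) ^ γ.rev.length = _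
  rw [Path.rev_rev, Path.rev_length, ← ofReal_norm, RCLike.norm_conj, ofReal_norm]

lemma Series.diff_adj (e : G.Dart) (a : G.Series) (γ δ : G.Path) :
    diff e (adj a) γ δ = conj (diff e.op a δ.rev γ.rev) := by
  by_cases h : γ.finish = e.src ∧ δ.start = e.tgt
  · have h' : δ.rev.finish = e.op.src ∧ γ.rev.start = e.op.tgt := by simpa using h.symm
    rw [diff, dif_pos h, diff, dif_pos h', adj, Path.rev_join]
  · have h' : ¬ (δ.rev.finish = e.op.src ∧ γ.rev.start = e.op.tgt) := by
      simpa [and_comm] using h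
    rw [diff, dif_neg h, diff, dif_neg h', map_zero]

lemma wnorm_monoAt_le {Y : G.Dart → G.Series} {ρ σ : ℝ≥0} (hY : ∀ e, (Y e).wnorm ρ ≤ σ)
    (γ : G.Path) : (Series.monoAt Y γ).wnorm ρ ≤ (σ : ℝ≥0∞) ^ γ.length := by
  rw [Series.monoAt, Path.length]
  generalize γ.darts = l
  induction l with
  | nil => rw [List.foldr_nil, wnorm_monomial]; simp
  | cons e l ih =>
    rw [List.foldr_cons, List.length_cons, pow_succ']
    exact (Series.wnorm_mul_le _ _ _).trans (mul_le_mul' (hY e) ih)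

lemma tsum_wnorm_subst_le {Y : G.Dart → G.Series} {ρ σ : ℝ≥0} (hY : ∀ e, (Y e).wnorm ρ ≤ σ)
    (W : G.Series) : ∑' δ, (W δ • Series.monoAt Y δ).wnorm ρ ≤ W.wnorm σ := by
  refine ENNReal.tsum_le_tsum fun δ => ?_
  rw [Series.wnorm_smul]
  gcongr
  exact wnorm_monoAt_le hY δ

lemma wnorm_subst_le {Y : G.Dart → G.Series} {ρ σ : ℝ≥0} (hY : ∀ e, (Y e).wnorm ρ ≤ σ)
    (W : G.Series) : (W.subst Y).wnorm ρ ≤ W.wnorm σ :=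
  (Series.wnorm_tsum_le ρ fun δ => W δ • Series.monoAt Y δ).trans (tsum_wnorm_subst_le hY W)

variable {A : Type*} [NormedRing A] [NormedAlgebra ℂ A]

/-- The operator `R ↦ S R T`. -/
def mulLR (S T : A) : A →L[ℂ] A := ContinuousLinearMap.mulLeftRight ℂ (A) S T

lemma mulLR_apply (S T R : A) : mulLR S T R = S * R * T :=
  ContinuousLinearMap.mulLeftRight_apply _ _ _ _ _

lemma enorm_mulLR_le (S T : A) : ‖mulLR S T‖ₑ ≤ ‖S‖ₑ * ‖T‖ₑ := by
  simp only [enorm_eq_nnnorm, ← ENNReal.coe_mul]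
  exact ENNReal.coe_le_coe.2 (ContinuousLinearMap.opNorm_mulLeftRight_apply_apply_le ℂ (A) S T)

lemma mulLR_mul_mulLR (S S' T T' : A) : mulLR S T * mulLR S' T' = mulLR (S * S') (T' * T) := by
  ext1 R
  rw [mul_apply_eq_comp, mulLR_apply, mulLR_apply, mulLR_apply]
  simp only [mul_assoc]

lemma mulLR_zero_left (T : A) : mulLR 0 T = 0 := by
  ext1 R; rw [mulLR_apply, zero_mul, zero_mul]; rfl

lemma mulLR_zero_right (T : A) : mulLR T 0 = 0 := by
  ext1 R; rw [mulLR_apply, mul_zero]; rfl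

/-! ### Evaluation of series and double series -/

/-- A family of mutually orthogonal idempotents of norm at most one, indexed by the vertices. -/
structure VProj (V A : Type*) [Fintype V] [NormedRing A] where
  p : V → A
  mul_self : ∀ v, p v * p v = p v
  mul_of_ne : ∀ v w, v ≠ w → p v * p w = 0
  norm_le : ∀ v, ‖p v‖ ≤ 1

variable [CompleteSpace A] (P : VProj V A)

namespace VProj

/-- The part `(p_{s(ε)} X_ε p_{t(ε)})_ε` of a family of operators. -/
def cutOps (X : G.Dart → A) : G.Dart → A := fun e => P.p e.src * X e * P.p e.tgt

lemma cutOps_add (X Y : G.Dart → A) : P.cutOps (X + Y) = P.cutOps X + P.cutOps Y := by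
  funext e; simp [cutOps, mul_add, add_mul]

lemma norm_cutOps_le (X : G.Dart → A) (e : G.Dart) : ‖P.cutOps X e‖ ≤ ‖X e‖ := by
  calc ‖P.cutOps X e‖ ≤ ‖P.p e.src‖ * ‖X e‖ * ‖P.p e.tgt‖ := norm_mul₃_le
    _ ≤ 1 * ‖X e‖ * 1 := by gcongr <;> exact P.norm_le _
    _ = ‖X e‖ := by ring

lemma cutOps_cutOps (X : G.Dart → A) : P.cutOps (P.cutOps X) = P.cutOps X := by
  funext e
  simp only [cutOps]
  rw [mul_assoc, mul_assoc, mul_assoc, P.mul_self, ← mul_assoc, P.mul_self]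
  simp only [mul_assoc]

lemma projOp_mul_cutOps (X : G.Dart → A) (e : G.Dart) :
    P.p e.src * P.cutOps X e = P.cutOps X e := by
  rw [cutOps, ← mul_assoc, ← mul_assoc, P.mul_self]

lemma cutOps_mul_projOp (X : G.Dart → A) (e : G.Dart) :
    P.cutOps X e * P.p e.tgt = P.cutOps X e := by
  rw [cutOps, mul_assoc, P.mul_self]

/-- The monomial `X_γ`. -/
def word (γ : G.Path) (X : G.Dart → A) : A := (γ.darts.map (P.cutOps X)).prod * P.p γ.finish

lemma word_eq (γ : G.Path) (X : G.Dart → A) :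
    P.word γ X = (γ.darts.map (P.cutOps X)).prod * P.p γ.finish := rfl

@[simp] lemma word_triv (v : V) (X : G.Dart → A) : P.word (Path.triv v) X = P.p v := by
  simp [word_eq]

lemma word_mul_projOp (γ : G.Path) (X : G.Dart → A) :
    P.word γ X * P.p γ.finish = P.word γ X := by
  rw [word_eq, mul_assoc, P.mul_self]

lemma projOp_mul_word (γ : G.Path) (X : G.Dart → A) :
    P.p γ.start * P.word γ X = P.word γ X := by
  rw [word_eq]
  cases h : γ.darts with
  | nil =>
    have h1 := Path.eq_triv_of_darts h
    have h2 : γ.finish = γ.start := by rw [h1]; rfl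
    simp [h2, P.mul_self]
  | cons e l =>
    rw [Path.start_eq_src (γ := γ) (e := e) (by rw [h]; rfl), List.map_cons, List.prod_cons,
      ← mul_assoc, ← mul_assoc, P.projOp_mul_cutOps]

lemma word_append (γ δ : G.Path) (h : γ.finish = δ.start) (X : G.Dart → A) :
    P.word (γ.append δ h) X = P.word γ X * P.word δ X := by
  have h1 : (γ.append δ h).finish = δ.finish := by
    have := Path.drop_finish (γ.append δ h) γ.length
    rw [Path.append_drop] at this
    exact this.symm
  rw [P.word_eq γ, mul_assoc, h, P.projOp_mul_word, word_eq, word_eq, h1, ← mul_assoc]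
  congr 1
  simp [Path.append]

lemma word_take_mul_word_drop (γ : G.Path) (i : ℕ) (X : G.Dart → A) :
    P.word (γ.take i) X * P.word (γ.drop i) X = P.word γ X := by
  rw [← P.word_append _ _ (Path.drop_start γ i).symm]
  congr 1
  refine Path.ext_darts rfl ?_
  simp [Path.append]

lemma word_mul_word_of_ne {γ δ : G.Path} (h : γ.finish ≠ δ.start) (X Y : G.Dart → A) :
    P.word γ X * P.word δ Y = 0 := by
  rw [← P.word_mul_projOp, ← P.projOp_mul_word δ, mul_assoc, ← mul_assoc (P.p _),
    P.mul_of_ne _ _ h, zero_mul, mul_zero]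

lemma norm_word_le (γ : G.Path) (X : G.Dart → A) {ρ : ℝ} (hX : ∀ e, ‖X e‖ ≤ ρ) :
    ‖P.word γ X‖ ≤ ρ ^ γ.length := by
  rw [word, Path.length]
  generalize γ.darts = l
  induction l with
  | nil => simpa using P.norm_le _
  | cons e l ih =>
    rw [List.map_cons, List.prod_cons, List.length_cons, pow_succ', mul_assoc]
    refine (norm_mul_le _ _).trans ?_
    have h0 : 0 ≤ ρ := (norm_nonneg _).trans (hX e)
    exact mul_le_mul ((P.norm_cutOps_le X e).trans (hX e)) ih (norm_nonneg _) h0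

lemma enorm_word_le (γ : G.Path) (X : G.Dart → A) {ρ : ℝ≥0} (hX : ∀ e, ‖X e‖ ≤ ρ) :
    ‖P.word γ X‖ₑ ≤ (ρ : ℝ≥0∞) ^ γ.length := by
  have h : ‖P.word γ X‖₊ ≤ ρ ^ γ.length := by exact_mod_cast P.norm_word_le γ X hX
  have h' : (‖P.word γ X‖₊ : ℝ≥0∞) ≤ ((ρ ^ γ.length : ℝ≥0) : ℝ≥0∞) := ENNReal.coe_le_coe.2 h
  rw [ENNReal.coe_pow] at h'
  exact h'

lemma word_mem {N : Subalgebra ℂ A} (hp : ∀ v, P.p v ∈ N) {X : G.Dart → A}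
    (hX : ∀ e, X e ∈ N) (γ : G.Path) : P.word γ X ∈ N := by
  rw [word_eq]
  refine mul_mem (list_prod_mem fun x hx => ?_) (hp _)
  obtain ⟨e, -, rfl⟩ := List.mem_map.1 hx
  exact mul_mem (mul_mem (hp _) (hX e)) (hp _)

/-- The value of a series at a family of operators. -/
def ev (X : G.Dart → A) (a : G.Series) : A := ∑' γ : G.Path, a γ • P.word γ X

lemma tsum_enorm_ev_le {X : G.Dart → A} {ρ : ℝ≥0} (hX : ∀ e, ‖X e‖ ≤ ρ) (a : G.Series) :
    ∑' γ : G.Path, ‖a γ • P.word γ X‖ₑ ≤ a.wnorm ρ := by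
  refine ENNReal.tsum_le_tsum fun γ => ?_
  rw [enorm_smul]
  gcongr
  exact P.enorm_word_le γ X hX

lemma summable_ev {X : G.Dart → A} {ρ : ℝ≥0} (hX : ∀ e, ‖X e‖ ≤ ρ) {a : G.Series}
    (ha : a.wnorm ρ < ⊤) : Summable (fun γ : G.Path => a γ • P.word γ X) :=
  Summable.of_enorm ((P.tsum_enorm_ev_le hX a).trans_lt ha).ne

lemma hasSum_ev {X : G.Dart → A} {ρ : ℝ≥0} (hX : ∀ e, ‖X e‖ ≤ ρ) {a : G.Series}
    (ha : a.wnorm ρ < ⊤) : HasSum (fun γ : G.Path => a γ • P.word γ X) (P.ev X a) :=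
  (P.summable_ev hX ha).hasSum

lemma enorm_ev_le {X : G.Dart → A} {ρ : ℝ≥0} (hX : ∀ e, ‖X e‖ ≤ ρ) (a : G.Series) :
    ‖P.ev X a‖ₑ ≤ a.wnorm ρ :=
  (Series.enorm_tsum_le _).trans (P.tsum_enorm_ev_le hX a)

lemma norm_ev_le {X : G.Dart → A} {ρ : ℝ≥0} (hX : ∀ e, ‖X e‖ ≤ ρ) {a : G.Series}
    (ha : a.wnorm ρ < ⊤) : ‖P.ev X a‖ ≤ (a.wnorm ρ).toReal := by
  rw [← toReal_enorm]
  exact ENNReal.toReal_mono ha.ne (P.enorm_ev_le hX a)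

lemma ev_mem {N : Subalgebra ℂ A} (hA : IsClosed (N : Set A))
    (hp : ∀ v, P.p v ∈ N) {X : G.Dart → A}
    (hX : ∀ e, X e ∈ N) (a : G.Series) : P.ev X a ∈ N := by
  by_cases h : Summable (fun γ : G.Path => a γ • P.word γ X)
  · refine hA.mem_of_tendsto h.hasSum (Filter.Eventually.of_forall fun s => ?_)
    exact sum_mem fun γ _ => N.smul_mem (P.word_mem hp hX γ) _
  · rw [ev, tsum_eq_zero_of_not_summable h]
    exact N.zero_mem

section Linear

variable {X : G.Dart → A} {ρ : ℝ≥0}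

lemma ev_add (hX : ∀ e, ‖X e‖ ≤ ρ) {a b : G.Series} (ha : a.wnorm ρ < ⊤) (hb : b.wnorm ρ < ⊤) :
    P.ev X (a + b) = P.ev X a + P.ev X b := by
  rw [ev, ev, ev, ← (P.summable_ev hX ha).tsum_add (P.summable_ev hX hb)]
  exact tsum_congr fun γ => add_smul _ _ _

lemma ev_smul (c : ℂ) (a : G.Series) : P.ev X (c • a) = c • P.ev X a := by
  rw [ev, ev, ← tsum_const_smul'']
  exact tsum_congr fun γ => by rw [Pi.smul_apply, smul_assoc]

lemma ev_neg (a : G.Series) : P.ev X (-a) = -P.ev X a := by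
  have := P.ev_smul (X := X) (-1) a
  simpa using this

lemma ev_sub (hX : ∀ e, ‖X e‖ ≤ ρ) {a b : G.Series} (ha : a.wnorm ρ < ⊤) (hb : b.wnorm ρ < ⊤) :
    P.ev X (a - b) = P.ev X a - P.ev X b := by
  rw [sub_eq_add_neg, P.ev_add hX ha (by rwa [Series.wnorm_neg]), P.ev_neg, sub_eq_add_neg]

@[simp] lemma ev_zero : P.ev X (0 : G.Series) = 0 := by simp [ev]

lemma ev_sum {ι : Type*} (hX : ∀ e, ‖X e‖ ≤ ρ) (s : Finset ι) {a : ι → G.Series}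
    (ha : ∀ i ∈ s, (a i).wnorm ρ < ⊤) : P.ev X (∑ i ∈ s, a i) = ∑ i ∈ s, P.ev X (a i) := by
  classical
  induction s using Finset.induction_on with
  | empty => simp
  | insert i s hi ih =>
    rw [Finset.sum_insert hi, Finset.sum_insert hi, P.ev_add hX (ha _ (Finset.mem_insert_self _ _)),
      ih fun j hj => ha j (Finset.mem_insert_of_mem hj)]
    refine (Series.wnorm_sum_le _ _ _).trans_lt (ENNReal.sum_lt_top.2 fun j hj => ?_)
    exact ha j (Finset.mem_insert_of_mem hj)

/-- Fubini for an absolutely convergent double sum over indices and paths. Sums of series are taken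
coefficientwise, so this is what lets evaluation pass through the Neumann series, substitutions and
the logarithmic series. -/
lemma hasSum_ev_tsum {ι : Type*} (hX : ∀ e, ‖X e‖ ≤ ρ) {a : ι → G.Series}
    (ha : ∑' i, (a i).wnorm ρ < ⊤) :
    HasSum (fun i => P.ev X (a i)) (P.ev X (fun γ => ∑' i, a i γ)) := by
  have hb : ∑' p : G.Path × ι, ‖a p.2 p.1 • P.word p.1 X‖ₑ < ⊤ := by
    rw [ENNReal.tsum_prod (f := fun γ i => ‖a i γ • P.word γ X‖ₑ), ENNReal.tsum_comm]
    exact (ENNReal.tsum_le_tsum fun i => P.tsum_enorm_ev_le hX (a i)).trans_lt ha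
  have hs : HasSum (fun p : G.Path × ι => a p.2 p.1 • P.word p.1 X) _ :=
    (Summable.of_enorm hb.ne).hasSum
  have hs' : HasSum (fun p : ι × G.Path => a p.1 p.2 • P.word p.2 X)
      (∑' p : G.Path × ι, a p.2 p.1 • P.word p.1 X) :=
    (Equiv.prodComm ι G.Path).hasSum_iff (f := fun p : G.Path × ι => a p.2 p.1 • P.word p.1 X).2 hs
  have h1 := hs'.prod_fiberwise fun i => P.hasSum_ev hX (ENNReal.lt_top_of_tsum_ne_top ha.ne i)
  convert h1 using 1
  rw [hs.summable.tsum_prod]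
  refine tsum_congr fun γ => ?_
  refine tsum_smul_of_enorm ?_
  refine lt_of_le_of_lt ?_ hb
  exact (ENNReal.tsum_comp_le_tsum_of_injective (Prod.mk_right_injective γ)
    (fun p : G.Path × ι => ‖a p.2 p.1 • P.word p.1 X‖ₑ))

end Linear

lemma ev_mono (X : G.Dart → A) (γ : G.Path) : P.ev X (Series.mono γ) = P.word γ X := by
  classical
  rw [ev, tsum_eq_single γ]
  · simp [Series.mono]
  · intro δ h
    simp [Series.mono, h]

/-- Words along non-composable paths multiply to zero, so summing over all pairs of paths agrees
with collecting the product by concatenated paths. -/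
lemma hasSum_ev_mult {X : G.Dart → A} {ρ : ℝ≥0} (hX : ∀ e, ‖X e‖ ≤ ρ) {u : G.Tensor}
    (hu : u.wnorm ρ < ⊤) : HasSum (fun p : G.Path × G.Path => u p.1 p.2 •
      (P.word p.1 X * P.word p.2 X)) (P.ev X u.mult) := by
  have hs : Summable (fun p : G.Path × G.Path => u p.1 p.2 • (P.word p.1 X * P.word p.2 X)) := by
    refine Summable.of_enorm (lt_of_le_of_lt (ENNReal.tsum_le_tsum fun p => ?_) hu).ne
    rw [enorm_smul, pow_add]
    gcongr
    refine (enorm_ops_mul_le _ _).trans ?_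
    gcongr <;> exact P.enorm_word_le _ X hX
  have h := hasSum_cut (F := fun γ δ => u γ δ • (P.word γ X * P.word δ X))
    (fun γ δ h => by rw [P.word_mul_word_of_ne h, smul_zero]) hs.hasSum
  have h1 : (fun γ : G.Path => ∑ i ∈ Finset.range (γ.length + 1),
      u (γ.take i) (γ.drop i) • (P.word (γ.take i) X * P.word (γ.drop i) X))
      = fun γ => u.mult γ • P.word γ X := by
    funext γ
    simp_rw [P.word_take_mul_word_drop, ← Finset.sum_smul]
    rfl
  rw [h1] at h
  rw [ev, h.tsum_eq]
  exact hs.hasSum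

lemma ev_mul {X : G.Dart → A} {ρ : ℝ≥0} (hX : ∀ e, ‖X e‖ ≤ ρ) {a b : G.Series}
    (ha : a.wnorm ρ < ⊤) (hb : b.wnorm ρ < ⊤) :
    P.ev X (Series.mul a b) = P.ev X a * P.ev X b := by
  rw [Series.mul_eq_mult]
  have h := P.hasSum_ev_mult hX (u := fun γ δ => a γ * b δ)
    (by rw [Series.wnorm_tmul]; exact ENNReal.mul_lt_top ha hb)
  rw [← h.tsum_eq, ev, ev]
  exact (hasSum_smul_mul_smul ((P.tsum_enorm_ev_le hX a).trans_lt ha)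
    ((P.tsum_enorm_ev_le hX b).trans_lt hb)).tsum_eq

/-! ### Adjoints -/

section Star

variable [StarRing A] [StarModule ℂ A] [ContinuousStar A] {P}

lemma star_word (hP : ∀ v, star (P.p v) = P.p v) (γ : G.Path) (X : G.Dart → A) :
    star (P.word γ X)
      = P.word γ.rev (fun e => star (X e.op)) := by
  have h : ∀ l : List G.Dart, star (l.map (P.cutOps X)).prod
      = ((l.map Dart.op).reverse.map
        (P.cutOps fun e => star (X e.op))).prod := by
    intro l
    induction l with
    | nil => simp
    | cons e l ih =>
      simp only [List.map_cons, List.prod_cons, List.reverse_cons, List.map_append, List.map_nil,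
        List.prod_append, List.prod_nil, mul_one]
      rw [star_mul, ih]
      congr 1
      simp only [cutOps, star_mul, hP, mul_assoc, Dart.op_op, Dart.op_src,
        Dart.op_tgt]
  rw [← P.projOp_mul_word γ, star_mul, hP, ← P.projOp_mul_word γ.rev, word_eq, word_eq,
    star_mul, hP, h, Path.rev_start, Path.rev_finish, Path.rev_darts, mul_assoc]

lemma star_ev (hP : ∀ v, star (P.p v) = P.p v) {X : G.Dart → A} {ρ : ℝ≥0} (hX : ∀ e, ‖X e‖ ≤ ρ) {a : G.Series}
    (ha : a.wnorm ρ < ⊤) : star (P.ev X a)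
      = P.ev (fun e => star (X e.op)) (Series.adj a) := by
  have h := (P.hasSum_ev hX ha).star
  rw [← (Path.revEquiv G).hasSum_iff] at h
  rw [← h.tsum_eq, ev]
  refine tsum_congr fun γ => ?_
  change star (a γ.rev • P.word γ.rev X) = _
  rw [star_smul, star_word hP, Path.rev_rev]
  rfl

end Star

/-! ### Substitution -/

lemma ev_monoAt {X : G.Dart → A} {ρ σ : ℝ≥0} (hX : ∀ e, ‖X e‖ ≤ ρ) {Y : G.Dart → G.Series}
    (hY : ∀ e, (Y e).wnorm ρ ≤ σ) (hc : P.cutOps (fun e => P.ev X (Y e)) = fun e => P.ev X (Y e))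
    (γ : G.Path) : P.ev X (Series.monoAt Y γ) = P.word γ (fun e => P.ev X (Y e)) := by
  rw [Series.monoAt, word_eq, hc]
  generalize γ.darts = l
  induction l with
  | nil => rw [List.foldr_nil, ev_mono]; simp
  | cons e l ih =>
    have h1 : (List.foldr (fun e a => Series.mul (Y e) a)
        (Series.mono (Path.triv γ.finish)) l).wnorm ρ ≤ (σ : ℝ≥0∞) ^ l.length := by
      clear ih
      induction l with
      | nil => rw [List.foldr_nil, wnorm_monomial]; simp
      | cons e l ih =>
        rw [List.foldr_cons, List.length_cons, pow_succ']
        exact (Series.wnorm_mul_le _ _ _).trans (mul_le_mul' (hY e) ih)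
    rw [List.foldr_cons, P.ev_mul hX ((hY e).trans_lt ENNReal.coe_lt_top)
      (h1.trans_lt (ENNReal.pow_lt_top ENNReal.coe_lt_top)), ih, List.map_cons, List.prod_cons,
      mul_assoc]

/-- The condition `hc` says that the substituted operators already lie between the right vertex
projections. Monomials in series use the substituted family as it is, whereas `word` cuts it down
first. -/
lemma ev_subst {X : G.Dart → A} {ρ σ : ℝ≥0} (hX : ∀ e, ‖X e‖ ≤ ρ) {Y : G.Dart → G.Series}
    (hY : ∀ e, (Y e).wnorm ρ ≤ σ) (hc : P.cutOps (fun e => P.ev X (Y e)) = fun e => P.ev X (Y e))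
    {W : G.Series} (hW : W.wnorm σ < ⊤) :
    P.ev X (W.subst Y) = P.ev (fun e => P.ev X (Y e)) W := by
  have h := P.hasSum_ev_tsum hX (a := fun δ => W δ • Series.monoAt Y δ)
    ((tsum_wnorm_subst_le hY W).trans_lt hW)
  have h1 : (fun γ => ∑' δ, (W δ • Series.monoAt Y δ) γ) = W.subst Y := rfl
  rw [h1] at h
  rw [← h.tsum_eq, ev]
  exact tsum_congr fun δ => by rw [P.ev_smul, P.ev_monoAt hX hY hc]

lemma cut_ev_of_support {X : G.Dart → A} {a : G.Series} {v w : V}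
    (h : ∀ γ, a γ ≠ 0 → γ.start = v ∧ γ.finish = w) : P.p v * P.ev X a * P.p w = P.ev X a := by
  by_cases hs : Summable (fun γ : G.Path => a γ • P.word γ X)
  · rw [ev, ← hs.tsum_mul_left, ← (hs.mul_left _).tsum_mul_right]
    refine tsum_congr fun γ => ?_
    by_cases h0 : a γ = 0
    · simp [h0]
    · obtain ⟨rfl, rfl⟩ := h γ h0
      rw [mul_smul_comm, P.projOp_mul_word, smul_mul_assoc, P.word_mul_projOp]
  · rw [ev, tsum_eq_zero_of_not_summable hs]
    simp

/-! ### Evaluation of double series -/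

/-- The operator `T ↦ ∑ u_{γδ} X_γ T X_δ`. -/
def evT (X : G.Dart → A) (u : G.Tensor) : A →L[ℂ] A :=
  ∑' p : G.Path × G.Path, u p.1 p.2 • mulLR (P.word p.1 X) (P.word p.2 X)

section Tensor

variable {X : G.Dart → A} {ρ : ℝ≥0}

lemma tsum_enorm_evT_le (hX : ∀ e, ‖X e‖ ≤ ρ) (u : G.Tensor) :
    ∑' p : G.Path × G.Path, ‖u p.1 p.2 • mulLR (P.word p.1 X) (P.word p.2 X)‖ₑ ≤ u.wnorm ρ := by
  refine ENNReal.tsum_le_tsum fun p => ?_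
  rw [enorm_smul, pow_add]
  gcongr
  refine (enorm_mulLR_le _ _).trans ?_
  gcongr <;> exact P.enorm_word_le _ X hX

lemma hasSum_evT (hX : ∀ e, ‖X e‖ ≤ ρ) {u : G.Tensor} (hu : u.wnorm ρ < ⊤) :
    HasSum (fun p : G.Path × G.Path => u p.1 p.2 • mulLR (P.word p.1 X) (P.word p.2 X)) (P.evT X u) :=
  (Summable.of_enorm ((P.tsum_enorm_evT_le hX u).trans_lt hu).ne).hasSum

lemma hasSum_evT_apply (hX : ∀ e, ‖X e‖ ≤ ρ) {u : G.Tensor} (hu : u.wnorm ρ < ⊤) (T : A) :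
    HasSum (fun p : G.Path × G.Path => u p.1 p.2 • (P.word p.1 X * T * P.word p.2 X)) (P.evT X u T) := by
  have h := (P.hasSum_evT hX hu).mapL (ContinuousLinearMap.apply ℂ (A) T)
  simpa only [ContinuousLinearMap.apply_apply, smul_apply, mulLR_apply] using h

lemma evT_add (hX : ∀ e, ‖X e‖ ≤ ρ) {u w : G.Tensor} (hu : u.wnorm ρ < ⊤) (hw : w.wnorm ρ < ⊤) :
    P.evT X (u + w) = P.evT X u + P.evT X w := by
  rw [← ((P.hasSum_evT hX hu).add (P.hasSum_evT hX hw)).tsum_eq, evT]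
  exact tsum_congr fun p => add_smul (u p.1 p.2) (w p.1 p.2) (mulLR (P.word p.1 X) (P.word p.2 X))

@[simp] lemma evT_zero : P.evT X (0 : G.Tensor) = 0 := by
  rw [evT, ← tsum_zero (α := A →L[ℂ] A) (β := G.Path × G.Path)]
  exact tsum_congr fun p => zero_smul ℂ (mulLR (P.word p.1 X) (P.word p.2 X))

lemma evT_sum {ι : Type*} (hX : ∀ e, ‖X e‖ ≤ ρ) (s : Finset ι) {u : ι → G.Tensor}
    (hu : ∀ i ∈ s, (u i).wnorm ρ < ⊤) : P.evT X (∑ i ∈ s, u i) = ∑ i ∈ s, P.evT X (u i) := by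
  classical
  induction s using Finset.induction_on with
  | empty => simp
  | insert i s hi ih =>
    rw [Finset.sum_insert hi, Finset.sum_insert hi, P.evT_add hX (hu _ (Finset.mem_insert_self _ _)),
      ih fun j hj => hu j (Finset.mem_insert_of_mem hj)]
    refine (Tensor.wnorm_sum_le _ _ _).trans_lt (ENNReal.sum_lt_top.2 fun j hj => ?_)
    exact hu j (Finset.mem_insert_of_mem hj)

lemma hasSum_evT_mul_evT (hX : ∀ e, ‖X e‖ ≤ ρ) {u w : G.Tensor} (hu : u.wnorm ρ < ⊤)
    (hw : w.wnorm ρ < ⊤) : HasSum (fun p : (G.Path × G.Path) × G.Path × G.Path =>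
      (u p.1.1 p.1.2 * w p.2.1 p.2.2) • mulLR (P.word p.1.1 X * P.word p.2.1 X)
        (P.word p.2.2 X * P.word p.1.2 X)) (P.evT X u * P.evT X w) := by
  have h := hasSum_smul_mul_smul (A := A →L[ℂ] A) (c := fun p : G.Path × G.Path => u p.1 p.2)
    (d := fun p : G.Path × G.Path => w p.1 p.2)
    (f := fun p => mulLR (P.word p.1 X) (P.word p.2 X))
    (g := fun p => mulLR (P.word p.1 X) (P.word p.2 X))
    ((P.tsum_enorm_evT_le hX u).trans_lt hu) ((P.tsum_enorm_evT_le hX w).trans_lt hw)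
  simp only [mulLR_mul_mulLR] at h
  exact h

/-- Composition of the maps `T ↦ a T b` multiplies the left factors in order and the right factors
in reverse, which is the product of the algebra tensored with its opposite. Hence matrices of double
series become operators on families. -/
lemma evT_mul (hX : ∀ e, ‖X e‖ ≤ ρ) {u w : G.Tensor} (hu : u.wnorm ρ < ⊤) (hw : w.wnorm ρ < ⊤) :
    P.evT X (Tensor.mul u w) = P.evT X u * P.evT X w := by
  have hp := P.hasSum_evT_mul_evT hX hu hw
  generalize P.evT X u * P.evT X w = s at hp
  have hp2 := hasSum_swapPairs (F := fun γ δ' γ' δ => (u γ δ' * w γ' δ) •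
    mulLR (P.word γ X * P.word γ' X) (P.word δ X * P.word δ' X)) hp
  have h := hasSum_cut₂ (F := fun γ γ' δ δ' => (u γ δ' * w γ' δ) •
    mulLR (P.word γ X * P.word γ' X) (P.word δ X * P.word δ' X))
    (fun γ γ' δ δ' h => by
      rcases h with h | h
      · rw [P.word_mul_word_of_ne h, mulLR_zero_left]; exact smul_zero (M := ℂ) (A := A →L[ℂ] A) (u γ δ' * w γ' δ)
      · rw [P.word_mul_word_of_ne h, mulLR_zero_right]; exact smul_zero (M := ℂ) (A := A →L[ℂ] A) (u γ δ' * w γ' δ)) hp2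
  rw [← h.tsum_eq, evT]
  refine tsum_congr fun p => ?_
  simp only [P.word_take_mul_word_drop, ← Finset.sum_smul]
  rfl

end Tensor

end VProj

end

section

variable {V E : Type*} [Fintype V] {G : WeightedGraph V E}

/-! ### Calculus -/

lemma hasSum_triple [Fintype E] {M : Type*} [AddCommMonoid M] [TopologicalSpace M]
    [ContinuousAdd M] {F : G.Path → G.Dart → G.Path → M} {s : G.Dart → M}
    (h : ∀ e, HasSum (fun p : G.Path × G.Path => F p.1 e p.2) (s e)) :
    HasSum (fun p : G.Path × G.Dart × G.Path => F p.1 p.2.1 p.2.2) (∑ e, s e) := by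
  classical
  have h1 : ∀ e, HasSum (fun p : G.Path × G.Dart × G.Path =>
      if p.2.1 = e then F p.1 p.2.1 p.2.2 else 0) (s e) := by
    intro e
    have hinj : Function.Injective (fun p : G.Path × G.Path => (p.1, e, p.2)) := by
      rintro ⟨a, b⟩ ⟨c, d⟩ hh
      simpa using hh
    rw [← hinj.hasSum_iff]
    · simpa [Function.comp_def] using h e
    · rintro ⟨a, b, c⟩ hx
      rw [if_neg]
      rintro rfl
      exact hx ⟨(a, c), rfl⟩
  have h2 := hasSum_sum (s := Finset.univ) fun e _ => h1 e
  simpa using h2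

/-- A Lipschitz constant on an open set bounds the derivative there, so summable constants suffice
for differentiation of the series term by term. -/
lemma differentiableAt_tsum_of_lipschitz {ι E F : Type*} [NormedAddCommGroup E] [NormedSpace ℂ E]
    [NormedAddCommGroup F] [NormedSpace ℂ F] [CompleteSpace F] {f : ι → E → F} {s : Set E}
    (hs : IsOpen s) (hs' : IsPreconnected s) {u : ι → ℝ≥0} (hu : Summable u)
    (hf : ∀ i, Differentiable ℂ (f i)) (hl : ∀ i, LipschitzOnWith (u i) (f i) s) {x : E}
    (hx : x ∈ s) (h0 : Summable fun i => f i x) :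
    DifferentiableAt ℂ (fun y => ∑' i, f i y) x :=
  (hasFDerivAt_tsum_of_isPreconnected (u := fun i => (u i : ℝ)) (NNReal.summable_coe.2 hu)
    hs hs' (fun i y _ => (hf i y).hasFDerivAt)
    (fun i _ hy => norm_fderiv_le_of_lipschitzOn ℂ (hs.mem_nhds hy) (hl i)) hx h0
    hx).differentiableAt

variable [Fintype E] {A : Type*} [NormedRing A] [NormedAlgebra ℂ A] [CompleteSpace A]

lemma norm_mulLR_le (S T : A) : ‖mulLR S T‖ ≤ ‖S‖ * ‖T‖ :=
  ContinuousLinearMap.opNorm_mulLeftRight_apply_apply_le ℂ A S T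

lemma norm_mulLR_sub_le (S S' T T' : A) :
    ‖mulLR S T - mulLR S' T'‖ ≤ ‖S - S'‖ * ‖T‖ + ‖S'‖ * ‖T - T'‖ := by
  have h : mulLR S T - mulLR S' T' = mulLR (S - S') T + mulLR S' (T - T') := by
    ext1 R
    rw [sub_apply, add_apply]
    simp only [mulLR_apply]
    noncomm_ring
  rw [h]
  exact (norm_add_le _ _).trans (add_le_add (norm_mulLR_le _ _) (norm_mulLR_le _ _))

namespace VProj

variable (P : VProj V A)

lemma word_take_succ (γ : G.Path) (i : Fin γ.length) (X : G.Dart → A) :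
    P.word (γ.take (i + 1)) X = P.word (γ.take i) X * P.cutOps X (γ.darts[(i : ℕ)]'i.2) := by
  have h1 : (γ.take (i + 1)).finish = (γ.darts[(i : ℕ)]'i.2).tgt := by
    rw [← Path.drop_succ_start γ i, Path.drop_start]
  have h2 : (γ.take (i + 1)).darts = (γ.take i).darts ++ [γ.darts[(i : ℕ)]'i.2] := by
    simp only [Path.take_darts]
    exact (List.take_concat_get' _ _ i.2).symm
  rw [word_eq, word_eq, h1, h2, Path.take_finish_src γ i, mul_assoc, P.projOp_mul_cutOps,
    List.map_append, List.prod_append, mul_assoc]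
  simp [P.cutOps_mul_projOp]

lemma word_drop (γ : G.Path) (i : Fin γ.length) (X : G.Dart → A) :
    P.word (γ.drop i) X = P.cutOps X (γ.darts[(i : ℕ)]'i.2) * P.word (γ.drop (i + 1)) X := by
  have h2 : (γ.drop i).darts = γ.darts[(i : ℕ)]'i.2 :: (γ.drop (i + 1)).darts := by
    simp only [Path.drop_darts]
    exact List.drop_eq_getElem_cons i.2
  rw [word_eq, word_eq, h2, Path.drop_finish, Path.drop_finish, List.map_cons, List.prod_cons,
    mul_assoc]

/-- A telescoping sum: the arguments are exchanged one edge at a time, with `Y` to the left of the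
current edge and `X` to its right. -/
lemma word_sub (γ : G.Path) (X Y : G.Dart → A) :
    P.word γ Y - P.word γ X = ∑ i : Fin γ.length, P.word (γ.take i) Y *
      (Y (γ.darts[(i : ℕ)]'i.2) - X (γ.darts[(i : ℕ)]'i.2)) * P.word (γ.drop (i + 1)) X := by
  have h1 : ∀ i : Fin γ.length, P.word (γ.take i) Y *
      (Y (γ.darts[(i : ℕ)]'i.2) - X (γ.darts[(i : ℕ)]'i.2)) * P.word (γ.drop (i + 1)) X =
      P.word (γ.take (i + 1)) Y * P.word (γ.drop (i + 1)) X
        - P.word (γ.take i) Y * P.word (γ.drop i) X := by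
    intro i
    have e1 := P.word_mul_projOp (γ.take i) Y
    have e2 := P.projOp_mul_word (γ.drop (i + 1)) X
    rw [Path.take_finish_src γ i] at e1
    rw [Path.drop_succ_start γ i] at e2
    have e3 : ∀ Z : G.Dart → A, P.word (γ.take i) Y * P.cutOps Z (γ.darts[(i : ℕ)]'i.2)
        * P.word (γ.drop (i + 1)) X
        = P.word (γ.take i) Y * Z (γ.darts[(i : ℕ)]'i.2) * P.word (γ.drop (i + 1)) X := by
      intro Z
      nth_rewrite 2 [← e1, ← e2]
      simp only [cutOps, mul_assoc]
    rw [P.word_take_succ γ i, P.word_drop γ i, ← mul_assoc (P.word (γ.take i) Y), e3, e3, mul_sub,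
      sub_mul]
  rw [Finset.sum_congr rfl fun i _ => h1 i,
    Fin.sum_univ_eq_sum_range (fun i => P.word (γ.take (i + 1)) Y * P.word (γ.drop (i + 1)) X
        - P.word (γ.take i) Y * P.word (γ.drop i) X) γ.length,
    Finset.sum_range_sub (fun i => P.word (γ.take i) Y * P.word (γ.drop i) X)]
  have h2 : γ.take γ.length = γ := Path.ext_darts rfl (List.take_length)
  have h3 : γ.drop γ.length = Path.triv γ.finish := by
    rw [Path.eq_triv_of_darts (γ := γ.drop γ.length) (List.drop_length), Path.drop_start, h2]
  have h4 : γ.drop 0 = γ := Path.ext_darts rfl rfl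
  have h5 : γ.take 0 = Path.triv γ.start := Path.ext_darts rfl rfl
  rw [h3, h4, h5, h2, word_triv, word_triv, P.word_mul_projOp, P.projOp_mul_word]

lemma norm_word_sub_le (γ : G.Path) {X Y : G.Dart → A} {ρ : ℝ≥0} (hX : ‖X‖ ≤ ρ) (hY : ‖Y‖ ≤ ρ) :
    ‖P.word γ Y - P.word γ X‖ ≤ γ.length * ρ ^ (γ.length - 1) * ‖Y - X‖ := by
  rw [word_sub]
  refine (norm_sum_le _ _).trans ?_
  calc _ ≤ ∑ i : Fin γ.length, (ρ : ℝ) ^ (γ.length - 1) * ‖Y - X‖ := by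
        refine Finset.sum_le_sum fun i _ => ?_
        refine norm_mul₃_le.trans ?_
        have h1 := P.norm_word_le (γ.take i) Y fun e => (norm_le_pi_norm Y e).trans hY
        have h2 := P.norm_word_le (γ.drop (i + 1)) X fun e => (norm_le_pi_norm X e).trans hX
        have h3 := norm_le_pi_norm (Y - X) (γ.darts[(i : ℕ)]'i.2)
        have h4 := Path.length_take_add_length_drop_succ γ i
        have h5 : γ.length - 1 = (γ.take i).length + (γ.drop (i + 1)).length := by omega
        rw [h5, pow_add, mul_right_comm]
        exact mul_le_mul (mul_le_mul h1 h2 (norm_nonneg _) (by positivity)) h3 (norm_nonneg _)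
          (by positivity)
    _ = _ := by simp [mul_assoc]

lemma differentiable_cutOps (e : G.Dart) : Differentiable ℂ fun X : G.Dart → A => P.cutOps X e := by
  unfold cutOps
  fun_prop

lemma differentiable_word (γ : G.Path) : Differentiable ℂ (P.word (A := A) γ) := by
  unfold word
  refine Differentiable.mul ?_ (differentiable_const _)
  generalize γ.darts = l
  induction l with
  | nil => exact differentiable_const _
  | cons e l ih =>
    simp only [List.map_cons, List.prod_cons]
    exact (P.differentiable_cutOps e).mul ih

/-- The operator `T ↦ ∑ u_{γδ} X_γ T Z_δ`. -/
def evB (X Z : G.Dart → A) (u : G.Tensor) : A →L[ℂ] A :=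
  ∑' p : G.Path × G.Path, u p.1 p.2 • mulLR (P.word p.1 X) (P.word p.2 Z)

lemma evB_self (X : G.Dart → A) (u : G.Tensor) : P.evB X X u = P.evT X u := rfl

lemma tsum_enorm_evB_le {X Z : G.Dart → A} {ρ : ℝ≥0} (hX : ‖X‖ ≤ ρ) (hZ : ‖Z‖ ≤ ρ) (u : G.Tensor) :
    ∑' p : G.Path × G.Path, ‖u p.1 p.2 • mulLR (P.word p.1 X) (P.word p.2 Z)‖ₑ ≤ u.wnorm ρ := by
  refine ENNReal.tsum_le_tsum fun p => ?_
  rw [enorm_smul, pow_add]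
  gcongr
  refine (enorm_mulLR_le _ _).trans ?_
  exact mul_le_mul' (P.enorm_word_le _ X fun e => (norm_le_pi_norm X e).trans hX)
    (P.enorm_word_le _ Z fun e => (norm_le_pi_norm Z e).trans hZ)

lemma hasSum_evB {X Z : G.Dart → A} {ρ : ℝ≥0} (hX : ‖X‖ ≤ ρ) (hZ : ‖Z‖ ≤ ρ) {u : G.Tensor}
    (hu : u.wnorm ρ < ⊤) :
    HasSum (fun p : G.Path × G.Path => u p.1 p.2 • mulLR (P.word p.1 X) (P.word p.2 Z))
      (P.evB X Z u) :=
  (Summable.of_enorm ((P.tsum_enorm_evB_le hX hZ u).trans_lt hu).ne).hasSum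

lemma hasSum_evB_apply {X Z : G.Dart → A} {ρ : ℝ≥0} (hX : ‖X‖ ≤ ρ) (hZ : ‖Z‖ ≤ ρ) {u : G.Tensor}
    (hu : u.wnorm ρ < ⊤) (T : A) :
    HasSum (fun p : G.Path × G.Path => u p.1 p.2 • (P.word p.1 X * T * P.word p.2 Z))
      (P.evB X Z u T) := by
  have h := (P.hasSum_evB hX hZ hu).mapL (ContinuousLinearMap.apply ℂ A T)
  simpa only [ContinuousLinearMap.apply_apply, smul_apply, mulLR_apply] using h

lemma norm_evB_le {X Z : G.Dart → A} {ρ : ℝ≥0} (hX : ‖X‖ ≤ ρ) (hZ : ‖Z‖ ≤ ρ) {u : G.Tensor}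
    (hu : u.wnorm ρ < ⊤) : ‖P.evB X Z u‖ ≤ (u.wnorm ρ).toReal := by
  rw [← toReal_enorm]
  exact ENNReal.toReal_mono hu.ne ((Series.enorm_tsum_le _).trans (P.tsum_enorm_evB_le hX hZ u))

/-- The two arguments are kept separate because this form serves twice: in the exact difference
formula `ev_sub_ev`, where they differ, and in differentiating `tr2` one slot at a time. -/
lemma differentiableAt_evB {X Z : G.Dart → A} {ρ : ℝ≥0} (hX : ‖X‖ < ρ) (hZ : ‖Z‖ < ρ)
    {u : G.Tensor} (hu : u.wnorm ρ < ⊤) :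
    DifferentiableAt ℂ (fun p : (G.Dart → A) × (G.Dart → A) => P.evB p.1 p.2 u) (X, Z) := by
  obtain ⟨σ, hσ, hσρ⟩ : ∃ σ : ℝ≥0, max ‖X‖₊ ‖Z‖₊ < σ ∧ σ < ρ :=
    exists_between (max_lt hX hZ)
  have hmem : ∀ p ∈ Metric.ball (0 : (G.Dart → A) × (G.Dart → A)) σ, ‖p.1‖ ≤ σ ∧ ‖p.2‖ ≤ σ := by
    intro p hp
    rw [mem_ball_zero_iff] at hp
    exact ⟨(norm_fst_le p).trans hp.le, (norm_snd_le p).trans hp.le⟩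
  have hX' : ‖X‖ ≤ σ := (lt_of_le_of_lt (le_max_left _ _) hσ).le
  have hZ' : ‖Z‖ ≤ σ := (lt_of_le_of_lt (le_max_right _ _) hσ).le
  -- On the ball of radius `σ` a pair of words of total length `n` has Lipschitz constant at most `n
  -- σ ^ (n - 1)`. By `nat_mul_pow_le` this is at most `(ρ - σ)⁻¹ ρ ^ n`, which is summable against
  -- the coefficients.
  refine differentiableAt_tsum_of_lipschitz (s := Metric.ball 0 σ) Metric.isOpen_ball
    (convex_ball _ _).isPreconnected
    (u := fun p => ‖u p.1 p.2‖₊ * ((ρ - σ)⁻¹ * ρ ^ (p.1.length + p.2.length))) ?_ ?_ ?_ ?_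
    (P.hasSum_evB hX' hZ' ((Tensor.wnorm_mono hσρ.le u).trans_lt hu)).summable
  · have h : Summable fun p : G.Path × G.Path => ‖u p.1 p.2‖₊ * ρ ^ (p.1.length + p.2.length) := by
      rw [← ENNReal.tsum_coe_ne_top_iff_summable]
      simpa [Tensor.wnorm, enorm_eq_nnnorm] using hu.ne
    exact (h.mul_left (ρ - σ)⁻¹).congr fun p => by ring
  · intro p
    have h1 : Differentiable ℂ fun q : (G.Dart → A) × (G.Dart → A) => P.word p.1 q.1 :=
      (P.differentiable_word p.1).comp differentiable_fst
    have h2 : Differentiable ℂ fun q : (G.Dart → A) × (G.Dart → A) => P.word p.2 q.2 :=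
      (P.differentiable_word p.2).comp differentiable_snd
    have h3 : Differentiable ℂ fun q : (G.Dart → A) × (G.Dart → A) =>
        mulLR (P.word p.1 q.1) (P.word p.2 q.2) := fun q =>
      ((ContinuousLinearMap.mulLeftRight ℂ A).differentiable.comp h1 q).clm_apply (h2 q)
    exact h3.const_smul (u p.1 p.2)
  · rintro ⟨γ, δ⟩
    refine LipschitzOnWith.of_dist_le_mul fun p hp q hq => ?_
    obtain ⟨hp1, hp2⟩ := hmem p hp
    obtain ⟨hq1, hq2⟩ := hmem q hq
    rw [dist_eq_norm, dist_eq_norm]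
    have h0 : ‖u γ δ • mulLR (P.word γ p.1) (P.word δ p.2)
        - u γ δ • mulLR (P.word γ q.1) (P.word δ q.2)‖
        = ‖u γ δ‖ * ‖mulLR (P.word γ p.1) (P.word δ p.2) - mulLR (P.word γ q.1) (P.word δ q.2)‖ := by
      rw [← smul_sub (u γ δ) (mulLR (P.word γ p.1) (P.word δ p.2))
        (mulLR (P.word γ q.1) (P.word δ q.2)), norm_smul]
    rw [h0, NNReal.coe_mul, coe_nnnorm, mul_assoc]
    refine mul_le_mul_of_nonneg_left ?_ (norm_nonneg _)
    refine (norm_mulLR_sub_le _ _ _ _).trans ?_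
    have e1 := P.norm_word_sub_le γ hq1 hp1
    have e2 := P.norm_word_sub_le δ hq2 hp2
    have e3 := P.norm_word_le δ p.2 fun e => (norm_le_pi_norm _ e).trans hp2
    have e4 := P.norm_word_le γ q.1 fun e => (norm_le_pi_norm _ e).trans hq1
    have n1 : ‖p.1 - q.1‖ ≤ ‖p - q‖ := norm_fst_le (p - q)
    have n2 : ‖p.2 - q.2‖ ≤ ‖p - q‖ := norm_snd_le (p - q)
    have hN := Series.nat_mul_pow_le hσρ (γ.length + δ.length)
    have hN' : ((γ.length : ℝ) + δ.length) * (σ : ℝ) ^ (γ.length + δ.length - 1)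
        ≤ (((ρ - σ)⁻¹ * ρ ^ (γ.length + δ.length) : ℝ≥0) : ℝ) := by
      have := NNReal.coe_le_coe.2 hN
      simpa using this
    refine le_trans ?_ (mul_le_mul_of_nonneg_right hN' (norm_nonneg _))
    have k1 : (γ.length : ℝ) * (σ : ℝ) ^ (γ.length - 1) * (σ : ℝ) ^ δ.length
        = γ.length * (σ : ℝ) ^ (γ.length + δ.length - 1) := by
      rcases Nat.eq_zero_or_pos γ.length with h | h
      · simp [h]
      · rw [mul_assoc, ← pow_add]; congr 2; omega
    have k2 : (δ.length : ℝ) * (σ : ℝ) ^ (δ.length - 1) * (σ : ℝ) ^ γ.length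
        = δ.length * (σ : ℝ) ^ (γ.length + δ.length - 1) := by
      rcases Nat.eq_zero_or_pos δ.length with h | h
      · simp [h]
      · rw [mul_assoc, ← pow_add]; congr 2; omega
    calc _ ≤ (γ.length * (σ : ℝ) ^ (γ.length - 1) * ‖p - q‖) * σ ^ δ.length
          + σ ^ γ.length * (δ.length * (σ : ℝ) ^ (δ.length - 1) * ‖p - q‖) := by
          refine add_le_add (mul_le_mul (e1.trans ?_) e3 (norm_nonneg _) (by positivity))
            (mul_le_mul e4 (e2.trans ?_) (norm_nonneg _) (by positivity))
          · exact mul_le_mul_of_nonneg_left n1 (by positivity)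
          · exact mul_le_mul_of_nonneg_left n2 (by positivity)
      _ = ((γ.length * (σ : ℝ) ^ (γ.length - 1) * (σ : ℝ) ^ δ.length)
          + (δ.length * (σ : ℝ) ^ (δ.length - 1) * (σ : ℝ) ^ γ.length)) * ‖p - q‖ := by ring
      _ = _ := by rw [k1, k2]; ring
  · rw [mem_ball_zero_iff, Prod.norm_mk]
    exact_mod_cast hσ

/-- Summing `word_sub` over the monomials shows that the free difference quotient is an exact
difference quotient and not only its limit. This yields both the derivative and the contraction
estimate for injectivity. -/
lemma ev_sub_ev {X Y : G.Dart → A} {ρ σ : ℝ≥0} (hσ : σ < ρ) (hX : ‖X‖ ≤ σ) (hY : ‖Y‖ ≤ σ)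
    {a : G.Series} (ha : a.wnorm ρ < ⊤) :
    P.ev Y a - P.ev X a = ∑ w, P.evB Y X (Series.diff w a) (Y w - X w) := by
  have hd : ∀ w, (Series.diff w a).wnorm σ < ⊤ := fun w =>
    (Series.wnorm_diff_le hσ w a).trans_lt (ENNReal.mul_lt_top ENNReal.coe_lt_top ha)
  have h1 := hasSum_triple (F := fun γ w δ => Series.diff w a γ δ •
    (P.word γ Y * (Y w - X w) * P.word δ X)) fun w => P.hasSum_evB_apply hY hX (hd w) (Y w - X w)
  have h2 := hasSum_cutTriple (F := fun γ w δ => Series.diff w a γ δ •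
    (P.word γ Y * (Y w - X w) * P.word δ X))
    (fun γ w δ h => by rw [Series.diff_of_not h, zero_smul]) h1
  simp only [Series.diff_cut, ← Finset.smul_sum, ← P.word_sub] at h2
  have ha' : a.wnorm σ < ⊤ := (Series.wnorm_mono hσ.le a).trans_lt ha
  have h3 := (P.hasSum_ev (fun e => (norm_le_pi_norm Y e).trans hY) ha').sub
    (P.hasSum_ev (fun e => (norm_le_pi_norm X e).trans hX) ha')
  simp only [← smul_sub] at h3
  exact h3.unique h2

/-- In the formula of `ev_sub_ev` the factor `Y - X` vanishes at `X`, so the product rule leaves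
only the value of the free difference quotient at the coinciding arguments. -/
lemma hasFDerivAt_ev {X : G.Dart → A} {ρ : ℝ≥0} (hX : ‖X‖ < ρ) {a : G.Series}
    (ha : a.wnorm ρ < ⊤) : HasFDerivAt (fun Y => P.ev Y a)
      (∑ w, (P.evT X (Series.diff w a)).comp (ContinuousLinearMap.proj (R := ℂ) w)) X := by
  obtain ⟨σ, hσ, hσρ⟩ : ∃ σ : ℝ≥0, ‖X‖₊ < σ ∧ σ < ρ := exists_between (a₁ := ‖X‖₊) hX
  have hσ' : ‖X‖ < σ := hσ
  have hd : ∀ w, (Series.diff w a).wnorm σ < ⊤ := fun w =>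
    (Series.wnorm_diff_le hσρ w a).trans_lt (ENNReal.mul_lt_top ENNReal.coe_lt_top ha)
  have h1 : ∀ w, HasFDerivAt (fun Y : G.Dart → A => P.evB Y X (Series.diff w a) (Y w - X w))
      ((P.evT X (Series.diff w a)).comp (ContinuousLinearMap.proj (R := ℂ) w)) X := by
    intro w
    have hb : DifferentiableAt ℂ (fun Y : G.Dart → A => P.evB Y X (Series.diff w a)) X :=
      DifferentiableAt.comp (g := fun p : (G.Dart → A) × (G.Dart → A) =>
        P.evB p.1 p.2 (Series.diff w a)) (f := fun Y => (Y, X)) X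
        (P.differentiableAt_evB hσ' hσ' (hd w))
        (differentiableAt_id.prodMk (differentiableAt_const X))
    have hp : HasFDerivAt (fun Y : G.Dart → A => Y w - X w)
        (ContinuousLinearMap.proj (R := ℂ) w) X :=
      ((ContinuousLinearMap.proj (R := ℂ) (φ := fun _ : G.Dart => A) w).hasFDerivAt).sub_const _
    have h := hb.hasFDerivAt.clm_apply hp
    refine h.congr_fderiv ?_
    rw [sub_self, evB_self]
    ext1 K
    simp
  have h2 := (HasFDerivAt.fun_sum (u := Finset.univ) fun w _ => h1 w).const_add (P.ev X a)
  refine h2.congr_of_eventuallyEq ?_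
  have hU : ∀ᶠ Y in nhds X, ‖Y‖ < σ := (continuous_norm.tendsto X).eventually_lt_const hσ'
  filter_upwards [hU] with Y hY
  rw [← P.ev_sub_ev hσρ hσ'.le hY.le ha]
  abel

end VProj

end

section

variable {V E : Type*} [Fintype V] {G : WeightedGraph V E} [Fintype E]
  {A : Type*} [NormedRing A] [NormedAlgebra ℂ A] [CompleteSpace A]

/-! ### Operators on families -/

open Classical in
/-- The family with a given entry at `e` and zero elsewhere. -/
def inj (e : G.Dart) : A →L[ℂ] (G.Dart → A) := ContinuousLinearMap.single ℂ (fun _ => A) e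

/-- The entry at `e`. -/
def prj (e : G.Dart) : (G.Dart → A) →L[ℂ] A := ContinuousLinearMap.proj (R := ℂ) e

open Classical in
lemma inj_apply (e f : G.Dart) (a : A) : inj e a f = if f = e then a else 0 := by
  change (Pi.single e a : G.Dart → A) f = _
  rw [Pi.single_apply]

lemma sum_inj (K : G.Dart → A) : ∑ e, inj e (K e) = K := by
  classical
  funext f
  rw [Finset.sum_apply]
  simp [inj_apply]

/-- The entries of an operator on families. -/
def entry (Θ : (G.Dart → A) →L[ℂ] (G.Dart → A)) (e f : G.Dart) : A →L[ℂ] A :=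
  (prj e).comp (Θ.comp (inj f))

lemma entry_apply (Θ : (G.Dart → A) →L[ℂ] (G.Dart → A)) (e f : G.Dart) (a : A) :
    entry Θ e f a = Θ (inj f a) e := rfl

lemma entry_mul (Θ Θ' : (G.Dart → A) →L[ℂ] (G.Dart → A)) (e f : G.Dart) :
    entry (Θ * Θ') e f = ∑ w, entry Θ e w * entry Θ' w f := by
  ext1 a
  rw [sum_apply, entry_apply, mul_apply_eq_comp]
  simp only [mul_apply_eq_comp, entry_apply]
  conv_lhs => rw [← sum_inj (Θ' (inj f a)), map_sum, Finset.sum_apply]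

lemma continuous_entry (e f : G.Dart) : Continuous fun Θ : (G.Dart → A) →L[ℂ] (G.Dart → A) =>
    entry Θ e f := by
  unfold entry
  fun_prop

lemma entry_add (Θ Θ' : (G.Dart → A) →L[ℂ] (G.Dart → A)) (e f : G.Dart) :
    entry (Θ + Θ') e f = entry Θ e f + entry Θ' e f := by
  ext1 a
  rw [add_apply, entry_apply, entry_apply, entry_apply, add_apply, Pi.add_apply]

lemma entry_smul (c : ℂ) (Θ : (G.Dart → A) →L[ℂ] (G.Dart → A)) (e f : G.Dart) :
    entry (c • Θ) e f = c • entry Θ e f := by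
  ext1 a
  rw [smul_apply, entry_apply, entry_apply, smul_apply, Pi.smul_apply]

namespace VProj

variable (P : VProj V A)

/-- The family `(f_ε(X))_ε`. -/
def evF (X : G.Dart → A) (f : G.Dart → G.Series) : G.Dart → A := fun e => P.ev X (f e)

/-- The operator of a matrix of double series. -/
def evM (X : G.Dart → A) (Q : G.TMatrix) : (G.Dart → A) →L[ℂ] (G.Dart → A) :=
  ContinuousLinearMap.pi fun e => ∑ w, (P.evT X (Q e w)).comp (prj w)

lemma evM_apply (X : G.Dart → A) (Q : G.TMatrix) (K : G.Dart → A) (e : G.Dart) :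
    P.evM X Q K e = ∑ w, P.evT X (Q e w) (K w) := by
  rw [evM, ContinuousLinearMap.pi_apply, sum_apply]
  rfl

lemma entry_evM (X : G.Dart → A) (Q : G.TMatrix) (e f : G.Dart) :
    entry (P.evM X Q) e f = P.evT X (Q e f) := by
  classical
  ext1 a
  rw [entry_apply, evM_apply, Finset.sum_eq_single f]
  · simp [inj_apply]
  · intro w _ hw
    simp [inj_apply, hw]
  · simp

lemma op_ext {Θ Θ' : (G.Dart → A) →L[ℂ] (G.Dart → A)} (h : ∀ e f, entry Θ e f = entry Θ' e f) :
    Θ = Θ' := by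
  ext1 K
  rw [← sum_inj K, map_sum, map_sum]
  refine Finset.sum_congr rfl fun f _ => ?_
  funext e
  rw [← entry_apply, h, entry_apply]

lemma evM_mul {X : G.Dart → A} {ρ : ℝ≥0} (hX : ‖X‖ ≤ ρ) {Q Q' : G.TMatrix}
    (hQ : ∀ e w, (Q e w).wnorm ρ < ⊤) (hQ' : ∀ e w, (Q' e w).wnorm ρ < ⊤) :
    P.evM X (Q.mul Q') = P.evM X Q * P.evM X Q' := by
  have hX' : ∀ e, ‖X e‖ ≤ ρ := fun e => (norm_le_pi_norm X e).trans hX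
  refine op_ext fun e f => ?_
  rw [entry_mul, entry_evM, TMatrix.mul, P.evT_sum hX' _ fun w _ =>
    (Tensor.wnorm_mul_le _ _ _).trans_lt (ENNReal.mul_lt_top (hQ e w) (hQ' w f))]
  refine Finset.sum_congr rfl fun w _ => ?_
  rw [P.evT_mul hX' (hQ e w) (hQ' w f), entry_evM, entry_evM]

/-- The norm on families is the maximum over the edges, for which an operator matrix is bounded by
its largest row sum; the matrix norm of the statement is of this kind. -/
lemma norm_evM_le {X : G.Dart → A} {ρ c : ℝ≥0} (hX : ‖X‖ ≤ ρ) {Q : G.TMatrix}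
    (hQ : ∀ e, ∑ w, (Q e w).wnorm ρ ≤ c) : ‖P.evM X Q‖ ≤ c := by
  refine ContinuousLinearMap.opNorm_le_bound _ c.2 fun K => ?_
  refine (pi_norm_le_iff_of_nonneg (by positivity)).2 fun e => ?_
  rw [evM_apply]
  have hfin : ∀ w, (Q e w).wnorm ρ < ⊤ := fun w =>
    (ENNReal.sum_lt_top.1 ((hQ e).trans_lt ENNReal.coe_lt_top)) w (Finset.mem_univ w)
  calc ‖∑ w, P.evT X (Q e w) (K w)‖ ≤ ∑ w, ((Q e w).wnorm ρ).toReal * ‖K‖ := by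
        refine (norm_sum_le _ _).trans (Finset.sum_le_sum fun w _ => ?_)
        refine (ContinuousLinearMap.le_opNorm _ _).trans ?_
        exact mul_le_mul (P.norm_evB_le hX hX (hfin w)) (norm_le_pi_norm K w) (norm_nonneg _)
          ENNReal.toReal_nonneg
    _ = (∑ w, (Q e w).wnorm ρ).toReal * ‖K‖ := by
        rw [← Finset.sum_mul, ENNReal.toReal_sum fun w _ => (hfin w).ne]
    _ ≤ c * ‖K‖ := by
        refine mul_le_mul_of_nonneg_right ?_ (norm_nonneg _)
        exact ENNReal.toReal_mono ENNReal.coe_ne_top (hQ e)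

lemma hasFDerivAt_evF {X : G.Dart → A} {ρ : ℝ≥0} (hX : ‖X‖ < ρ) {f : G.Dart → G.Series}
    (hf : ∀ e, (f e).wnorm ρ < ⊤) : HasFDerivAt (fun Y => P.evF Y f) (P.evM X (jac f)) X :=
  hasFDerivAt_pi.2 fun e => P.hasFDerivAt_ev hX (hf e)

lemma wnorm_jac_lt_top {ρ σ : ℝ≥0} (h : σ < ρ) {f : G.Dart → G.Series}
    (hf : ∀ e, (f e).wnorm ρ < ⊤) (e w : G.Dart) : (jac f e w).wnorm σ < ⊤ :=
  (Series.wnorm_diff_le h w (f e)).trans_lt (ENNReal.mul_lt_top ENNReal.coe_lt_top (hf e))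

lemma differentiableAt_evT {X : G.Dart → A} {ρ : ℝ≥0} (hX : ‖X‖ < ρ) {u : G.Tensor}
    (hu : u.wnorm ρ < ⊤) : DifferentiableAt ℂ (fun Y : G.Dart → A => P.evT Y u) X :=
  DifferentiableAt.comp (g := fun p : (G.Dart → A) × (G.Dart → A) => P.evB p.1 p.2 u)
    (f := fun Y => (Y, Y)) X (P.differentiableAt_evB hX hX hu)
    (differentiableAt_id.prodMk differentiableAt_id)

lemma differentiableAt_evM {X : G.Dart → A} {ρ : ℝ≥0} (hX : ‖X‖ < ρ) {Q : G.TMatrix}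
    (hQ : ∀ e w, (Q e w).wnorm ρ < ⊤) :
    DifferentiableAt ℂ (fun Y : G.Dart → A => P.evM Y Q) X := by
  have h1 : ∀ e, DifferentiableAt ℂ
      (fun Y : G.Dart → A => ∑ w, (P.evT Y (Q e w)).comp (prj (A := A) w)) X := fun e =>
    DifferentiableAt.fun_sum fun w _ =>
      (P.differentiableAt_evT hX (hQ e w)).clm_comp (differentiableAt_const _)
  have h2 : ∀ Y : G.Dart → A, P.evM Y Q = ∑ e, (inj e).comp
      (∑ w, (P.evT Y (Q e w)).comp (prj (A := A) w)) := by
    intro Y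
    ext1 K
    rw [sum_apply, ← sum_inj (P.evM Y Q K)]
    refine Finset.sum_congr rfl fun e _ => ?_
    rw [ContinuousLinearMap.comp_apply, evM_apply, sum_apply]
    rfl
  simp only [h2]
  have h3 : ∀ e, DifferentiableAt ℂ (fun Y : G.Dart → A => (inj e).comp
      (∑ w, (P.evT Y (Q e w)).comp (prj (A := A) w))) X := fun e =>
    (differentiableAt_const (inj e)).clm_comp (h1 e)
  exact DifferentiableAt.fun_sum (𝕜 := ℂ) (E := G.Dart → A)
    (F := (G.Dart → A) →L[ℂ] (G.Dart → A)) fun e _ => h3 e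

/-- The Jacobian is a first derivative near `X` and is itself differentiable at `X`, so the second
derivative is symmetric. This is the integrability fact that turns the derivative along `H` of the
Jacobian applied to `K` into the derivative of the Jacobian along `K`. -/
lemma fderiv_evM_symm {X : G.Dart → A} {ρ : ℝ≥0} (hX : ‖X‖ < ρ) {f : G.Dart → G.Series}
    (hf : ∀ e, (f e).wnorm ρ < ⊤) (H K : G.Dart → A) :
    fderiv ℂ (fun Y => P.evM Y (jac f)) X H K = fderiv ℂ (fun Y => P.evM Y (jac f)) X K H := by
  obtain ⟨σ, hσ, hσρ⟩ : ∃ σ : ℝ≥0, ‖X‖₊ < σ ∧ σ < ρ := exists_between (a₁ := ‖X‖₊) hX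
  refine second_derivative_symmetric_of_eventually (f := fun Y => P.evF Y f)
    (f' := fun Y => P.evM Y (jac f)) (x := X) ?_
    (P.differentiableAt_evM hσ (wnorm_jac_lt_top hσρ hf)).hasFDerivAt H K
  have hU : ∀ᶠ Y in nhds X, ‖Y‖ < ρ := (continuous_norm.tendsto X).eventually_lt_const hX
  filter_upwards [hU] with Y hY
  exact P.hasFDerivAt_evF hY hf

end VProj

end

section

variable {V E : Type*} [Fintype V] {G : WeightedGraph V E} [Fintype E]
  {A : Type*} [NormedRing A] [NormedAlgebra ℂ A] [CompleteSpace A]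

/-! ### Traces -/

/-- A functional `τ` that is tracial on a closed subalgebra `N` containing the projections,
together with the functional on operators that extends `τ ⊗ τ`. -/
structure TraceData (P : VProj V A) where
  τ : A →L[ℂ] ℂ
  N : Subalgebra ℂ A
  isClosed : IsClosed (N : Set A)
  proj_mem : ∀ v, P.p v ∈ N
  comm : ∀ a ∈ N, ∀ b ∈ N, τ (a * b) = τ (b * a)
  tr2 : (A →L[ℂ] A) →L[ℂ] ℂ
  tr2_mulLR : ∀ a b, tr2 (mulLR a b) = τ a * τ b

lemma mulLR_one_one : mulLR (1 : A) 1 = 1 := by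
  ext1 R; rw [mulLR_apply, one_mul, mul_one]; rfl

/-- The two-sided multiplications by elements of a subalgebra. -/
def mulLRSubmonoid (N : Subalgebra ℂ A) : Submonoid (A →L[ℂ] A) where
  carrier := {Φ | ∃ a ∈ N, ∃ b ∈ N, Φ = mulLR a b}
  mul_mem' := by
    rintro _ _ ⟨a, ha, b, hb, rfl⟩ ⟨c, hc, d, hd, rfl⟩
    exact ⟨a * c, N.mul_mem ha hc, d * b, N.mul_mem hd hb, mulLR_mul_mulLR _ _ _ _⟩
  one_mem' := ⟨1, N.one_mem, 1, N.one_mem, mulLR_one_one.symm⟩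

/-- The closed algebra that they generate. -/
def mulLRAlg (N : Subalgebra ℂ A) : Subalgebra ℂ (A →L[ℂ] A) :=
  (Algebra.adjoin ℂ (mulLRSubmonoid N : Set (A →L[ℂ] A))).topologicalClosure

lemma isClosed_mulLRAlg (N : Subalgebra ℂ A) : IsClosed (mulLRAlg N : Set (A →L[ℂ] A)) :=
  Subalgebra.isClosed_topologicalClosure _

lemma mulLR_mem {N : Subalgebra ℂ A} {a b : A} (ha : a ∈ N) (hb : b ∈ N) :
    mulLR a b ∈ mulLRAlg N :=
  Subalgebra.le_topologicalClosure _ (Algebra.subset_adjoin ⟨a, ha, b, hb, rfl⟩)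

/-- A continuous linear condition on the algebra may be checked on two-sided multiplications. -/
lemma mulLRAlg_induction {N : Subalgebra ℂ A} {F : Type*} [NormedAddCommGroup F]
    [NormedSpace ℂ F] {φ ψ : (A →L[ℂ] A) →L[ℂ] F}
    (h : ∀ a ∈ N, ∀ b ∈ N, φ (mulLR a b) = ψ (mulLR a b)) {Φ : A →L[ℂ] A}
    (hΦ : Φ ∈ mulLRAlg N) : φ Φ = ψ Φ := by
  have hcl : IsClosed {Φ | φ Φ = ψ Φ} := isClosed_eq φ.continuous ψ.continuous
  refine closure_minimal (fun Φ hΦ => ?_) hcl hΦ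
  have h1 : Φ ∈ Submodule.span ℂ (mulLRSubmonoid N : Set (A →L[ℂ] A)) := by
    have h2 := Algebra.adjoin_eq_span ℂ (mulLRSubmonoid N : Set (A →L[ℂ] A))
    rw [Submonoid.closure_eq] at h2
    rw [← h2]
    exact hΦ
  clear hΦ
  change φ Φ = ψ Φ
  induction h1 using Submodule.span_induction with
  | mem Φ h1 => obtain ⟨a, ha, b, hb, rfl⟩ := h1; exact h a ha b hb
  | zero => simp
  | add x y _ _ hx hy => exact (map_add φ x y).trans ((congrArg₂ _ hx hy).trans (map_add ψ x y).symm)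
  | smul c x _ hx => exact (map_smul φ c x).trans ((congrArg _ hx).trans (map_smul ψ c x).symm)

/-- The derivative of `T (j ^ n)` for a functional `T` that is tracial on a set containing `j` and
its derivative. -/
lemma hasDerivAt_trace_pow {B : Type*} [NormedRing B] [NormedAlgebra ℂ B] (T : B →L[ℂ] ℂ)
    (M : Submonoid B) (hT : ∀ a ∈ M, ∀ b ∈ M, T (a * b) = T (b * a)) {j : ℂ → B} {j' : B}
    (hj : HasDerivAt j j' 0) (h0 : j 0 ∈ M) (h' : j' ∈ M) (n : ℕ) :
    HasDerivAt (fun t => T (j t ^ (n + 1))) ((n + 1 : ℂ) * T (j' * j 0 ^ n)) 0 := by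
  -- The extra factor `j 0 ^ k` makes the induction close: the product rule multiplies the previous
  -- derivative by `j 0` on the right.
  have key : ∀ n : ℕ, ∃ d, HasDerivAt (fun t => j t ^ (n + 1)) d 0 ∧
      ∀ k, T (d * j 0 ^ k) = (n + 1 : ℂ) * T (j' * j 0 ^ (n + k)) := by
    intro n
    induction n with
    | zero => exact ⟨j', by simpa using hj, fun k => by simp⟩
    | succ n ih =>
      obtain ⟨d, hd', hk⟩ := ih
      refine ⟨d * j 0 + j 0 ^ (n + 1) * j', ?_, fun k => ?_⟩
      · have := hd'.fun_mul hj
        simpa only [pow_succ _ (n + 1)] using this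
      · rw [add_mul, map_add, mul_assoc d, ← pow_succ', hk, mul_assoc,
          hT _ (pow_mem h0 _) _ (mul_mem h' (pow_mem h0 _)), mul_assoc j', ← pow_add]
        have e1 : n + (k + 1) = n + 1 + k := by ring
        have e2 : k + (n + 1) = n + 1 + k := by ring
        rw [e1, e2]
        push_cast
        ring
  obtain ⟨d, hd', hk⟩ := key n
  have h1 := hk 0
  rw [pow_zero, mul_one, add_zero] at h1
  rw [← h1]
  exact T.hasFDerivAt.comp_hasDerivAt (0 : ℂ) hd'

namespace TraceData

variable {P : VProj V A} (D : TraceData P)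

/-- On two-sided multiplications `tr2` is `τ ⊗ τ`, which inherits the trace property from each leg.
Continuity carries it to the closed algebra, one argument at a time. -/
lemma tr2_comm {Φ Ψ : A →L[ℂ] A} (hΦ : Φ ∈ mulLRAlg D.N) (hΨ : Ψ ∈ mulLRAlg D.N) :
    D.tr2 (Φ * Ψ) = D.tr2 (Ψ * Φ) := by
  have h1 : ∀ a ∈ D.N, ∀ b ∈ D.N, ∀ Ψ ∈ mulLRAlg D.N,
      D.tr2 (mulLR a b * Ψ) = D.tr2 (Ψ * mulLR a b) := by
    intro a ha b hb Ψ hΨ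
    refine mulLRAlg_induction (φ := D.tr2.comp (ContinuousLinearMap.compL ℂ A A A (mulLR a b)))
      (ψ := D.tr2.comp ((ContinuousLinearMap.compL ℂ A A A).flip (mulLR a b)))
      (fun c hc d hd => ?_) hΨ
    change D.tr2 (mulLR a b * mulLR c d) = D.tr2 (mulLR c d * mulLR a b)
    rw [mulLR_mul_mulLR, mulLR_mul_mulLR, D.tr2_mulLR, D.tr2_mulLR]
    rw [D.comm a ha c hc, D.comm d hd b hb]
  refine mulLRAlg_induction (φ := D.tr2.comp ((ContinuousLinearMap.compL ℂ A A A).flip Ψ))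
      (ψ := D.tr2.comp (ContinuousLinearMap.compL ℂ A A A Ψ))
      (fun c hc d hd => ?_) hΦ
  exact h1 c hc d hd Ψ hΨ

/-- The trace of operators on families. -/
def TT : ((G.Dart → A) →L[ℂ] (G.Dart → A)) →L[ℂ] ℂ :=
  ∑ e, D.tr2.comp (((ContinuousLinearMap.compL ℂ A (G.Dart → A) A) (prj e)).comp
    ((ContinuousLinearMap.compL ℂ A (G.Dart → A) (G.Dart → A)).flip (inj e)))

lemma TT_apply (Θ : (G.Dart → A) →L[ℂ] (G.Dart → A)) : D.TT Θ = ∑ e, D.tr2 (entry Θ e e) := by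
  rw [TT, sum_apply]
  rfl

/-- The operators on families with entries in the algebra of two-sided multiplications. -/
def InAlg (Θ : (G.Dart → A) →L[ℂ] (G.Dart → A)) : Prop := ∀ e f, entry Θ e f ∈ mulLRAlg D.N

variable {D}

lemma InAlg.mul {Θ Θ' : (G.Dart → A) →L[ℂ] (G.Dart → A)} (h : D.InAlg Θ) (h' : D.InAlg Θ') :
    D.InAlg (Θ * Θ') := fun e f => by
  rw [entry_mul]
  exact sum_mem fun w _ => mul_mem (h e w) (h' w f)

lemma InAlg.add {Θ Θ' : (G.Dart → A) →L[ℂ] (G.Dart → A)} (h : D.InAlg Θ) (h' : D.InAlg Θ') :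
    D.InAlg (Θ + Θ') := fun e f => by
  rw [entry_add]
  exact add_mem (h e f) (h' e f)

lemma InAlg.smul {Θ : (G.Dart → A) →L[ℂ] (G.Dart → A)} (c : ℂ) (h : D.InAlg Θ) :
    D.InAlg (c • Θ) := fun e f => by
  rw [entry_smul]
  exact (mulLRAlg D.N).smul_mem (h e f) c

lemma InAlg.one : D.InAlg (1 : (G.Dart → A) →L[ℂ] (G.Dart → A)) := fun e f => by
  classical
  have h : entry (1 : (G.Dart → A) →L[ℂ] (G.Dart → A)) e f = if e = f then 1 else 0 := by
    ext1 a
    rw [entry_apply]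
    change inj f a e = _
    rw [inj_apply]
    split_ifs <;> rfl
  rw [h]
  split_ifs
  · exact one_mem _
  · exact zero_mem _

variable (D) in
/-- They form a subring. -/
def inAlg : Submonoid ((G.Dart → A) →L[ℂ] (G.Dart → A)) where
  carrier := {Θ | D.InAlg Θ}
  mul_mem' := InAlg.mul
  one_mem' := InAlg.one

lemma isClosed_inAlg : IsClosed {Θ : (G.Dart → A) →L[ℂ] (G.Dart → A) | D.InAlg Θ} := by
  have h : {Θ : (G.Dart → A) →L[ℂ] (G.Dart → A) | D.InAlg Θ}
      = ⋂ e, ⋂ f, (fun Θ => entry Θ e f) ⁻¹' (mulLRAlg D.N : Set (A →L[ℂ] A)) := by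
    ext Θ
    simp only [Set.mem_iInter]
    rfl
  rw [h]
  exact isClosed_iInter fun e => isClosed_iInter fun f =>
    (isClosed_mulLRAlg D.N).preimage (continuous_entry e f)

lemma TT_comm {Θ Θ' : (G.Dart → A) →L[ℂ] (G.Dart → A)} (h : D.InAlg Θ) (h' : D.InAlg Θ') :
    D.TT (Θ * Θ') = D.TT (Θ' * Θ) := by
  rw [TT_apply, TT_apply]
  simp only [entry_mul, map_sum]
  rw [Finset.sum_comm]
  exact Finset.sum_congr rfl fun e _ => Finset.sum_congr rfl fun w _ =>
    D.tr2_comm (h _ _) (h' _ _)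

lemma evT_mem {X : G.Dart → A} (hX : ∀ e, X e ∈ D.N) (u : G.Tensor) :
    P.evT X u ∈ mulLRAlg D.N := by
  by_cases hs : Summable fun p : G.Path × G.Path =>
      u p.1 p.2 • mulLR (P.word p.1 X) (P.word p.2 X)
  · refine (isClosed_mulLRAlg D.N).mem_of_tendsto hs.hasSum
      (Filter.Eventually.of_forall fun s => sum_mem fun p _ => ?_)
    exact (mulLRAlg D.N).smul_mem
      (mulLR_mem (P.word_mem D.proj_mem hX _) (P.word_mem D.proj_mem hX _)) _
  · rw [VProj.evT, tsum_eq_zero_of_not_summable hs]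
    exact zero_mem _

lemma evM_inAlg {X : G.Dart → A} (hX : ∀ e, X e ∈ D.N) (Q : G.TMatrix) : D.InAlg (P.evM X Q) :=
  fun e f => by
    rw [VProj.entry_evM]
    exact evT_mem hX _

lemma TT_deriv_mul_pow {j : ℂ → (G.Dart → A) →L[ℂ] (G.Dart → A)}
    {j' : (G.Dart → A) →L[ℂ] (G.Dart → A)} (hj : HasDerivAt j j' 0) (h0 : D.InAlg (j 0))
    (h' : D.InAlg j') (n : ℕ) :
    HasDerivAt (fun t => D.TT (j t ^ (n + 1))) ((n + 1 : ℂ) * D.TT (j' * j 0 ^ n)) 0 := by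
  have hj2 : HasDerivAt (F := (G.Dart → A) →L[ℂ] (G.Dart → A)) j j' 0 := hj
  exact hasDerivAt_trace_pow (B := (G.Dart → A) →L[ℂ] (G.Dart → A)) D.TT D.inAlg
    (fun Θ h Θ' h' => TT_comm h h') hj2 h0 h' n

/-- The algebra is a closed linear subspace, so limits of difference quotients remain in it. The
trace property thereby becomes available for derivatives of the Jacobian. -/
lemma inAlg_deriv {j : ℂ → (G.Dart → A) →L[ℂ] (G.Dart → A)}
    {j' : (G.Dart → A) →L[ℂ] (G.Dart → A)} (hj : HasDerivAt j j' 0) (h : ∀ t, D.InAlg (j t)) :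
    D.InAlg j' := by
  have hj2 : HasDerivAt (F := (G.Dart → A) →L[ℂ] (G.Dart → A)) j j' 0 := hj
  have ht := (hasDerivAt_iff_tendsto_slope_zero (𝕜 := ℂ)
    (F := (G.Dart → A) →L[ℂ] (G.Dart → A))).1 hj2
  refine isClosed_inAlg.mem_of_tendsto (f := fun t : ℂ => t⁻¹ • (j (0 + t) - j 0)) ht
    (Filter.Eventually.of_forall fun t => ?_)
  refine InAlg.smul _ ?_
  rw [sub_eq_add_neg, ← neg_one_smul ℂ (j 0)]
  exact (h _).add ((h _).smul _)

/-! ### Double series and their partial traces -/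

variable (D)

/-- The partial trace `a ⊗ b ↦ τ(b(x)) a`. -/
def idT (x : G.Dart → A) (u : G.Tensor) : G.Series := fun γ => ∑' δ, u γ δ * D.τ (P.word δ x)

/-- The partial trace `a ⊗ b ↦ τ(a(x)) b`. -/
def Tid (x : G.Dart → A) (u : G.Tensor) : G.Series := fun δ => ∑' γ, D.τ (P.word γ x) * u γ δ

variable {D}

lemma enorm_τ_word_le {x : G.Dart → A} {ρ : ℝ≥0} (hx : ‖x‖ ≤ ρ) (γ : G.Path) :
    ‖D.τ (P.word γ x)‖ₑ ≤ ‖D.τ‖ₑ * (ρ : ℝ≥0∞) ^ γ.length := by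
  have h : ‖D.τ (P.word γ x)‖ₑ ≤ ‖D.τ‖ₑ * ‖P.word γ x‖ₑ := by
    simp only [enorm_eq_nnnorm, ← ENNReal.coe_mul]
    exact ENNReal.coe_le_coe.2 (D.τ.le_opNNNorm _)
  refine h.trans ?_
  gcongr
  exact P.enorm_word_le γ x fun e => (norm_le_pi_norm x e).trans hx

lemma wnorm_idT_le {x : G.Dart → A} {ρ : ℝ≥0} (hx : ‖x‖ ≤ ρ) (u : G.Tensor) :
    (D.idT x u).wnorm ρ ≤ ‖D.τ‖ₑ * u.wnorm ρ := by
  rw [Series.wnorm, Tensor.wnorm, ENNReal.tsum_prod (f := fun γ δ => ‖u γ δ‖ₑ *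
    (ρ : ℝ≥0∞) ^ (γ.length + δ.length)), ← ENNReal.tsum_mul_left]
  refine ENNReal.tsum_le_tsum fun γ => ?_
  rw [← ENNReal.tsum_mul_left]
  refine (mul_le_mul_left (Series.enorm_tsum_le _) _).trans ?_
  rw [← ENNReal.tsum_mul_right]
  refine ENNReal.tsum_le_tsum fun δ => ?_
  rw [enorm_mul]
  calc _ ≤ ‖u γ δ‖ₑ * (‖D.τ‖ₑ * (ρ : ℝ≥0∞) ^ δ.length) * (ρ : ℝ≥0∞) ^ γ.length := by
        gcongr
        exact enorm_τ_word_le hx δ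
    _ = _ := by rw [pow_add]; ring

lemma Tid_eq (x : G.Dart → A) (u : G.Tensor) : D.Tid x u = D.idT x u.flip := by
  funext δ
  exact tsum_congr fun γ => mul_comm _ _

lemma wnorm_Tid_le {x : G.Dart → A} {ρ : ℝ≥0} (hx : ‖x‖ ≤ ρ) (u : G.Tensor) :
    (D.Tid x u).wnorm ρ ≤ ‖D.τ‖ₑ * u.wnorm ρ := by
  rw [Tid_eq]
  exact (wnorm_idT_le hx _).trans_eq (by rw [Tensor.wnorm_flip])

lemma hasSum_tr2_evB {X Z : G.Dart → A} {ρ : ℝ≥0} (hX : ‖X‖ ≤ ρ) (hZ : ‖Z‖ ≤ ρ) {u : G.Tensor}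
    (hu : u.wnorm ρ < ⊤) : HasSum (fun p : G.Path × G.Path =>
      u p.1 p.2 * (D.τ (P.word p.1 X) * D.τ (P.word p.2 Z))) (D.tr2 (P.evB X Z u)) := by
  have h := (P.hasSum_evB hX hZ hu).mapL D.tr2
  have h1 : (fun p : G.Path × G.Path =>
      D.tr2 (u p.1 p.2 • mulLR (P.word p.1 X) (P.word p.2 Z))) = fun p =>
      u p.1 p.2 * (D.τ (P.word p.1 X) * D.τ (P.word p.2 Z)) := by
    funext p
    rw [← D.tr2_mulLR]
    exact map_smul D.tr2 _ _
  rwa [h1] at h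

end TraceData

end

section

variable {V E : Type*} [Fintype V] {G : WeightedGraph V E} [Fintype E]
  {A : Type*} [NormedRing A] [NormedAlgebra ℂ A] [CompleteSpace A]

/-! ### Directional derivatives -/

namespace Series

lemma diff_add (w : G.Dart) (a b : G.Series) : diff w (a + b) = diff w a + diff w b := by
  funext γ δ
  by_cases h : γ.finish = w.src ∧ δ.start = w.tgt
  · simp [diff, h]
  · simp [diff, h]

lemma diff_smul (w : G.Dart) (c : ℂ) (a : G.Series) : diff w (c • a) = c • diff w a := by
  funext γ δ
  by_cases h : γ.finish = w.src ∧ δ.start = w.tgt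
  · simp [diff, h]
  · simp [diff, h]

lemma diff_tsum {ι : Type*} (w : G.Dart) (a : ι → G.Series) :
    diff w (fun γ => ∑' i, a i γ) = fun γ δ => ∑' i, diff w (a i) γ δ := by
  funext γ δ
  by_cases h : γ.finish = w.src ∧ δ.start = w.tgt
  · simp [diff, h]
  · simp [diff, h]

end Series

namespace VProj

variable (P : VProj V A)

lemma evT_smul (X : G.Dart → A) (c : ℂ) (u : G.Tensor) : P.evT X (c • u) = c • P.evT X u := by
  rw [evT, evT, ← tsum_const_smul'' (α := A →L[ℂ] A)]
  refine tsum_congr fun p => ?_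
  exact mul_smul c (u p.1 p.2) (mulLR (P.word p.1 X) (P.word p.2 X))

lemma hasSum_evT_tsum {ι : Type*} {X : G.Dart → A} {ρ : ℝ≥0} (hX : ∀ e, ‖X e‖ ≤ ρ)
    {u : ι → G.Tensor} (hu : ∑' i, (u i).wnorm ρ < ⊤) :
    HasSum (fun i => P.evT X (u i)) (P.evT X (fun γ δ => ∑' i, u i γ δ)) := by
  let F : ι → G.Path × G.Path → A →L[ℂ] A := fun i p =>
    u i p.1 p.2 • mulLR (P.word p.1 X) (P.word p.2 X)
  have hb : ∑' q : (G.Path × G.Path) × ι, ‖F q.2 q.1‖ₑ < ⊤ := by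
    rw [ENNReal.tsum_prod (f := fun p i => ‖F i p‖ₑ), ENNReal.tsum_comm]
    exact (ENNReal.tsum_le_tsum fun i => P.tsum_enorm_evT_le hX (u i)).trans_lt hu
  have hs : HasSum (fun q : (G.Path × G.Path) × ι => F q.2 q.1) _ :=
    (Summable.of_enorm hb.ne).hasSum
  have hs' : HasSum (fun q : ι × G.Path × G.Path => F q.1 q.2) (∑' q : (G.Path × G.Path) × ι,
      F q.2 q.1) :=
    (Equiv.prodComm ι (G.Path × G.Path)).hasSum_iff (f := fun q : (G.Path × G.Path) × ι =>
      F q.2 q.1).2 hs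
  have h1 := hs'.prod_fiberwise fun i => P.hasSum_evT hX (ENNReal.lt_top_of_tsum_ne_top hu.ne i)
  convert h1 using 1
  rw [hs.summable.tsum_prod]
  refine tsum_congr fun p => ?_
  refine tsum_smul_of_enorm (M := A →L[ℂ] A) ?_
  refine lt_of_le_of_lt ?_ hb
  exact (ENNReal.tsum_comp_le_tsum_of_injective (Prod.mk_right_injective p)
    (fun q : (G.Path × G.Path) × ι => ‖F q.2 q.1‖ₑ))

lemma hasDerivAt_line (x K : G.Dart → A) : HasDerivAt (fun t : ℂ => x + t • K) K 0 := by
  have h := ((hasDerivAt_id (0 : ℂ)).smul_const K).const_add x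
  simpa using h

lemma hasDerivAt_ev {x : G.Dart → A} {ρ : ℝ≥0} (hx : ‖x‖ < ρ) {a : G.Series}
    (ha : a.wnorm ρ < ⊤) (K : G.Dart → A) : HasDerivAt (fun t : ℂ => P.ev (x + t • K) a)
      (∑ w, P.evT x (Series.diff w a) (K w)) 0 := by
  have h0 : x + (0 : ℂ) • K = x := by simp
  have h := HasFDerivAt.comp_hasDerivAt (0 : ℂ) (l := fun Y => P.ev Y a)
    (f := fun t : ℂ => x + t • K) (by rw [h0]; exact P.hasFDerivAt_ev hx ha)
    (hasDerivAt_line x K)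
  rw [sum_apply] at h
  exact h

lemma word_cutTriple (γ : G.Path) (i : Fin γ.length) (X : G.Dart → A) :
    P.word (γ.take i) X * X (γ.darts[(i : ℕ)]'i.2) * P.word (γ.drop (i + 1)) X = P.word γ X := by
  have e1 := P.word_mul_projOp (γ.take i) X
  have e2 := P.projOp_mul_word (γ.drop (i + 1)) X
  rw [Path.take_finish_src γ i] at e1
  rw [Path.drop_succ_start γ i] at e2
  rw [← P.word_take_mul_word_drop γ (i + 1), P.word_take_succ γ i]
  nth_rewrite 1 [← e1, ← e2]
  simp only [cutOps, mul_assoc]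

/-- Euler's identity: replacing each variable in turn by `μ(w)` times itself multiplies a monomial
by the sum of the weights of its edges. -/
lemma ev_number {X : G.Dart → A} {ρ σ : ℝ≥0} (hσ : σ < ρ) (hX : ‖X‖ ≤ σ) {g : G.Series}
    (hg : g.wnorm ρ < ⊤) :
    ∑ w, P.evT X (Series.diff w g) ((w.wt : ℂ) • X w) = P.ev X (Series.number g) := by
  have hd : ∀ w, (Series.diff w g).wnorm σ < ⊤ := fun w =>
    (Series.wnorm_diff_le hσ w g).trans_lt (ENNReal.mul_lt_top ENNReal.coe_lt_top hg)
  have h1 := hasSum_triple (F := fun γ w δ => Series.diff w g γ δ •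
    (P.word γ X * ((w.wt : ℂ) • X w) * P.word δ X)) fun w =>
      P.hasSum_evT_apply (fun e => (norm_le_pi_norm X e).trans hX) (hd w) ((w.wt : ℂ) • X w)
  have h2 := hasSum_cutTriple (F := fun γ w δ => Series.diff w g γ δ •
    (P.word γ X * ((w.wt : ℂ) • X w) * P.word δ X))
    (fun γ w δ h => by rw [Series.diff_of_not h, zero_smul]) h1
  rw [← h2.tsum_eq, ev]
  refine tsum_congr fun γ => ?_
  simp only [Series.diff_cut, mul_smul_comm, smul_mul_assoc, word_cutTriple, ← Finset.smul_sum,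
    ← Finset.sum_smul]
  rw [Series.number, mul_comm, mul_smul]
  congr 2
  rw [Path.wt, ← Complex.ofReal_sum]
  congr 1
  have h3 : (γ.darts.map Dart.wt) = List.ofFn fun i : Fin γ.length => (γ.darts[(i : ℕ)]'i.2).wt := by
    refine List.ext_getElem (by simp [Path.length]) fun n h1 h2 => ?_
    simp
    rfl
  rw [h3, List.sum_ofFn]

end VProj

namespace TraceData

variable {P : VProj V A} (D : TraceData P)

/-- The derivative of `τ(a(X))` at `x` in the direction `K`. -/
def psi (x K : G.Dart → A) (a : G.Series) : ℂ := D.τ (∑ w, P.evT x (Series.diff w a) (K w))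

variable {D}

lemma hasDerivAt_τ_ev {x : G.Dart → A} {ρ : ℝ≥0} (hx : ‖x‖ < ρ) {a : G.Series}
    (ha : a.wnorm ρ < ⊤) (K : G.Dart → A) :
    HasDerivAt (fun t : ℂ => D.τ (P.ev (x + t • K) a)) (D.psi x K a) 0 :=
  D.τ.hasFDerivAt.comp_hasDerivAt (0 : ℂ) (P.hasDerivAt_ev hx ha K)

lemma psi_add {x : G.Dart → A} {ρ σ : ℝ≥0} (hσ : σ < ρ) (hx : ‖x‖ ≤ σ) (K : G.Dart → A)
    {a b : G.Series} (ha : a.wnorm ρ < ⊤) (hb : b.wnorm ρ < ⊤) :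
    D.psi x K (a + b) = D.psi x K a + D.psi x K b := by
  have hd : ∀ {a : G.Series}, a.wnorm ρ < ⊤ → ∀ w, (Series.diff w a).wnorm σ < ⊤ := fun h w =>
    (Series.wnorm_diff_le hσ w _).trans_lt (ENNReal.mul_lt_top ENNReal.coe_lt_top h)
  rw [psi, psi, psi, ← map_add, ← Finset.sum_add_distrib]
  congr 1
  refine Finset.sum_congr rfl fun w _ => ?_
  rw [Series.diff_add, P.evT_add (fun e => (norm_le_pi_norm x e).trans hx) (hd ha w) (hd hb w)]
  rfl

lemma psi_smul (x K : G.Dart → A) (c : ℂ) (a : G.Series) :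
    D.psi x K (c • a) = c * D.psi x K a := by
  rw [psi, psi, ← smul_eq_mul, ← map_smul, Finset.smul_sum]
  congr 1
  refine Finset.sum_congr rfl fun w _ => ?_
  rw [Series.diff_smul, P.evT_smul]
  rfl

lemma hasSum_psi {ι : Type*} {x : G.Dart → A} {ρ σ : ℝ≥0} (hσ : σ < ρ) (hx : ‖x‖ ≤ σ)
    (K : G.Dart → A) {a : ι → G.Series} (ha : ∑' i, (a i).wnorm ρ < ⊤) :
    HasSum (fun i => D.psi x K (a i)) (D.psi x K (fun γ => ∑' i, a i γ)) := by
  unfold psi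
  suffices h : HasSum (fun i => ∑ w, P.evT x (Series.diff w (a i)) (K w))
      (∑ w, P.evT x (Series.diff w (fun γ => ∑' i, a i γ)) (K w)) from h.mapL D.τ
  refine hasSum_sum fun w _ => ?_
  rw [Series.diff_tsum]
  refine (P.hasSum_evT_tsum (u := fun i => Series.diff w (a i))
    (fun e => (norm_le_pi_norm x e).trans hx) ?_).mapL (ContinuousLinearMap.apply ℂ A (K w))
  refine (ENNReal.tsum_le_tsum fun i => Series.wnorm_diff_le hσ w (a i)).trans_lt ?_
  rw [ENNReal.tsum_mul_left]
  exact ENNReal.mul_lt_top ENNReal.coe_lt_top ha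

/-- Under the trace a term `X_γ T X_δ` becomes `X_δ X_γ T`, and the resulting flip followed by
multiplication is the recipe for the cyclic gradient. -/
lemma τ_evT {x : G.Dart → A} {σ : ℝ≥0} (hx : ‖x‖ ≤ σ) (hxN : ∀ e, x e ∈ D.N) {u : G.Tensor}
    (hu : u.wnorm σ < ⊤) {T : A} (hT : T ∈ D.N) :
    D.τ (P.evT x u T) = D.τ (P.ev x (Tensor.mult (Tensor.flip u)) * T) := by
  have hx' : ∀ e, ‖x e‖ ≤ σ := fun e => (norm_le_pi_norm x e).trans hx
  have h1 := (P.hasSum_evT_apply hx' hu T).mapL D.τ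
  have h2 := ((P.hasSum_ev_mult hx' (u := Tensor.flip u)
    (by rwa [Tensor.wnorm_flip])).mul_right T).mapL D.τ
  rw [← (Equiv.prodComm G.Path G.Path).hasSum_iff] at h2
  refine h1.unique ?_
  convert h2 using 2 with p
  simp only [Function.comp_apply, Equiv.prodComm_apply, Prod.fst_swap, Prod.snd_swap, Tensor.flip,
    smul_mul_assoc, map_smul]
  rw [mul_assoc, D.comm _ (P.word_mem D.proj_mem hxN _) _
    (mul_mem hT (P.word_mem D.proj_mem hxN _)), mul_assoc T, D.comm T hT _
    (mul_mem (P.word_mem D.proj_mem hxN _) (P.word_mem D.proj_mem hxN _))]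

/-- The cyclic gradient is the gradient of `X ↦ τ(a(X))`. The edge is reversed because `𝒟_ε` is
built from `∂_{ε^op}`. -/
lemma psi_eq {x : G.Dart → A} {ρ σ : ℝ≥0} (hσ : σ < ρ) (hx : ‖x‖ ≤ σ) (hxN : ∀ e, x e ∈ D.N)
    {K : G.Dart → A} (hK : ∀ e, K e ∈ D.N) {a : G.Series} (ha : a.wnorm ρ < ⊤) :
    D.psi x K a = ∑ w : G.Dart, D.τ (P.ev x (grad a w.op) * K w) := by
  rw [psi, map_sum]
  refine Finset.sum_congr rfl fun w _ => ?_
  rw [τ_evT hx hxN ((Series.wnorm_diff_le hσ w a).trans_lt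
    (ENNReal.mul_lt_top ENNReal.coe_lt_top ha)) (hK w), grad, Dart.op_op]

/-- Reversal of directed edges. -/
def opEquiv : G.Dart ≃ G.Dart := ⟨Dart.op, Dart.op, Dart.op_op, Dart.op_op⟩

lemma sum_op {M : Type*} [AddCommMonoid M] (F : G.Dart → M) : ∑ e : G.Dart, F e.op = ∑ e, F e :=
  Equiv.sum_comp opEquiv F

lemma τ_ev_number {X : G.Dart → A} {ρ σ : ℝ≥0} (hσ : σ < ρ) (hX : ‖X‖ ≤ σ)
    (hXN : ∀ e, X e ∈ D.N) {g : G.Series} (hg : g.wnorm ρ < ⊤) :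
    D.τ (P.ev X (Series.number g)) =
      ∑ e : G.Dart, (e.wt : ℂ) * D.τ (X e.op * P.ev X (grad g e)) := by
  have h := psi_eq (D := D) (K := fun w => (w.wt : ℂ) • X w) hσ hX hXN
    (fun w => D.N.smul_mem (hXN w) _) hg
  rw [psi, P.ev_number hσ hX hg] at h
  rw [h, ← sum_op]
  refine Finset.sum_congr rfl fun w _ => ?_
  rw [Dart.op_op, Dart.op_wt, mul_smul_comm, map_smul, smul_eq_mul,
    D.comm _ (P.ev_mem D.isClosed D.proj_mem hXN _) _ (hXN _)]

/-- With the second argument frozen, the functional becomes the trace of an ordinary series in the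
first one, whose coefficients are given by a partial trace. -/
lemma tr2_evB_left {X Z : G.Dart → A} {ρ : ℝ≥0} (hX : ‖X‖ ≤ ρ) (hZ : ‖Z‖ ≤ ρ) {u : G.Tensor}
    (hu : u.wnorm ρ < ⊤) : D.tr2 (P.evB X Z u) = D.τ (P.ev X (D.idT Z u)) := by
  have h1 := hasSum_tr2_evB (D := D) hX hZ hu
  have hw : (D.idT Z u).wnorm ρ < ⊤ :=
    (wnorm_idT_le hZ u).trans_lt (ENNReal.mul_lt_top enorm_lt_top hu)
  have h2 := (P.hasSum_ev (fun e => (norm_le_pi_norm X e).trans hX) hw).mapL D.τ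
  have h3 := h1.prod_fiberwise fun γ => (h1.summable.prod_factor γ).hasSum
  refine h3.unique ?_
  convert h2 using 2 with γ
  rw [map_smul, smul_eq_mul, idT, ← tsum_mul_right]
  exact tsum_congr fun δ => by ring

lemma tr2_evB_right {X Z : G.Dart → A} {ρ : ℝ≥0} (hX : ‖X‖ ≤ ρ) (hZ : ‖Z‖ ≤ ρ) {u : G.Tensor}
    (hu : u.wnorm ρ < ⊤) : D.tr2 (P.evB X Z u) = D.τ (P.ev Z (D.Tid X u)) := by
  have hu' : u.flip.wnorm ρ < ⊤ := by rwa [Tensor.wnorm_flip]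
  rw [Tid_eq, ← tr2_evB_left hZ hX hu']
  have h1 := hasSum_tr2_evB (D := D) hX hZ hu
  have h2 := hasSum_tr2_evB (D := D) hZ hX hu'
  rw [← (Equiv.prodComm G.Path G.Path).hasSum_iff] at h2
  refine h1.unique ?_
  convert h2 using 2 with p
  simp only [Function.comp_apply, Equiv.prodComm_apply, Prod.fst_swap, Prod.snd_swap, Tensor.flip]
  ring

/-- The total derivative on the diagonal is the sum of the two partial derivatives. Each partial
derivative freezes one leg at `x` and is given by one of the partial traces, which explains the
combination `1 ⊗ τ + τ ⊗ 1`. -/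
lemma hasDerivAt_tr2_evT {x : G.Dart → A} {ρ : ℝ≥0} (hx : ‖x‖ < ρ) {u : G.Tensor}
    (hu : u.wnorm ρ < ⊤) (K : G.Dart → A) :
    HasDerivAt (fun t : ℂ => D.tr2 (P.evT (x + t • K) u))
      (D.psi x K (D.idT x u + D.Tid x u)) 0 := by
  obtain ⟨σ, hσ, hσρ⟩ : ∃ σ : ℝ≥0, ‖x‖₊ < σ ∧ σ < ρ := exists_between (a₁ := ‖x‖₊) hx
  have hσ' : ‖x‖ < σ := hσ
  have hB := D.tr2.hasFDerivAt.comp (x, x) (P.differentiableAt_evB hx hx hu).hasFDerivAt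
  set L := D.tr2.comp (fderiv ℂ (fun p : (G.Dart → A) × (G.Dart → A) => P.evB p.1 p.2 u) (x, x))
  have key : ∀ (f : ℂ → (G.Dart → A) × (G.Dart → A)) (f'), f 0 = (x, x) → HasDerivAt f f' 0 →
      HasDerivAt (fun t => D.tr2 (P.evB (f t).1 (f t).2 u)) (L f') 0 := by
    intro f f' hf0 hf
    rw [← hf0] at hB
    exact hB.comp_hasDerivAt (0 : ℂ) hf
  have hl := VProj.hasDerivAt_line x K
  have h0 : x + (0 : ℂ) • K = x := by simp
  have hev : ∀ᶠ t : ℂ in nhds 0, ‖x + t • K‖ < ρ := by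
    have hc : Filter.Tendsto (fun t : ℂ => ‖x + t • K‖) (nhds 0) (nhds ‖x‖) := by
      have := hl.continuousAt.norm
      rwa [ContinuousAt, h0] at this
    exact hc.eventually_lt_const hx
  have hI : (D.idT x u).wnorm ρ < ⊤ :=
    (wnorm_idT_le hx.le u).trans_lt (ENNReal.mul_lt_top enorm_lt_top hu)
  have hT : (D.Tid x u).wnorm ρ < ⊤ :=
    (wnorm_Tid_le hx.le u).trans_lt (ENNReal.mul_lt_top enorm_lt_top hu)
  have h1 : L (K, 0) = D.psi x K (D.idT x u) := by
    have e1 : HasDerivAt (fun t : ℂ => D.tr2 (P.evB (x + t • K) x u)) (L (K, 0)) 0 :=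
      key (fun t : ℂ => (x + t • K, x)) _ (by rw [h0]) (hl.prodMk (hasDerivAt_const _ _))
    refine e1.unique ((hasDerivAt_τ_ev hx hI K).congr_of_eventuallyEq ?_)
    filter_upwards [hev] with t ht using tr2_evB_left ht.le hx.le hu
  have h2 : L (0, K) = D.psi x K (D.Tid x u) := by
    have e1 : HasDerivAt (fun t : ℂ => D.tr2 (P.evB x (x + t • K) u)) (L (0, K)) 0 :=
      key (fun t : ℂ => (x, x + t • K)) _ (by rw [h0]) ((hasDerivAt_const _ _).prodMk hl)
    refine e1.unique ((hasDerivAt_τ_ev hx hT K).congr_of_eventuallyEq ?_)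
    filter_upwards [hev] with t ht using tr2_evB_right hx.le ht.le hu
  have h3 : HasDerivAt (fun t : ℂ => D.tr2 (P.evT (x + t • K) u)) (L (K, K)) 0 :=
    key (fun t : ℂ => (x + t • K, x + t • K)) _ (by rw [h0]) (hl.prodMk hl)
  have h4 : (K, K) = (K, (0 : G.Dart → A)) + ((0 : G.Dart → A), K) := by simp
  rwa [h4, map_add, h1, h2, ← psi_add hσρ hσ'.le K hI hT] at h3

end TraceData

end

section

variable {V E : Type*} [Fintype V] {G : WeightedGraph V E}

/-! ### The action of double series on series -/

/-- Cutting a path in three. -/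
def cutThree (p : Σ γ : G.Path, Σ i : Fin (γ.length + 1), Fin ((γ.drop i).length + 1)) :
    G.Path × G.Path × G.Path :=
  (p.1.take p.2.1, cutPair ⟨p.1.drop p.2.1, p.2.2⟩)

lemma cutThree_injective : Function.Injective (cutThree (G := G)) := by
  rintro ⟨γ, i, j⟩ ⟨γ', i', j'⟩ h
  have h2 := cutPair_injective (congrArg Prod.snd h)
  have e1 : γ.take i = γ'.take i' := congrArg Prod.fst h
  have e2 : γ.drop i = γ'.drop i' := congrArg Sigma.fst h2
  have h1 : cutPair ⟨γ, i⟩ = cutPair ⟨γ', i'⟩ := Prod.ext e1 e2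
  have h3 := cutPair_injective h1
  simp only [Sigma.mk.injEq] at h3
  obtain ⟨rfl, h3⟩ := h3
  obtain rfl := eq_of_heq h3
  simp only [Sigma.mk.injEq, heq_eq_eq, true_and] at h2
  subst h2
  rfl

lemma mem_range_cutThree {p : G.Path × G.Path × G.Path} (h : p.1.finish = p.2.1.start)
    (h' : p.2.1.finish = p.2.2.start) : p ∈ Set.range (cutThree (G := G)) := by
  obtain ⟨⟨η, j⟩, hη⟩ := mem_range_cutPair (p := p.2) h'
  have h1 : p.1.finish = η.start := by
    rw [h, ← hη]
    rfl
  obtain ⟨⟨γ, i⟩, hγ⟩ := mem_range_cutPair (p := (p.1, η)) h1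
  have e1 : γ.take i = p.1 := congrArg Prod.fst hγ
  have e2 : γ.drop i = η := congrArg Prod.snd hγ
  subst e2
  exact ⟨⟨γ, i, j⟩, Prod.ext e1 hη⟩

lemma hasSum_cut₃ {M : Type*} [AddCommMonoid M] [TopologicalSpace M] [ContinuousAdd M]
    [RegularSpace M] {F : G.Path → G.Path → G.Path → M}
    (hF : ∀ γ δ ε, ¬ (γ.finish = δ.start ∧ δ.finish = ε.start) → F γ δ ε = 0) {s : M}
    (h : HasSum (fun p : G.Path × G.Path × G.Path => F p.1 p.2.1 p.2.2) s) :
    HasSum (fun γ : G.Path => ∑ i ∈ Finset.range (γ.length + 1),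
      ∑ j ∈ Finset.range ((γ.drop i).length + 1),
        F (γ.take i) ((γ.drop i).take j) ((γ.drop i).drop j)) s := by
  have h1 : HasSum ((fun p : G.Path × G.Path × G.Path => F p.1 p.2.1 p.2.2) ∘ cutThree) s := by
    refine (cutThree_injective.hasSum_iff fun p hp => hF _ _ _ fun hh => hp ?_).2 h
    exact mem_range_cutThree hh.1 hh.2
  refine h1.sigma fun γ => ?_
  rw [Finset.sum_range]
  simp_rw [Finset.sum_range]
  have h2 := hasSum_fintype fun c : (Σ i : Fin (γ.length + 1), Fin ((γ.drop i).length + 1)) =>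
    ((fun p : G.Path × G.Path × G.Path => F p.1 p.2.1 p.2.2) ∘ cutThree) ⟨γ, c⟩
  rw [Fintype.sum_sigma] at h2
  exact h2

lemma Tensor.act_eq (u : G.Tensor) (a : G.Series) (γ : G.Path) :
    act u a γ = ∑ i ∈ Finset.range (γ.length + 1), ∑ j ∈ Finset.range ((γ.drop i).length + 1),
      u (γ.take i) ((γ.drop i).drop j) * a ((γ.drop i).take j) := rfl

lemma tsum_act (f : G.Path → G.Path → ℝ≥0∞) (g : G.Path → ℝ≥0∞) :
    ∑' p : G.Path × G.Path × G.Path, f p.1 p.2.2 * g p.2.1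
      = (∑' p : G.Path × G.Path, f p.1 p.2) * ∑' γ, g γ := by
  rw [ENNReal.tsum_prod (f := fun (γ : G.Path) (q : G.Path × G.Path) => f γ q.2 * g q.1),
    ENNReal.tsum_prod (f := fun γ δ => f γ δ), ← ENNReal.tsum_mul_right]
  refine tsum_congr fun γ => ?_
  rw [ENNReal.tsum_prod (f := fun δ ε => f γ ε * g δ), ENNReal.tsum_comm, ← ENNReal.tsum_mul_right]
  refine tsum_congr fun ε => ?_
  rw [ENNReal.tsum_mul_left]

lemma Tensor.wnorm_act_le (ρ : ℝ≥0) (u : G.Tensor) (a : G.Series) :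
    (act u a).wnorm ρ ≤ wnorm ρ u * a.wnorm ρ := by
  classical
  set F : G.Path → G.Path → G.Path → ℝ≥0∞ := fun γ δ ε =>
    if ¬ (γ.finish = δ.start ∧ δ.finish = ε.start) then 0 else
    (‖u γ ε‖ₑ * (ρ : ℝ≥0∞) ^ (γ.length + ε.length)) * (‖a δ‖ₑ * (ρ : ℝ≥0∞) ^ δ.length) with hF
  have h := hasSum_cut₃ (F := F) (fun _ _ _ h => if_pos h) ENNReal.summable.hasSum
  refine (ENNReal.tsum_le_tsum (g := fun γ : G.Path =>
    ∑ i ∈ Finset.range (γ.length + 1), ∑ j ∈ Finset.range ((γ.drop i).length + 1),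
      F (γ.take i) ((γ.drop i).take j) ((γ.drop i).drop j)) fun γ => ?_).trans
      (h.tsum_eq.le.trans ?_)
  · rw [act_eq]
    refine (mul_le_mul_left (enorm_sum_le _ _) _).trans ?_
    rw [Finset.sum_mul]
    refine Finset.sum_le_sum fun i _ => ?_
    refine (mul_le_mul_left (enorm_sum_le _ _) _).trans ?_
    rw [Finset.sum_mul]
    refine Finset.sum_le_sum fun j _ => ?_
    rw [hF]
    dsimp only
    rw [if_neg (by simp), enorm_mul]
    have e : γ.length = (γ.take i).length + ((γ.drop i).take j).length
        + ((γ.drop i).drop j).length := by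
      rw [add_assoc, Path.length_take_add_length_drop (γ.drop i) j,
        Path.length_take_add_length_drop γ i]
    rw [e]
    apply le_of_eq
    ring
  · rw [wnorm, Series.wnorm, ← tsum_act (fun γ ε => ‖u γ ε‖ₑ * (ρ : ℝ≥0∞) ^ (γ.length + ε.length))]
    refine ENNReal.tsum_le_tsum fun p => ?_
    rw [hF]
    dsimp only
    split_ifs
    · exact le_rfl
    · exact zero_le

variable {A : Type*} [NormedRing A] [NormedAlgebra ℂ A] [CompleteSpace A]

namespace VProj

variable (P : VProj V A)

/-- Both sides sum over triples of paths: grouping them by their concatenation gives the left side,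
and summing the middle path first gives the right side. -/
lemma ev_act {X : G.Dart → A} {ρ : ℝ≥0} (hX : ∀ e, ‖X e‖ ≤ ρ) {u : G.Tensor}
    (hu : u.wnorm ρ < ⊤) {a : G.Series} (ha : a.wnorm ρ < ⊤) :
    P.ev X (Tensor.act u a) = P.evT X u (P.ev X a) := by
  set F : G.Path → G.Path → G.Path → A := fun γ δ ε =>
    (u γ ε * a δ) • (P.word γ X * P.word δ X * P.word ε X) with hF
  have hs : Summable (fun p : G.Path × G.Path × G.Path => F p.1 p.2.1 p.2.2) := by
    refine Summable.of_enorm (lt_of_le_of_lt (b := u.wnorm ρ * a.wnorm ρ) ?_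
      (ENNReal.mul_lt_top hu ha)).ne
    rw [Tensor.wnorm, Series.wnorm,
      ← tsum_act (fun γ ε => ‖u γ ε‖ₑ * (ρ : ℝ≥0∞) ^ (γ.length + ε.length))]
    refine ENNReal.tsum_le_tsum fun p => ?_
    rw [hF]
    dsimp only
    rw [enorm_smul, enorm_mul]
    calc _ ≤ ‖u p.1 p.2.2‖ₑ * ‖a p.2.1‖ₑ * ((ρ : ℝ≥0∞) ^ p.1.length * (ρ : ℝ≥0∞) ^ p.2.1.length
          * (ρ : ℝ≥0∞) ^ p.2.2.length) := by
          gcongr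
          refine (enorm_ops_mul_le _ _).trans (mul_le_mul' ((enorm_ops_mul_le _ _).trans
            (mul_le_mul' ?_ ?_)) ?_) <;> exact P.enorm_word_le _ X hX
      _ = _ := by rw [pow_add]; ring
  have h := hasSum_cut₃ (F := F) (fun γ δ ε h => by
    rw [hF]
    dsimp only
    by_cases h1 : γ.finish = δ.start
    · rw [mul_assoc, P.word_mul_word_of_ne (γ := δ) fun h2 => h ⟨h1, h2⟩, mul_zero, smul_zero]
    · rw [P.word_mul_word_of_ne h1, zero_mul, smul_zero]) hs.hasSum
  have e1 : P.ev X (Tensor.act u a) = ∑' p : G.Path × G.Path × G.Path, F p.1 p.2.1 p.2.2 := by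
    rw [← h.tsum_eq, ev]
    refine tsum_congr fun γ => ?_
    simp only [hF, mul_assoc, P.word_take_mul_word_drop, ← Finset.sum_smul]
    rfl
  rw [e1]
  let φ : (G.Path × G.Path) × G.Path ≃ G.Path × G.Path × G.Path :=
    ⟨fun p => (p.1.1, p.2, p.1.2), fun p => ((p.1, p.2.2), p.2.1), fun _ => rfl, fun _ => rfl⟩
  have h2 : HasSum (fun q : (G.Path × G.Path) × G.Path => F q.1.1 q.2 q.1.2)
      (∑' p : G.Path × G.Path × G.Path, F p.1 p.2.1 p.2.2) :=
    (φ.hasSum_iff (f := fun p : G.Path × G.Path × G.Path => F p.1 p.2.1 p.2.2)).2 hs.hasSum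
  refine (h2.prod_fiberwise (g := fun p => u p.1 p.2 • (P.word p.1 X * P.ev X a * P.word p.2 X))
    fun p => ?_).unique (P.hasSum_evT_apply hX hu _)
  have h3 := (((P.hasSum_ev hX ha).mul_left (P.word p.1 X)).mul_right (P.word p.2 X)).const_smul
    (u p.1 p.2)
  have h4 : (fun δ => F p.1 δ p.2) = fun δ =>
      u p.1 p.2 • (P.word p.1 X * a δ • P.word δ X * P.word p.2 X) := by
    funext δ
    rw [hF, mul_smul_comm, smul_mul_assoc, smul_smul]
  rw [h4]
  exact h3

variable [Fintype E]

lemma evF_act {X : G.Dart → A} {ρ : ℝ≥0} (hX : ‖X‖ ≤ ρ) {Q : G.TMatrix}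
    (hQ : ∀ e w, (Q e w).wnorm ρ < ⊤) {f : G.Dart → G.Series} (hf : ∀ e, (f e).wnorm ρ < ⊤) :
    P.evF X (Q.act f) = P.evM X Q (P.evF X f) := by
  have hX' : ∀ e, ‖X e‖ ≤ ρ := fun e => (norm_le_pi_norm X e).trans hX
  funext e
  rw [evM_apply, evF, TMatrix.act, P.ev_sum hX' _ fun w _ =>
    (Tensor.wnorm_act_le _ _ _).trans_lt (ENNReal.mul_lt_top (hQ e w) (hf w))]
  exact Finset.sum_congr rfl fun w _ => P.ev_act hX' (hQ e w) (hf w)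

end VProj

lemma TMatrix.wnorm_act_le [Fintype E] {ρ : ℝ≥0} {Q : G.TMatrix} {c : ℝ≥0∞}
    (hQ : ∀ e, ∑ w, (Q e w).wnorm ρ ≤ c) {f : G.Dart → G.Series} {b : ℝ≥0∞}
    (hf : ∀ e, (f e).wnorm ρ ≤ b) (e : G.Dart) : (Q.act f e).wnorm ρ ≤ c * b := by
  refine (Series.wnorm_sum_le _ _ _).trans ?_
  calc _ ≤ ∑ w, (Q e w).wnorm ρ * b := Finset.sum_le_sum fun w _ =>
        (Tensor.wnorm_act_le _ _ _).trans (by gcongr; exact hf w)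
    _ ≤ c * b := by rw [← Finset.sum_mul]; gcongr; exact hQ e

/-- The Neumann series solves `κ + Q # κ = b` for a matrix `Q` of norm less than one. -/
lemma exists_add_act_eq [Fintype E] {ρ c : ℝ≥0} (hc : c < 1) {Q : G.TMatrix}
    (hQ : ∀ e, ∑ w, (Q e w).wnorm ρ ≤ c) {b : G.Dart → G.Series} (hb : ∀ e, (b e).wnorm ρ < ⊤) :
    ∃ κ : G.Dart → G.Series, (∀ e, (κ e).wnorm ρ < ⊤) ∧
      ∀ (P : VProj V A) (X : G.Dart → A), ‖X‖ ≤ ρ →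
        P.evF X κ + P.evM X Q (P.evF X κ) = P.evF X b := by
  -- The terms `(-Q #)^m b` of the Neumann series. It is summed as a power series and not as an
  -- operator, so that one `κ` works for every `X` in the ball and can be differentiated.
  let θ : ℕ → G.Dart → G.Series := fun m => Nat.rec b (fun _ f => -(Q.act f)) m
  have hθ : ∀ m, θ (m + 1) = -(Q.act (θ m)) := fun m => rfl
  set B : ℝ≥0∞ := ∑ e, (b e).wnorm ρ
  have hB : B < ⊤ := ENNReal.sum_lt_top.2 fun e _ => hb e
  have hθB : ∀ m e, (θ m e).wnorm ρ ≤ (c : ℝ≥0∞) ^ m * B := by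
    intro m
    induction m with
    | zero =>
      intro e
      rw [pow_zero, one_mul]
      exact Finset.single_le_sum (f := fun e => (b e).wnorm ρ) (fun _ _ => zero_le)
        (Finset.mem_univ e)
    | succ m ih =>
      intro e
      rw [hθ, Pi.neg_apply, Series.wnorm_neg, pow_succ', mul_assoc]
      exact TMatrix.wnorm_act_le hQ ih e
  have hsum : ∀ e, ∑' m, (θ m e).wnorm ρ < ⊤ := by
    intro e
    refine (ENNReal.tsum_le_tsum fun m => hθB m e).trans_lt ?_
    rw [ENNReal.tsum_mul_right, ENNReal.tsum_geometric]
    refine ENNReal.mul_lt_top (ENNReal.inv_lt_top.2 (tsub_pos_of_lt ?_)) hB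
    exact_mod_cast hc
  have hfin : ∀ m e, (θ m e).wnorm ρ < ⊤ := fun m e => ENNReal.lt_top_of_tsum_ne_top (hsum e).ne m
  have hQf : ∀ e w, (Q e w).wnorm ρ < ⊤ := fun e w =>
    (ENNReal.sum_lt_top.1 ((hQ e).trans_lt ENNReal.coe_lt_top)) w (Finset.mem_univ w)
  refine ⟨fun e γ => ∑' m, θ m e γ, fun e => (Series.wnorm_tsum_le ρ _).trans_lt (hsum e), ?_⟩
  intro P X hX
  have hX' : ∀ e, ‖X e‖ ≤ ρ := fun e => (norm_le_pi_norm X e).trans hX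
  set κ : G.Dart → G.Series := fun e γ => ∑' m, θ m e γ
  have h1 : HasSum (fun m => P.evF X (θ m)) (P.evF X κ) :=
    Pi.hasSum.2 fun e => P.hasSum_ev_tsum hX' (hsum e)
  have h2 : HasSum (fun m => P.evF X (θ (m + 1))) (-(P.evM X Q (P.evF X κ))) := by
    have h3 := (h1.mapL (P.evM X Q)).neg
    have h4 : (fun m => P.evF X (θ (m + 1))) = fun m => -P.evM X Q (P.evF X (θ m)) := by
      funext m
      rw [hθ, ← P.evF_act hX hQf (hfin m)]
      funext e
      exact P.ev_neg _
    rw [h4]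
    exact h3
  have h4 := (hasSum_nat_add_iff (f := fun m => P.evF X (θ m)) 1).1 h2
  have h5 := h1.unique h4
  rw [Finset.range_one, Finset.sum_singleton] at h5
  nth_rewrite 1 [h5]
  change -(P.evM X Q (P.evF X κ)) + P.evF X b + P.evM X Q (P.evF X κ) = P.evF X b
  abel

end

/-! ### Neumann series, powers of the Jacobian and the shifted family -/

section

variable {V E : Type*} [Fintype V] {G : WeightedGraph V E}

lemma grad_support {a : G.Series} {e : G.Dart} {γ : G.Path} (h : grad a e γ ≠ 0) :
    γ.start = e.src ∧ γ.finish = e.tgt := by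
  have h0 : ∑ i ∈ Finset.range (γ.length + 1),
      Series.diff e.op a (γ.drop i) (γ.take i) ≠ 0 := h
  obtain ⟨i, -, hi⟩ := Finset.exists_ne_zero_of_sum_ne_zero h0
  by_contra hh
  refine hi (Series.diff_of_not fun h' => hh ?_)
  rw [Path.drop_finish, Path.take_start] at h'
  exact h'.symm

/-- The family `z + 𝒟 g`. -/
def shift (g : G.Series) : G.Dart → G.Series := fun e => Series.var e + grad g e

/-- A trace of a Neumann series. -/
lemma trace_neumann {B : Type*} [NormedRing B] [NormedAlgebra ℂ B] [CompleteSpace B] (T : B →L[ℂ] ℂ)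
    (M : Subalgebra ℂ B) (hM : IsClosed (M : Set B)) (hT : ∀ a ∈ M, ∀ b ∈ M, T (a * b) = T (b * a))
    {J t b d : B} (hJ : ‖J‖ < 1) (hJM : J ∈ M) (hd : d ∈ M)
    (h : t * (1 + J) = b + (1 + J) * d) :
    HasSum (fun m : ℕ => (-1 : ℂ) ^ m * T (b * J ^ m)) (T t - T d) := by
  have hJ' : ‖-J‖ < 1 := by rwa [norm_neg]
  have hs := (summable_geometric_of_norm_lt_one hJ').hasSum
  set r := ∑' m : ℕ, (-J) ^ m
  have h1 : (1 + J) * r = 1 := by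
    have := mul_neg_geom_series (-J) hJ'
    rwa [sub_neg_eq_add] at this
  have h3 : r * (1 + J) = 1 := by
    have := geom_series_mul_neg (-J) hJ'
    rwa [sub_neg_eq_add] at this
  have hr : r ∈ M := by
    refine hM.mem_of_tendsto hs (Filter.Eventually.of_forall fun s => ?_)
    exact sum_mem fun m _ => pow_mem (neg_mem hJM) m
  -- Multiplying the hypothesis on the right by `r = (1 + J)⁻¹` leaves the conjugate `(1 + J) d r`
  -- of `d`, whose trace is that of `d`.
  have h2 : T t - T d = T (b * r) := by
    have e1 : t = b * r + (1 + J) * (d * r) := by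
      rw [← mul_assoc, ← add_mul, ← h, mul_assoc, h1, mul_one]
    have e2 : T ((1 + J) * (d * r)) = T d := by
      rw [hT _ (add_mem (one_mem M) hJM) _ (mul_mem hd hr), mul_assoc, h3, mul_one]
    rw [e1, map_add, e2, add_sub_cancel_right]
  rw [h2]
  have h4 := (hs.mul_left b).mapL T
  have h5 : (fun m : ℕ => T (b * (-J) ^ m)) = fun m => (-1 : ℂ) ^ m * T (b * J ^ m) := by
    funext m
    rw [← neg_one_smul ℂ J, smul_pow, mul_smul_comm, map_smul, smul_eq_mul]
  rwa [h5] at h4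

variable [Fintype E]
  {A : Type*} [NormedRing A] [NormedAlgebra ℂ A] [CompleteSpace A]

namespace TMatrix

lemma sum_wnorm_mul_le {ρ : ℝ≥0} {Q Q' : G.TMatrix} {c c' : ℝ≥0∞}
    (hQ : ∀ e, ∑ w, (Q e w).wnorm ρ ≤ c) (hQ' : ∀ e, ∑ w, (Q' e w).wnorm ρ ≤ c') (e : G.Dart) :
    ∑ f, (mul Q Q' e f).wnorm ρ ≤ c * c' := by
  calc _ ≤ ∑ f, ∑ w, (Q e w).wnorm ρ * (Q' w f).wnorm ρ := Finset.sum_le_sum fun f _ =>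
        (Tensor.wnorm_sum_le _ _ _).trans
          (Finset.sum_le_sum fun w _ => Tensor.wnorm_mul_le _ _ _)
    _ = ∑ w, (Q e w).wnorm ρ * ∑ f, (Q' w f).wnorm ρ := by
        rw [Finset.sum_comm]
        simp only [Finset.mul_sum]
    _ ≤ ∑ w, (Q e w).wnorm ρ * c' := by gcongr with w; exact hQ' w
    _ ≤ c * c' := by rw [← Finset.sum_mul]; gcongr; exact hQ e

lemma P_eq (e w : G.Dart) [Decidable (e = w)] : (P e w : G.Tensor) = if e = w then
    (fun γ δ => Series.mono (Path.triv e.src) γ * Series.mono (Path.triv e.tgt) δ) else 0 := by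
  funext γ δ
  rw [P]
  split_ifs <;> rfl

lemma sum_wnorm_P_le (ρ : ℝ≥0) (e : G.Dart) : ∑ w, (P e w : G.Tensor).wnorm ρ ≤ 1 := by
  classical
  rw [Finset.sum_eq_single e]
  · rw [P_eq, if_pos rfl, Series.wnorm_tmul, wnorm_monomial, wnorm_monomial]
    simp [Path.length, Path.triv]
  · intro w _ hw
    rw [P_eq, if_neg (Ne.symm hw)]
    simp [Tensor.wnorm]
  · simp

lemma sum_wnorm_pow_le {ρ : ℝ≥0} {Q : G.TMatrix} {c : ℝ≥0∞} (hQ : ∀ e, ∑ w, (Q e w).wnorm ρ ≤ c)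
    (m : ℕ) (e : G.Dart) : ∑ w, (pow Q m e w).wnorm ρ ≤ c ^ m := by
  induction m generalizing e with
  | zero => rw [pow_zero]; exact sum_wnorm_P_le ρ e
  | succ m ih => rw [pow_succ]; exact sum_wnorm_mul_le ih hQ e

lemma wnorm_lt_top_of_sum {ρ : ℝ≥0} {Q : G.TMatrix} {c : ℝ≥0∞} (hc : c < ⊤)
    (hQ : ∀ e, ∑ w, (Q e w).wnorm ρ ≤ c) (e w : G.Dart) : (Q e w).wnorm ρ < ⊤ :=
  (ENNReal.sum_lt_top.1 ((hQ e).trans_lt hc)) w (Finset.mem_univ w)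

end TMatrix

namespace VProj

variable (P : VProj V A)

lemma evT_tmul_mono (X : G.Dart → A) (γ δ : G.Path) :
    P.evT X (fun γ' δ' => Series.mono γ γ' * Series.mono δ δ') = mulLR (P.word γ X) (P.word δ X) := by
  classical
  rw [evT, tsum_eq_single (γ, δ)]
  · ext1 T
    simp [Series.mono]
  · rintro ⟨γ', δ'⟩ h
    have h' : Series.mono γ γ' * Series.mono δ δ' = 0 := by
      by_contra hh
      refine h (Prod.ext ?_ ?_)
      · by_contra h1; exact hh (by simp [Series.mono, h1])
      · by_contra h1; exact hh (by simp [Series.mono, h1])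
    ext1 T
    rw [smul_apply, h', zero_smul]
    rfl

lemma evM_P_apply (X K : G.Dart → A) (e : G.Dart) :
    P.evM X TMatrix.P K e = P.p e.src * K e * P.p e.tgt := by
  classical
  rw [evM_apply, Finset.sum_eq_single e]
  · rw [TMatrix.P_eq, if_pos rfl, evT_tmul_mono, mulLR_apply, word_triv, word_triv]
  · intro w _ hw
    rw [TMatrix.P_eq, if_neg (Ne.symm hw), evT_zero]
    rfl
  · simp

lemma evM_M (X : G.Dart → A) (K : G.Dart → A) (e : G.Dart) :
    P.evM X TMatrix.M K e = (e.wt : ℂ) • (P.p e.src * K e * P.p e.tgt) := by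
  rw [← P.evM_P_apply X, evM_apply, evM_apply, Finset.smul_sum]
  refine Finset.sum_congr rfl fun w _ => ?_
  rw [TMatrix.M, P.evT_smul]
  rfl

lemma evT_cut {X : G.Dart → A} {ρ : ℝ≥0} (hX : ‖X‖ ≤ ρ) {u : G.Tensor} (hu : u.wnorm ρ < ⊤)
    {v w : V} (h : ∀ γ δ, u γ δ ≠ 0 → γ.start = v ∧ δ.finish = w) (T : A) :
    P.p v * P.evT X u T * P.p w = P.evT X u T := by
  have h1 := P.hasSum_evT_apply (fun e => (norm_le_pi_norm X e).trans hX) hu T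
  refine ((h1.mul_left (P.p v)).mul_right (P.p w)).unique ?_
  have h5 : (fun q : G.Path × G.Path => P.p v * u q.1 q.2 • (P.word q.1 X * T * P.word q.2 X)
      * P.p w) = fun q => u q.1 q.2 • (P.word q.1 X * T * P.word q.2 X) := by
    funext q
    by_cases h0 : u q.1 q.2 = 0
    · simp [h0]
    · obtain ⟨h2, h3⟩ := h _ _ h0
      have e1 := P.projOp_mul_word q.1 X
      have e2 := P.word_mul_projOp q.2 X
      rw [h2] at e1
      rw [h3] at e2
      rw [mul_smul_comm, smul_mul_assoc]
      congr 1
      nth_rewrite 2 [← e1, ← e2]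
      simp only [mul_assoc]
  rw [h5]
  exact h1

lemma jac_grad_support {g : G.Series} {e w : G.Dart} {γ δ : G.Path}
    (h : jac (grad g) e w γ δ ≠ 0) : γ.start = e.src ∧ δ.finish = e.tgt := by
  have h0 : γ.finish = w.src ∧ δ.start = w.tgt := by
    by_contra hh
    exact h (Series.diff_of_not hh)
  have h1 : grad g e (γ.join w δ h0) ≠ 0 := by
    have : jac (grad g) e w γ δ = grad g e (γ.join w δ h0) := dif_pos h0
    rwa [this] at h
  have h2 := grad_support h1
  rwa [Path.join_start, Path.join_finish] at h2

/-- The exponent starts at one because the zeroth formal power is `P`, which evaluates to a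
compression and not to the identity. The compression acts trivially on the Jacobian, whose rows
already lie in the right corners. -/
lemma evM_pow_jac {X : G.Dart → A} {ρ c : ℝ≥0} (hX : ‖X‖ ≤ ρ) {g : G.Series}
    (hJ : ∀ e, ∑ w, (jac (grad g) e w).wnorm ρ ≤ c) (m : ℕ) :
    P.evM X (TMatrix.pow (jac (grad g)) (m + 1)) = P.evM X (jac (grad g)) ^ (m + 1) := by
  have h0 := TMatrix.wnorm_lt_top_of_sum ENNReal.coe_lt_top hJ
  have h1 : ∀ m e w, (TMatrix.pow (jac (grad g)) m e w).wnorm ρ < ⊤ := fun m =>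
    TMatrix.wnorm_lt_top_of_sum (ENNReal.pow_lt_top ENNReal.coe_lt_top)
      (TMatrix.sum_wnorm_pow_le hJ m)
  induction m with
  | zero =>
    rw [TMatrix.pow, P.evM_mul hX (h1 0) h0, zero_add, pow_one]
    ext1 K
    funext e
    rw [mul_apply_eq_comp, TMatrix.pow, P.evM_P_apply, evM_apply, Finset.mul_sum, Finset.sum_mul]
    exact Finset.sum_congr rfl fun w _ => P.evT_cut hX (h0 e w) (fun _ _ => jac_grad_support) _
  | succ m ih => rw [TMatrix.pow, P.evM_mul hX (h1 (m + 1)) h0, ih, pow_succ _ (m + 1)]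

lemma word_cutOps (γ : G.Path) (X : G.Dart → A) : P.word γ (P.cutOps X) = P.word γ X := by
  rw [word, word, P.cutOps_cutOps]

lemma ev_cutOps (X : G.Dart → A) (a : G.Series) : P.ev (P.cutOps X) a = P.ev X a := by
  simp only [ev, P.word_cutOps]

lemma ev_var (X : G.Dart → A) (e : G.Dart) : P.ev X (Series.var e) = P.cutOps X e := by
  rw [Series.var, P.ev_mono, word_eq]
  simp only [Path.single, List.map_cons, List.map_nil, List.prod_cons, List.prod_nil, mul_one]
  exact P.cutOps_mul_projOp X e

lemma wnorm_var (ρ : ℝ≥0) (e : G.Dart) : (Series.var e).wnorm ρ < ⊤ := by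
  rw [Series.var, wnorm_monomial]
  exact ENNReal.pow_lt_top ENNReal.coe_lt_top

lemma cutOps_add_evF {X : G.Dart → A} {ρ : ℝ≥0} (hX : ‖X‖ ≤ ρ) {g : G.Series}
    (hg : ∀ e, (grad g e).wnorm ρ < ⊤) :
    P.cutOps (X + P.evF X (grad g)) = P.evF X (shift g) := by
  funext e
  have h1 : P.cutOps (P.evF X (grad g)) e = P.ev X (grad g e) :=
    P.cut_ev_of_support fun γ => grad_support
  rw [P.cutOps_add, Pi.add_apply, h1, evF, shift, P.ev_add (fun e => (norm_le_pi_norm X e).trans hX)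
    (wnorm_var ρ e) (hg e), P.ev_var]

/-- A value at the shifted operators is a value at the original ones of a composed series. Words see
only the cut-down family, so this holds even when `X` itself is not cut down, as is needed in a full
neighbourhood. -/
lemma ev_add_evF {X : G.Dart → A} {ρ s : ℝ≥0} (hX : ‖X‖ ≤ ρ) {g : G.Series}
    (hg : ∀ e, (grad g e).wnorm ρ < ⊤) (hY : ∀ e, (shift g e).wnorm ρ ≤ s) {q : G.Series}
    (hq : q.wnorm s < ⊤) :
    P.ev (X + P.evF X (grad g)) q = P.ev X (q.subst (shift g)) := by
  have h1 : P.cutOps (P.evF X (shift g)) = P.evF X (shift g) := by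
    rw [← P.cutOps_add_evF hX hg, P.cutOps_cutOps]
  rw [P.ev_subst (fun e => (norm_le_pi_norm X e).trans hX) hY h1 hq, ← P.ev_cutOps,
    P.cutOps_add_evF hX hg]
  rfl

end VProj

end

/-! ### Variation of the traces of powers of the Jacobian -/

section

variable {V E : Type*} [Fintype V] {G : WeightedGraph V E} [Fintype E]
  {A : Type*} [NormedRing A] [NormedAlgebra ℂ A] [CompleteSpace A]

namespace TraceData

variable {P : VProj V A} {D : TraceData P}

variable (D) in
/-- The operators on families with entries in the closed algebra of two-sided multiplications. -/
def inAlgSub : Subalgebra ℂ ((G.Dart → A) →L[ℂ] (G.Dart → A)) where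
  carrier := {Θ | D.InAlg Θ}
  mul_mem' := InAlg.mul
  add_mem' := InAlg.add
  algebraMap_mem' := fun r => by
    rw [Algebra.algebraMap_eq_smul_one]
    exact InAlg.smul r InAlg.one

/-- The formal analogue of `Tensor.idTrace + Tensor.traceId` for the powers of the Jacobian. -/
def trTerm (D : TraceData P) (x : G.Dart → A) (g : G.Series) (m : ℕ) : G.Series :=
  D.idT x (TMatrix.tr (TMatrix.pow (jac (grad g)) m)) +
    D.Tid x (TMatrix.tr (TMatrix.pow (jac (grad g)) m))

lemma wnorm_tr_pow_le {ρ : ℝ≥0} {Q : G.TMatrix} {c : ℝ≥0∞} (hQ : ∀ e, ∑ w, (Q e w).wnorm ρ ≤ c)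
    (m : ℕ) : (TMatrix.tr (TMatrix.pow Q m)).wnorm ρ ≤ Fintype.card G.Dart * c ^ m := by
  refine (Tensor.wnorm_sum_le _ _ _).trans ?_
  calc _ ≤ ∑ _e : G.Dart, c ^ m := Finset.sum_le_sum fun e _ =>
        (Finset.single_le_sum (f := fun w => (TMatrix.pow Q m e w).wnorm ρ) (fun _ _ => zero_le)
          (Finset.mem_univ e)).trans (TMatrix.sum_wnorm_pow_le hQ m e)
    _ = _ := by simp

lemma wnorm_trTerm_le {x : G.Dart → A} {ρ : ℝ≥0} (hx : ‖x‖ ≤ ρ) {g : G.Series} {c : ℝ≥0∞}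
    (hJ : ∀ e, ∑ w, (jac (grad g) e w).wnorm ρ ≤ c) (m : ℕ) :
    (D.trTerm x g m).wnorm ρ ≤ 2 * ‖D.τ‖ₑ * Fintype.card G.Dart * c ^ m := by
  refine (Series.wnorm_add_le _ _ _).trans ?_
  calc _ ≤ ‖D.τ‖ₑ * (Fintype.card G.Dart * c ^ m) + ‖D.τ‖ₑ * (Fintype.card G.Dart * c ^ m) :=
        add_le_add ((wnorm_idT_le hx _).trans (by gcongr; exact wnorm_tr_pow_le hJ m))
          ((wnorm_Tid_le hx _).trans (by gcongr; exact wnorm_tr_pow_le hJ m))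
    _ = _ := by ring

lemma TT_evM {X : G.Dart → A} {ρ : ℝ≥0} (hX : ‖X‖ ≤ ρ) {Q : G.TMatrix}
    (hQ : ∀ e w, (Q e w).wnorm ρ < ⊤) : D.TT (P.evM X Q) = D.tr2 (P.evT X (TMatrix.tr Q)) := by
  rw [TT_apply, TMatrix.tr, P.evT_sum (fun e => (norm_le_pi_norm X e).trans hX) _
    (fun e _ => hQ e e), map_sum]
  simp only [VProj.entry_evM]

section Jacobian

variable {x K : G.Dart → A} {g : G.Series} {ρ c : ℝ≥0}

lemma hasDerivAt_evM (hx : ‖x‖ < ρ) (hJ : ∀ e, ∑ w, (jac (grad g) e w).wnorm ρ ≤ c)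
    (K : G.Dart → A) : HasDerivAt (fun t : ℂ => P.evM (x + t • K) (jac (grad g)))
      (fderiv ℂ (fun X => P.evM X (jac (grad g))) x K) 0 := by
  have h := (P.differentiableAt_evM hx
    (TMatrix.wnorm_lt_top_of_sum ENNReal.coe_lt_top hJ)).hasFDerivAt
  have h0 : x = x + (0 : ℂ) • K := by simp
  have hl := VProj.hasDerivAt_line x K
  rw [h0] at h
  have h2 := HasFDerivAt.comp_hasDerivAt (𝕜 := ℂ) (F := G.Dart → A)
    (E := (G.Dart → A) →L[ℂ] (G.Dart → A)) (0 : ℂ) h hl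
  rw [← h0] at h2
  exact h2

lemma eventually_norm_line (hx : ‖x‖ < ρ) (K : G.Dart → A) :
    ∀ᶠ t : ℂ in nhds 0, ‖x + t • K‖ < ρ := by
  have h := (VProj.hasDerivAt_line x K).continuousAt.norm
  rw [ContinuousAt, zero_smul, add_zero] at h
  exact h.eventually_lt_const hx

/-- The derivative of the trace of the `(m + 1)`st power is computed twice: from traciality, with
the factor `m + 1`, and from the double series of that power through `hasDerivAt_tr2_evT`. -/
lemma TT_deriv_jac (hx : ‖x‖ < ρ) (hxN : ∀ e, x e ∈ D.N) (hKN : ∀ e, K e ∈ D.N)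
    (hJ : ∀ e, ∑ w, (jac (grad g) e w).wnorm ρ ≤ c) (m : ℕ) :
    (m + 1 : ℂ) * D.TT (fderiv ℂ (fun X => P.evM X (jac (grad g))) x K
      * P.evM x (jac (grad g)) ^ m) = D.psi x K (D.trTerm x g (m + 1)) := by
  have hN : ∀ (t : ℂ) (e), (x + t • K) e ∈ D.N := fun t e =>
    add_mem (hxN e) (D.N.smul_mem (hKN e) t)
  have hj := hasDerivAt_evM (P := P) hx hJ K
  have hj' := inAlg_deriv hj fun t => evM_inAlg (D := D) (hN t) _
  have h0 : D.InAlg (P.evM (x + (0 : ℂ) • K) (jac (grad g))) := evM_inAlg (hN 0) _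
  have h1 := TT_deriv_mul_pow hj h0 hj' m
  rw [zero_smul, add_zero] at h1
  have hpow : ∀ e w, (TMatrix.pow (jac (grad g)) (m + 1) e w).wnorm ρ < ⊤ :=
    TMatrix.wnorm_lt_top_of_sum (ENNReal.pow_lt_top ENNReal.coe_lt_top)
      (TMatrix.sum_wnorm_pow_le hJ (m + 1))
  have hu : (TMatrix.tr (TMatrix.pow (jac (grad g)) (m + 1))).wnorm ρ < ⊤ :=
    (wnorm_tr_pow_le hJ _).trans_lt (ENNReal.mul_lt_top (ENNReal.natCast_lt_top _)
      (ENNReal.pow_lt_top ENNReal.coe_lt_top))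
  refine h1.unique ((hasDerivAt_tr2_evT (D := D) hx hu K).congr_of_eventuallyEq ?_)
  filter_upwards [eventually_norm_line hx K] with t ht
  rw [← P.evM_pow_jac ht.le hJ, TT_evM ht.le hpow]

end Jacobian

/-- The Schwinger-Dyson equation for `x` with the quadratic potential, on monomials. -/
def QuadSD (D : TraceData P) (x : G.Dart → A) : Prop :=
  ∀ (e : G.Dart) (γ : G.Path), (e.wt : ℂ) * D.τ (x e.op * P.word γ x) =
    D.tr2 (P.evT x (Series.diff e (Series.mono γ)))

/-- Linearity and absolute convergence extend the equation from monomials to series. The smaller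
radius pays for the free difference quotient; the extension is needed because `κ` is a power series.
-/
lemma QuadSD.ev {x : G.Dart → A} (h : D.QuadSD x) {ρ σ : ℝ≥0} (hσ : σ < ρ) (hx : ‖x‖ ≤ σ)
    {a : G.Series} (ha : a.wnorm ρ < ⊤) (e : G.Dart) :
    (e.wt : ℂ) * D.τ (x e.op * P.ev x a) = D.tr2 (P.evT x (Series.diff e a)) := by
  have hx' : ∀ e, ‖x e‖ ≤ σ := fun e => (norm_le_pi_norm x e).trans hx
  have ha' : a.wnorm σ < ⊤ := (Series.wnorm_mono hσ.le a).trans_lt ha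
  have h1 := (((P.hasSum_ev hx' ha').mul_left (x e.op)).mapL D.τ).mul_left (e.wt : ℂ)
  have h2 : ∑' γ : G.Path, (a γ • Series.mono γ : G.Series).wnorm ρ < ⊤ := by
    simp only [Series.wnorm_smul, wnorm_monomial]
    exact ha
  have h3 : ∑' γ : G.Path, (Series.diff e (a γ • Series.mono γ : G.Series)).wnorm σ < ⊤ := by
    refine (ENNReal.tsum_le_tsum fun γ => Series.wnorm_diff_le hσ e _).trans_lt ?_
    rw [ENNReal.tsum_mul_left]
    exact ENNReal.mul_lt_top ENNReal.coe_lt_top h2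
  have h4 := (P.hasSum_evT_tsum hx' h3).mapL D.tr2
  have h5 : (fun γ δ => ∑' i : G.Path, Series.diff e (a i • Series.mono i) γ δ)
      = Series.diff e a := by
    rw [← Series.diff_tsum]
    congr 1
    funext γ
    rw [tsum_eq_single γ]
    · simp [Series.mono]
    · intro δ hδ
      simp [Series.mono, hδ.symm]
  rw [h5] at h4
  refine h1.unique ?_
  have h6 : (fun γ : G.Path => (e.wt : ℂ) * D.τ (x e.op * a γ • P.word γ x)) =
      fun γ => D.tr2 (P.evT x (Series.diff e (a γ • Series.mono γ))) := by
    funext γ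
    rw [Series.diff_smul, P.evT_smul, mul_smul_comm, map_smul]
    have e1 : D.tr2 (a γ • P.evT x (Series.diff e (Series.mono γ)))
        = a γ • D.tr2 (P.evT x (Series.diff e (Series.mono γ))) := map_smul D.tr2 _ _
    rw [e1, ← h e γ, smul_eq_mul, smul_eq_mul]
    ring
  rw [h6]
  exact h4

end TraceData

end

/-! ### The defect of the Schwinger-Dyson equation under the change of variables -/

section

variable {V E : Type*} [Fintype V] {G : WeightedGraph V E} [Fintype E]
  {A : Type*} [NormedRing A] [NormedAlgebra ℂ A] [CompleteSpace A]

lemma wnorm_dot_lt_top {ρ : ℝ≥0} {f h : G.Dart → G.Series} (hf : ∀ e, (f e).wnorm ρ < ⊤)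
    (hh : ∀ e, (h e).wnorm ρ < ⊤) : (dot f h).wnorm ρ < ⊤ :=
  (Series.wnorm_sum_le _ _ _).trans_lt (ENNReal.sum_lt_top.2 fun e _ =>
    (Series.wnorm_mul_le _ _ _).trans_lt (ENNReal.mul_lt_top (hf e) (hh e.op)))

lemma sum_wnorm_M_le (ρ : ℝ≥0) (e : G.Dart) : ∑ w, (TMatrix.M e w : G.Tensor).wnorm ρ ≤ 1 := by
  refine le_trans (Finset.sum_le_sum fun w _ => ?_) (TMatrix.sum_wnorm_P_le ρ e)
  refine ENNReal.tsum_le_tsum fun p => ?_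
  rw [TMatrix.M, Pi.smul_apply, Pi.smul_apply, smul_eq_mul, enorm_mul]
  gcongr
  have h1 : ‖(e.wt : ℂ)‖ₑ ≤ 1 := by
    rw [← ofReal_norm, Complex.norm_real, Real.norm_eq_abs, Dart.wt,
      abs_of_nonneg (Real.sqrt_nonneg _)]
    refine ENNReal.ofReal_le_one.2 (Real.sqrt_le_one.2 ?_)
    exact mul_le_one₀ (wt_le_one _) (G.wt_pos _).le (wt_le_one _)
  calc _ ≤ 1 * ‖(TMatrix.P e w : G.Tensor) p.1 p.2‖ₑ := by gcongr
    _ = _ := one_mul _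

lemma VProj.ev_dot_M {P : VProj V A} {X : G.Dart → A} {ρ : ℝ≥0} (hX : ‖X‖ ≤ ρ) {g : G.Series}
    (hf : ∀ e, (grad g e).wnorm ρ < ⊤) :
    P.ev X (dot (grad g) (TMatrix.act TMatrix.M (grad g)))
      = ∑ e : G.Dart, (e.wt : ℂ) • (P.ev X (grad g e) * P.ev X (grad g e.op)) := by
  have hX' : ∀ e, ‖X e‖ ≤ ρ := fun e => (norm_le_pi_norm X e).trans hX
  have hM := TMatrix.wnorm_lt_top_of_sum (by simp) (sum_wnorm_M_le (G := G) ρ)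
  have hMf : ∀ e, (TMatrix.act TMatrix.M (grad g) e).wnorm ρ < ⊤ := fun e =>
    (Series.wnorm_sum_le _ _ _).trans_lt (ENNReal.sum_lt_top.2 fun w _ =>
      (Tensor.wnorm_act_le _ _ _).trans_lt (ENNReal.mul_lt_top (hM e w) (hf w)))
  rw [dot, P.ev_sum hX' _ fun e _ => (Series.wnorm_mul_le _ _ _).trans_lt
    (ENNReal.mul_lt_top (hf e) (hMf e.op))]
  refine Finset.sum_congr rfl fun e _ => ?_
  have h1 : P.ev X (TMatrix.act TMatrix.M (grad g) e.op) = (e.wt : ℂ) • P.ev X (grad g e.op) := by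
    have h2 := congrFun (P.evF_act hX hM hf) e.op
    rw [P.evM_M] at h2
    refine h2.trans ?_
    rw [Dart.op_wt]
    congr 1
    exact P.cut_ev_of_support fun γ => grad_support
  rw [P.ev_mul hX' (hf e) (hMf e.op), h1, mul_smul_comm]

namespace TraceData

variable {P : VProj V A} {D : TraceData P} {x : G.Dart → A} {g : G.Series} {ρ ρ' c s s' : ℝ≥0}

lemma norm_shift_le (hx : ‖x‖ ≤ ρ) (hxc : P.cutOps x = x) (hf : ∀ e, (grad g e).wnorm ρ < ⊤)
    (hY : ∀ e, (shift g e).wnorm ρ ≤ s) : ‖x + P.evF x (grad g)‖ ≤ s := by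
  have h1 := P.cutOps_add_evF hx hf
  have h2 : P.cutOps (x + P.evF x (grad g)) = x + P.evF x (grad g) := by
    rw [P.cutOps_add, hxc]
    congr 1
    funext e
    exact P.cut_ev_of_support fun γ => grad_support
  rw [← h2, h1]
  refine (pi_norm_le_iff_of_nonneg s.2).2 fun e => ?_
  have h3 := P.norm_ev_le (fun e => (norm_le_pi_norm x e).trans hx)
    ((hY e).trans_lt ENNReal.coe_lt_top)
  exact h3.trans (ENNReal.toReal_mono ENNReal.coe_ne_top (hY e))

lemma hasFDerivAt_shift (hx : ‖x‖ < ρ) (hf : ∀ e, (grad g e).wnorm ρ < ⊤) :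
    HasFDerivAt (fun X => X + P.evF X (grad g)) (1 + P.evM x (jac (grad g))) x :=
  (hasFDerivAt_id x).add (P.hasFDerivAt_evF hx hf)

/-- This is the core of the argument: the derivative of the equation for `κ` compares the divergence
of `q` at `y` with that of `κ` at `x`. The difference is the variation of the logarithm of the
Jacobian, and the divergence of `κ` is known from the Schwinger-Dyson equation of `x`. -/
lemma hasSum_TT_deriv (hx : ‖x‖ < ρ) (hxN : ∀ e, x e ∈ D.N) (hxc : P.cutOps x = x)
    (hQ : D.QuadSD x) (hf : ∀ e, (grad g e).wnorm ρ < ⊤)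
    (hJ : ∀ e, ∑ w, (jac (grad g) e w).wnorm ρ ≤ c) (hc : c < 1)
    (hY : ∀ e, (shift g e).wnorm ρ ≤ s) (hs : s < s') {q κ : G.Dart → G.Series}
    (hq : ∀ e, (q e).wnorm s' < ⊤) (hκ : ∀ e, (κ e).wnorm ρ < ⊤)
    (hκ' : ∀ X, ‖X‖ ≤ ρ → P.evF X κ + P.evM X (jac (grad g)) (P.evF X κ)
      = P.evF X (fun e => (q e).subst (shift g))) :
    HasSum (fun m : ℕ => (-1 : ℂ) ^ m * D.TT (fderiv ℂ (fun X => P.evM X (jac (grad g))) x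
        (P.evF x κ) * P.evM x (jac (grad g)) ^ m))
      (∑ e, D.tr2 (P.evT (x + P.evF x (grad g)) (Series.diff e (q e)))
        - ∑ e : G.Dart, (e.wt : ℂ) * D.τ (x e.op * P.ev x (κ e))) := by
  obtain ⟨σ, hσ, hσρ⟩ : ∃ σ : ℝ≥0, ‖x‖₊ < σ ∧ σ < ρ := exists_between (a₁ := ‖x‖₊) hx
  have hσ' : ‖x‖ < σ := hσ
  obtain ⟨s₁, hs₁, hs₁'⟩ := exists_between hs
  have hJf := TMatrix.wnorm_lt_top_of_sum ENNReal.coe_lt_top hJ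
  have hfN : ∀ e, P.evF x (grad g) e ∈ D.N := fun e => P.ev_mem D.isClosed D.proj_mem hxN _
  have hκN : ∀ e, P.evF x κ e ∈ D.N := fun e => P.ev_mem D.isClosed D.proj_mem hxN _
  have hyN : ∀ e, (x + P.evF x (grad g)) e ∈ D.N := fun e => add_mem (hxN e) (hfN e)
  set y := x + P.evF x (grad g) with hy
  have hys : ‖y‖ ≤ s := norm_shift_le hx.le hxc hf hY
  have hys' : ‖y‖ < s' := lt_of_le_of_lt hys hs
  have hys₁ : ‖y‖ < s₁ := lt_of_le_of_lt hys hs₁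
  have hqs : ∀ e, (q e).wnorm s < ⊤ := fun e => (Series.wnorm_mono hs.le _).trans_lt (hq e)
  set J := P.evM x (jac (grad g)) with hJdef
  set A' := fderiv ℂ (fun X => P.evM X (jac (grad g))) x (P.evF x κ) with hA'
  have d1 : HasFDerivAt (fun X => P.evF (X + P.evF X (grad g)) q)
      ((P.evM y (jac q)).comp (1 + J)) x :=
    HasFDerivAt.comp (g := fun Z => P.evF Z q) x (P.hasFDerivAt_evF hys' hq)
      (hasFDerivAt_shift hx hf)
  have hM := (P.differentiableAt_evM hx hJf).hasFDerivAt
  have d2 : HasFDerivAt (fun X => P.evF X κ + P.evM X (jac (grad g)) (P.evF X κ))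
      (P.evM x (jac κ) + (J.comp (P.evM x (jac κ)) +
        (fderiv ℂ (fun X => P.evM X (jac (grad g))) x).flip (P.evF x κ))) x :=
    (P.hasFDerivAt_evF hx hκ).add (hM.clm_apply (P.hasFDerivAt_evF hx hκ))
  -- The equation for `κ` is needed in a neighbourhood of `x`, not only at `x`, since it is
  -- differentiated next.
  have hev : (fun X => P.evF (X + P.evF X (grad g)) q) =ᶠ[nhds x]
      fun X => P.evF X κ + P.evM X (jac (grad g)) (P.evF X κ) := by
    have hU : ∀ᶠ X in nhds x, ‖X‖ < ρ := (continuous_norm.tendsto x).eventually_lt_const hx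
    filter_upwards [hU] with X hX
    rw [hκ' X hX.le]
    funext e
    exact P.ev_add_evF hX.le hf hY (hqs e)
  have d3 := d1.unique (d2.congr_of_eventuallyEq hev)
  -- Comparison of the derivatives of the two sides. Symmetry of the second derivative rewrites the
  -- term in which the Jacobian is differentiated along `H` as `A' H`.
  have key : P.evM y (jac q) * (1 + J) = A' + (1 + J) * P.evM x (jac κ) := by
    refine d3.trans ?_
    ext1 H
    have hsym := P.fderiv_evM_symm hx hf H (P.evF x κ)
    rw [add_apply, add_apply, add_apply, ContinuousLinearMap.flip_apply, hsym, mul_apply_eq_comp,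
      add_apply]
    change _ + (_ + A' H) = A' H + (_ + _)
    rw [ContinuousLinearMap.comp_apply, ← add_assoc, add_comm]
    rfl
  have hA'N : D.InAlg A' := inAlg_deriv (hasDerivAt_evM hx hJ (P.evF x κ)) fun t =>
    evM_inAlg (fun e => add_mem (hxN e) (D.N.smul_mem (hκN e) t)) _
  have hJN : D.InAlg J := evM_inAlg hxN _
  have hJ1 : ‖J‖ < 1 := (P.norm_evM_le hx.le hJ).trans_lt (by exact_mod_cast hc)
  have main := trace_neumann (B := (G.Dart → A) →L[ℂ] (G.Dart → A)) D.TT D.inAlgSub isClosed_inAlg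
    (fun a ha b hb => TT_comm ha hb) hJ1 hJN (d := P.evM x (jac κ)) (evM_inAlg hxN _) key
  have t1 : D.TT (P.evM y (jac q)) = ∑ e, D.tr2 (P.evT y (Series.diff e (q e))) := by
    rw [TT_apply]
    simp only [VProj.entry_evM]
    rfl
  have t2 : D.TT (P.evM x (jac κ)) = ∑ e : G.Dart, (e.wt : ℂ) * D.τ (x e.op * P.ev x (κ e)) := by
    rw [TT_apply]
    refine Finset.sum_congr rfl fun e _ => ?_
    rw [VProj.entry_evM, hQ.ev hσρ hσ'.le (hκ e) e]
    rfl
  rw [t1, t2] at main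
  exact main

lemma tsum_wnorm_trTerm_lt_top (hx : ‖x‖ ≤ ρ)
    (hJ : ∀ e, ∑ w, (jac (grad g) e w).wnorm ρ ≤ c) (hc : c < 1) :
    ∑' m : ℕ, (((-1 : ℂ) ^ (m + 1) / ((m : ℂ) + 1)) • D.trTerm x g (m + 1)).wnorm ρ < ⊤ := by
  have h1 : ∀ m : ℕ, ‖((-1 : ℂ) ^ (m + 1) / ((m : ℂ) + 1))‖ₑ ≤ 1 := by
    intro m
    rw [← ofReal_norm, norm_div, norm_pow, norm_neg, norm_one, one_pow]
    refine ENNReal.ofReal_le_one.2 ?_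
    have h2 : ‖(m : ℂ) + 1‖ = m + 1 := by
      rw [← Nat.cast_add_one, Complex.norm_natCast, Nat.cast_add_one]
    rw [h2, div_le_one (by positivity)]
    linarith [Nat.cast_nonneg (α := ℝ) m]
  calc _ ≤ ∑' m : ℕ, 2 * ‖D.τ‖ₑ * Fintype.card G.Dart * (c : ℝ≥0∞) ^ m := by
        refine ENNReal.tsum_le_tsum fun m => ?_
        rw [Series.wnorm_smul]
        refine (mul_le_mul' (h1 m) (wnorm_trTerm_le hx hJ (m + 1))).trans ?_
        rw [one_mul]
        refine mul_le_mul_right ?_ _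
        rw [pow_succ]
        calc (c : ℝ≥0∞) ^ m * c ≤ (c : ℝ≥0∞) ^ m * 1 := by gcongr; exact_mod_cast hc.le
          _ = _ := mul_one _
    _ < ⊤ := by
        rw [ENNReal.tsum_mul_left, ENNReal.tsum_geometric]
        refine ENNReal.mul_lt_top (ENNReal.mul_lt_top (ENNReal.mul_lt_top (by simp) enorm_lt_top)
          (ENNReal.natCast_lt_top _)) (ENNReal.inv_lt_top.2 (tsub_pos_of_lt ?_))
        exact_mod_cast hc

variable (D) in
/-- The logarithmic series `∑ (-1)^m / m (1 ⊗ τ + τ ⊗ 1) Tr (J^m)`. -/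
def logTerm (x : G.Dart → A) (g : G.Series) : G.Series := fun γ =>
  ∑' m : ℕ, (((-1 : ℂ) ^ (m + 1) / ((m : ℂ) + 1)) • D.trTerm x g (m + 1)) γ

/-- The factor `m + 1` from differentiating a power cancels the denominator of the logarithm, and a
geometric series in the Jacobian remains. -/
lemma hasSum_psi_logTerm (hx : ‖x‖ < ρ) (hxN : ∀ e, x e ∈ D.N) {K : G.Dart → A}
    (hKN : ∀ e, K e ∈ D.N) (hJ : ∀ e, ∑ w, (jac (grad g) e w).wnorm ρ ≤ c) (hc : c < 1) :
    HasSum (fun m : ℕ => (-1 : ℂ) ^ m * D.TT (fderiv ℂ (fun X => P.evM X (jac (grad g))) x K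
        * P.evM x (jac (grad g)) ^ m)) (-D.psi x K (D.logTerm x g)) := by
  obtain ⟨σ, hσ, hσρ⟩ : ∃ σ : ℝ≥0, ‖x‖₊ < σ ∧ σ < ρ := exists_between (a₁ := ‖x‖₊) hx
  have hσ' : ‖x‖ < σ := hσ
  have h1 := (hasSum_psi (D := D) hσρ hσ'.le K (tsum_wnorm_trTerm_lt_top (D := D) hx.le hJ hc)).neg
  have h3 : (fun m : ℕ => -D.psi x K (((-1 : ℂ) ^ (m + 1) / ((m : ℂ) + 1)) •
      D.trTerm x g (m + 1))) = fun m : ℕ => (-1 : ℂ) ^ m * D.TT (fderiv ℂ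
        (fun X => P.evM X (jac (grad g))) x K * P.evM x (jac (grad g)) ^ m) := by
    funext m
    have h2 : (m : ℂ) + 1 ≠ 0 := Nat.cast_add_one_ne_zero m
    rw [psi_smul, ← TT_deriv_jac hx hxN hKN hJ m, pow_succ]
    field_simp
  rw [h3] at h1
  exact h1

lemma evM_apply_mem (hx : ‖x‖ ≤ ρ) (hxN : ∀ e, x e ∈ D.N) {K : G.Dart → A}
    (hKN : ∀ e, K e ∈ D.N) {Q : G.TMatrix} (hQ : ∀ e w, (Q e w).wnorm ρ < ⊤) (e : G.Dart) :
    P.evM x Q K e ∈ D.N := by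
  rw [VProj.evM_apply]
  refine sum_mem fun w _ => ?_
  refine D.isClosed.mem_of_tendsto
    (P.hasSum_evT_apply (fun e => (norm_le_pi_norm x e).trans hx) (hQ e w) (K w))
    (Filter.Eventually.of_forall fun t => sum_mem fun p _ => D.N.smul_mem ?_ _)
  exact mul_mem (mul_mem (P.word_mem D.proj_mem hxN _) (hKN w)) (P.word_mem D.proj_mem hxN _)

/-- Traciality and the symmetry of the weights under reversal make the two terms of the product rule
equal, which cancels the factor one half. -/
lemma hasDerivAt_quadratic {Z : ℂ → G.Dart → A} {H : G.Dart → A} (hZ : HasDerivAt Z H 0)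
    (hZN : ∀ e, Z 0 e ∈ D.N) (hHN : ∀ e, H e ∈ D.N) :
    HasDerivAt (fun t => (1 / 2 : ℂ) * ∑ e : G.Dart, (e.wt : ℂ) * D.τ (Z t e.op * Z t e))
      (∑ e : G.Dart, (e.wt : ℂ) * D.τ (Z 0 e.op * H e)) 0 := by
  have hZe : ∀ e, HasDerivAt (fun t => Z t e) (H e) 0 := fun e => hasDerivAt_pi.1 hZ e
  have h1 : HasDerivAt (fun t => (1 / 2 : ℂ) * ∑ e : G.Dart, (e.wt : ℂ) * D.τ (Z t e.op * Z t e))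
      ((1 / 2 : ℂ) * ∑ e : G.Dart, (e.wt : ℂ) * D.τ (H e.op * Z 0 e + Z 0 e.op * H e)) 0 := by
    refine HasDerivAt.const_mul _ (HasDerivAt.fun_sum fun e _ => HasDerivAt.const_mul _ ?_)
    exact D.τ.hasFDerivAt.comp_hasDerivAt (0 : ℂ) ((hZe e.op).fun_mul (hZe e))
  convert h1 using 1
  have h2 : ∑ e : G.Dart, (e.wt : ℂ) * D.τ (H e.op * Z 0 e)
      = ∑ e : G.Dart, (e.wt : ℂ) * D.τ (Z 0 e.op * H e) := by
    rw [← sum_op]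
    refine Finset.sum_congr rfl fun e _ => ?_
    rw [Dart.op_op, Dart.op_wt, D.comm _ (hHN e) _ (hZN e.op)]
  simp only [map_add, mul_add, Finset.sum_add_distrib, h2]
  ring

lemma hasDerivAt_shift_line (hx : ‖x‖ < ρ) (hf : ∀ e, (grad g e).wnorm ρ < ⊤) (K : G.Dart → A) :
    HasDerivAt (fun t : ℂ => x + t • K + P.evF (x + t • K) (grad g))
      (K + P.evM x (jac (grad g)) K) 0 := by
  have h0 : x = x + (0 : ℂ) • K := by simp
  have h := hasFDerivAt_shift (P := P) hx hf
  have hl := VProj.hasDerivAt_line x K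
  rw [h0] at h
  have h2 := h.comp_hasDerivAt (0 : ℂ) hl
  rw [← h0] at h2
  exact h2

/-- Both sides are the derivative along `x + t K` of half the weighted quadratic form of `Φ(X) = X +
𝒟g(X)`. The left side uses the chain rule. The right side expands first: the square of `X`, the
cross term, which is the trace of the number operator by `τ_ev_number`, and the square of `𝒟g(X)`.
-/
lemma sum_wt_τ_shift (hx : ‖x‖ < ρ) (hρ : ρ < ρ') (hxN : ∀ e, x e ∈ D.N) (hg : g.wnorm ρ' < ⊤)
    (hJf : ∀ e w, (jac (grad g) e w).wnorm ρ < ⊤) {K : G.Dart → A} (hKN : ∀ e, K e ∈ D.N) :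
    ∑ e : G.Dart, (e.wt : ℂ) * D.τ ((x + P.evF x (grad g)) e.op *
        (K + P.evM x (jac (grad g)) K) e)
      = ∑ e : G.Dart, (e.wt : ℂ) * D.τ (x e.op * K e) + D.psi x K (Series.number g)
        + D.psi x K ((1 / 2 : ℂ) • dot (grad g) (TMatrix.act TMatrix.M (grad g))) := by
  have hf : ∀ e, (grad g e).wnorm ρ < ⊤ := fun e =>
    (Series.wnorm_grad_le hρ e g).trans_lt (ENNReal.mul_lt_top ENNReal.coe_lt_top hg)
  have hn : (Series.number g).wnorm ρ < ⊤ := (Series.wnorm_number_le hρ g).trans_lt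
    (ENNReal.mul_lt_top ENNReal.coe_lt_top (ENNReal.mul_lt_top ENNReal.coe_lt_top hg))
  have hM := TMatrix.wnorm_lt_top_of_sum (by simp) (sum_wnorm_M_le (G := G) ρ)
  have hd : ((1 / 2 : ℂ) • dot (grad g) (TMatrix.act TMatrix.M (grad g))).wnorm ρ < ⊤ := by
    rw [Series.wnorm_smul]
    refine ENNReal.mul_lt_top enorm_lt_top (wnorm_dot_lt_top hf fun e => ?_)
    exact (Series.wnorm_sum_le _ _ _).trans_lt (ENNReal.sum_lt_top.2 fun w _ =>
      (Tensor.wnorm_act_le _ _ _).trans_lt (ENNReal.mul_lt_top (hM e w) (hf w)))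
  have hfN : ∀ {X : G.Dart → A}, (∀ e, X e ∈ D.N) → ∀ e, P.evF X (grad g) e ∈ D.N := fun h e =>
    P.ev_mem D.isClosed D.proj_mem h _
  have hHN : ∀ e, (K + P.evM x (jac (grad g)) K) e ∈ D.N := fun e =>
    add_mem (hKN e) (evM_apply_mem hx.le hxN hKN hJf e)
  have h0 : x + (0 : ℂ) • K = x := by simp
  have d1 := hasDerivAt_quadratic (D := D) (hasDerivAt_shift_line (P := P) hx hf K)
    (fun e => by rw [h0]; exact add_mem (hxN e) (hfN hxN e)) hHN
  have d2 := ((hasDerivAt_quadratic (D := D) (VProj.hasDerivAt_line x K)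
    (fun e => by rw [h0]; exact hxN e) hKN).add (hasDerivAt_τ_ev (D := D) hx hn K)).add
      (hasDerivAt_τ_ev (D := D) hx hd K)
  rw [h0] at d1 d2
  refine d1.unique (d2.congr_of_eventuallyEq ?_)
  filter_upwards [eventually_norm_line hx K] with t ht
  have hXN : ∀ e, (x + t • K) e ∈ D.N := fun e => add_mem (hxN e) (D.N.smul_mem (hKN e) t)
  simp only [Pi.add_apply (f := fun t : ℂ => _)]
  generalize x + t • K = X at ht hXN
  have hFN := hfN hXN
  have e1 : ∑ e : G.Dart, (e.wt : ℂ) * D.τ (P.evF X (grad g) e.op * X e)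
      = ∑ e : G.Dart, (e.wt : ℂ) * D.τ (X e.op * P.evF X (grad g) e) := by
    rw [← sum_op]
    refine Finset.sum_congr rfl fun e _ => ?_
    rw [Dart.op_op, Dart.op_wt, D.comm _ (hFN e) _ (hXN e.op)]
  have e2 := τ_ev_number (D := D) hρ ht.le hXN hg
  have e3 : D.τ (P.ev X ((1 / 2 : ℂ) • dot (grad g) (TMatrix.act TMatrix.M (grad g))))
      = (1 / 2 : ℂ) * ∑ e : G.Dart, (e.wt : ℂ) *
        D.τ (P.evF X (grad g) e.op * P.evF X (grad g) e) := by
    rw [P.ev_smul, P.ev_dot_M ht.le hf, map_smul, map_sum, smul_eq_mul]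
    congr 1
    refine Finset.sum_congr rfl fun e _ => ?_
    rw [map_smul, smul_eq_mul, D.comm _ (hFN e.op) _ (hFN e)]
    rfl
  rw [e2, e3]
  simp only [Pi.add_apply, add_mul, mul_add, map_add, Finset.sum_add_distrib, e1]
  change _ = _ + ∑ e : G.Dart, (e.wt : ℂ) * D.τ (X e.op * P.evF X (grad g) e) + _
  ring

/-- The chain rule for `τ(W(Φ(X)))`: the left side differentiates `W` at the shifted point, the
right side the composed series at `x`. -/
lemma sum_τ_grad_shift (hx : ‖x‖ < ρ) (hxN : ∀ e, x e ∈ D.N) (hxc : P.cutOps x = x)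
    (hf : ∀ e, (grad g e).wnorm ρ < ⊤) (hJf : ∀ e w, (jac (grad g) e w).wnorm ρ < ⊤)
    (hY : ∀ e, (shift g e).wnorm ρ ≤ s) (hs : s < s')
    {W : G.Series} (hW : W.wnorm s' < ⊤) {K : G.Dart → A} (hKN : ∀ e, K e ∈ D.N) :
    ∑ e : G.Dart, D.τ (P.ev (x + P.evF x (grad g)) (grad W e.op) *
        (K + P.evM x (jac (grad g)) K) e) = D.psi x K (W.subst (shift g)) := by
  have hWs : W.wnorm s < ⊤ := (Series.wnorm_mono hs.le W).trans_lt hW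
  have hyN : ∀ e, (x + P.evF x (grad g)) e ∈ D.N := fun e =>
    add_mem (hxN e) (P.ev_mem D.isClosed D.proj_mem hxN _)
  have hHN : ∀ e, (K + P.evM x (jac (grad g)) K) e ∈ D.N := fun e =>
    add_mem (hKN e) (evM_apply_mem hx.le hxN hKN hJf e)
  have hys := norm_shift_le hx.le hxc hf hY
  rw [← psi_eq hs hys hyN hHN hW]
  have h0 : x + (0 : ℂ) • K = x := by simp
  have hl := hasDerivAt_shift_line (P := P) hx hf K
  have h1 : HasFDerivAt (fun Z => P.ev Z W) (∑ w, (P.evT (x + P.evF x (grad g))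
      (Series.diff w W)).comp (ContinuousLinearMap.proj (R := ℂ) w))
      (x + (0 : ℂ) • K + P.evF (x + (0 : ℂ) • K) (grad g)) := by
    rw [h0]
    exact P.hasFDerivAt_ev (lt_of_le_of_lt hys hs) hW
  have h2 := D.τ.hasFDerivAt.comp_hasDerivAt (0 : ℂ) (h1.comp_hasDerivAt (0 : ℂ) hl)
  rw [sum_apply] at h2
  have h3 := hasDerivAt_τ_ev (D := D) hx ((wnorm_subst_le hY W).trans_lt hWs) K
  refine HasDerivAt.unique h2 (h3.congr_of_eventuallyEq ?_)
  filter_upwards [eventually_norm_line hx K] with t ht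
  simp only [Function.comp_apply]
  rw [P.ev_add_evF ht.le hf hY hWs]

variable (D) in
/-- The terms of the transport equation converge. -/
lemma wnorm_transport_terms_lt_top (hx : ‖x‖ ≤ ρ) (hρ : ρ < ρ') (hg : g.wnorm ρ' < ⊤)
    (hJ : ∀ e, ∑ w, (jac (grad g) e w).wnorm ρ ≤ c) (hc : c < 1)
    (hY : ∀ e, (shift g e).wnorm ρ ≤ s) (hs : s < s') {W : G.Series} (hW : W.wnorm s' < ⊤) :
    (Series.number g).wnorm ρ < ⊤ ∧
      ((1 / 2 : ℂ) • dot (grad g) (TMatrix.act TMatrix.M (grad g))).wnorm ρ < ⊤ ∧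
      (W.subst (shift g)).wnorm ρ < ⊤ ∧ (D.logTerm x g).wnorm ρ < ⊤ := by
  have hf : ∀ e, (grad g e).wnorm ρ < ⊤ := fun e =>
    (Series.wnorm_grad_le hρ e g).trans_lt (ENNReal.mul_lt_top ENNReal.coe_lt_top hg)
  have hM := TMatrix.wnorm_lt_top_of_sum (by simp) (sum_wnorm_M_le (G := G) ρ)
  refine ⟨(Series.wnorm_number_le hρ g).trans_lt
    (ENNReal.mul_lt_top ENNReal.coe_lt_top (ENNReal.mul_lt_top ENNReal.coe_lt_top hg)), ?_,
    (wnorm_subst_le hY W).trans_lt ((Series.wnorm_mono hs.le _).trans_lt hW),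
    (Series.wnorm_tsum_le ρ _).trans_lt (tsum_wnorm_trTerm_lt_top hx hJ hc)⟩
  rw [Series.wnorm_smul]
  refine ENNReal.mul_lt_top enorm_lt_top (wnorm_dot_lt_top hf fun e => ?_)
  exact (Series.wnorm_sum_le _ _ _).trans_lt (ENNReal.sum_lt_top.2 fun w _ =>
    (Tensor.wnorm_act_le _ _ _).trans_lt (ENNReal.mul_lt_top (hM e w) (hf w)))

/-- The defect in the Schwinger-Dyson equation. -/
lemma schwingerDyson_defect (hx : ‖x‖ < ρ) (hρ : ρ < ρ') (hxN : ∀ e, x e ∈ D.N)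
    (hxc : P.cutOps x = x) (hQ : D.QuadSD x) (hg : g.wnorm ρ' < ⊤)
    (hJ : ∀ e, ∑ w, (jac (grad g) e w).wnorm ρ ≤ c) (hc : c < 1)
    (hY : ∀ e, (shift g e).wnorm ρ ≤ s) (hs : s < s') {W : G.Series} (hW : W.wnorm s' < ⊤)
    {q : G.Dart → G.Series} (hq : ∀ e, (q e).wnorm s' < ⊤) :
    ∃ K : G.Dart → A, (∀ e, K e ∈ D.N) ∧
      K + P.evM x (jac (grad g)) K = P.evF (x + P.evF x (grad g)) q ∧
      ∑ e : G.Dart, D.τ (((e.wt : ℂ) • (x + P.evF x (grad g)) e.op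
          + P.ev (x + P.evF x (grad g)) (grad W e.op)) * P.evF (x + P.evF x (grad g)) q e)
        - ∑ e, D.tr2 (P.evT (x + P.evF x (grad g)) (Series.diff e (q e)))
      = ∑ e : G.Dart, D.τ (P.ev x (grad (Series.number g + (1 / 2 : ℂ) • dot (grad g)
          (TMatrix.act TMatrix.M (grad g)) + W.subst (shift g) + D.logTerm x g) e.op) * K e) := by
  obtain ⟨σ, hσ, hσρ⟩ : ∃ σ : ℝ≥0, ‖x‖₊ < σ ∧ σ < ρ := exists_between (a₁ := ‖x‖₊) hx
  have hσ' : ‖x‖ < σ := hσ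
  have hf : ∀ e, (grad g e).wnorm ρ < ⊤ := fun e =>
    (Series.wnorm_grad_le hρ e g).trans_lt (ENNReal.mul_lt_top ENNReal.coe_lt_top hg)
  obtain ⟨hn, hd, hWY, hL⟩ := wnorm_transport_terms_lt_top D hx.le hρ hg hJ hc hY hs hW
  have hJf := TMatrix.wnorm_lt_top_of_sum ENNReal.coe_lt_top hJ
  have hqs : ∀ e, (q e).wnorm s < ⊤ := fun e => (Series.wnorm_mono hs.le _).trans_lt (hq e)
  obtain ⟨κ, hκ, hκ'⟩ := exists_add_act_eq (A := A) hc hJ (b := fun e => (q e).subst (shift g))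
    fun e => (wnorm_subst_le hY _).trans_lt (hqs e)
  have hKN : ∀ e, P.evF x κ e ∈ D.N := fun e => P.ev_mem D.isClosed D.proj_mem hxN _
  have hH : P.evF x κ + P.evM x (jac (grad g)) (P.evF x κ)
      = P.evF (x + P.evF x (grad g)) q := by
    rw [hκ' P x hx.le]
    funext e
    exact (P.ev_add_evF hx.le hf hY (hqs e)).symm
  refine ⟨P.evF x κ, hKN, hH, ?_⟩
  -- The same series has been summed in two ways, once as the difference of divergences and once as
  -- minus the derivative of the logarithmic term.
  have h1 := (hasSum_TT_deriv hx hxN hxc hQ hf hJ hc hY hs hq hκ (hκ' P)).unique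
    (hasSum_psi_logTerm hx hxN hKN hJ hc)
  have h2 := sum_wt_τ_shift hx hρ hxN hg hJf hKN
  have h3 := sum_τ_grad_shift hx hxN hxc hf hJf hY hs hW hKN
  rw [hH] at h2 h3
  have add_lt : ∀ {a b : G.Series}, a.wnorm ρ < ⊤ → b.wnorm ρ < ⊤ → (a + b).wnorm ρ < ⊤ :=
    fun ha hb => (Series.wnorm_add_le _ _ _).trans_lt (ENNReal.add_lt_top.2 ⟨ha, hb⟩)
  rw [← psi_eq hσρ hσ'.le hxN hKN (add_lt (add_lt (add_lt hn hd) hWY) hL),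
    psi_add hσρ hσ'.le _ (add_lt (add_lt hn hd) hWY) hL, psi_add hσρ hσ'.le _ (add_lt hn hd) hWY,
    psi_add hσρ hσ'.le _ hn hd]
  simp only [add_mul, map_add, smul_mul_assoc, map_smul, smul_eq_mul, Finset.sum_add_distrib]
  rw [h2, h3]
  change _ - _ = -_ at h1
  have h4 : ∑ e : G.Dart, (e.wt : ℂ) * D.τ (x e.op * P.ev x (κ e))
      = ∑ e : G.Dart, (e.wt : ℂ) * D.τ (x e.op * P.evF x κ e) := rfl
  rw [h4] at h1
  linear_combination (-1 : ℂ) * h1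

end TraceData

end

section

variable {V E : Type*} [Fintype V] {G : WeightedGraph V E} [Fintype E]
  {A : Type*} [NormedRing A] [NormedAlgebra ℂ A] [CompleteSpace A]

/-! ### Transposed systems and injectivity -/

/-- The transpose, for the pairing `(ζ, K) ↦ ∑ τ(ζ_ε K_ε)`. -/
def TMatrix.transpose (Q : G.TMatrix) : G.TMatrix := fun e f => (Q f e).flip

/-- The exact difference formula `ev_sub_ev` makes `f` a contraction with constant `c < 1` on the
ball, so `X ↦ X + f(X)` is injective there. -/
lemma VProj.eq_of_add_evF_eq (P : VProj V A) {X Y : G.Dart → A} {ρ σ c : ℝ≥0} (hσ : σ < ρ)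
    (hX : ‖X‖ ≤ σ) (hY : ‖Y‖ ≤ σ) {f : G.Dart → G.Series} (hf : ∀ e, (f e).wnorm ρ < ⊤)
    (hJ : ∀ e, ∑ w, (jac f e w).wnorm σ ≤ c) (hc : c < 1)
    (h : X + P.evF X f = Y + P.evF Y f) : X = Y := by
  have hfin : ∀ e w, (jac f e w).wnorm σ < ⊤ := fun e w =>
    (ENNReal.sum_lt_top.1 ((hJ e).trans_lt ENNReal.coe_lt_top)) w (Finset.mem_univ w)
  have h1 : ‖Y - X‖ ≤ c * ‖Y - X‖ := by
    refine (pi_norm_le_iff_of_nonneg (by positivity)).2 fun e => ?_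
    have h2 := congrFun h e
    simp only [Pi.add_apply, evF] at h2
    have h3 : (Y - X) e = -(P.ev Y (f e) - P.ev X (f e)) := by
      rw [Pi.sub_apply, neg_sub, sub_eq_sub_iff_add_eq_add, ← h2, add_comm]
    rw [h3, norm_neg, P.ev_sub_ev hσ hX hY (hf e)]
    calc _ ≤ ∑ w, ((jac f e w).wnorm σ).toReal * ‖Y - X‖ := by
          refine (norm_sum_le _ _).trans (Finset.sum_le_sum fun w _ => ?_)
          refine (ContinuousLinearMap.le_opNorm _ _).trans ?_
          exact mul_le_mul (P.norm_evB_le hY hX (hfin e w)) (norm_le_pi_norm (Y - X) w)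
            (norm_nonneg _) ENNReal.toReal_nonneg
      _ = (∑ w, (jac f e w).wnorm σ).toReal * ‖Y - X‖ := by
          rw [← Finset.sum_mul, ENNReal.toReal_sum fun w _ => (hfin e w).ne]
      _ ≤ c * ‖Y - X‖ := by
          refine mul_le_mul_of_nonneg_right ?_ (norm_nonneg _)
          exact ENNReal.toReal_mono ENNReal.coe_ne_top (hJ e)
  have hc' : (c : ℝ) < 1 := by exact_mod_cast hc
  have h4 : ‖Y - X‖ = 0 := by nlinarith [norm_nonneg (Y - X)]
  exact (sub_eq_zero.1 (norm_eq_zero.1 h4)).symm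

namespace TraceData

variable {P : VProj V A} {D : TraceData P}

/-- Cyclicity moves `X_δ` from the right of `T` to the left of `S`, which exchanges the legs of the
double series. -/
lemma τ_mul_evT {x : G.Dart → A} {σ : ℝ≥0} (hx : ‖x‖ ≤ σ) (hxN : ∀ e, x e ∈ D.N) {u : G.Tensor}
    (hu : u.wnorm σ < ⊤) {S T : A} (hS : S ∈ D.N) (hT : T ∈ D.N) :
    D.τ (S * P.evT x u T) = D.τ (P.evT x u.flip S * T) := by
  have hx' : ∀ e, ‖x e‖ ≤ σ := fun e => (norm_le_pi_norm x e).trans hx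
  have h1 := ((P.hasSum_evT_apply hx' hu T).mul_left S).mapL D.τ
  have h2 := ((P.hasSum_evT_apply hx' (u := Tensor.flip u)
    (by rwa [Tensor.wnorm_flip]) S).mul_right T).mapL D.τ
  rw [← (Equiv.prodComm G.Path G.Path).hasSum_iff] at h2
  refine h1.unique ?_
  convert h2 using 2 with p
  have hw : ∀ γ, P.word γ x ∈ D.N := P.word_mem D.proj_mem hxN
  simp only [Function.comp_apply, Equiv.prodComm_apply, Prod.fst_swap, Prod.snd_swap, Tensor.flip,
    smul_mul_assoc, mul_smul_comm, map_smul]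
  rw [← mul_assoc, D.comm _ (mul_mem hS (mul_mem (hw _) hT)) _ (hw _)]
  simp only [mul_assoc]

lemma sum_τ_mul_evM {x : G.Dart → A} {σ : ℝ≥0} (hx : ‖x‖ ≤ σ) (hxN : ∀ e, x e ∈ D.N)
    {Q : G.TMatrix} (hQ : ∀ e w, (Q e w).wnorm σ < ⊤) {Z K : G.Dart → A} (hZ : ∀ e, Z e ∈ D.N)
    (hK : ∀ e, K e ∈ D.N) :
    ∑ e, D.τ (Z e * P.evM x Q K e) = ∑ e, D.τ (P.evM x Q.transpose Z e * K e) := by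
  simp only [VProj.evM_apply, Finset.mul_sum, Finset.sum_mul, map_sum]
  rw [Finset.sum_comm]
  exact Finset.sum_congr rfl fun w _ => Finset.sum_congr rfl fun e _ =>
    τ_mul_evT hx hxN (hQ e w) (hZ e) (hK w)

/-- Only the row sums of `Q` are controlled. They are the column sums of the transpose and bound it
in the ℓ¹ norm over the edges, dual to the maximum norm. -/
lemma sum_norm_evM_transpose_le (P : VProj V A) {x : G.Dart → A} {σ c : ℝ≥0} (hx : ‖x‖ ≤ σ)
    {Q : G.TMatrix} (hQ : ∀ e, ∑ w, (Q e w).wnorm σ ≤ c) (Z : G.Dart → A) :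
    ∑ e, ‖P.evM x Q.transpose Z e‖ ≤ c * ∑ e, ‖Z e‖ := by
  have hfin : ∀ e w, (Q e w).wnorm σ < ⊤ := fun e w =>
    (ENNReal.sum_lt_top.1 ((hQ e).trans_lt ENNReal.coe_lt_top)) w (Finset.mem_univ w)
  calc _ ≤ ∑ e, ∑ w, ((Q w e).wnorm σ).toReal * ‖Z w‖ := by
        refine Finset.sum_le_sum fun e _ => ?_
        rw [VProj.evM_apply]
        refine (norm_sum_le _ _).trans (Finset.sum_le_sum fun w _ => ?_)
        refine (ContinuousLinearMap.le_opNorm _ _).trans ?_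
        refine mul_le_mul_of_nonneg_right ?_ (norm_nonneg _)
        rw [← Tensor.wnorm_flip]
        exact P.norm_evB_le hx hx (by rw [TMatrix.transpose, Tensor.wnorm_flip]; exact hfin w e)
    _ = ∑ w, (∑ e, (Q w e).wnorm σ).toReal * ‖Z w‖ := by
        rw [Finset.sum_comm]
        refine Finset.sum_congr rfl fun w _ => ?_
        rw [← Finset.sum_mul, ENNReal.toReal_sum fun e _ => (hfin w e).ne]
    _ ≤ ∑ w, c * ‖Z w‖ := Finset.sum_le_sum fun w _ =>
        mul_le_mul_of_nonneg_right (ENNReal.toReal_mono ENNReal.coe_ne_top (hQ w)) (norm_nonneg _)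
    _ = _ := by rw [Finset.mul_sum]

/-- Solution of `ζ + Qᵗ ζ = Z`. -/
lemma exists_add_evM_transpose_eq {x : G.Dart → A} {σ c : ℝ≥0} (hx : ‖x‖ ≤ σ)
    (hxN : ∀ e, x e ∈ D.N) {Q : G.TMatrix} (hQ : ∀ e, ∑ w, (Q e w).wnorm σ ≤ c) (hc : c < 1)
    {Z : G.Dart → A} (hZ : ∀ e, Z e ∈ D.N) :
    ∃ ζ : G.Dart → A, (∀ e, ζ e ∈ D.N) ∧ ζ + P.evM x Q.transpose ζ = Z := by
  set T := P.evM x Q.transpose with hT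
  -- The Neumann series for the transpose. Unlike `κ`, its solution is needed only as a family of
  -- operators, so it is summed in the Banach algebra.
  let z : ℕ → G.Dart → A := fun k => (fun Y => -(T Y))^[k] Z
  have hz : ∀ k, z (k + 1) = -(T (z k)) := fun k => Function.iterate_succ_apply' _ _ _
  have hn : ∀ k, ∑ e, ‖z k e‖ ≤ c ^ k * ∑ e, ‖Z e‖ := by
    intro k
    induction k with
    | zero => simp [z]
    | succ k ih =>
      rw [hz]
      simp only [Pi.neg_apply, norm_neg]
      refine (sum_norm_evM_transpose_le P hx hQ _).trans ?_
      rw [pow_succ' (c : ℝ) k, mul_assoc]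
      exact mul_le_mul_of_nonneg_left ih c.2
  have hN : ∀ k e, z k e ∈ D.N := by
    intro k
    induction k with
    | zero => exact hZ
    | succ k ih =>
      intro e
      rw [hz, Pi.neg_apply]
      refine neg_mem (evM_apply_mem hx hxN ih (fun e w => ?_) e)
      rw [TMatrix.transpose, Tensor.wnorm_flip]
      exact (ENNReal.sum_lt_top.1 ((hQ w).trans_lt ENNReal.coe_lt_top)) e (Finset.mem_univ e)
  have hs : Summable z := by
    refine Summable.of_norm_bounded (g := fun k => (c : ℝ) ^ k * ∑ e, ‖Z e‖)
      ((summable_geometric_of_lt_one c.2 (by exact_mod_cast hc)).mul_right _) fun k => ?_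
    refine ((pi_norm_le_iff_of_nonneg (Finset.sum_nonneg fun e _ => norm_nonneg _)).2
      fun e => ?_).trans (hn k)
    exact Finset.single_le_sum (f := fun e => ‖z k e‖) (fun e _ => norm_nonneg _)
      (Finset.mem_univ e)
  refine ⟨∑' k, z k, fun e => ?_, ?_⟩
  · have h1 := (continuous_apply e).tendsto _ |>.comp hs.hasSum
    refine D.isClosed.mem_of_tendsto h1 (Filter.Eventually.of_forall fun s => ?_)
    simp only [Function.comp_apply, Finset.sum_apply]
    exact sum_mem fun k _ => hN k e
  · have h1 : HasSum (fun k => z (k + 1)) (-(T (∑' k, z k))) := by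
      simp only [hz]
      exact (hs.hasSum.mapL T).neg
    have h2 : ∑' k, z k = Z + -(T (∑' k, z k)) := by
      conv_lhs => rw [hs.tsum_eq_zero_add, h1.tsum_eq]
      rfl
    nth_rewrite 1 [h2]
    exact neg_add_cancel_right _ _

end TraceData

end

/-! ### Representation of the defect by a family of operators -/

section

variable {V E : Type*} [Fintype V] {G : WeightedGraph V E} [Fintype E]
  {A : Type*} [NormedRing A] [NormedAlgebra ℂ A] [CompleteSpace A]

namespace TraceData

variable {P : VProj V A} {D : TraceData P} {x : G.Dart → A} {g W : G.Series} {ρ ρ' c s s' : ℝ≥0}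

/-- The transpose has norm less than one in the ℓ¹ norm over the edges. -/
lemma add_evM_transpose_eq_zero_iff (hx : ‖x‖ ≤ ρ) {Q : G.TMatrix}
    (hQ : ∀ e, ∑ w, (Q e w).wnorm ρ ≤ c) (hc : c < 1) {ζ : G.Dart → A} :
    ζ + P.evM x Q.transpose ζ = 0 ↔ ζ = 0 := by
  refine ⟨fun h => ?_, fun h => by rw [h, map_zero, add_zero]⟩
  have h1 := sum_norm_evM_transpose_le P hx hQ ζ
  rw [← neg_eq_iff_add_eq_zero.2 h] at h1
  simp only [Pi.neg_apply, norm_neg] at h1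
  have h0 : ∀ e ∈ Finset.univ, 0 ≤ ‖ζ e‖ := fun e _ => norm_nonneg _
  have hc' : (c : ℝ) < 1 := by exact_mod_cast hc
  have h2 : ∑ e, ‖ζ e‖ = 0 := by nlinarith [Finset.sum_nonneg h0]
  funext e
  exact norm_eq_zero.1 ((Finset.sum_eq_zero_iff_of_nonneg h0).1 h2 e (Finset.mem_univ e))

/-- The defect in the Schwinger-Dyson equation is represented by a family that vanishes if and only
if the cyclic gradient of the transport equation does. -/
lemma exists_schwingerDyson_defect (hx : ‖x‖ < ρ) (hρ : ρ < ρ') (hxN : ∀ e, x e ∈ D.N)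
    (hxc : P.cutOps x = x) (hQ : D.QuadSD x) (hg : g.wnorm ρ' < ⊤)
    (hJ : ∀ e, ∑ w, (jac (grad g) e w).wnorm ρ ≤ c) (hc : c < 1)
    (hY : ∀ e, (shift g e).wnorm ρ ≤ s) (hs : s < s') (hW : W.wnorm s' < ⊤) :
    ∃ ζ : G.Dart → A, (∀ e, ζ e ∈ D.N) ∧
      (ζ = 0 ↔ ∀ e, P.ev x (grad (Series.number g +
        (1 / 2 : ℂ) • dot (grad g) (TMatrix.act TMatrix.M (grad g)) + W.subst (shift g) +
        D.logTerm x g) e) = 0) ∧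
      ∀ (e : G.Dart) (a : G.Series), a.wnorm s' < ⊤ →
        D.τ (((e.wt : ℂ) • (x + P.evF x (grad g)) e.op +
          P.ev (x + P.evF x (grad g)) (grad W e.op)) * P.ev (x + P.evF x (grad g)) a) -
        D.tr2 (P.evT (x + P.evF x (grad g)) (Series.diff e a)) =
        D.τ (ζ e * P.ev (x + P.evF x (grad g)) a) := by
  classical
  set a₀ := Series.number g + (1 / 2 : ℂ) • dot (grad g) (TMatrix.act TMatrix.M (grad g)) +
    W.subst (shift g) + D.logTerm x g with ha₀
  have hZN : ∀ e : G.Dart, P.ev x (grad a₀ e.op) ∈ D.N := fun e =>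
    P.ev_mem D.isClosed D.proj_mem hxN _
  obtain ⟨ζ, hζ, hζZ⟩ := exists_add_evM_transpose_eq (D := D) hx.le hxN hJ hc hZN
  refine ⟨ζ, hζ, ?_, fun e a ha => ?_⟩
  · rw [← add_evM_transpose_eq_zero_iff hx.le hJ hc, hζZ]
    refine ⟨fun h e => ?_, fun h => funext fun e => h e.op⟩
    have := congrFun h e.op
    simpa only [Dart.op_op, Pi.zero_apply] using this
  · have hq : ∀ f, ((Pi.single e a : G.Dart → G.Series) f).wnorm s' < ⊤ := by
      intro f
      rcases eq_or_ne f e with rfl | h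
      · rwa [Pi.single_eq_same]
      · rw [Pi.single_eq_of_ne h]
        simp [Series.wnorm]
    obtain ⟨K, hK, hKq, h⟩ := schwingerDyson_defect (D := D) hx hρ hxN hxc hQ hg hJ hc hY hs hW hq
    have hfin : ∀ e w, (jac (grad g) e w).wnorm ρ < ⊤ := fun e w =>
      (ENNReal.sum_lt_top.1 ((hJ e).trans_lt ENNReal.coe_lt_top)) w (Finset.mem_univ w)
    have h1 : ∑ f, D.τ (P.ev x (grad a₀ f.op) * K f) =
        ∑ f, D.τ (ζ f * P.evF (x + P.evF x (grad g)) (Pi.single e a) f) := by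
      rw [← hKq]
      simp only [Pi.add_apply, mul_add, map_add, Finset.sum_add_distrib]
      rw [sum_τ_mul_evM hx.le hxN hfin hζ hK, ← Finset.sum_add_distrib]
      refine Finset.sum_congr rfl fun f _ => ?_
      rw [← map_add, ← add_mul]
      congr 2
      exact (congrFun hζZ f).symm
    rw [← ha₀, h1] at h
    have h0 : ∀ f, f ≠ e → P.ev (x + P.evF x (grad g)) ((Pi.single e a : G.Dart → G.Series) f) = 0 :=
      fun f hf => by
        rw [Pi.single_eq_of_ne hf]
        exact P.ev_zero
    rw [Finset.sum_eq_single e (fun f _ hf => by rw [VProj.evF, h0 f hf, mul_zero, map_zero])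
      (by simp), Finset.sum_eq_single e (fun f _ hf => by
        rw [Pi.single_eq_of_ne hf]
        have h2 : Series.diff f (0 : G.Series) = 0 := by
          rw [← zero_smul ℂ (0 : G.Series), Series.diff_smul, zero_smul]
        rw [h2]
        exact (congrArg D.tr2 P.evT_zero).trans (map_zero D.tr2))
      (by simp), Finset.sum_eq_single e (fun f _ hf => by rw [VProj.evF, h0 f hf, mul_zero, map_zero])
      (by simp)] at h
    simpa only [VProj.evF, Pi.single_eq_same] using h

end TraceData

end

section

variable {V E : Type*} [Fintype V] {G : WeightedGraph V E} [Fintype E]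

/-! ### Comparison of norms -/

namespace Series

/-- The paths of length zero. -/
def trivEquiv : V ≃ ({γ : G.Path | γ.length ≠ 0}ᶜ : Set G.Path) where
  toFun v := ⟨Path.triv v, by simp⟩
  invFun γ := γ.1.start
  left_inv v := rfl
  right_inv γ := by
    have h : γ.1.length = 0 := not_not.1 γ.2
    exact Subtype.ext (Path.eq_triv_of_darts (List.length_eq_zero_iff.1 h)).symm

lemma wnorm_eq (ρ : ℝ≥0) (a : G.Series) : a.wnorm ρ = ∑ v, ‖a (Path.triv v)‖ₑ +
    ∑' γ : {γ : G.Path // γ.length ≠ 0}, ‖a γ‖ₑ * (ρ : ℝ≥0∞) ^ (γ : G.Path).length := by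
  have h1 := ENNReal.summable.tsum_add_tsum_compl (s := {γ : G.Path | γ.length ≠ 0})
    (f := fun γ : G.Path => ‖a γ‖ₑ * (ρ : ℝ≥0∞) ^ γ.length) ENNReal.summable
  rw [wnorm, ← h1, add_comm]
  congr 1
  rw [← trivEquiv.tsum_eq, tsum_fintype]
  refine Finset.sum_congr rfl fun v _ => ?_
  change ‖a (Path.triv v)‖ₑ * (ρ : ℝ≥0∞) ^ 0 = _
  rw [pow_zero, mul_one]

lemma normR_eq (R : ℝ) (a : G.Series) : a.normR R = (⨆ v : V, ‖a (Path.triv v)‖ₑ) +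
    ∑' γ : {γ : G.Path // γ.length ≠ 0},
      ‖a γ‖ₑ * (R.toNNReal : ℝ≥0∞) ^ (γ : G.Path).length := rfl

lemma normR_le_wnorm (R : ℝ) (a : G.Series) : a.normR R ≤ a.wnorm R.toNNReal := by
  rw [normR_eq, wnorm_eq]
  gcongr
  exact iSup_le fun v => Finset.single_le_sum (f := fun v => ‖a (Path.triv v)‖ₑ)
    (fun _ _ => zero_le) (Finset.mem_univ v)

/-- The two norms differ only in the constant terms, where one sums and the other takes a supremum;
with finitely many vertices finiteness is the same. -/
lemma wnorm_lt_top_of_normR {R : ℝ} {a : G.Series} (h : a.normR R < ⊤) :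
    a.wnorm R.toNNReal < ⊤ := by
  rw [normR_eq, ENNReal.add_lt_top] at h
  rw [wnorm_eq, ENNReal.add_lt_top]
  exact ⟨ENNReal.sum_lt_top.2 fun v _ => enorm_lt_top, h.2⟩

/-- If at most one constant coefficient of `b` is non-zero and `b` is dominated by `a`, then the
weighted `ℓ¹` norm of `b` is dominated by the norm of `a`. -/
lemma wnorm_le_normR_of_le {R : ℝ} {a b : G.Series} (h : ∀ γ, ‖b γ‖ₑ ≤ ‖a γ‖ₑ) {v : V}
    (hv : ∀ w, w ≠ v → b (Path.triv w) = 0) : b.wnorm R.toNNReal ≤ a.normR R := by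
  rw [normR_eq, wnorm_eq]
  gcongr with γ
  · rw [Finset.sum_eq_single v (fun w _ hw => by rw [hv w hw, enorm_zero]) (by simp)]
    exact (h _).trans (le_iSup (fun v => ‖a (Path.triv v)‖ₑ) v)
  · exact h _

end Series

/-- In a representation of `u` as a sum of tensor products, the left factors may be restricted to
paths from `v` and the right factors to paths into `w`. Each factor then has at most one constant
coefficient, so the supremum over the vertices and the sum over them agree. Without the support
condition the inequality would need a constant, and the bound by one on the Jacobian would be lost.
-/
lemma Tensor.wnorm_le_projNorm {R : ℝ} {u : G.Tensor} {v w : V}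
    (h : ∀ γ δ, u γ δ ≠ 0 → γ.start = v ∧ δ.finish = w) :
    u.wnorm R.toNNReal ≤ u.projNorm R := by
  classical
  refine le_iInf fun a => le_iInf fun b => le_iInf fun hab => ?_
  let a' : ℕ → G.Series := fun n γ => if γ.start = v then a n γ else 0
  let b' : ℕ → G.Series := fun n δ => if δ.finish = w then b n δ else 0
  have h1 : u = fun γ δ => ∑' n, a' n γ * b' n δ := by
    funext γ δ
    by_cases hγ : γ.start = v
    · by_cases hδ : δ.finish = w
      · simp only [a', b', if_pos hγ, if_pos hδ]
        exact (hab γ δ).tsum_eq.symm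
      · simp only [b', if_neg hδ, mul_zero, tsum_zero]
        by_contra hu
        exact hδ (h γ δ hu).2
    · simp only [a', if_neg hγ, zero_mul, tsum_zero]
      by_contra hu
      exact hγ (h γ δ hu).1
  have h2 : u.wnorm R.toNNReal ≤ ∑' n, Tensor.wnorm R.toNNReal (fun γ δ => a' n γ * b' n δ) := by
    conv_lhs => rw [h1]
    simp only [Tensor.wnorm]
    rw [ENNReal.tsum_comm]
    refine ENNReal.tsum_le_tsum fun p => ?_
    rw [ENNReal.tsum_mul_right]
    gcongr
    exact Series.enorm_tsum_le _
  refine h2.trans (ENNReal.tsum_le_tsum fun n => ?_)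
  rw [Series.wnorm_tmul]
  refine mul_le_mul' (Series.wnorm_le_normR_of_le (v := v) (fun γ => ?_) fun v' hv' => ?_)
    (Series.wnorm_le_normR_of_le (v := w) (fun γ => ?_) fun v' hv' => ?_)
  · simp only [a']
    split_ifs
    · exact le_rfl
    · simp
  · exact if_neg hv'
  · simp only [b']
    split_ifs
    · exact le_rfl
    · simp
  · exact if_neg hv'

lemma sum_wnorm_jac_le (R : ℝ) (g : G.Series) (e : G.Dart) :
    ∑ w, (jac (grad g) e w).wnorm R.toNNReal ≤ TMatrix.norm R (jac (grad g)) :=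
  (Finset.sum_le_sum fun _ _ => Tensor.wnorm_le_projNorm fun _ _ => VProj.jac_grad_support).trans
    (le_iSup (fun e => ∑ w, Tensor.projNorm R (jac (grad g) e w)) e)

lemma shift_support {g : G.Series} {e : G.Dart} {γ : G.Path} (h : shift g e γ ≠ 0) :
    γ.start = e.src ∧ γ.finish = e.tgt := by
  by_cases hg : grad g e γ = 0
  · have h1 : Series.var e γ ≠ 0 := by
      intro h2
      apply h
      change Series.var e γ + grad g e γ = 0
      rw [h2, hg, add_zero]
    have h2 : γ = Path.single e := by
      by_contra h3
      exact h1 (if_neg h3)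
    rw [h2]
    exact ⟨rfl, rfl⟩
  · exact grad_support hg

lemma wnorm_shift_le (R : ℝ) (g : G.Series) (e : G.Dart) :
    (shift g e).wnorm R.toNNReal ≤ (shift g e).normR R := by
  refine Series.wnorm_le_normR_of_le (fun _ => le_rfl) (v := e.src) fun w hw => ?_
  by_contra h
  exact hw (shift_support h).1

/-- If `𝒟_e g` cancelled the variable `z_e`, its coefficient there would be -1. This is also the
constant coefficient of a diagonal entry of the Jacobian, which would then have norm at least one.
-/
lemma shift_single_ne {g : G.Series} {ρ : ℝ≥0} (e : G.Dart)
    (hJ : ∑ w, (jac (grad g) e w).wnorm ρ < 1) : shift g e (Path.single e) ≠ 0 := by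
  intro h
  have h1 : grad g e (Path.single e) = -1 := by
    have h2 : Series.var e (Path.single e) = 1 := if_pos rfl
    have h3 : Series.var e (Path.single e) + grad g e (Path.single e) = 0 := h
    rw [h2] at h3
    linear_combination h3
  have hh : (Path.triv e.src : G.Path).finish = e.src ∧ (Path.triv e.tgt : G.Path).start = e.tgt :=
    ⟨rfl, rfl⟩
  have h2 : jac (grad g) e e (Path.triv e.src) (Path.triv e.tgt) = -1 := by
    rw [← h1]
    exact dif_pos hh
  have h3 : (1 : ℝ≥0∞) ≤ (jac (grad g) e e).wnorm ρ := by
    have h4 := ENNReal.le_tsum (f := fun p : G.Path × G.Path =>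
      ‖jac (grad g) e e p.1 p.2‖ₑ * (ρ : ℝ≥0∞) ^ (p.1.length + p.2.length))
      (Path.triv e.src, Path.triv e.tgt)
    simp only [h2] at h4
    simpa [Tensor.wnorm] using h4
  have h4 := Finset.single_le_sum (f := fun w => (jac (grad g) e w).wnorm ρ)
    (fun _ _ => zero_le) (Finset.mem_univ e)
  exact absurd hJ (not_lt.2 (h3.trans h4))

lemma Series.wnorm_lt_of_ne {ρ ρ' : ℝ≥0} (h : ρ < ρ') {a : G.Series} (ha : a.wnorm ρ' < ⊤)
    {γ : G.Path} (hγ : a γ ≠ 0) (hl : γ.length ≠ 0) : a.wnorm ρ < a.wnorm ρ' := by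
  refine ENNReal.tsum_lt_tsum (i := γ) ((wnorm_mono h.le a).trans_lt ha).ne (fun δ => ?_) ?_
  · gcongr
  · refine (ENNReal.mul_lt_mul_iff_right (enorm_ne_zero.2 hγ) enorm_lt_top.ne).2 ?_
    exact ENNReal.pow_lt_pow_left hl (ENNReal.coe_lt_coe.2 h)

/-- Radii for which the abstract transport theorem applies. -/
lemma exists_radii {R S r m : ℝ} (hR : m < R) (hr : m < r) (h0 : 0 ≤ m) {g : G.Series}
    (hg : g.normR R < ⊤) (hJ : TMatrix.norm R (jac (grad g)) < 1)
    (hY : ∀ e : G.Dart, (shift g e).normR r ≤ ENNReal.ofReal S) (hS : 0 < S) :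
    ∃ ρ ρ' c s : ℝ≥0, m < ρ ∧ ρ < ρ' ∧ g.wnorm ρ' < ⊤ ∧
      (∀ e, ∑ w, (jac (grad g) e w).wnorm ρ ≤ c) ∧ c < 1 ∧
      (∀ e, (shift g e).wnorm ρ ≤ s) ∧ s < S.toNNReal := by
  obtain ⟨ρ, h1, h2⟩ := exists_between (lt_min hR hr)
  have hρ0 : 0 ≤ ρ := h0.trans h1.le
  have hρR : ρ.toNNReal < R.toNNReal :=
    (Real.toNNReal_lt_toNNReal_iff_of_nonneg hρ0).2 (h2.trans_le (min_le_left _ _))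
  have hρr : ρ.toNNReal < r.toNNReal :=
    (Real.toNNReal_lt_toNNReal_iff_of_nonneg hρ0).2 (h2.trans_le (min_le_right _ _))
  have hJρ : ∀ e, ∑ w, (jac (grad g) e w).wnorm ρ.toNNReal ≤ TMatrix.norm R (jac (grad g)) :=
    fun e => (Finset.sum_le_sum fun w _ => Tensor.wnorm_mono hρR.le _).trans
      (sum_wnorm_jac_le R g e)
  -- The hypothesis gives only a weak inequality with `S`, but differentiating `W` requires room
  -- below `S`. The norm decreases strictly with the radius because the coefficient of `z_e` is
  -- non-zero.
  have hYρ : ∀ e, (shift g e).wnorm ρ.toNNReal < (S.toNNReal : ℝ≥0∞) := fun e => by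
    have h3 : (shift g e).wnorm r.toNNReal ≤ (S.toNNReal : ℝ≥0∞) :=
      (wnorm_shift_le r g e).trans (hY e)
    exact (Series.wnorm_lt_of_ne hρr (h3.trans_lt ENNReal.coe_lt_top)
      (shift_single_ne e ((hJρ e).trans_lt hJ)) (by simp [Path.single, Path.length])).trans_le h3
  have hS' : 0 < S.toNNReal := Real.toNNReal_pos.2 hS
  refine ⟨ρ.toNNReal, R.toNNReal, (TMatrix.norm R (jac (grad g))).toNNReal,
    Finset.univ.sup fun e : G.Dart => ((shift g e).wnorm ρ.toNNReal).toNNReal, ?_, hρR,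
    Series.wnorm_lt_top_of_normR hg, fun e => ?_, ?_, fun e => ?_, ?_⟩
  · rwa [Real.coe_toNNReal _ hρ0]
  · rw [ENNReal.coe_toNNReal (hJ.trans ENNReal.one_lt_top).ne]
    exact hJρ e
  · rwa [← ENNReal.coe_lt_coe, ENNReal.coe_toNNReal (hJ.trans ENNReal.one_lt_top).ne]
  · rw [← ENNReal.coe_toNNReal ((hYρ e).trans ENNReal.coe_lt_top).ne, ENNReal.coe_le_coe]
    exact Finset.le_sup (f := fun e : G.Dart => ((shift g e).wnorm ρ.toNNReal).toNNReal)
      (Finset.mem_univ e)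
  -- Positivity of `S` covers a graph without edges, where the supremum is zero.
  · refine (Finset.sup_lt_iff hS').2 fun e _ => ?_
    rw [← ENNReal.coe_lt_coe, ENNReal.coe_toNNReal ((hYρ e).trans ENNReal.coe_lt_top).ne]
    exact hYρ e

end

section

variable {V E : Type*} [Fintype V] {G : WeightedGraph V E} [Fintype E]

/-! ### The Fock space as an instance of the abstract setting -/

/-- A telescoping sum that moves `T` through the word one edge at a time; commutation with the
vertex projections removes the boundary terms. -/
lemma VProj.word_commutator {A : Type*} [NormedRing A] [NormedAlgebra ℂ A] [CompleteSpace A]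
    (P : VProj V A) {T : A} (hT : ∀ v, T * P.p v = P.p v * T) {X : G.Dart → A}
    (hX : P.cutOps X = X) (γ : G.Path) :
    T * P.word γ X = P.word γ X * T + ∑ i : Fin γ.length, P.word (γ.take i) X *
      (T * X (γ.darts[(i : ℕ)]'i.2) - X (γ.darts[(i : ℕ)]'i.2) * T) * P.word (γ.drop (i + 1)) X := by
  have h1 : ∀ i : Fin γ.length, P.word (γ.take i) X *
      (T * X (γ.darts[(i : ℕ)]'i.2) - X (γ.darts[(i : ℕ)]'i.2) * T) * P.word (γ.drop (i + 1)) X =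
      -(P.word (γ.take (i + 1)) X * T * P.word (γ.drop (i + 1)) X
        - P.word (γ.take i) X * T * P.word (γ.drop i) X) := by
    intro i
    rw [P.word_take_succ γ i, P.word_drop γ i, hX]
    noncomm_ring
  rw [Finset.sum_congr rfl fun i _ => h1 i, Finset.sum_neg_distrib,
    Fin.sum_univ_eq_sum_range (fun i => P.word (γ.take (i + 1)) X * T * P.word (γ.drop (i + 1)) X
        - P.word (γ.take i) X * T * P.word (γ.drop i) X) γ.length,
    Finset.sum_range_sub (fun i => P.word (γ.take i) X * T * P.word (γ.drop i) X)]
  have h2 : γ.take γ.length = γ := Path.ext_darts rfl (List.take_length)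
  have h3 : γ.drop γ.length = Path.triv γ.finish := by
    rw [Path.eq_triv_of_darts (γ := γ.drop γ.length) (List.drop_length), Path.drop_start, h2]
  have h4 : γ.drop 0 = γ := Path.ext_darts rfl rfl
  have h5 : γ.take 0 = Path.triv γ.start := Path.ext_darts rfl rfl
  rw [h3, h4, h5, h2, VProj.word_triv, VProj.word_triv, mul_assoc, hT, ← mul_assoc,
    P.word_mul_projOp, ← hT, mul_assoc, P.projOp_mul_word]
  abel

lemma projOp_mul_projOp_same (v : V) : (projOp v * projOp v : G.Fock →L[ℂ] G.Fock) = projOp v := by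
  refine op_ext fun ξ γ => ?_
  rw [mul_apply_eq_comp, coef_projOp, coef_projOp]
  split_ifs <;> rfl

lemma projOp_mul_projOp_of_ne {v w : V} (h : v ≠ w) :
    (projOp v * projOp w : G.Fock →L[ℂ] G.Fock) = 0 := by
  refine op_ext fun ξ γ => ?_
  rw [mul_apply_eq_comp, coef_projOp, coef_projOp]
  split_ifs with h1 h2
  · exact absurd (h1.symm.trans h2) h
  · rfl
  · rfl

lemma projOp_mul_creation (e : G.Dart) : projOp e.src * creation e = creation e := by
  classical
  refine op_ext fun ξ γ => ?_
  rw [mul_apply_eq_comp, coef_projOp, coef_creation]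
  by_cases h : γ.darts.head? = some e
  · rw [if_pos (Path.start_eq_src h)]
  · simp [h]

lemma creation_mul_projOp (e : G.Dart) : creation e * projOp e.tgt = creation e := by
  classical
  refine op_ext fun ξ γ => ?_
  rw [mul_apply_eq_comp, coef_creation, coef_creation, coef_projOp]
  by_cases h : γ.darts.head? = some e
  · rw [if_pos (Path.drop_one_start h)]
  · simp [h]

variable (G) in
/-- The projections `p_v` on the Fock space. -/
def fockProj : VProj V (G.Fock →L[ℂ] G.Fock) where
  p := projOp
  mul_self := projOp_mul_projOp_same
  mul_of_ne _ _ := projOp_mul_projOp_of_ne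
  norm_le _ := norm_pullback_le _ _ _

lemma cutOps_gen : G.fockProj.cutOps gen = gen := by
  funext e
  have h1 := congrArg ContinuousLinearMap.adjoint (projOp_mul_creation e.op)
  have h2 := congrArg ContinuousLinearMap.adjoint (creation_mul_projOp e.op)
  rw [adjoint_mul, adjoint_projOp] at h1 h2
  change projOp e.src * gen e * projOp e.tgt = _
  rw [gen_eq, mul_add, add_mul, mul_smul_comm, mul_smul_comm, smul_mul_assoc,
    smul_mul_assoc, projOp_mul_creation, creation_mul_projOp]
  simp only [Dart.op_src, Dart.op_tgt] at h1 h2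
  rw [h2, h1]

lemma word_eq_monoOp {y : G.Dart → G.Fock →L[ℂ] G.Fock} (hy : G.fockProj.cutOps y = y)
    (γ : G.Path) : G.fockProj.word γ y = Series.monoOp y γ := by
  rw [VProj.word, hy, Series.monoOp]
  induction γ.darts with
  | nil => exact one_mul _
  | cons e l ih => rw [List.map_cons, List.prod_cons, List.foldr_cons, mul_assoc, ih]

lemma ev_eq_eval {y : G.Dart → G.Fock →L[ℂ] G.Fock} (hy : G.fockProj.cutOps y = y)
    (a : G.Series) : G.fockProj.ev y a = Series.eval y a :=
  tsum_congr fun γ => by rw [word_eq_monoOp hy]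

variable (G) in
/-- The extension of `τ ⊗ τ` to operators on operators. -/
def traceTrace : ((G.Fock →L[ℂ] G.Fock) →L[ℂ] (G.Fock →L[ℂ] G.Fock)) →L[ℂ] ℂ :=
  ∑ v, ∑ w, (G.wt v * G.wt w : ℂ) • (innerSL ℂ (ket (Path.triv v))).comp
    ((ContinuousLinearMap.apply ℂ G.Fock (ket (Path.triv w))).comp
      (ContinuousLinearMap.apply ℂ (G.Fock →L[ℂ] G.Fock) (ketbra (Path.triv v) (Path.triv w))))

/-- Inserting the rank one operator from `w` to `v` between `S` and `T` splits the matrix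
coefficient into a diagonal coefficient of `S` and one of `T`. -/
lemma traceTrace_mulLR (S T : G.Fock →L[ℂ] G.Fock) :
    traceTrace G (mulLR S T) = traceL G S * traceL G T := by
  rw [traceL_apply, traceL_apply, trace_eq, trace_eq, Finset.sum_mul_sum, traceTrace, sum_apply]
  refine Finset.sum_congr rfl fun v _ => ?_
  rw [sum_apply]
  refine Finset.sum_congr rfl fun w _ => ?_
  change (G.wt v * G.wt w : ℂ) * inner ℂ (ket (Path.triv v))
    (S (ketbra (Path.triv v) (Path.triv w) (T (ket (Path.triv w))))) = _
  rw [ketbra_apply, map_smul, inner_smul_right, inner_ket_left]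
  ring

variable (G) in
/-- The trace of the free graph law. -/
def fockTrace : TraceData G.fockProj where
  τ := traceL G
  N := tracialAlg G
  isClosed := isClosed_tracialAlg
  proj_mem := projOp_mem_tracialAlg
  comm a ha b hb := by rw [traceL_apply, traceL_apply, trace_mul_comm ha hb]
  tr2 := traceTrace G
  tr2_mulLR := traceTrace_mulLR

lemma trace_mul_projOp (T : G.Fock →L[ℂ] G.Fock) (v : V) : trace (T * projOp v)
    = G.wt v * coef (T (ket (Path.triv v))) (Path.triv v) := by
  classical
  have h : ∀ w, projOp v (ket (Path.triv w : G.Path)) = if w = v then ket (Path.triv v) else 0 := by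
    intro w
    refine fock_ext fun γ => ?_
    rw [coef_projOp, coef_ket]
    by_cases hw : w = v
    · subst hw
      by_cases hγ : γ = Path.triv w
      · subst hγ; simp
      · simp [coef_ket, hγ]
    · rw [if_neg hw, coef_zero]
      by_cases hγ : γ = Path.triv w
      · subst hγ; simp [hw]
      · simp [hγ]
  rw [trace_eq, Finset.sum_eq_single v]
  · rw [mul_apply_eq_comp, h, if_pos rfl]
  · intro w _ hw
    rw [mul_apply_eq_comp, h, if_neg hw, map_zero, coef_zero, mul_zero]
  · simp

lemma trace_projOp_mul (T : G.Fock →L[ℂ] G.Fock) (v : V) : trace (projOp v * T)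
    = G.wt v * coef (T (ket (Path.triv v))) (Path.triv v) := by
  classical
  rw [trace_eq, Finset.sum_eq_single v]
  · rw [mul_apply_eq_comp, coef_projOp, if_pos (Path.triv_start v)]
  · intro w _ hw
    rw [mul_apply_eq_comp, coef_projOp, if_neg (by simpa using hw), mul_zero]
  · simp

open Classical in
lemma gen_ket_triv (e : G.Dart) (v : V) : gen e (ket (Path.triv v)) =
    if v = e.tgt then e.quart • ContinuousLinearMap.adjoint (rann e) (ket (Path.triv e.src))
      else 0 := by
  rw [gen_eq, add_apply, smul_apply, smul_apply, adjoint_creation_ket, if_neg (by simp), smul_zero,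
    add_zero]
  by_cases hv : v = e.tgt
  · subst hv
    rw [if_pos rfl, adjoint_rann_ket (by simp), creation_ket (by simp)]
    congr 2
    refine Path.ext_darts ?_ ?_
    · rw [Path.cons_start (by simp), Path.snoc_start]; rfl
    · rw [Path.cons_darts (by simp), Path.snoc_darts (by simp)]; rfl
  · rw [if_neg hv]
    have h : creation e (ket (Path.triv v : G.Path)) = 0 := by
      refine fock_ext fun γ => ?_
      rw [coef_creation, coef_ket, coef_zero]
      split_ifs with h1 h2
      · exact absurd ((congrArg Path.start h2).symm.trans (Path.drop_one_start h1)) hv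
      · rfl
      · rfl
    rw [h, smul_zero]

/-- The trace of a product with a generator. -/
lemma trace_gen_mul (e : G.Dart) (T : G.Fock →L[ℂ] G.Fock) : trace (gen e.op * T) =
    G.wt e.tgt * e.quart * coef (rann e (T (ket (Path.triv e.tgt)))) (Path.triv e.src) := by
  have h : ∀ v, coef ((gen e.op * T) (ket (Path.triv v))) (Path.triv v)
      = inner ℂ (gen e (ket (Path.triv v))) (T (ket (Path.triv v))) := by
    intro v
    rw [← inner_ket_left, mul_apply_eq_comp, ← adjoint_gen, ContinuousLinearMap.adjoint_inner_right]
  rw [trace_eq, Finset.sum_eq_single e.tgt]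
  · rw [h, gen_ket_triv, if_pos rfl, inner_smul_left, Dart.conj_quart,
      ContinuousLinearMap.adjoint_inner_left, inner_ket_left, mul_assoc]
  · intro v _ hv
    rw [h, gen_ket_triv, if_neg hv, inner_zero_left, mul_zero]
  · simp

lemma norm_gen_le (e : G.Dart) : ‖(gen e : G.Fock →L[ℂ] G.Fock)‖ ≤ ‖(gen : G.Dart → G.Fock →L[ℂ] G.Fock)‖ :=
  norm_le_pi_norm (gen : G.Dart → G.Fock →L[ℂ] G.Fock) e

open Classical in
/-- Both sides of the Schwinger-Dyson equation of the generators, on a monomial. -/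
lemma tr2_evT_diff_mono (e : G.Dart) (γ : G.Path) :
    G.fockTrace.tr2 (G.fockProj.evT gen (Series.diff e (Series.mono γ))) =
      ∑ i : Fin γ.length, if γ.darts[(i : ℕ)]'i.2 = e then
        traceL G (G.fockProj.word (γ.take i) gen) *
          traceL G (G.fockProj.word (γ.drop (i + 1)) gen) else 0 := by
  set ρ : ℝ≥0 := ‖(gen : G.Dart → G.Fock →L[ℂ] G.Fock)‖₊ with hρ
  have hu : (Series.diff e (Series.mono γ)).wnorm ρ < ⊤ := by
    refine (Series.wnorm_diff_le (lt_add_one ρ) e _).trans_lt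
      (ENNReal.mul_lt_top ENNReal.coe_lt_top ?_)
    rw [wnorm_monomial]
    exact ENNReal.pow_lt_top ENNReal.coe_lt_top
  have h1 := TraceData.hasSum_tr2_evB (D := G.fockTrace) (X := gen) (Z := gen) (ρ := ρ)
    le_rfl le_rfl hu
  have h2 := hasSum_triple (F := fun δ w η => if w = e then
    Series.diff e (Series.mono γ) δ η * (G.fockTrace.τ (G.fockProj.word δ gen) *
      G.fockTrace.τ (G.fockProj.word η gen)) else 0)
    (s := fun w => if w = e then
      G.fockTrace.tr2 (G.fockProj.evB gen gen (Series.diff e (Series.mono γ))) else 0) (fun w => by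
      by_cases hw : w = e
      · simpa only [hw, if_true] using h1
      · simpa only [hw, if_false] using hasSum_zero)
  rw [Finset.sum_ite_eq' Finset.univ e, if_pos (Finset.mem_univ e)] at h2
  have h3 := hasSum_cutTriple (F := fun δ w η => if w = e then
    Series.diff e (Series.mono γ) δ η * (G.fockTrace.τ (G.fockProj.word δ gen) *
      G.fockTrace.τ (G.fockProj.word η gen)) else 0) (fun δ w η h => by
        by_cases hw : w = e
        · subst hw
          rw [if_pos rfl, Series.diff_of_not h, zero_mul]
        · rw [if_neg hw]) h2
  refine h3.tsum_eq.symm.trans ?_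
  have h4 : ∀ (δ : G.Path) (i : Fin δ.length), Series.mono γ δ = 0 →
      (if δ.darts[(i : ℕ)]'i.2 = e then
        Series.diff e (Series.mono γ) (δ.take i) (δ.drop (i + 1)) *
          (G.fockTrace.τ (G.fockProj.word (δ.take i) gen) *
            G.fockTrace.τ (G.fockProj.word (δ.drop (i + 1)) gen)) else 0) = 0 := by
    intro δ i h
    split_ifs with hi
    · rw [← hi, Series.diff_cut, h, zero_mul]
    · rfl
  rw [tsum_eq_single γ fun δ hδ => Finset.sum_eq_zero fun i _ => h4 δ i (if_neg hδ)]
  refine Finset.sum_congr rfl fun i _ => ?_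
  by_cases hi : γ.darts[(i : ℕ)]'i.2 = e
  · rw [if_pos hi, if_pos hi]
    nth_rewrite 1 [← hi]
    rw [Series.diff_cut, Series.mono, if_pos rfl, one_mul]
    rfl
  · rw [if_neg hi, if_neg hi]

/-- By `trace_gen_mul` the left side is a coefficient of `rann e` applied after the word. Moving
`rann e` through the word leaves only the commutators, since it annihilates the paths of length
zero. A commutator is non-zero only at an occurrence of `e`, where the rank one operator splits the
word as the free difference quotient does; `Dart.wt_mul_quart_sq` matches the constants. -/
lemma quadSD_gen : G.fockTrace.QuadSD gen := by
  classical
  intro e γ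
  rw [tr2_evT_diff_mono]
  change (e.wt : ℂ) * traceL G (gen e.op * G.fockProj.word γ gen) = _
  have hcomm := G.fockProj.word_commutator (T := rann e) (rann_mul_projOp e) cutOps_gen γ
  rw [traceL_apply, trace_gen_mul, ← mul_apply_eq_comp, hcomm, add_apply, mul_apply_eq_comp, rann_ket,
    if_neg (by simp), map_zero, zero_add, sum_apply, coef_sum, Finset.mul_sum, Finset.mul_sum]
  refine Finset.sum_congr rfl fun i _ => ?_
  by_cases hi : γ.darts[(i : ℕ)]'i.2 = e
  · rw [if_pos hi, rann_mul_gen, if_pos hi.symm, add_sub_cancel_left]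
    have e1 := G.fockProj.word_mul_projOp (γ.take i) gen
    have e2 := G.fockProj.projOp_mul_word (γ.drop (i + 1)) gen
    rw [Path.take_finish_src γ i, hi] at e1
    rw [Path.drop_succ_start γ i, hi] at e2
    rw [← e1, ← e2]
    change _ = traceL G (G.fockProj.word (γ.take i) gen * projOp e.src) *
      traceL G (projOp e.tgt * G.fockProj.word (γ.drop (i + 1)) gen)
    rw [traceL_apply, traceL_apply, trace_mul_projOp, trace_projOp_mul]
    rw [e1, e2, mul_smul_comm, smul_mul_assoc, smul_apply, coef_smul, mul_apply_eq_comp,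
      mul_apply_eq_comp, ketbra_apply, map_smul, coef_smul]
    linear_combination coef (G.fockProj.word (γ.take i) gen (ket (Path.triv e.src)))
      (Path.triv e.src) * coef (G.fockProj.word (γ.drop (i + 1)) gen (ket (Path.triv e.tgt)))
      (Path.triv e.tgt) * e.wt_mul_quart_sq
  · rw [if_neg hi, rann_mul_gen, if_neg (Ne.symm hi), add_zero, sub_self, mul_zero, zero_mul]
    simp

end

section

variable {V E : Type*} [Fintype V] {G : WeightedGraph V E} [Fintype E]

/-! ### The transported generators generate a dense subspace -/

namespace VProj

variable {A : Type*} [NormedRing A] [NormedAlgebra ℂ A] [CompleteSpace A] (P : VProj V A)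

lemma cutOps_conj {u : A} (hp : ∀ v, u * P.p v = P.p v * u) (X : G.Dart → A) (e : G.Dart) :
    P.cutOps (fun e => u * X e * u) e = u * P.cutOps X e * u := by
  change P.p e.src * (u * X e * u) * P.p e.tgt = u * (P.p e.src * X e * P.p e.tgt) * u
  calc P.p e.src * (u * X e * u) * P.p e.tgt = (P.p e.src * u) * X e * (u * P.p e.tgt) := by
        simp only [mul_assoc]
    _ = _ := by rw [← hp, hp e.tgt]; simp only [mul_assoc]

lemma word_conj {u : A} (hu : u * u = 1) (hp : ∀ v, u * P.p v = P.p v * u) (X : G.Dart → A)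
    (γ : G.Path) : P.word γ (fun e => u * X e * u) = u * P.word γ X * u := by
  rw [word_eq, word_eq]
  have h : ∀ l : List G.Dart, (l.map (P.cutOps fun e => u * X e * u)).prod
      = u * (l.map (P.cutOps X)).prod * u := by
    intro l
    induction l with
    | nil => simp [hu]
    | cons e l ih =>
      rw [List.map_cons, List.map_cons, List.prod_cons, List.prod_cons, ih, P.cutOps_conj hp]
      calc u * P.cutOps X e * u * (u * (l.map (P.cutOps X)).prod * u)
          = u * P.cutOps X e * (u * u) * (l.map (P.cutOps X)).prod * u := by
            simp only [mul_assoc]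
        _ = _ := by rw [hu, mul_one]; simp only [mul_assoc]
  rw [h, mul_assoc, hp]
  simp only [mul_assoc]

lemma ev_conj {u : A} (hu : u * u = 1) (hp : ∀ v, u * P.p v = P.p v * u) {X : G.Dart → A}
    {ρ : ℝ≥0} (hX : ∀ e, ‖X e‖ ≤ ρ) {a : G.Series} (ha : a.wnorm ρ < ⊤) :
    P.ev (fun e => u * X e * u) a = u * P.ev X a * u := by
  have h := ((P.hasSum_ev hX ha).mul_left u).mul_right u
  rw [← h.tsum_eq, ev]
  refine tsum_congr fun γ => ?_
  rw [P.word_conj hu hp, mul_smul_comm, smul_mul_assoc]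

lemma mul_word_of_start {y : G.Dart → A} (hy : P.cutOps y = y) (e : G.Dart) {γ : G.Path}
    (h : γ.start = e.tgt) : y e * P.word γ y = P.word (Path.cons e γ) y := by
  rw [word_eq, word_eq, Path.cons_darts h, Path.cons_finish, List.map_cons, List.prod_cons, hy,
    mul_assoc]

lemma mul_word_of_ne {y : G.Dart → A} (hy : P.cutOps y = y) (e : G.Dart) {γ : G.Path}
    (h : γ.start ≠ e.tgt) : y e * P.word γ y = 0 := by
  rw [← hy, ← P.cutOps_mul_projOp, ← P.projOp_mul_word, mul_assoc, ← mul_assoc (P.p e.tgt),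
    P.mul_of_ne _ _ h.symm, zero_mul, mul_zero]

end VProj

/-- Invariance under `T` and its adjoint makes the subspace reducing, so the orthogonal projection,
and with it the reflection, commutes with `T`. -/
lemma reflection_commute {H : Type*} [NormedAddCommGroup H] [InnerProductSpace ℂ H]
    [CompleteSpace H] (K : Submodule ℂ H) [K.HasOrthogonalProjection] {T : H →L[ℂ] H}
    (h : ∀ ξ ∈ K, T ξ ∈ K) (h' : ∀ ξ ∈ K, ContinuousLinearMap.adjoint T ξ ∈ K) (ξ : H) :
    K.reflection (T ξ) = T (K.reflection ξ) := by
  have h1 : K.starProjection (T ξ) = T (K.starProjection ξ) := by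
    refine Submodule.eq_starProjection_of_mem_orthogonal
      (h _ (Submodule.starProjection_apply_mem K ξ)) ?_
    rw [← map_sub, Submodule.mem_orthogonal]
    intro η hη
    rw [← ContinuousLinearMap.adjoint_inner_left]
    exact (Submodule.mem_orthogonal K _).1 (Submodule.sub_starProjection_mem_orthogonal ξ) _
      (h' η hη)
  rw [Submodule.reflection_apply, Submodule.reflection_apply, h1, map_sub, map_nsmul]

lemma exists_reflection {H : Type*} [NormedAddCommGroup H] [InnerProductSpace ℂ H]
    [CompleteSpace H] (K : Submodule ℂ H) (hK : IsClosed (K : Set H)) :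
    ∃ u : H →L[ℂ] H, u * u = 1 ∧ ‖u‖ ≤ 1 ∧ (∀ ξ, u ξ = ξ ↔ ξ ∈ K) ∧
      ∀ T : H →L[ℂ] H, (∀ ξ ∈ K, T ξ ∈ K) → (∀ ξ ∈ K, ContinuousLinearMap.adjoint T ξ ∈ K) →
        u * T = T * u := by
  have : CompleteSpace K := hK.completeSpace_coe
  let u : H →L[ℂ] H := K.reflection.toContinuousLinearEquiv
  have hu : ∀ ξ, u ξ = K.reflection ξ := fun _ => rfl
  refine ⟨u, ?_, ContinuousLinearMap.opNorm_le_bound _ zero_le_one fun ξ => ?_, fun ξ => ?_,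
    fun T h h' => ?_⟩
  · ext1 ξ
    exact Submodule.reflection_reflection K ξ
  · rw [hu, LinearIsometryEquiv.norm_map, one_mul]
  · rw [hu]
    exact Submodule.reflection_eq_self_iff ξ
  · ext1 ξ
    exact reflection_commute K h h' ξ

/-- The vectors obtained by applying the monomials in `y` to the vacuum. -/
def wordSpan (y : G.Dart → G.Fock →L[ℂ] G.Fock) : Submodule ℂ G.Fock :=
  (Submodule.span ℂ (Set.range fun γ => G.fockProj.word γ y (vac G))).topologicalClosure

lemma word_vac_mem (y : G.Dart → G.Fock →L[ℂ] G.Fock) (γ : G.Path) :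
    G.fockProj.word γ y (vac G) ∈ wordSpan y :=
  Submodule.le_topologicalClosure _ (Submodule.subset_span ⟨γ, rfl⟩)

lemma apply_mem_wordSpan {y : G.Dart → G.Fock →L[ℂ] G.Fock} {T : G.Fock →L[ℂ] G.Fock}
    (h : ∀ γ, T * G.fockProj.word γ y = 0 ∨ ∃ δ, T * G.fockProj.word γ y = G.fockProj.word δ y)
    {ξ : G.Fock} (hξ : ξ ∈ wordSpan y) : T ξ ∈ wordSpan y := by
  refine map_mem_closure T.continuous hξ fun η hη => ?_
  have h1 : Submodule.span ℂ (Set.range fun γ => G.fockProj.word γ y (vac G)) ≤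
      (Submodule.span ℂ (Set.range fun γ => G.fockProj.word γ y (vac G))).comap T.toLinearMap := by
    refine Submodule.span_le.2 ?_
    rintro _ ⟨γ, rfl⟩
    change T (G.fockProj.word γ y (vac G)) ∈ Submodule.span ℂ _
    rw [← mul_apply_eq_comp]
    rcases h γ with h | ⟨δ, h⟩
    · rw [h]
      exact Submodule.zero_mem _
    · rw [h]
      exact Submodule.subset_span ⟨δ, rfl⟩
  exact h1 hη

lemma gen_apply_mem_wordSpan {y : G.Dart → G.Fock →L[ℂ] G.Fock} (hy : G.fockProj.cutOps y = y)
    (e : G.Dart) {ξ : G.Fock} (hξ : ξ ∈ wordSpan y) : y e ξ ∈ wordSpan y := by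
  refine apply_mem_wordSpan (fun γ => ?_) hξ
  by_cases h : γ.start = e.tgt
  · exact Or.inr ⟨_, G.fockProj.mul_word_of_start hy e h⟩
  · exact Or.inl (G.fockProj.mul_word_of_ne hy e h)

lemma projOp_apply_mem_wordSpan {y : G.Dart → G.Fock →L[ℂ] G.Fock} (v : V) {ξ : G.Fock}
    (hξ : ξ ∈ wordSpan y) : projOp v ξ ∈ wordSpan y := by
  refine apply_mem_wordSpan (fun γ => ?_) hξ
  change G.fockProj.p v * _ = 0 ∨ ∃ δ, G.fockProj.p v * _ = _
  by_cases h : v = γ.start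
  · exact Or.inr ⟨γ, by rw [h, G.fockProj.projOp_mul_word]⟩
  · left
    rw [← G.fockProj.projOp_mul_word, ← mul_assoc, G.fockProj.mul_of_ne _ _ h, zero_mul]

/-- Conjugation by `u` passes through the evaluation of power series and fixes `y`, so the
conjugated generators solve the same equation `X + f(X) = y` in the same ball; `eq_of_add_evF_eq`
says that the solution is unique. -/
lemma mul_gen_of_conj {f : G.Dart → G.Series} {ρ c : ℝ≥0}
    (hx : ‖(gen : G.Dart → G.Fock →L[ℂ] G.Fock)‖ < ρ) (hf : ∀ e, (f e).wnorm ρ < ⊤)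
    (hJ : ∀ e, ∑ w, (jac f e w).wnorm ρ ≤ c) (hc : c < 1)
    {y : G.Dart → G.Fock →L[ℂ] G.Fock} (hyf : y = gen + G.fockProj.evF gen f)
    {u : G.Fock →L[ℂ] G.Fock} (hu : u * u = 1) (hn : ‖u‖ ≤ 1)
    (hp : ∀ v, u * G.fockProj.p v = G.fockProj.p v * u) (hy : ∀ e, u * y e = y e * u) :
    (fun e : G.Dart => u * gen e * u) = gen := by
  set σ : ℝ≥0 := ‖(gen : G.Dart → G.Fock →L[ℂ] G.Fock)‖₊ with hσ
  have hσρ : σ < ρ := hx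
  have hg : ∀ e : G.Dart, ‖(gen e : G.Fock →L[ℂ] G.Fock)‖ ≤ σ := norm_gen_le
  refine G.fockProj.eq_of_add_evF_eq (σ := σ) hσρ ?_ le_rfl hf
    (fun e => (Finset.sum_le_sum fun w _ => Tensor.wnorm_mono hσρ.le _).trans (hJ e)) hc ?_
  · refine (pi_norm_le_iff_of_nonneg σ.2).2 fun e => ?_
    calc ‖u * gen e * u‖ ≤ ‖u‖ * ‖(gen e : G.Fock →L[ℂ] G.Fock)‖ * ‖u‖ := norm_mul₃_le
      _ ≤ 1 * σ * 1 := by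
        refine mul_le_mul (mul_le_mul hn (hg e) (norm_nonneg _) zero_le_one) hn (norm_nonneg _) ?_
        rw [one_mul]
        exact σ.2
      _ = σ := by ring
  · rw [← hyf]
    funext e
    change u * gen e * u + G.fockProj.ev (fun e : G.Dart => u * gen e * u) (f e) = y e
    rw [G.fockProj.ev_conj hu hp hg ((Series.wnorm_mono hσρ.le _).trans_lt (hf e)), ← add_mul,
      ← mul_add]
    have h1 : gen e + G.fockProj.ev gen (f e) = y e := (congrFun hyf e).symm
    rw [h1, hy, mul_assoc, hu, mul_one]

/-- The subspace is invariant under the self-adjoint family `y`. To see that it is invariant under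
the generators as well, no inverse series for `y` in terms of `x` is needed: commutation of the
reflection passes from `y` to `x` by uniqueness. -/
lemma wordSpan_eq_top {f : G.Dart → G.Series} {ρ c : ℝ≥0}
    (hx : ‖(gen : G.Dart → G.Fock →L[ℂ] G.Fock)‖ < ρ) (hf : ∀ e, (f e).wnorm ρ < ⊤)
    (hJ : ∀ e, ∑ w, (jac f e w).wnorm ρ ≤ c) (hc : c < 1)
    {y : G.Dart → G.Fock →L[ℂ] G.Fock} (hyf : y = gen + G.fockProj.evF gen f)
    (hyc : G.fockProj.cutOps y = y)
    (hya : ∀ e, ContinuousLinearMap.adjoint (y e) = y e.op) : wordSpan y = ⊤ := by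
  have hcl : IsClosed (wordSpan y : Set G.Fock) := Submodule.isClosed_topologicalClosure _
  obtain ⟨u, hu, hn, hK, hT⟩ := exists_reflection (wordSpan y) hcl
  have hp : ∀ v, u * projOp v = projOp v * u := fun v =>
    hT _ (fun _ hη => projOp_apply_mem_wordSpan v hη) fun η hη => by
      rw [adjoint_projOp]
      exact projOp_apply_mem_wordSpan v hη
  have hy : ∀ e, u * y e = y e * u := fun e =>
    hT _ (fun _ hη => gen_apply_mem_wordSpan hyc e hη) fun η hη => by
      rw [hya]
      exact gen_apply_mem_wordSpan hyc e.op hη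
  have hX := mul_gen_of_conj hx hf hJ hc hyf hu hn hp hy
  refine eq_top_of_gen_mem _ hcl (fun v => ?_) fun e ξ hξ => ?_
  · have h1 : projOp v (vac G) ∈ wordSpan y := by
      have := word_vac_mem y (Path.triv v)
      rwa [VProj.word_triv] at this
    rw [projOp_vac] at h1
    have h2 : ((Real.sqrt (G.wt v) : ℝ) : ℂ) ≠ 0 :=
      Complex.ofReal_ne_zero.2 (Real.sqrt_pos.2 (G.wt_pos v)).ne'
    exact (Submodule.smul_mem_iff _ h2).1 h1
  · have h2 : u * gen e = gen e * u := by
      have h3 : u * gen e * u = gen e := congrFun hX e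
      calc u * gen e = u * gen e * u * u := by rw [mul_assoc (u * gen e), hu, mul_one]
        _ = gen e * u := by rw [h3]
    rw [← hK, ← mul_apply_eq_comp, h2, mul_apply_eq_comp, (hK ξ).2 hξ]

/-- An operator in the left algebra that annihilates the monomials in `y` under the trace is
zero. -/
lemma eq_zero_of_trace_mul_word {y : G.Dart → G.Fock →L[ℂ] G.Fock} (hy : wordSpan y = ⊤)
    (hyN : ∀ e, y e ∈ tracialAlg G) {ζ : G.Fock →L[ℂ] G.Fock} (hζ : ζ ∈ leftAlg G)
    (h : ∀ γ, trace (ζ * G.fockProj.word γ y) = 0) : ζ = 0 := by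
  have h1 : ∀ ξ ∈ wordSpan y, inner ℂ (ContinuousLinearMap.adjoint ζ (vac G)) ξ = 0 := by
    intro ξ hξ
    have hcl : IsClosed {ξ : G.Fock | inner ℂ (ContinuousLinearMap.adjoint ζ (vac G)) ξ = (0 : ℂ)} :=
      isClosed_eq (by fun_prop) continuous_const
    refine closure_minimal (fun η hη => ?_) hcl hξ
    have h2 : Submodule.span ℂ (Set.range fun γ => G.fockProj.word γ y (vac G)) ≤
        LinearMap.ker (innerSL ℂ (ContinuousLinearMap.adjoint ζ (vac G))).toLinearMap := by
      refine Submodule.span_le.2 ?_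
      rintro _ ⟨γ, rfl⟩
      change inner ℂ (ContinuousLinearMap.adjoint ζ (vac G)) (G.fockProj.word γ y (vac G)) = 0
      rw [ContinuousLinearMap.adjoint_inner_left, ← mul_apply_eq_comp, ← trace_eq_inner, h]
      exact mul_mem hζ (leftAlg_of_tracial (G.fockProj.word_mem projOp_mem_tracialAlg hyN γ))
    exact h2 hη
  -- The vector is orthogonal to a dense subspace, hence to itself.
  have h2 : ContinuousLinearMap.adjoint ζ (vac G) = 0 :=
    inner_self_eq_zero.1 (h1 _ (hy ▸ Submodule.mem_top))
  have h3 := eq_zero_of_apply_vac (adjoint_mem_leftAlg hζ) h2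
  rw [← ContinuousLinearMap.adjoint_adjoint ζ, h3, map_zero]

end

section

variable {V E : Type*} [Fintype V] {G : WeightedGraph V E} [Fintype E]

/-! ### Cyclic gradients -/

lemma grad_add (a b : G.Series) (e : G.Dart) : grad (a + b) e = grad a e + grad b e := by
  funext γ
  simp only [grad, Series.diff_add, Tensor.mult, Tensor.flip, Pi.add_apply, Finset.sum_add_distrib]

lemma grad_smul (c : ℂ) (a : G.Series) (e : G.Dart) : grad (c • a) e = c • grad a e := by
  funext γ
  simp only [grad, Series.diff_smul, Tensor.mult, Tensor.flip, Pi.smul_apply, Finset.smul_sum]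

lemma grad_sub (a b : G.Series) (e : G.Dart) : grad (a - b) e = grad a e - grad b e := by
  rw [sub_eq_add_neg, ← neg_one_smul ℂ b, grad_add, grad_smul, neg_one_smul, ← sub_eq_add_neg]

lemma grad_sum {ι : Type*} (s : Finset ι) (a : ι → G.Series) (e : G.Dart) :
    grad (∑ i ∈ s, a i) e = ∑ i ∈ s, grad (a i) e := by
  classical
  induction s using Finset.induction_on with
  | empty => rw [Finset.sum_empty, Finset.sum_empty, ← zero_smul ℂ (0 : G.Series), grad_smul,
      zero_smul, zero_smul]
  | insert i s hi ih => rw [Finset.sum_insert hi, Finset.sum_insert hi, grad_add, ih]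

lemma Path.rev_take (γ : G.Path) (i : ℕ) :
    γ.rev.take i = (γ.drop (γ.length - i)).rev := by
  refine ext_darts ?_ ?_
  · rw [take_start, rev_start, rev_start, drop_finish]
  · rw [take_darts, rev_darts, rev_darts, drop_darts, List.take_reverse, List.map_drop,
      List.length_map]
    rfl

lemma Path.rev_drop (γ : G.Path) (i : ℕ) :
    γ.rev.drop i = (γ.take (γ.length - i)).rev := by
  refine ext_darts ?_ ?_
  · rw [drop_start, rev_take γ i, rev_finish, drop_start, rev_start]
  · rw [drop_darts, rev_darts, rev_darts, take_darts, List.drop_reverse, List.map_take,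
      List.length_map]
    rfl

/-- Reversal turns a cut at an edge into a cut at its opposite and exchanges the two pieces. For `g
= g^*` this makes `y` a self-adjoint family, in the sense that the adjoint of `y_ε` is `y_{ε^op}`.
-/
lemma adj_grad (a : G.Series) (e : G.Dart) :
    Series.adj (grad a e) = grad (Series.adj a) e.op := by
  funext γ
  change conj (∑ i ∈ Finset.range (γ.rev.length + 1), Series.diff e.op a (γ.rev.drop i)
    (γ.rev.take i)) = ∑ i ∈ Finset.range (γ.length + 1),
      Series.diff e.op.op (Series.adj a) (γ.drop i) (γ.take i)
  rw [Path.rev_length, map_sum, ← Finset.sum_range_reflect]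
  refine Finset.sum_congr rfl fun i hi => ?_
  have hi' : i ≤ γ.length := Nat.lt_succ_iff.1 (Finset.mem_range.1 hi)
  have h1 : γ.length + 1 - 1 - i = γ.length - i := by omega
  have h2 : γ.length - (γ.length - i) = i := by omega
  rw [Dart.op_op, Series.diff_adj, h1, Path.rev_take,
    Path.rev_drop, h2]

open Classical in
lemma mono_mul_mono (α β : G.Path) : Series.mul (Series.mono α) (Series.mono β) =
    if h : α.finish = β.start then Series.mono (α.append β h) else 0 := by
  funext γ
  have key : ∀ i, γ.take i = α → γ.drop i = β → ∃ h : α.finish = β.start, γ = α.append β h := by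
    rintro i rfl rfl
    have h : (γ.take i).finish = (γ.drop i).start := rfl
    exact ⟨h, Path.ext_take_drop (i := i) (j := (γ.take i).length)
      (Path.append_take _ _ h).symm (Path.append_drop _ _ h).symm⟩
  have hz : (¬ ∃ h : α.finish = β.start, γ = α.append β h) →
      Series.mul (Series.mono α) (Series.mono β) γ = 0 := fun h =>
    Finset.sum_eq_zero fun i _ => by
      simp only [Series.mono]
      split_ifs with h1 h2
      · exact absurd (key i h1 h2) h
      all_goals simp
  by_cases h : α.finish = β.start
  · rw [dif_pos h]
    by_cases hγ : γ = α.append β h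
    · subst hγ
      have hl := Path.length_append α β h
      rw [Series.mono, if_pos rfl, Series.mul, Finset.sum_eq_single α.length]
      · rw [Path.append_take, Path.append_drop, Series.mono, Series.mono, if_pos rfl, if_pos rfl,
          one_mul]
      · intro i hi hne
        rw [Series.mono, if_neg, zero_mul]
        intro h1
        have h2 := congrArg Path.length h1
        rw [Path.length_take (Nat.lt_succ_iff.1 (Finset.mem_range.1 hi))] at h2
        exact hne h2
      · intro h1
        exact absurd (Finset.mem_range.2 (by omega)) h1
    · rw [hz fun ⟨_, h'⟩ => hγ h', Series.mono, if_neg hγ]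
  · rw [dif_neg h]
    exact hz fun ⟨h', _⟩ => h h'

open Classical in
lemma diff_mono (w : G.Dart) (q : G.Path) : Series.diff w (Series.mono q) =
    ∑ i : Fin q.length, if q.darts[(i : ℕ)]'i.2 = w then
      (fun γ δ => Series.mono (q.drop (i + 1)) δ * Series.mono (q.take i) γ : G.Tensor) else 0 := by
  funext γ δ
  rw [Finset.sum_apply, Finset.sum_apply]
  have key : ∀ i : Fin q.length, q.darts[(i : ℕ)]'i.2 = w → γ = q.take i → δ = q.drop (i + 1) →
      ∃ h : γ.finish = w.src ∧ δ.start = w.tgt, γ.join w δ h = q := by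
    rintro i rfl rfl rfl
    exact ⟨⟨Path.take_finish_src q i, Path.drop_succ_start q i⟩, Path.join_take_drop q i⟩
  have hz : ∀ i : Fin q.length, ¬ (q.darts[(i : ℕ)]'i.2 = w ∧ γ = q.take i ∧ δ = q.drop (i + 1)) →
      (if q.darts[(i : ℕ)]'i.2 = w then (fun γ δ => Series.mono (q.drop (i + 1)) δ *
        Series.mono (q.take i) γ : G.Tensor) else 0) γ δ = 0 := by
    intro i hi
    by_cases h1 : q.darts[(i : ℕ)]'i.2 = w
    · rw [if_pos h1]
      simp only [Series.mono]
      split_ifs with h2 h3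
      · exact absurd ⟨h1, h3, h2⟩ hi
      all_goals simp
    · rw [if_neg h1]
      rfl
  by_cases h : ∃ h : γ.finish = w.src ∧ δ.start = w.tgt, γ.join w δ h = q
  · obtain ⟨h, rfl⟩ := h
    have hl : γ.length < (γ.join w δ h).length := by rw [Path.join_length]; omega
    rw [Series.diff, dif_pos h, Series.mono, if_pos rfl, Finset.sum_eq_single ⟨γ.length, hl⟩]
    · rw [if_pos (Path.getElem_join γ δ w h hl), Path.take_join, Path.drop_join, Series.mono,
        Series.mono, if_pos rfl, if_pos rfl, one_mul]
    · intro i _ hne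
      refine hz i fun hi => hne (Fin.ext ?_)
      have h2 := congrArg Path.length hi.2.1
      rw [Path.length_take i.2.le] at h2
      exact h2.symm
    · simp
  · rw [Finset.sum_eq_zero fun i _ => hz i fun hi => h (key i hi.1 hi.2.1 hi.2.2), Series.diff]
    split_ifs with h1
    · rw [Series.mono, if_neg fun h2 => h ⟨h1, h2⟩]
    · rfl

open Classical in
lemma grad_mono (e : G.Dart) (q : G.Path) : grad (Series.mono q) e =
    ∑ i : Fin q.length, if q.darts[(i : ℕ)]'i.2 = e.op then
      Series.mul (Series.mono (q.drop (i + 1))) (Series.mono (q.take i)) else 0 := by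
  have h1 : ∀ i : Fin q.length, (if q.darts[(i : ℕ)]'i.2 = e.op then
      Series.mul (Series.mono (q.drop (i + 1))) (Series.mono (q.take i)) else 0) =
      Tensor.mult (Tensor.flip (if q.darts[(i : ℕ)]'i.2 = e.op then
      (fun γ δ => Series.mono (q.drop (i + 1)) δ * Series.mono (q.take i) γ : G.Tensor)
        else 0)) := by
    intro i
    split_ifs
    · rfl
    · funext γ
      exact (Finset.sum_eq_zero fun _ _ => rfl).symm
  rw [grad, diff_mono, Finset.sum_congr rfl fun i _ => h1 i]
  funext γ
  rw [Finset.sum_apply]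
  simp only [Tensor.mult, Tensor.flip, Finset.sum_apply]
  rw [Finset.sum_comm]

lemma adj_var (e : G.Dart) : Series.adj (Series.var e) = Series.var e.op := by
  classical
  have h : (Path.single e).rev = Path.single e.op :=
    Path.ext_darts rfl rfl
  funext γ
  simp only [Series.adj, Series.var, Series.mono]
  by_cases hγ : γ = Path.single e.op
  · rw [if_pos hγ, hγ, ← h, Path.rev_rev, if_pos rfl, map_one]
  · rw [if_neg hγ, if_neg fun h' => hγ ?_, map_zero]
    rw [← h, ← h', Path.rev_rev]

open Classical in
lemma grad_adj_var_mul_var (e f : G.Dart) :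
    grad (Series.mul (Series.adj (Series.var f)) (Series.var f)) e =
      (if f.op = e.op then Series.var e else 0) + if f = e.op then Series.var e else 0 := by
  have hc : (Path.single f.op).finish = (Path.single f).start := rfl
  rw [adj_var, Series.var, Series.var, mono_mul_mono, dif_pos hc, grad_mono]
  refine (Fin.sum_univ_two _).trans ?_
  have h1 : Series.mul (Series.mono (((Path.single f.op).append (Path.single f) hc).drop 1))
      (Series.mono (((Path.single f.op).append (Path.single f) hc).take 0)) = Series.var f := by
    rw [mono_mul_mono, dif_pos (by rfl)]
    exact congrArg Series.mono (Path.ext_darts rfl rfl)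
  have h2 : Series.mul (Series.mono (((Path.single f.op).append (Path.single f) hc).drop 2))
      (Series.mono (((Path.single f.op).append (Path.single f) hc).take 1)) = Series.var f.op := by
    rw [mono_mul_mono, dif_pos (by rfl)]
    exact congrArg Series.mono (Path.ext_darts rfl rfl)
  change (if f.op = e.op then Series.mul (Series.mono
      (((Path.single f.op).append (Path.single f) hc).drop 1)) (Series.mono
      (((Path.single f.op).append (Path.single f) hc).take 0)) else 0) +
    (if f = e.op then Series.mul (Series.mono
      (((Path.single f.op).append (Path.single f) hc).drop 2)) (Series.mono
      (((Path.single f.op).append (Path.single f) hc).take 1)) else 0) = _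
  rw [h1, h2]
  congr 1
  · split_ifs with h
    · rw [Dart.op_injective h]
    · rfl
  · split_ifs with h
    · rw [h]; rfl
    · rfl

/-- The edges `e` and `e.op` contribute equally and cancel the factor one half. A loop is its own
opposite, and its single term is hit twice by the cyclic gradient, so no case distinction arises. -/
lemma grad_quadPotential (e : G.Dart) :
    grad (quadPotential G) e = (e.wt : ℂ) • Series.var e := by
  classical
  rw [quadPotential, grad_smul, grad_sum]
  simp only [grad_smul, grad_adj_var_mul_var, Dart.op_inj, smul_add, smul_ite, smul_zero,
    Finset.sum_add_distrib, Finset.sum_ite_eq', Finset.mem_univ, if_true, Dart.op_wt]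
  rw [← add_smul, add_halves, one_smul]

end

section

variable {V E : Type*} [Fintype V] {G : WeightedGraph V E} [Fintype E]

/-! ### The transport equation on the Fock space -/

lemma trTerm_gen (g : G.Series) (m : ℕ) : G.fockTrace.trTerm gen g m = traceTerm g m := by
  have h : ∀ γ, G.fockTrace.τ (G.fockProj.word γ gen) = trace (Series.monoOp gen γ) := fun γ => by
    rw [word_eq_monoOp cutOps_gen]
    exact traceL_apply _
  have h1 : ∀ u : G.Tensor, G.fockTrace.idT gen u = Tensor.idTrace u := fun u => by
    funext γ
    exact tsum_congr fun δ => by rw [h]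
  have h2 : ∀ u : G.Tensor, G.fockTrace.Tid gen u = Tensor.traceId u := fun u => by
    funext γ
    exact tsum_congr fun δ => by rw [h]
  rw [TraceData.trTerm, h1, h2]
  rfl

lemma Series.summable_of_wnorm {ι : Type*} {ρ : ℝ≥0} (hρ : 0 < ρ) {a : ι → G.Series}
    (h : ∑' i, (a i).wnorm ρ < ⊤) : Summable a := by
  refine Pi.summable.2 fun γ => Summable.of_enorm fun htop => ?_
  have h1 : (∑' i, ‖a i γ‖ₑ) * (ρ : ℝ≥0∞) ^ γ.length ≤ ∑' i, (a i).wnorm ρ := by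
    rw [← ENNReal.tsum_mul_right]
    exact ENNReal.tsum_le_tsum fun i =>
      ENNReal.le_tsum (f := fun γ : G.Path => ‖a i γ‖ₑ * (ρ : ℝ≥0∞) ^ γ.length) γ
  rw [htop, ENNReal.top_mul (pow_ne_zero _ (ENNReal.coe_ne_zero.2 hρ.ne'))] at h1
  exact absurd (h1.trans_lt h) (lt_irrefl _)

lemma logTerm_gen {g : G.Series} {ρ c : ℝ≥0} (hρ : 0 < ρ)
    (hx : ‖(gen : G.Dart → G.Fock →L[ℂ] G.Fock)‖ ≤ ρ)
    (hJ : ∀ e, ∑ w, (jac (grad g) e w).wnorm ρ ≤ c) (hc : c < 1) :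
    G.fockTrace.logTerm gen g =
      ∑' m : ℕ, ((-1 : ℂ) ^ (m + 1) / ((m : ℂ) + 1)) • traceTerm g (m + 1) := by
  have h := TraceData.tsum_wnorm_trTerm_lt_top (D := G.fockTrace) hx hJ hc
  simp only [trTerm_gen] at h
  funext γ
  rw [tsum_apply (Series.summable_of_wnorm hρ h), TraceData.logTerm]
  simp only [trTerm_gen]

lemma trace_adjoint (T : G.Fock →L[ℂ] G.Fock) :
    trace (ContinuousLinearMap.adjoint T) = conj (trace T) := by
  rw [trace_eq, trace_eq, map_sum]
  refine Finset.sum_congr rfl fun v _ => ?_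
  rw [map_mul, Complex.conj_ofReal, ← inner_ket_left, ← inner_ket_left,
    ContinuousLinearMap.adjoint_inner_right, inner_conj_symm]

lemma adjoint_ev {y : G.Dart → G.Fock →L[ℂ] G.Fock}
    (hya : ∀ e, ContinuousLinearMap.adjoint (y e) = y e.op) {ρ : ℝ≥0} (hy : ∀ e, ‖y e‖ ≤ ρ)
    {a : G.Series} (ha : a.wnorm ρ < ⊤) :
    ContinuousLinearMap.adjoint (G.fockProj.ev y a) = G.fockProj.ev y (Series.adj a) := by
  have h := VProj.star_ev (P := G.fockProj) (fun v => adjoint_projOp v) hy ha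
  rw [ContinuousLinearMap.star_eq_adjoint] at h
  rw [h]
  congr 1
  funext e
  exact hya e.op

lemma Series.IsPoly.wnorm_lt_top {a : G.Series} (ha : a.IsPoly) (ρ : ℝ≥0) : a.wnorm ρ < ⊤ := by
  rw [Series.wnorm, tsum_eq_sum (s := ha.toFinset) fun γ hγ => ?_]
  · exact ENNReal.sum_lt_top.2 fun γ _ =>
      ENNReal.mul_lt_top enorm_lt_top (ENNReal.pow_lt_top ENNReal.coe_lt_top)
  · have h : a γ = 0 := by
      by_contra h
      exact hγ ((Set.Finite.mem_toFinset ha).2 h)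
    rw [h, enorm_zero, zero_mul]

lemma Series.IsPoly.adj {a : G.Series} (ha : a.IsPoly) : (Series.adj a).IsPoly := by
  refine (ha.image Path.rev).subset fun γ hγ => ⟨γ.rev, fun h => hγ ?_, Path.rev_rev γ⟩
  change conj (a γ.rev) = 0
  rw [h, map_zero]

lemma adj_adj (a : G.Series) : Series.adj (Series.adj a) = a := by
  funext γ
  change conj (conj (a γ.rev.rev)) = _
  rw [Complex.conj_conj, Path.rev_rev]

lemma Series.IsPoly.finite_diff {a : G.Series} (ha : a.IsPoly) (e : G.Dart) :
    {p : G.Path × G.Path | Series.diff e a p.1 p.2 ≠ 0}.Finite := by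
  refine (ha.biUnion fun γ _ => Set.finite_range fun i : Fin γ.length =>
    (γ.take i, γ.drop (i + 1))).subset ?_
  rintro ⟨γ, δ⟩ hp
  have h : γ.finish = e.src ∧ δ.start = e.tgt := by
    by_contra h
    exact hp (Series.diff_of_not h)
  have hl : γ.length < (γ.join e δ h).length := by rw [Path.join_length]; omega
  refine Set.mem_biUnion (x := γ.join e δ h) (fun h0 => hp ?_) ⟨⟨γ.length, hl⟩, ?_⟩
  · exact (dif_pos h).trans h0
  · exact Prod.ext (Path.take_join _ _ _ h) (Path.drop_join _ _ _ h)

variable {y : G.Dart → G.Fock →L[ℂ] G.Fock} {s : ℝ≥0}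

lemma finsum_law (hy : ‖y‖ ≤ s) (hyc : G.fockProj.cutOps y = y) {q : G.Series} (hq : q.IsPoly)
    (e : G.Dart) : ∑ᶠ p : G.Path × G.Path, Series.diff e q p.1 p.2 *
      (law y (Series.mono p.1) * law y (Series.mono p.2)) =
        traceTrace G (G.fockProj.evT y (Series.diff e q)) := by
  have hu : (Series.diff e q).wnorm s < ⊤ :=
    (Series.wnorm_diff_le (lt_add_one s) e _).trans_lt
      (ENNReal.mul_lt_top ENNReal.coe_lt_top (hq.wnorm_lt_top _))
  have h1 := TraceData.hasSum_tr2_evB (D := G.fockTrace) hy hy hu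
  have hl : ∀ γ, law y (Series.mono γ) = G.fockTrace.τ (G.fockProj.word γ y) := fun γ => by
    rw [law, ← ev_eq_eval hyc, VProj.ev_mono]
    exact (traceL_apply _).symm
  simp only [hl]
  rw [← tsum_eq_finsum (L := SummationFilter.unconditional _)]
  · exact h1.tsum_eq
  · exact (hq.finite_diff e).subset fun p hp h0 => hp (by simp only [h0, zero_mul])

/-- Taking adjoints reverses words and exchanges the legs of the free difference quotient. It is
needed because the Schwinger-Dyson equation contains the adjoint of the cyclic gradient. -/
lemma conj_traceTrace (hy : ‖y‖ ≤ s) (hya : ∀ e, ContinuousLinearMap.adjoint (y e) = y e.op)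
    {q : G.Series} (hq : q.IsPoly) (e : G.Dart) :
    conj (traceTrace G (G.fockProj.evT y (Series.diff e q))) =
      traceTrace G (G.fockProj.evT y (Series.diff e.op (Series.adj q))) := by
  have hu : ∀ {q : G.Series}, q.IsPoly → ∀ e, (Series.diff e q).wnorm s < ⊤ := fun hq e =>
    (Series.wnorm_diff_le (lt_add_one s) e _).trans_lt
      (ENNReal.mul_lt_top ENNReal.coe_lt_top (hq.wnorm_lt_top _))
  have h1 := TraceData.hasSum_tr2_evB (D := G.fockTrace) hy hy (hu hq e)
  have h2 := TraceData.hasSum_tr2_evB (D := G.fockTrace) hy hy (hu hq.adj e.op)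
  have hc : ∀ γ, conj (G.fockTrace.τ (G.fockProj.word γ y)) =
      G.fockTrace.τ (G.fockProj.word γ.rev y) := fun γ => by
    have h3 := VProj.star_word (P := G.fockProj) (fun v => adjoint_projOp v) γ y
    have h4 : (fun e : G.Dart => star (y e.op)) = y := funext fun e => hya e.op
    rw [h4, ContinuousLinearMap.star_eq_adjoint] at h3
    change conj (traceL G _) = traceL G _
    rw [traceL_apply, traceL_apply, ← trace_adjoint, h3]
  have h3 := h1.map (starRingEnd ℂ).toAddMonoidHom Complex.continuous_conj
  let φ : G.Path × G.Path ≃ G.Path × G.Path :=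
    (Equiv.prodComm _ _).trans ((Path.revEquiv G).prodCongr (Path.revEquiv G))
  rw [← φ.hasSum_iff] at h2
  refine h3.unique ?_
  have h4 : (fun p : G.Path × G.Path => Series.diff e.op (Series.adj q) p.1 p.2 *
      (G.fockTrace.τ (G.fockProj.word p.1 y) * G.fockTrace.τ (G.fockProj.word p.2 y))) ∘ φ =
      (starRingEnd ℂ).toAddMonoidHom ∘ fun p : G.Path × G.Path => Series.diff e q p.1 p.2 *
        (G.fockTrace.τ (G.fockProj.word p.1 y) * G.fockTrace.τ (G.fockProj.word p.2 y)) := by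
    funext p
    change Series.diff e.op (Series.adj q) p.2.rev p.1.rev *
      (G.fockTrace.τ (G.fockProj.word p.2.rev y) * G.fockTrace.τ (G.fockProj.word p.1.rev y)) =
      conj (Series.diff e q p.1 p.2 *
        (G.fockTrace.τ (G.fockProj.word p.1 y) * G.fockTrace.τ (G.fockProj.word p.2 y)))
    rw [map_mul, map_mul, hc, hc, Series.diff_adj, Dart.op_op, Path.rev_rev, Path.rev_rev]
    ring
  rw [h4] at h2
  exact h2

/-- The Schwinger-Dyson equation, in terms of the conjugate variables. -/
lemma schwingerDyson_iff {s' : ℝ≥0} {W : G.Series} (hs : s < s') (hW : W.wnorm s' < ⊤)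
    (hy : ‖y‖ ≤ s) (hyc : G.fockProj.cutOps y = y) (hyN : ∀ e, y e ∈ tracialAlg G)
    (hya : ∀ e, ContinuousLinearMap.adjoint (y e) = y e.op) :
    SchwingerDyson (law y) (quadPotential G + W) ↔ ∀ (e : G.Dart) (q : G.Series), q.IsPoly →
      traceL G (((e.wt : ℂ) • y e.op + G.fockProj.ev y (grad W e.op)) * G.fockProj.ev y q) =
        traceTrace G (G.fockProj.evT y (Series.diff e q)) := by
  have hy' : ∀ e, ‖y e‖ ≤ s := fun e => (norm_le_pi_norm y e).trans hy
  have hgW : ∀ e, (grad W e).wnorm s < ⊤ := fun e =>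
    (Series.wnorm_grad_le hs e W).trans_lt (ENNReal.mul_lt_top ENNReal.coe_lt_top hW)
  have hv : ∀ e : G.Dart, ((e.wt : ℂ) • Series.var e : G.Series).wnorm s < ⊤ := fun e => by
    rw [Series.wnorm_smul]
    exact ENNReal.mul_lt_top enorm_lt_top (VProj.wnorm_var s e)
  have hgU : ∀ e : G.Dart, grad (quadPotential G + W) e = (e.wt : ℂ) • Series.var e + grad W e :=
    fun e => by rw [grad_add, grad_quadPotential]
  have hU : ∀ e, (grad (quadPotential G + W) e).wnorm s < ⊤ := fun e => by
    rw [hgU]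
    exact (Series.wnorm_add_le _ _ _).trans_lt (ENNReal.add_lt_top.2 ⟨hv e, hgW e⟩)
  have hξ : ∀ e : G.Dart, G.fockProj.ev y (grad (quadPotential G + W) e) =
      (e.wt : ℂ) • y e + G.fockProj.ev y (grad W e) := fun e => by
    rw [hgU, G.fockProj.ev_add hy' (hv e) (hgW e), VProj.ev_smul, VProj.ev_var, hyc]
  have hN : ∀ a : G.Series, G.fockProj.ev y a ∈ tracialAlg G := fun a =>
    G.fockProj.ev_mem isClosed_tracialAlg projOp_mem_tracialAlg hyN a
  have key : ∀ (e : G.Dart) (q : G.Series), q.IsPoly →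
      conj (law y (Series.mul (Series.adj (grad (quadPotential G + W) e)) q)) =
        traceL G (((e.wt : ℂ) • y e + G.fockProj.ev y (grad W e)) *
          G.fockProj.ev y (Series.adj q)) := by
    intro e q hq
    rw [law, ← ev_eq_eval hyc, G.fockProj.ev_mul hy' (by rw [Series.wnorm_adj]; exact hU e)
      (hq.wnorm_lt_top s), ← trace_adjoint, adjoint_mul, adjoint_ev hya hy' (hq.wnorm_lt_top s),
      adjoint_ev hya hy' (by rw [Series.wnorm_adj]; exact hU e), adj_adj, ← hξ,
      trace_mul_comm (hN _) (hN _), traceL_apply]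
  -- Conjugating both sides moves the adjoint from the potential to the test polynomial. Since `q`
  -- ranges over all polynomials, it may then be replaced by its adjoint, and `e` by its opposite.
  have key2 : ∀ (e : G.Dart) (q : G.Series), q.IsPoly →
      (law y (Series.mul (Series.adj (grad (quadPotential G + W) e)) q) =
        ∑ᶠ p : G.Path × G.Path, Series.diff e q p.1 p.2 *
          (law y (Series.mono p.1) * law y (Series.mono p.2)) ↔
        traceL G (((e.wt : ℂ) • y e + G.fockProj.ev y (grad W e)) *
          G.fockProj.ev y (Series.adj q)) =
        traceTrace G (G.fockProj.evT y (Series.diff e.op (Series.adj q)))) := by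
    intro e q hq
    rw [finsum_law hy hyc hq, ← key e q hq, ← conj_traceTrace hy hya hq]
    exact (starRingEnd ℂ).injective.eq_iff.symm
  refine ⟨fun h e q hq => ?_, fun h e q hq => (key2 e q hq).2 ?_⟩
  · have h1 := (key2 e.op (Series.adj q) hq.adj).1 (h e.op (Series.adj q) hq.adj)
    rwa [adj_adj, Dart.op_op, Dart.op_wt] at h1
  · have h1 := h e.op (Series.adj q) hq.adj
    rwa [Dart.op_op, Dart.op_wt] at h1

end

section

variable {V E : Type*} [Fintype V] {G : WeightedGraph V E} [Fintype E]

/-! ### Transport -/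

lemma tsum_normR_traceTerm_lt_top {R : ℝ} (hR0 : 0 ≤ R) (hR : ∀ e : G.Dart, ‖gen e‖ < R)
    {g : G.Series} (hJ : TMatrix.norm R (jac (grad g)) < 1) :
    ∑' m : ℕ, (((-1 : ℂ) ^ (m + 1) / ((m : ℂ) + 1)) • traceTerm g (m + 1)).normR R < ⊤ := by
  have hx : ‖(gen : G.Dart → G.Fock →L[ℂ] G.Fock)‖ ≤ R.toNNReal := by
    rw [Real.coe_toNNReal _ hR0]
    exact (pi_norm_le_iff_of_nonneg hR0).2 fun e => (hR e).le
  have hJ' : ∀ e, ∑ w, (jac (grad g) e w).wnorm R.toNNReal ≤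
      ((TMatrix.norm R (jac (grad g))).toNNReal : ℝ≥0∞) := fun e => by
    rw [ENNReal.coe_toNNReal (hJ.trans ENNReal.one_lt_top).ne]
    exact sum_wnorm_jac_le R g e
  have hc : (TMatrix.norm R (jac (grad g))).toNNReal < 1 := by
    rwa [← ENNReal.coe_lt_coe, ENNReal.coe_toNNReal (hJ.trans ENNReal.one_lt_top).ne]
  have h := TraceData.tsum_wnorm_trTerm_lt_top (D := G.fockTrace) hx hJ' hc
  simp only [trTerm_gen] at h
  exact (ENNReal.tsum_le_tsum fun m => Series.normR_le_wnorm R _).trans_lt h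

variable {g W : G.Series} {ρ ρ' c s s' : ℝ≥0}

lemma add_evF_gen (hx : ‖(gen : G.Dart → G.Fock →L[ℂ] G.Fock)‖ ≤ ρ)
    (hf : ∀ e, (grad g e).wnorm ρ < ⊤) :
    gen + G.fockProj.evF gen (grad g) = fun e => Series.eval gen (shift g e) := by
  funext e
  rw [← ev_eq_eval cutOps_gen, shift,
    G.fockProj.ev_add (fun e => (norm_gen_le e).trans hx) (VProj.wnorm_var ρ e) (hf e),
    VProj.ev_var, cutOps_gen]
  rfl

lemma cutOps_add_evF_gen (hx : ‖(gen : G.Dart → G.Fock →L[ℂ] G.Fock)‖ ≤ ρ)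
    (hf : ∀ e, (grad g e).wnorm ρ < ⊤) :
    G.fockProj.cutOps (gen + G.fockProj.evF gen (grad g)) =
      gen + G.fockProj.evF gen (grad g) := by
  rw [G.fockProj.cutOps_add_evF hx hf, add_evF_gen hx hf]
  funext e
  exact ev_eq_eval cutOps_gen _

lemma adjoint_add_evF_gen (hx : ‖(gen : G.Dart → G.Fock →L[ℂ] G.Fock)‖ ≤ ρ)
    (hf : ∀ e, (grad g e).wnorm ρ < ⊤) (hga : g.adj = g) (e : G.Dart) :
    ContinuousLinearMap.adjoint ((gen + G.fockProj.evF gen (grad g) : G.Dart → G.Fock →L[ℂ] G.Fock) e) =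
      (gen + G.fockProj.evF gen (grad g) : G.Dart → G.Fock →L[ℂ] G.Fock) e.op := by
  have h := adjoint_ev (y := gen) adjoint_gen (fun e => (norm_gen_le e).trans hx) (hf e)
  rw [adj_grad, hga] at h
  rw [Pi.add_apply, map_add, adjoint_gen]
  exact congrArg _ h

/-- The representing family `ζ` is annihilated by all monomials in `y` under the trace if and only
if it is zero, by density of those monomials, and it is zero if and only if the transport equation
holds. -/
lemma schwingerDyson_law_iff (hx : ‖(gen : G.Dart → G.Fock →L[ℂ] G.Fock)‖ < ρ) (hρ : ρ < ρ')
    (hg : g.wnorm ρ' < ⊤) (hga : g.adj = g)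
    (hJ : ∀ e, ∑ w, (jac (grad g) e w).wnorm ρ ≤ c) (hc : c < 1)
    (hY : ∀ e, (shift g e).wnorm ρ ≤ s) (hs : s < s') (hW : W.wnorm s' < ⊤) :
    SchwingerDyson (law (gen + G.fockProj.evF gen (grad g))) (quadPotential G + W) ↔
      ∀ e, G.fockProj.ev gen (grad (Series.number g +
        (1 / 2 : ℂ) • dot (grad g) (TMatrix.act TMatrix.M (grad g)) + W.subst (shift g) +
        G.fockTrace.logTerm gen g) e) = 0 := by
  have hf : ∀ e, (grad g e).wnorm ρ < ⊤ := fun e =>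
    (Series.wnorm_grad_le hρ e g).trans_lt (ENNReal.mul_lt_top ENNReal.coe_lt_top hg)
  obtain ⟨ζ, hζN, hζ, h⟩ := TraceData.exists_schwingerDyson_defect (D := G.fockTrace) hx hρ
    gen_mem_tracialAlg cutOps_gen quadSD_gen hg hJ hc hY hs hW
  have hyN : ∀ e, (gen + G.fockProj.evF gen (grad g) : G.Dart → G.Fock →L[ℂ] G.Fock) e ∈
      tracialAlg G := fun e =>
    add_mem (gen_mem_tracialAlg e)
      (G.fockProj.ev_mem isClosed_tracialAlg projOp_mem_tracialAlg gen_mem_tracialAlg _)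
  have hyc := cutOps_add_evF_gen hx.le hf
  have hya := adjoint_add_evF_gen hx.le hf hga
  have hyn := TraceData.norm_shift_le hx.le cutOps_gen hf hY
  have htop := wordSpan_eq_top hx hf hJ hc rfl hyc hya
  rw [schwingerDyson_iff hs hW hyn hyc hyN hya, ← hζ]
  generalize hy : gen + G.fockProj.evF gen (grad g) = y at *
  refine ⟨fun h1 => funext fun e => ?_, fun h1 e q hq => ?_⟩
  · refine eq_zero_of_trace_mul_word htop hyN (leftAlg_of_tracial (hζN e)) fun γ => ?_
    have hq : (Series.mono γ).IsPoly :=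
      (Set.finite_singleton γ).subset fun δ hδ => by
        by_contra h2
        exact hδ (if_neg h2)
    have h2 := h e (Series.mono γ) (hq.wnorm_lt_top s')
    rw [VProj.ev_mono] at h2
    have h3 := h1 e (Series.mono γ) hq
    rw [VProj.ev_mono] at h3
    rw [← traceL_apply]
    exact h2.symm.trans (sub_eq_zero.2 h3)
  · have h2 := h e q (hq.wnorm_lt_top s')
    rw [h1, Pi.zero_apply, zero_mul, map_zero] at h2
    exact sub_eq_zero.1 h2

end

end WeightedGraph

end

open WeightedGraph in
theorem corollary2p5 {V E : Type*} [Fintype V] [Fintype E] (G : WeightedGraph V E)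
    (R S r : ℝ) (hR0 : 0 < R) (hS0 : 0 < S)
    (hR : ∀ e : G.Dart, ‖gen e‖ < R)
    (hr : ∀ e : G.Dart, ‖gen e‖ < r)
    (W : G.Series) (hW : W.normR S < ⊤)
    (g : G.Series) (hg : g.normR R < ⊤) (hga : g.adj = g)
    (hJ : TMatrix.norm R (jac (grad g)) < 1)
    (hY : ∀ e : G.Dart, (Series.var e + grad g e).normR r ≤ ENNReal.ofReal S) :
    ∑' m : ℕ, (((-1 : ℂ) ^ (m + 1) / ((m : ℂ) + 1)) • traceTerm g (m + 1)).normR R < ⊤ ∧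
    (SchwingerDyson (law fun e => Series.eval gen (Series.var e + grad g e))
        (quadPotential G + W) ↔
      ∀ e : G.Dart,
        Series.eval gen (grad (Series.number g) e) =
          Series.eval gen
            (grad (-(W.subst fun e => Series.var e + grad g e)
              - (1 / 2 : ℂ) • dot (grad g) (TMatrix.act TMatrix.M (grad g))
              - ∑' m : ℕ, ((-1 : ℂ) ^ (m + 1) / ((m : ℂ) + 1)) • traceTerm g (m + 1)) e)) := by
  refine ⟨tsum_normR_traceTerm_lt_top hR0.le hR hJ, ?_⟩
  have hgen : ∀ {a : ℝ}, 0 < a → (∀ e : G.Dart, ‖gen e‖ < a) →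
      ‖(gen : G.Dart → G.Fock →L[ℂ] G.Fock)‖ < a := fun ha h => (pi_norm_lt_iff ha).2 h
  -- In a graph without edges the hypotheses say nothing about `r`, which may even be negative; any
  -- positive radius serves instead.
  obtain ⟨r', hr', hY'⟩ : ∃ r' : ℝ, ‖(gen : G.Dart → G.Fock →L[ℂ] G.Fock)‖ < r' ∧
      ∀ e : G.Dart, (shift g e).normR r' ≤ ENNReal.ofReal S := by
    rcases isEmpty_or_nonempty G.Dart with hE | ⟨⟨e⟩⟩
    · exact ⟨1, hgen one_pos hE.elim, hE.elim⟩
    · exact ⟨r, hgen ((norm_nonneg _).trans_lt (hr e)) hr, hY⟩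
  obtain ⟨ρ, ρ', c, s, hx, hρ, hgρ, hJρ, hc, hYs, hs⟩ :=
    exists_radii (hgen hR0 hR) hr' (norm_nonneg _) hg hJ hY' hS0
  have hf : ∀ e, (grad g e).wnorm ρ < ⊤ := fun e =>
    (Series.wnorm_grad_le hρ e g).trans_lt (ENNReal.mul_lt_top ENNReal.coe_lt_top hgρ)
  have hWS := Series.wnorm_lt_top_of_normR hW
  obtain ⟨h1, h2, h3, h4⟩ := TraceData.wnorm_transport_terms_lt_top G.fockTrace hx.le hρ hgρ hJρ hc
    hYs hs hWS
  have hρ0 : 0 < ρ := (norm_nonneg _).trans_lt hx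
  have hsd := schwingerDyson_law_iff hx hρ hgρ hga hJρ hc hYs hs hWS
  rw [add_evF_gen hx.le hf] at hsd
  refine hsd.trans (forall_congr' fun e => ?_)
  rw [logTerm_gen hρ0 hx.le hJρ hc] at h4 ⊢
  -- The vanishing of one gradient is rewritten as the equality of two. Evaluation is additive only
  -- on convergent series, hence the slightly smaller radius `σ` for the gradients.
  have hsplit : ∀ a b d l : G.Series, a + b + d + l = a - (-d - b - l) := fun a b d l => by ring
  obtain ⟨σ, hσ, hσρ⟩ := exists_between (a₁ := ‖(gen : G.Dart → G.Fock →L[ℂ] G.Fock)‖₊) hx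
  have hgrad : ∀ {a : G.Series}, a.wnorm ρ < ⊤ → (grad a e).wnorm σ < ⊤ := fun ha =>
    (Series.wnorm_grad_le hσρ e _).trans_lt (ENNReal.mul_lt_top ENNReal.coe_lt_top ha)
  have hsub : ∀ {a b : G.Series}, a.wnorm ρ < ⊤ → b.wnorm ρ < ⊤ → (a - b).wnorm ρ < ⊤ :=
    fun {a b} ha hb => by
      rw [sub_eq_add_neg]
      refine (Series.wnorm_add_le _ _ _).trans_lt (ENNReal.add_lt_top.2 ⟨ha, ?_⟩)
      rwa [Series.wnorm_neg]
  have hneg : (-W.subst (shift g)).wnorm ρ < ⊤ := by rwa [Series.wnorm_neg]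
  rw [hsplit, grad_sub, G.fockProj.ev_sub (fun e => (norm_gen_le e).trans hσ.le) (hgrad h1)
    (hgrad (hsub (hsub hneg h2) h4)), sub_eq_zero, ev_eq_eval cutOps_gen, ev_eq_eval cutOps_gen]
  rfl
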